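/- **Network.** A multitype network has finitely many job types $i=1,\dots,I$ and finitely many single-server stations. Jobs of type $i$ visit a fixed sequence of $J_i\ge 1$ stations $\sigma(i,1),\dots,\sigma(i,J_i)$ (repetitions allowed) and then leave; a type $i$ job in its $j$-th stage is a class $(i,j)$ job. Interarrival times $X^i_k$ and service times $S^{i,j}_k$ ($k\ge1$) are non-negative random variables. A state is $(q,z_1,z_2)$: queue lengths $q\in\mathbb Z_+^d$ ($d=\sum_iJ_i$), residual interarrival times $z_1\in\mathbb R_+^I$ and residual service times $z_2\in\mathbb R_+^d$ (the latter used only for non-empty classes). From such an initial state, $X^i_1$ is replaced by $z_{1,i}$ and, if $q_{i,j}>0$, $S^{i,j}_1$ by $z_{2,i,j}$. A scheduling policy chooses at each time $t$, for each station, at most one class, as a function of the arrivals and departures observed up to $t$; the station serves the head-of-the-line job of that class (which must be non-empty), and interrupted jobs resume where they stopped. The policy is non-idling if a station serves whenever one of its classes is non-empty. All policies below are of this non-idling, head-of-the-line, preemptive-resume kind. $\mathbf Q(t)$ is the resulting vector of queue lengths, $\mathbf D_{i,j}(t)$ the number of class $(i,j)$ departures in $[0,t]$, and $\|\cdot\|$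 is the $L_1$ norm. **Assumptions.** (A) Each sequence $(X^i_k)_k$, $(S^{i,j}_k)_k$ is i.i.d. with finite positive mean, and the sequences are mutually independent. Put $\lambda_i=1/\mathbb E[X^i_1]$, $\mu_{i,j}=1/\mathbb E[S^{i,j}_1]$. (B) For each of these sequences $(Z_k)$, with mean $\alpha$ and $N(t)=\max\{n: Z_1+\dots+Z_n\le t\}$: for every $\epsilon>0$ there are $L,V>0$ such that for all $z>0$, $n\ge1$, $t\ge0$, $$\mathbb P\Big(\Big|\sum_{k\le n}Z_k-z-\alpha n\Big|\ge\epsilon n\,\Big|\,Z_1\ge z\Big)\le Ve^{-Ln},\qquad \mathbb P\Big(\Big|N(t+z)-\frac t\alpha\Big|\ge\epsilon t\,\Big|\,Z_1\ge z\Big)\le Ve^{-Lt}.$$ (C) From every state, under every policy and for every $n>0$, almost surely $\|\mathbf Q(t)\|\ge n$ for some $t$. **Fluid model.** A fluid solution on $[0,\theta]$ (or $[0,\infty)$) is a pair $(\bar Q,\bar T)$ of non-negative functions of time, indexed by the classes, with each $\bar T_{i,j}$ non-decreasing, $\bar T_{i,j}(0)=0$, $\bar Q_{i,1}(t)=\bar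 Q_{i,1}(0)+\lambda_it-\mu_{i,1}\bar T_{i,1}(t)$, $\bar Q_{i,j}(t)=\bar Q_{i,j}(0)+\mu_{i,j-1}\bar T_{i,j-1}(t)-\mu_{i,j}\bar T_{i,j}(t)$ for $j\ge2$, and $\bar T_\sigma(t_2)-\bar T_\sigma(t_1)\le t_2-t_1$ for $t_1\le t_2$ and each station $\sigma$, where $\bar T_\sigma$, $\bar Q_\sigma$ denote sums over the classes served at $\sigma$. It is non-idling if $\int\bar Q_\sigma(t)\,d(t-\bar T_\sigma(t))=0$ for every $\sigma$. The fluid model is globally weakly stable if every non-idling fluid solution on $[0,\infty)$ with $\bar Q(0)=0$ has $\bar Q\equiv0$. It has the Finite Decomposition Property (FDP) if there are $\nu,B>0$ such that for every $\theta>0$ and every non-idling fluid solution $(\bar Q,\bar T)$ on $[0,\theta]$ with $\bar Q(t)\ne0$ for all $t\in[0,\theta]$ there are a non-idling fluid solution $(\tilde Q,\tilde T)$ on $[0,\theta]$ and times $0=t_0<\dots<t_M=\theta$ with $M\le\nu\theta\sup_{[0,\theta]}\|\bar Q(t)\|^{-1}+B$, $\inf_{[0,\theta]}\|\tilde Q(t)\|\ge\inf_{[0,\theta]}\|\bar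 Q(t)\|$, $\tilde Q(t_m)=\bar Q(t_m)$ for all $m$, and, on each interval $(t_r,t_{r+1})$ and for each station $\sigma$, $\tilde Q_\sigma$ either everywhere positive or everywhere zero. **Theorem.** Consider a multitype stochastic network satisfying (A), (B) and (C) whose fluid model is not globally weakly stable and has the FDP. Then: 1. For every initial state $(q,z_1,z_2)$ there is a non-idling scheduling policy under which $\liminf_{t\to\infty}\|\mathbf Q(t)\|/t>0$ almost surely; in particular it is not the case that $\mathbf D_{i,J_i}(t)/t\to\lambda_i$ almost surely for every $i$ (the network is not rate stable). 2. There is $\gamma>0$ such that (*) from every $q\in\mathbb R_+^d$ there is a non-idling fluid solution on $[0,\infty)$ with $\bar Q(0)=q$ and $\|\bar Q(t)\|\ge\gamma t$ for all $t\ge0$. For every $\gamma>0$ satisfying (*), every $$C>13(\lambda_{\max}+\mu_{\max})^2\,I\,J_{\max}^3,\qquad \lambda_{\max}=\max_i\{\lambda_i,\lambda_i^{-1}\},\ \mu_{\max}=\max_{i,j}\{\mu_{i,j},\mu_{i,j}^{-1}\},\ J_{\max}=\max_iJ_i,$$ and every initial state, there is a non-idling scheduling policy under which, with $\theta=\max(1,3/\gamma)$,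 $$\liminf_{t\to\infty}\frac{\|\mathbf Q(t)\|}{t}\ \ge\ \frac{\min(\gamma/C,1)}{8\,\theta}\qquad\text{almost surely.}$$ -/

import Mathlib

open MeasureTheory ProbabilityTheory Filter Set
open scoped Topology NNReal ENNReal

noncomputable section

/-- The topology of an open multitype network: finitely many types, finitely many single-server
stations, and for each type `i` a fixed route through `stages i ≥ 1` stations (repetitions
allowed). A class is a pair (type, stage); stages are numbered from `0`. -/
structure MultitypeNetwork where
  numTypes : ℕ
  numStations : ℕ
  stages : Fin numTypes → ℕ
  stages_pos : ∀ i, 0 < stages i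
  station : (Σ i : Fin numTypes, Fin (stages i)) → Fin numStations

namespace MultitypeNetwork

/-- Classes `(i, j)`. -/
abbrev Class (N : MultitypeNetwork) : Type := Σ i : Fin N.numTypes, Fin (N.stages i)

/-- The `L₁` norm of a vector indexed by the classes. -/
def l1 (N : MultitypeNetwork) (q : N.Class → ℝ) : ℝ := ∑ c, |q c|

/-- The sum of a vector over the classes served at the station `σ`. -/
def stationSum (N : MultitypeNetwork) (σ : Fin N.numStations) (q : N.Class → ℝ) : ℝ :=
  ∑ c with N.station c = σ, q c

/-! ### The fluid model -/

/-- `(Q, T)` solves the fluid equations, for arrival rates `lam` and service rates `mu`, on the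
time set `I` (which is `[0, θ]` or `[0, ∞)`). The fluid arrivals `A_i(t) = lam i * t` and
departures `D_c(t) = mu c * T_c(t)` are substituted into the flow balance equations. -/
structure IsFluidSolution (N : MultitypeNetwork) (lam : Fin N.numTypes → ℝ) (mu : N.Class → ℝ)
    (I : Set ℝ) (Q T : ℝ → N.Class → ℝ) : Prop where
  first_stage : ∀ i : Fin N.numTypes, ∀ t ∈ I,
    Q t ⟨i, ⟨0, N.stages_pos i⟩⟩ = Q 0 ⟨i, ⟨0, N.stages_pos i⟩⟩ + lam i * t
      - mu ⟨i, ⟨0, N.stages_pos i⟩⟩ * T t ⟨i, ⟨0, N.stages_pos i⟩⟩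
  next_stage : ∀ (i : Fin N.numTypes) (j : ℕ) (h : j + 1 < N.stages i), ∀ t ∈ I,
    Q t ⟨i, ⟨j + 1, h⟩⟩ = Q 0 ⟨i, ⟨j + 1, h⟩⟩
      + mu ⟨i, ⟨j, Nat.lt_of_succ_lt h⟩⟩ * T t ⟨i, ⟨j, Nat.lt_of_succ_lt h⟩⟩
      - mu ⟨i, ⟨j + 1, h⟩⟩ * T t ⟨i, ⟨j + 1, h⟩⟩
  feasible : ∀ σ, ∀ t₁ ∈ I, ∀ t₂ ∈ I, t₁ ≤ t₂ →
    N.stationSum σ (fun c => T t₂ c - T t₁ c) ≤ t₂ - t₁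
  queue_nonneg : ∀ t ∈ I, ∀ c, 0 ≤ Q t c
  time_nonneg : ∀ t ∈ I, ∀ c, 0 ≤ T t c
  time_mono : ∀ c, MonotoneOn (fun t => T t c) I
  time_zero : ∀ c, T 0 c = 0

/-- A fluid solution is non-idling on `I` if `∫_I Q_σ dI_σ = 0` for every station `σ`, where
`I_σ(t) = t - T_σ(t)` is the cumulative idle time. As `I_σ` is Lipschitz and nondecreasing,
`dI_σ = I_σ' dt` with `I_σ' ≥ 0` almost everywhere. -/
def FluidNonIdling (N : MultitypeNetwork) (I : Set ℝ) (Q T : ℝ → N.Class → ℝ) : Prop :=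
  ∀ σ, ∫⁻ t in I, ENNReal.ofReal
    (N.stationSum σ (Q t) * deriv (fun s => s - N.stationSum σ (T s)) t) = 0

/-- Every non-idling fluid solution on `[0, ∞)` that starts at zero stays at zero. -/
def GloballyWeaklyStable (N : MultitypeNetwork) (lam : Fin N.numTypes → ℝ)
    (mu : N.Class → ℝ) : Prop :=
  ∀ Q T : ℝ → N.Class → ℝ, N.IsFluidSolution lam mu (Ici 0) Q T →
    N.FluidNonIdling (Ici 0) Q T → Q 0 = 0 → ∀ t, 0 ≤ t → Q t = 0

/-- The Finite Decomposition Property of the fluid model. -/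
def FiniteDecomposition (N : MultitypeNetwork) (lam : Fin N.numTypes → ℝ)
    (mu : N.Class → ℝ) : Prop :=
  ∃ ν B : ℝ, 0 < ν ∧ 0 < B ∧
    ∀ θ : ℝ, 0 < θ → ∀ Q T : ℝ → N.Class → ℝ,
      N.IsFluidSolution lam mu (Icc 0 θ) Q T → N.FluidNonIdling (Icc 0 θ) Q T →
      (∀ t ∈ Icc 0 θ, Q t ≠ 0) →
      ∃ Q' T' : ℝ → N.Class → ℝ,
        N.IsFluidSolution lam mu (Icc 0 θ) Q' T' ∧ N.FluidNonIdling (Icc 0 θ) Q' T' ∧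
        ∃ (M : ℕ) (τ : Fin (M + 1) → ℝ), StrictMono τ ∧ τ 0 = 0 ∧ τ (Fin.last M) = θ ∧
          (M : ℝ) ≤ ν * θ * sSup ((fun t => 1 / N.l1 (Q t)) '' Icc 0 θ) + B ∧
          sInf ((fun t => N.l1 (Q t)) '' Icc 0 θ) ≤ sInf ((fun t => N.l1 (Q' t)) '' Icc 0 θ) ∧
          (∀ m, Q' (τ m) = Q (τ m)) ∧
          ∀ (r : Fin M) (σ : Fin N.numStations),
            (∀ t ∈ Ioo (τ r.castSucc) (τ r.succ), 0 < N.stationSum σ (Q' t)) ∨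
            (∀ t ∈ Ioo (τ r.castSucc) (τ r.succ), N.stationSum σ (Q' t) = 0)

/-- From every initial fluid level there is a non-idling fluid solution on `[0, ∞)` that diverges
linearly at rate at least `γ`. -/
def FluidDivergesAtRate (N : MultitypeNetwork) (lam : Fin N.numTypes → ℝ) (mu : N.Class → ℝ)
    (γ : ℝ) : Prop :=
  ∀ q : N.Class → ℝ, (∀ c, 0 ≤ q c) →
    ∃ Q T : ℝ → N.Class → ℝ, N.IsFluidSolution lam mu (Ici 0) Q T ∧
      N.FluidNonIdling (Ici 0) Q T ∧ Q 0 = q ∧ ∀ t, 0 ≤ t → γ * t ≤ N.l1 (Q t)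

/-- The quantity `13 (λ_max + μ_max)² I J_max³`, where `λ_max = max_i {λ_i, λ_i⁻¹}`,
`μ_max = max_c {μ_c, μ_c⁻¹}`, `I` is the number of types and `J_max` the longest route. -/
def parameterBound (N : MultitypeNetwork) (lam : Fin N.numTypes → ℝ) (mu : N.Class → ℝ) : ℝ :=
  13 * ((⨆ i, max (lam i) (lam i)⁻¹) + ⨆ c, max (mu c) (mu c)⁻¹) ^ 2
    * N.numTypes * ((Finset.univ.sup N.stages : ℕ) : ℝ) ^ 3

/-! ### The stochastic network -/

/-- The stochastic primitives: interarrival times `X i k` of type `i` and service times `S c k`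
of class `c`, `k = 0, 1, 2, …`. -/
structure Primitives (N : MultitypeNetwork) (Ω : Type*) where
  X : Fin N.numTypes → ℕ → Ω → ℝ
  S : N.Class → ℕ → Ω → ℝ

/-- A state: queue lengths, residual interarrival times and residual service times (the residual
service time of a class is only meaningful, and only used, if its queue is not empty). -/
structure State (N : MultitypeNetwork) where
  q : N.Class → ℕ
  z₁ : Fin N.numTypes → ℝ≥0
  z₂ : N.Class → ℝ≥0

/-- A control: `u t ω σ` is the class whose head-of-the-line job is served by `σ` at time `t`
(`none` if the station idles). -/
abbrev Control (N : MultitypeNetwork) (Ω : Type*) : Type _ :=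
  ℝ → Ω → Fin N.numStations → Option N.Class

namespace Primitives

variable {N : MultitypeNetwork} {Ω : Type*}

/-- Interarrival times seen from the initial state `x`: the first one is the residual time. -/
def interarrival (p : N.Primitives Ω) (x : N.State) (i : Fin N.numTypes) (k : ℕ) (ω : Ω) : ℝ :=
  if k = 0 then (x.z₁ i : ℝ) else p.X i k ω

/-- Service times seen from the initial state `x`: the job that is initially at the head of the
line of a nonempty class needs its residual service time. -/
def service (p : N.Primitives Ω) (x : N.State) (c : N.Class) (k : ℕ) (ω : Ω) : ℝ :=
  if k = 0 ∧ 0 < x.q c then (x.z₂ c : ℝ) else p.S c k ω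

/-- `A_i(t) = max {k : ∑_{r ≤ k} X_r ≤ t}`, the number of external arrivals of type `i`
in `[0, t]`. -/
def arrivals (p : N.Primitives Ω) (x : N.State) (i : Fin N.numTypes) (t : ℝ) (ω : Ω) : ℕ :=
  sSup {k : ℕ | ∑ r ∈ Finset.range k, p.interarrival x i r ω ≤ t}

/-- `T_c(t)`, the time spent in `[0, t]` on serving class `c`. -/
def busyTime (u : N.Control Ω) (c : N.Class) (t : ℝ) (ω : Ω) : ℝ :=
  volume.real {s : ℝ | s ∈ Icc 0 t ∧ u s ω (N.station c) = some c}

open Classical in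
/-- The number of departures from stage `j` of type `i` in `[0, t]`, by recursion on the stage: the
largest `k` such that the first `k` service times add up to at most `T_{i,j}(t)`, among the `k`
that do not exceed the number of jobs that have been present in the class by time `t`.
Interrupted jobs resume where they were stopped. If all service times are positive, the
restriction on `k` is automatic, because only classes with jobs are served; it
matters only for service times equal to zero. -/
def departuresAux (p : N.Primitives Ω) (x : N.State) (u : N.Control Ω) (i : Fin N.numTypes) :
    (j : ℕ) → j < N.stages i → ℝ → Ω → ℕ
  | 0, h, t, ω =>
    Nat.findGreatest
      (fun k => ∑ r ∈ Finset.range k, p.service x ⟨i, ⟨0, h⟩⟩ r ω ≤ busyTime u ⟨i, ⟨0, h⟩⟩ t ω)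
      (x.q ⟨i, ⟨0, h⟩⟩ + p.arrivals x i t ω)
  | j + 1, h, t, ω =>
    Nat.findGreatest
      (fun k => ∑ r ∈ Finset.range k, p.service x ⟨i, ⟨j + 1, h⟩⟩ r ω
        ≤ busyTime u ⟨i, ⟨j + 1, h⟩⟩ t ω)
      (x.q ⟨i, ⟨j + 1, h⟩⟩ + departuresAux p x u i j (Nat.lt_of_succ_lt h) t ω)

/-- `D_c(t)`, the number of departures from class `c` in `[0, t]`. -/
def departures (p : N.Primitives Ω) (x : N.State) (u : N.Control Ω) (c : N.Class)
    (t : ℝ) (ω : Ω) : ℕ :=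
  p.departuresAux x u c.1 c.2.1 c.2.2 t ω

/-- The number of jobs that enter class `c` in `[0, t]`: external arrivals at the first stage,
departures from the preceding stage otherwise. -/
def inflow (p : N.Primitives Ω) (x : N.State) (u : N.Control Ω) :
    N.Class → ℝ → Ω → ℕ
  | ⟨i, ⟨0, _⟩⟩, t, ω => p.arrivals x i t ω
  | ⟨i, ⟨j + 1, h⟩⟩, t, ω => p.departures x u ⟨i, ⟨j, Nat.lt_of_succ_lt h⟩⟩ t ω

/-- `Q_c(t)`, the queue length of class `c` (the subtraction never truncates). -/
def queue (p : N.Primitives Ω) (x : N.State) (u : N.Control Ω) (c : N.Class)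
    (t : ℝ) (ω : Ω) : ℕ :=
  x.q c + p.inflow x u c t ω - p.departures x u c t ω

theorem departures_le (p : N.Primitives Ω) (x : N.State) (u : N.Control Ω) (c : N.Class)
    (t : ℝ) (ω : Ω) : p.departures x u c t ω ≤ x.q c + p.inflow x u c t ω := by
  rcases c with ⟨i, ⟨_ | j, h⟩⟩
  · exact Nat.findGreatest_le _
  · exact Nat.findGreatest_le _

/-- `‖Q(t)‖`, the total number of jobs in the network. -/
def totalQueue (p : N.Primitives Ω) (x : N.State) (u : N.Control Ω) (t : ℝ) (ω : Ω) : ℕ :=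
  ∑ c, p.queue x u c t ω

/-- The information observed up to time `t`: external arrivals and departures from all classes. -/
abbrev history (p : N.Primitives Ω) (x : N.State) (u : N.Control Ω) (t : ℝ) : MeasurableSpace Ω :=
  ⨆ s ∈ Icc 0 t,
    (⨆ i, MeasurableSpace.comap (p.arrivals x i s) ⊤) ⊔
      ⨆ c, MeasurableSpace.comap (p.departures x u c s) ⊤

variable [MeasurableSpace Ω]

/-- `u` is the control exerted by a non-idling, head-of-the-line, preemptive-resume scheduling
policy when the network starts in the state `x`: it is measurable, it is non-anticipating (the
choice at time `t` is a function of the history up to `t`), a station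
serves only classes of its own that have jobs present, and it does serve one
whenever any job is present at the station. -/
structure IsNonIdlingPolicy (p : N.Primitives Ω) (P : Measure Ω) (x : N.State)
    (u : N.Control Ω) : Prop where
  measurable : ∀ σ c, MeasurableSet {y : ℝ × Ω | u y.1 y.2 σ = some c}
  nonanticipating : ∀ t, 0 ≤ t → ∀ σ c,
    MeasurableSet[p.history x u t] {ω | u t ω σ = some c}
  serves_present : ∀ᵐ ω ∂P, ∀ t, 0 ≤ t → ∀ σ c, u t ω σ = some c →
    N.station c = σ ∧ 0 < p.queue x u c t ω
  non_idling : ∀ᵐ ω ∂P, ∀ t, 0 ≤ t → ∀ σ,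
    (∃ c, N.station c = σ ∧ 0 < p.queue x u c t ω) → u t ω σ ≠ none

/-- The arrival rate of type `i`. -/
def arrivalRate (p : N.Primitives Ω) (P : Measure Ω) (i : Fin N.numTypes) : ℝ :=
  (∫ ω, p.X i 0 ω ∂P)⁻¹

/-- The service rate of class `c`. -/
def serviceRate (p : N.Primitives Ω) (P : Measure Ω) (c : N.Class) : ℝ :=
  (∫ ω, p.S c 0 ω ∂P)⁻¹

/-- For every type, the rate of departures from its last stage equals its arrival rate. -/
def RateStable (p : N.Primitives Ω) (P : Measure Ω) (x : N.State) (u : N.Control Ω) : Prop :=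
  ∀ i : Fin N.numTypes, ∀ᵐ ω ∂P,
    Tendsto (fun t : ℝ => (p.departures x u
        ⟨i, ⟨N.stages i - 1, Nat.sub_lt (N.stages_pos i) Nat.one_pos⟩⟩ t ω : ℝ) / t)
      atTop (𝓝 (p.arrivalRate P i))

/-- The lower limit of `‖Q(t)‖ / t` as `t → ∞`. -/
def growthRate (p : N.Primitives Ω) (x : N.State) (u : N.Control Ω) (ω : Ω) : EReal :=
  liminf (fun t : ℝ => (((p.totalQueue x u t ω : ℝ) / t : ℝ) : EReal)) atTop

/-- The interarrival and service times are non-negative random variables with finite positive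
means, identically distributed along each sequence and all mutually independent. -/
structure AssumptionA (p : N.Primitives Ω) (P : Measure Ω) : Prop where
  measurable_X : ∀ i k, Measurable (p.X i k)
  measurable_S : ∀ c k, Measurable (p.S c k)
  nonneg_X : ∀ i k ω, 0 ≤ p.X i k ω
  nonneg_S : ∀ c k ω, 0 ≤ p.S c k ω
  integrable_X : ∀ i, Integrable (p.X i 0) P
  integrable_S : ∀ c, Integrable (p.S c 0) P
  mean_pos_X : ∀ i, 0 < ∫ ω, p.X i 0 ω ∂P
  mean_pos_S : ∀ c, 0 < ∫ ω, p.S c 0 ω ∂P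
  ident_X : ∀ i k, IdentDistrib (p.X i k) (p.X i 0) P P
  ident_S : ∀ c k, IdentDistrib (p.S c k) (p.S c 0) P P
  indep : iIndepFun
    (fun a : (Fin N.numTypes ⊕ N.Class) × ℕ => Sum.elim p.X p.S a.1 a.2) P

end Primitives

end MultitypeNetwork

/-- Large deviations bounds for a sequence `Z 0, Z 1, …` with mean `α` and for its counting process
`N(t) = max {n : Z 0 + ⋯ + Z (n-1) ≤ t}`, conditionally on `Z 0 ≥ z` and uniformly in `z > 0`.
(If `Z 0 ≥ z` has probability zero, the conditional measure is `0` and nothing is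
required.) -/
def LDBounds {Ω : Type*} [MeasurableSpace Ω] (P : Measure Ω) (Z : ℕ → Ω → ℝ) : Prop :=
  ∀ ε : ℝ, 0 < ε → ∃ L V : ℝ, 0 < L ∧ 0 < V ∧ ∀ z : ℝ, 0 < z →
    (∀ n : ℕ, 1 ≤ n →
      (P[|{ω | z ≤ Z 0 ω}]).real
        {ω | ε * n ≤ |∑ k ∈ Finset.range n, Z k ω - z - (∫ ω', Z 0 ω' ∂P) * n|}
        ≤ V * Real.exp (-L * n)) ∧
    (∀ t : ℝ, 0 ≤ t →
      (P[|{ω | z ≤ Z 0 ω}]).real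
        {ω | ε * t ≤ |((sSup {n : ℕ | ∑ k ∈ Finset.range n, Z k ω ≤ t + z} : ℕ) : ℝ)
          - t / ∫ ω', Z 0 ω' ∂P|}
        ≤ V * Real.exp (-L * t))

namespace MultitypeNetwork.Primitives

variable {N : MultitypeNetwork} {Ω : Type*} [MeasurableSpace Ω]

/-- All the primitive sequences satisfy the large deviations bounds. -/
def AssumptionB (p : N.Primitives Ω) (P : Measure Ω) : Prop :=
  (∀ i, LDBounds P (p.X i)) ∧ ∀ c, LDBounds P (p.S c)

/-- From every state and under every scheduling policy, the total queue length reaches every level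
in finite time almost surely. -/
def AssumptionC (p : N.Primitives Ω) (P : Measure Ω) : Prop :=
  ∀ (x : N.State) (u : N.Control Ω), p.IsNonIdlingPolicy P x u → ∀ n : ℕ, 0 < n →
    ∀ᵐ ω ∂P, ∃ t : ℝ, 0 ≤ t ∧ n ≤ p.totalQueue x u t ω

end MultitypeNetwork.Primitives

end

open MeasureTheory ProbabilityTheory Filter Set
open scoped Topology NNReal ENNReal

noncomputable section

/-! An unstable fluid model has trajectories that grow linearly. The stochastic network can be
steered along magnified copies of such a trajectory while the law of large numbers holds, and once
the network is large the law holds for the whole future with probability close to one.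

Fluid part. Without global weak stability some fluid solution leaves zero (`exists_excursion`). It
can be superposed on any initial level: the old fluid is served only with the capacity that the
excursion leaves idle (`exists_layer`, `IsBusyFluid.exists_dominating`). Layering larger and larger
excursions at doubling times, and passing to a limit, gives linear divergence from every level
(`exists_fluidDivergesAtRate`). Given such a rate `γ`, the finite decomposition property turns the
solution on `[0, θ]` into linear pieces whose number is bounded uniformly over the starting levels
of norm one (`exists_plan`). The choice of `θ` gives `γ θ ≥ 3`, so the norm at least triples.

Policy. A phase that starts with `n` jobs follows the plan magnified by `n`: every unit of time is
cut into slots reserved for the classes in proportion to the planned rates (`trackingRule`). The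
non-idling constraint does no harm, because on each piece a station is either fully booked or empty
in the plan, so that no class can run far ahead of it. The error grows by a constant factor per
piece (`TracksRates.abs_queue_sub_le`), and the number of pieces is bounded. Hence law of large
numbers errors that are small relative to `n` turn the planned tripling into an actual doubling
(`Primitives.exists_phase_growth`). Phase lengths are proportional to their initial sizes, so
repeated doubling is linear growth in time (`Primitives.le_growthRate_of_phases`). The constant is
governed by the smallest planned norm `γ / (γ + ∑ μ)`; this is where the lower bound for `C` enters.

Probabilistic part. The control defined by the rule is a fixed point, built by successive
approximation on the space of all item sequences (`Rule.control_eq_next`). By (C) the queue reaches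
any prescribed size. At the first such time on a dyadic grid, the items after those in use are
independent of the past (`Path.IsPast.measure_not_fresh_le`), and by (B) the residual times of those
in use have uniformly small tails (`Path.IsPast.measure_residual_le`). So the law of large numbers
holds from then on, up to an error `ε (t - τ + M)`, with probability as close to one as desired if
the size `M` is large. The policy does not involve `M`, so growth holds almost surely
(`Path.ae_le_growthRate`).

Rate stability is excluded by conservation of jobs: together with the law of large numbers for the
arrivals it would force growth rate zero (`Primitives.RateStable.ae_growthRate_eq_zero`). -/

namespace MultitypeNetwork

variable {N : MultitypeNetwork}

/-! ### Flows along the routes -/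

/-- What enters a class: the external input `a` at the first stage, the output `d` of the preceding
class at the later stages. -/
def upstream (N : MultitypeNetwork) {α : Type*} (a : Fin N.numTypes → α) (d : N.Class → α) :
    N.Class → α
  | ⟨i, ⟨0, _⟩⟩ => a i
  | ⟨i, ⟨j + 1, h⟩⟩ => d ⟨i, ⟨j, Nat.lt_of_succ_lt h⟩⟩

/-- Induction along the routes. -/
theorem upstream_induction {p : N.Class → Prop}
    (first : ∀ i, p ⟨i, ⟨0, N.stages_pos i⟩⟩)
    (next : ∀ i j (h : j + 1 < N.stages i), p ⟨i, ⟨j, Nat.lt_of_succ_lt h⟩⟩ → p ⟨i, ⟨j + 1, h⟩⟩)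
    (c : N.Class) : p c := by
  rcases c with ⟨i, ⟨j, h⟩⟩
  induction j with
  | zero => exact first i
  | succ j ih => exact next i j h (ih _)

/-- `upstream` only selects a coordinate of the pair `(a, d)`, so it commutes with every pointwise
operation. This moves factors, sums, differences and casts through the flow balance. -/
theorem upstream_comp {α β : Type*} (f : α → β) (a : Fin N.numTypes → α)
    (d : N.Class → α) (c : N.Class) :
    N.upstream (fun i => f (a i)) (fun c => f (d c)) c = f (N.upstream a d c) := by
  rcases c with ⟨i, ⟨_ | j, h⟩⟩ <;> rfl

theorem upstream_comp₂ {α β δ : Type*} (f : α → β → δ) (a : Fin N.numTypes → α)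
    (d : N.Class → α) (a' : Fin N.numTypes → β) (d' : N.Class → β) (c : N.Class) :
    N.upstream (fun i => f (a i) (a' i)) (fun c => f (d c) (d' c)) c
      = f (N.upstream a d c) (N.upstream a' d' c) := by
  rcases c with ⟨i, ⟨_ | j, h⟩⟩ <;> rfl

theorem upstream_forall {α : Type*} {p : α → Prop} {a : Fin N.numTypes → α} {d : N.Class → α}
    (ha : ∀ i, p (a i)) (hd : ∀ c, p (d c)) (c : N.Class) : p (N.upstream a d c) := by
  rcases c with ⟨i, ⟨_ | j, h⟩⟩
  · exact ha i
  · exact hd _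

theorem upstream_forall₂ {α β : Type*} {p : α → β → Prop} {a : Fin N.numTypes → α}
    {d : N.Class → α} {a' : Fin N.numTypes → β} {d' : N.Class → β}
    (ha : ∀ i, p (a i) (a' i)) (hd : ∀ c, p (d c) (d' c)) (c : N.Class) :
    p (N.upstream a d c) (N.upstream a' d' c) := by
  rcases c with ⟨i, ⟨_ | j, h⟩⟩
  · exact ha i
  · exact hd _

theorem stationSum_nonneg {σ : Fin N.numStations} {q : N.Class → ℝ} (hq : ∀ c, 0 ≤ q c) :
    0 ≤ N.stationSum σ q :=
  Finset.sum_nonneg fun c _ => hq c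

theorem stationSum_sub (σ : Fin N.numStations) (q r : N.Class → ℝ) :
    N.stationSum σ (fun c => q c - r c) = N.stationSum σ q - N.stationSum σ r :=
  Finset.sum_sub_distrib _ _

theorem stationSum_add (σ : Fin N.numStations) (q r : N.Class → ℝ) :
    N.stationSum σ (fun c => q c + r c) = N.stationSum σ q + N.stationSum σ r :=
  Finset.sum_add_distrib

theorem stationSum_mul (σ : Fin N.numStations) (s : ℝ) (q : N.Class → ℝ) :
    N.stationSum σ (fun c => s * q c) = s * N.stationSum σ q :=
  (Finset.mul_sum _ _ _).symm

theorem stationSum_mono (σ : Fin N.numStations) {q r : N.Class → ℝ} (h : ∀ c, q c ≤ r c) :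
    N.stationSum σ q ≤ N.stationSum σ r :=
  Finset.sum_le_sum fun c _ => h c

theorem le_stationSum {q : N.Class → ℝ} (hq : ∀ c, 0 ≤ q c) (c : N.Class) :
    q c ≤ N.stationSum (N.station c) q :=
  Finset.single_le_sum (f := q) (fun c _ => hq c) (by simp)

theorem exists_pos_of_stationSum_pos {σ : Fin N.numStations} {q : N.Class → ℝ}
    (h : 0 < N.stationSum σ q) : ∃ c, N.station c = σ ∧ 0 < q c := by
  by_contra! hc
  refine h.not_ge (Finset.sum_nonpos fun c hcσ => hc c ?_)
  simpa using hcσ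

theorem l1_of_nonneg {q : N.Class → ℝ} (hq : ∀ c, 0 ≤ q c) : N.l1 q = ∑ c, q c :=
  Finset.sum_congr rfl fun c _ => abs_of_nonneg (hq c)

theorem l1_nonneg (q : N.Class → ℝ) : 0 ≤ N.l1 q :=
  Finset.sum_nonneg fun _ _ => abs_nonneg _

/-! ### Fluid solutions -/

/-- A non-idling fluid solution, with the non-idling condition stated on time intervals: a station
that is never empty in `[s, t]` works all the time. -/
structure IsBusyFluid (N : MultitypeNetwork) (lam : Fin N.numTypes → ℝ) (mu : N.Class → ℝ)
    (I : Set ℝ) (Q T : ℝ → N.Class → ℝ) : Prop where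
  balance : ∀ t ∈ I, ∀ c, Q t c = Q 0 c
    + N.upstream (fun i => lam i * t) (fun c => mu c * T t c) c - mu c * T t c
  feasible : ∀ σ, ∀ s ∈ I, ∀ t ∈ I, s ≤ t →
    N.stationSum σ (T t) - N.stationSum σ (T s) ≤ t - s
  queue_nonneg : ∀ t ∈ I, ∀ c, 0 ≤ Q t c
  time_mono : ∀ c, ∀ s ∈ I, ∀ t ∈ I, s ≤ t → T s c ≤ T t c
  time_zero : ∀ c, T 0 c = 0
  busy : ∀ σ, ∀ s ∈ I, ∀ t ∈ I, s ≤ t → (∀ x ∈ Icc s t, 0 < N.stationSum σ (Q x)) →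
    t - s ≤ N.stationSum σ (T t) - N.stationSum σ (T s)

variable {lam : Fin N.numTypes → ℝ} {mu : N.Class → ℝ} {I : Set ℝ} {Q T : ℝ → N.Class → ℝ}

theorem IsFluidSolution.balance (h : N.IsFluidSolution lam mu I Q T) {t : ℝ} (ht : t ∈ I)
    (c : N.Class) : Q t c = Q 0 c
      + N.upstream (fun i => lam i * t) (fun c => mu c * T t c) c - mu c * T t c := by
  rcases c with ⟨i, ⟨_ | j, hj⟩⟩
  · exact h.first_stage i t ht
  · exact h.next_stage i j hj t ht

/-- When all increments are non-negative, one class cannot gain more than its whole station. This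
makes every busy time Lipschitz with constant one. -/
theorem sub_le_of_mono_of_feasible {u v : N.Class → ℝ} (huv : ∀ c, u c ≤ v c) {x : ℝ}
    (h : ∀ σ, N.stationSum σ v - N.stationSum σ u ≤ x) (c : N.Class) : v c - u c ≤ x := by
  have := le_stationSum (q := fun c => v c - u c) (fun c => sub_nonneg.2 (huv c)) c
  rw [stationSum_sub] at this
  exact this.trans (h _)

theorem abs_sub_le_of_mono {f : ℝ → ℝ} {x y : ℝ} (K : ℝ)
    (h : ∀ s ∈ I, ∀ t ∈ I, s ≤ t → f s ≤ f t ∧ f t - f s ≤ K * (t - s)) (hx : x ∈ I) (hy : y ∈ I) :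
    |f x - f y| ≤ K * |x - y| := by
  rcases le_total x y with hxy | hxy
  · obtain ⟨h1, h2⟩ := h x hx y hy hxy
    rw [abs_sub_comm, abs_of_nonneg (sub_nonneg.2 h1), abs_sub_comm x y,
      abs_of_nonneg (sub_nonneg.2 hxy)]
    exact h2
  · obtain ⟨h1, h2⟩ := h y hy x hx hxy
    rw [abs_of_nonneg (sub_nonneg.2 h1), abs_of_nonneg (sub_nonneg.2 hxy)]
    exact h2

theorem continuousOn_of_abs_sub_le {f : ℝ → ℝ} {K : ℝ}
    (h : ∀ x ∈ I, ∀ y ∈ I, |f x - f y| ≤ K * |x - y|) : ContinuousOn f I := by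
  have : LipschitzOnWith (Real.toNNReal K) f I := by
    refine LipschitzOnWith.of_dist_le_mul fun x hx y hy => ?_
    rw [Real.dist_eq, Real.dist_eq]
    refine (h x hx y hy).trans ?_
    gcongr
    exact Real.le_coe_toNNReal K
  exact this.continuousOn

theorem continuousOn_of_balance
    (hb : ∀ t ∈ I, ∀ c, Q t c = Q 0 c
      + N.upstream (fun i => lam i * t) (fun c => mu c * T t c) c - mu c * T t c)
    (hT : ∀ c, ContinuousOn (fun t => T t c) I) (c : N.Class) :
    ContinuousOn (fun t => Q t c) I := by
  have h1 : ContinuousOn (fun t => Q 0 c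
      + N.upstream (fun i => lam i * t) (fun c => mu c * T t c) c - mu c * T t c) I := by
    refine (continuousOn_const.add ?_).sub (continuousOn_const.mul (hT c))
    rcases c with ⟨i, ⟨_ | j, hj⟩⟩
    · exact continuousOn_const.mul continuousOn_id
    · exact continuousOn_const.mul (hT _)
  exact h1.congr fun t ht => hb t ht c

namespace IsBusyFluid

theorem time_sub_le (h : N.IsBusyFluid lam mu I Q T) {s t : ℝ} (hs : s ∈ I) (ht : t ∈ I)
    (hst : s ≤ t) (c : N.Class) : T t c - T s c ≤ t - s :=
  sub_le_of_mono_of_feasible (fun c => h.time_mono c s hs t ht hst)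
    (fun σ => h.feasible σ s hs t ht hst) c

theorem continuousOn_time (h : N.IsBusyFluid lam mu I Q T) (c : N.Class) :
    ContinuousOn (fun t => T t c) I :=
  continuousOn_of_abs_sub_le (K := 1) fun _ hx _ hy => abs_sub_le_of_mono 1
    (fun s hs t ht hst => ⟨h.time_mono c s hs t ht hst, by
      rw [one_mul]; exact h.time_sub_le hs ht hst c⟩) hx hy

theorem continuousOn_queue (h : N.IsBusyFluid lam mu I Q T) (c : N.Class) :
    ContinuousOn (fun t => Q t c) I :=
  continuousOn_of_balance h.balance h.continuousOn_time c

theorem continuousOn_stationSum_queue (h : N.IsBusyFluid lam mu I Q T) (σ : Fin N.numStations) :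
    ContinuousOn (fun t => N.stationSum σ (Q t)) I :=
  continuousOn_finsetSum _ fun c _ => h.continuousOn_queue c

theorem mono (h : N.IsBusyFluid lam mu I Q T) {J : Set ℝ} (hJ : J ⊆ I) :
    N.IsBusyFluid lam mu J Q T where
  balance t ht := h.balance t (hJ ht)
  feasible σ s hs t ht := h.feasible σ s (hJ hs) t (hJ ht)
  queue_nonneg t ht := h.queue_nonneg t (hJ ht)
  time_mono c s hs t ht := h.time_mono c s (hJ hs) t (hJ ht)
  time_zero := h.time_zero
  busy σ s hs t ht := h.busy σ s (hJ hs) t (hJ ht)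

theorem isFluidSolution (h : N.IsBusyFluid lam mu I Q T) (h0 : (0 : ℝ) ∈ I)
    (hI : ∀ t ∈ I, 0 ≤ t) : N.IsFluidSolution lam mu I Q T where
  first_stage i t ht := h.balance t ht _
  next_stage i j hj t ht := h.balance t ht _
  feasible σ s hs t ht hst := by
    rw [stationSum_sub]; exact h.feasible σ s hs t ht hst
  queue_nonneg := h.queue_nonneg
  time_nonneg t ht c := by
    rw [← h.time_zero c]; exact h.time_mono c 0 h0 t ht (hI t ht)
  time_mono c s hs t ht hst := h.time_mono c s hs t ht hst
  time_zero := h.time_zero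

/-- The interval form of the non-idling condition implies the integral form. -/
theorem fluidNonIdling (h : N.IsBusyFluid lam mu I Q T) (hI : OrdConnected I) :
    N.FluidNonIdling I Q T := by
  intro σ
  -- The frontier of an interval is a null set, so only interior points matter, where the two-sided
  -- `deriv` sees values inside `I` only.
  have hfr : ∀ᵐ t ∂(volume.restrict I), t ∈ interior I := by
    rw [ae_restrict_iff' hI.measurableSet]
    have hnull : volume (I \ interior I) = 0 := by
      refine measure_mono_null (sdiff_subset_sdiff_left subset_closure) ?_
      exact hI.convex.addHaar_frontier volume
    rw [measure_eq_zero_iff_ae_notMem] at hnull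
    filter_upwards [hnull] with t ht htI
    by_contra hti
    exact ht ⟨htI, hti⟩
  rw [lintegral_congr_ae (g := fun _ => 0), lintegral_zero]
  filter_upwards [hfr] with t ht
  have htI : t ∈ I := interior_subset ht
  rcases (stationSum_nonneg (σ := σ) (h.queue_nonneg t htI)).eq_or_lt with h0 | hpos
  · simp [← h0]
  · have hnhds : I ∈ 𝓝 t := mem_interior_iff_mem_nhds.1 ht
    have hc : ContinuousAt (fun t => N.stationSum σ (Q t)) t :=
      (h.continuousOn_stationSum_queue σ).continuousAt hnhds
    have hev : ∀ᶠ x in 𝓝 t, x ∈ I ∧ 0 < N.stationSum σ (Q x) :=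
      (show ∀ᶠ x in 𝓝 t, x ∈ I from hnhds).and (hc.eventually (lt_mem_nhds hpos))
    obtain ⟨δ, hδ, hball⟩ := Metric.eventually_nhds_iff_ball.1 hev
    -- Near a time at which the station is not empty, full work and feasibility pin the idle time to
    -- a constant, so its derivative vanishes.
    have hconst : (fun s => s - N.stationSum σ (T s)) =ᶠ[𝓝 t]
        fun _ => t - N.stationSum σ (T t) := by
      filter_upwards [Metric.ball_mem_nhds t hδ] with x hx
      have hsub : uIcc t x ⊆ Metric.ball t δ := by
        rw [Real.ball_eq_Ioo] at hx ⊢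
        exact OrdConnected.uIcc_subset ordConnected_Ioo (by constructor <;> linarith) hx
      have hpos' : ∀ y ∈ uIcc t x, 0 < N.stationSum σ (Q y) := fun y hy => (hball y (hsub hy)).2
      rcases le_total t x with htx | htx
      · rw [uIcc_of_le htx] at hpos'
        have h1 := h.busy σ t htI x (hball x hx).1 htx hpos'
        have h2 := h.feasible σ t htI x (hball x hx).1 htx
        linarith
      · rw [uIcc_of_ge htx] at hpos'
        have h1 := h.busy σ x (hball x hx).1 t htI htx hpos'
        have h2 := h.feasible σ x (hball x hx).1 t htI htx
        linarith
    rw [hconst.deriv_eq]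
    simp

end IsBusyFluid

/-- The integral form of the non-idling condition implies the interval form. -/
theorem IsFluidSolution.isBusyFluid (h : N.IsFluidSolution lam mu I Q T)
    (hn : N.FluidNonIdling I Q T) (hI : OrdConnected I) : N.IsBusyFluid lam mu I Q T := by
  have hfeas : ∀ σ, ∀ s ∈ I, ∀ t ∈ I, s ≤ t →
      N.stationSum σ (T t) - N.stationSum σ (T s) ≤ t - s := fun σ s hs t ht hst => by
    rw [← stationSum_sub]; exact h.feasible σ s hs t ht hst
  have hmono : ∀ c, ∀ s ∈ I, ∀ t ∈ I, s ≤ t → T s c ≤ T t c :=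
    fun c s hs t ht hst => h.time_mono c hs ht hst
  have hT : ∀ c, ContinuousOn (fun t => T t c) I := fun c =>
    continuousOn_of_abs_sub_le (K := 1) fun _ hx _ hy => abs_sub_le_of_mono 1
      (fun s hs t ht hst => ⟨hmono c s hs t ht hst, by
        rw [one_mul]
        exact sub_le_of_mono_of_feasible (fun c => hmono c s hs t ht hst)
          (fun σ => hfeas σ s hs t ht hst) c⟩) hx hy
  have hQ := continuousOn_of_balance (fun t ht => h.balance ht) hT
  refine ⟨fun t ht => h.balance ht, hfeas, h.queue_nonneg, hmono, h.time_zero, ?_⟩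
  intro σ s hs t ht hst hpos
  have hsub : Icc s t ⊆ I := hI.out hs ht
  set f : ℝ → ℝ := fun s => s - N.stationSum σ (T s) with hf
  have hQσ : ContinuousOn (fun t => N.stationSum σ (Q t)) I :=
    continuousOn_finsetSum _ fun c _ => hQ c
  have hae : ∀ᵐ x ∂(volume.restrict I), N.stationSum σ (Q x) * deriv f x ≤ 0 := by
    have h1 := hn σ
    rw [lintegral_eq_zero_iff'] at h1
    · filter_upwards [h1] with x hx
      simpa using hx
    · refine ENNReal.measurable_ofReal.comp_aemeasurable ?_
      exact (hQσ.aemeasurable hI.measurableSet).mul (measurable_deriv f).aemeasurable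
  rw [ae_restrict_iff' hI.measurableSet] at hae
  have hder : ∀ᵐ x ∂(volume.restrict (Icc s t)), deriv f x ≤ 0 := by
    rw [ae_restrict_iff' measurableSet_Icc]
    filter_upwards [hae] with x hx hxst
    exact nonpos_of_mul_nonpos_right (hx (hsub hxst)) (hpos x hxst)
  have hlip : ∀ x ∈ Icc s t, ∀ y ∈ Icc s t, |f x - f y| ≤ 1 * |x - y| := by
    intro x hx y hy
    refine abs_sub_le_of_mono (I := Icc s t) 1 (fun a ha b hb hab => ?_) hx hy
    have h1 := hfeas σ a (hsub ha) b (hsub hb) hab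
    have h2 : N.stationSum σ (T a) ≤ N.stationSum σ (T b) :=
      stationSum_mono σ fun c => hmono c a (hsub ha) b (hsub hb) hab
    simp only [hf]
    constructor <;> linarith
  -- The idle time is Lipschitz, hence the integral of its derivative; the latter is almost
  -- everywhere non-positive on `[s, t]`.
  have hac : AbsolutelyContinuousOnInterval f s t := by
    refine LipschitzOnWith.absolutelyContinuousOnInterval (K := 1) ?_
    rw [uIcc_of_le hst]
    refine LipschitzOnWith.of_dist_le_mul fun x hx y hy => ?_
    rw [Real.dist_eq, Real.dist_eq]
    exact_mod_cast hlip x hx y hy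
  have hint := hac.integral_deriv_eq_sub
  have hle : ∫ x in s..t, deriv f x ≤ 0 := by
    rw [intervalIntegral.integral_of_le hst, ← integral_Icc_eq_integral_Ioc]
    exact integral_nonpos_of_ae hder
  rw [hint] at hle
  simp only [hf] at hle
  linarith

end MultitypeNetwork

namespace MultitypeNetwork

variable {N : MultitypeNetwork}

/-! ### Operations on fluid solutions -/

/-- A continuous function that is locally non-increasing to the right of every point is
non-increasing. -/
theorem le_of_right_locally_le {f : ℝ → ℝ} {s t : ℝ} (hst : s ≤ t)
    (hf : ContinuousOn f (Icc s t))
    (hloc : ∀ x ∈ Ico s t, ∃ δ > 0, ∀ y ∈ Ioo x (x + δ), f y ≤ f x) : f t ≤ f s := by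
  have hcl : IsClosed ({x | f x ≤ f s} ∩ Icc s t) := by
    rw [inter_comm]
    exact hf.preimage_isClosed_of_isClosed isClosed_Icc (isClosed_Iic (a := f s))
  refine hcl.Icc_subset_of_forall_exists_gt (a := s) (b := t) (le_refl (f s)) ?_
    (right_mem_Icc.2 hst)
  rintro x ⟨hx, hxI⟩ y hy
  obtain ⟨δ, hδ, h⟩ := hloc x hxI
  have hy' : x < y := hy
  obtain ⟨z, hz1, hz2⟩ := exists_between (lt_min hy' (lt_add_of_pos_right x hδ))
  refine ⟨z, ?_, hz1, (hz2.trans_le (min_le_left _ _)).le⟩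
  exact (h z ⟨hz1, hz2.trans_le (min_le_right _ _)⟩).trans hx

/-- A bound for the rate of change of the queues in a fluid solution. -/
def fluidLip (N : MultitypeNetwork) (lam : Fin N.numTypes → ℝ) (mu : N.Class → ℝ) : ℝ :=
  (∑ i, |lam i| + ∑ c, |mu c|) + ∑ c, |mu c|

variable {lam : Fin N.numTypes → ℝ} {mu : N.Class → ℝ} {I : Set ℝ} {Q T : ℝ → N.Class → ℝ}

theorem fluidLip_nonneg : 0 ≤ N.fluidLip lam mu := by
  unfold fluidLip
  positivity

namespace IsBusyFluid

theorem abs_queue_sub_le (h : N.IsBusyFluid lam mu I Q T) {s t : ℝ} (hs : s ∈ I) (ht : t ∈ I)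
    (c : N.Class) : |Q t c - Q s c| ≤ N.fluidLip lam mu * |t - s| := by
  have hT : ∀ c, |mu c * T t c - mu c * T s c| ≤ (∑ c, |mu c|) * |t - s| := fun c => by
    rw [← mul_sub, abs_mul]
    have h1 : |T t c - T s c| ≤ 1 * |t - s| := abs_sub_le_of_mono 1
      (fun s hs t ht hst => ⟨h.time_mono c s hs t ht hst, by
        rw [one_mul]; exact h.time_sub_le hs ht hst c⟩) ht hs
    rw [one_mul] at h1
    exact mul_le_mul (Finset.single_le_sum (f := fun c => |mu c|) (fun _ _ => abs_nonneg _)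
      (Finset.mem_univ c)) h1 (abs_nonneg _) (Finset.sum_nonneg fun _ _ => abs_nonneg _)
  have hU : |N.upstream (fun i => lam i * t) (fun c => mu c * T t c) c
      - N.upstream (fun i => lam i * s) (fun c => mu c * T s c) c|
      ≤ (∑ i, |lam i| + ∑ c, |mu c|) * |t - s| := by
    refine upstream_forall₂ (p := fun x y => |x - y| ≤ (∑ i, |lam i| + ∑ c, |mu c|) * |t - s|)
      (fun i => ?_) (fun c => ?_) c
    · rw [← mul_sub, abs_mul]
      refine mul_le_mul_of_nonneg_right ?_ (abs_nonneg _)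
      exact (Finset.single_le_sum (f := fun i => |lam i|) (fun _ _ => abs_nonneg _)
        (Finset.mem_univ i)).trans
        (le_add_of_nonneg_right (Finset.sum_nonneg fun _ _ => abs_nonneg _))
    · refine (hT c).trans (mul_le_mul_of_nonneg_right ?_ (abs_nonneg _))
      exact le_add_of_nonneg_left (Finset.sum_nonneg fun _ _ => abs_nonneg _)
  rw [h.balance t ht c, h.balance s hs c, fluidLip, add_mul]
  calc _ = |(N.upstream (fun i => lam i * t) (fun c => mu c * T t c) c
      - N.upstream (fun i => lam i * s) (fun c => mu c * T s c) c)
      - (mu c * T t c - mu c * T s c)| := by congr 1; ring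
    _ ≤ _ := (abs_sub _ _).trans (add_le_add hU (hT c))

theorem abs_stationSum_sub_le (h : N.IsBusyFluid lam mu I Q T) {s t : ℝ} (hs : s ∈ I)
    (ht : t ∈ I) (σ : Fin N.numStations) : |N.stationSum σ (Q t) - N.stationSum σ (Q s)|
      ≤ Fintype.card N.Class * N.fluidLip lam mu * |t - s| := by
  rw [← stationSum_sub]
  refine (Finset.abs_sum_le_sum_abs _ _).trans ?_
  refine (Finset.sum_le_sum fun c _ => h.abs_queue_sub_le hs ht c).trans ?_
  rw [Finset.sum_const, nsmul_eq_mul, mul_assoc]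
  refine mul_le_mul_of_nonneg_right ?_ (mul_nonneg fluidLip_nonneg (abs_nonneg _))
  exact_mod_cast Finset.card_le_univ _

theorem l1_sub_le (h : N.IsBusyFluid lam mu I Q T) {s t : ℝ} (hs : s ∈ I)
    (ht : t ∈ I) : N.l1 (Q s) - N.l1 (Q t) ≤ Fintype.card N.Class * N.fluidLip lam mu * |t - s| := by
  unfold l1
  rw [← Finset.sum_sub_distrib]
  refine (Finset.sum_le_sum fun c _ => ((abs_sub_abs_le_abs_sub _ _).trans ?_ :
    _ ≤ N.fluidLip lam mu * |t - s|)).trans ?_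
  · rw [abs_sub_comm]; exact h.abs_queue_sub_le hs ht c
  · rw [Finset.sum_const, nsmul_eq_mul, mul_assoc, Finset.card_univ]

theorem continuousOn_l1 (h : N.IsBusyFluid lam mu I Q T) : ContinuousOn (fun t => N.l1 (Q t)) I :=
  continuousOn_finsetSum _ fun c _ => (h.continuousOn_queue c).abs

/-- A fluid solution is non-idling if every station works just after each time at which it is not
empty. -/
theorem of_right_local
    (balance : ∀ t, 0 ≤ t → ∀ c, Q t c = Q 0 c
      + N.upstream (fun i => lam i * t) (fun c => mu c * T t c) c - mu c * T t c)
    (feasible : ∀ σ s t, 0 ≤ s → s ≤ t →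
      N.stationSum σ (T t) - N.stationSum σ (T s) ≤ t - s)
    (queue_nonneg : ∀ t, 0 ≤ t → ∀ c, 0 ≤ Q t c)
    (time_mono : ∀ c s t, 0 ≤ s → s ≤ t → T s c ≤ T t c)
    (time_zero : ∀ c, T 0 c = 0)
    (busy : ∀ σ x, 0 ≤ x → 0 < N.stationSum σ (Q x) → ∃ δ > 0, ∀ y ∈ Ioo x (x + δ),
      y - x ≤ N.stationSum σ (T y) - N.stationSum σ (T x)) :
    N.IsBusyFluid lam mu (Ici 0) Q T := by
  refine ⟨balance, fun σ s hs t _ => feasible σ s t hs, queue_nonneg,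
    fun c s hs t _ => time_mono c s t hs, time_zero, ?_⟩
  intro σ s hs t ht hst hpos
  have hT : ∀ c, ContinuousOn (fun t => T t c) (Icc s t) := fun c =>
    continuousOn_of_abs_sub_le (K := 1) fun _ hx _ hy => abs_sub_le_of_mono 1
      (fun a ha b hb hab => by
        have ha0 : 0 ≤ a := le_trans hs ha.1
        refine ⟨time_mono c a b ha0 hab, ?_⟩
        rw [one_mul]
        exact sub_le_of_mono_of_feasible (fun c => time_mono c a b ha0 hab)
          (fun σ => feasible σ a b ha0 hab) c) hx hy
  have := le_of_right_locally_le (f := fun x => x - N.stationSum σ (T x)) hst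
    (continuousOn_id.sub (continuousOn_finsetSum _ fun c _ => hT c)) (fun x hx => by
      obtain ⟨δ, hδ, h⟩ := busy σ x (le_trans hs hx.1) (hpos x ⟨hx.1, hx.2.le⟩)
      exact ⟨δ, hδ, fun y hy => by linarith [h y hy]⟩)
  linarith

/-- By continuity a non-empty station stays non-empty for a while. Together with `of_right_local`
this reduces non-idling to what happens just after each time, a form that survives cutting and
pasting. -/
theorem busy_right (h : N.IsBusyFluid lam mu (Ici 0) Q T) {σ : Fin N.numStations} {x : ℝ}
    (hx : 0 ≤ x) (hpos : 0 < N.stationSum σ (Q x)) : ∃ δ > 0, ∀ y ∈ Ioo x (x + δ),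
      y - x ≤ N.stationSum σ (T y) - N.stationSum σ (T x) := by
  have hc := h.continuousOn_stationSum_queue σ x hx
  have hev := hc.eventually (lt_mem_nhds hpos)
  obtain ⟨δ, hδ, hb⟩ := Metric.mem_nhdsWithin_iff.1 hev
  refine ⟨δ, hδ, fun y hy => h.busy σ x hx y (hx.trans hy.1.le) hy.1.le fun z hz => ?_⟩
  refine hb ⟨?_, hx.trans hz.1⟩
  rw [Real.ball_eq_Ioo]
  exact ⟨by linarith [hz.1], by linarith [hz.2, hy.2]⟩

/-- The rates are constant, so the fluid equations are invariant under a common dilation of time and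
space. -/
theorem scale (h : N.IsBusyFluid lam mu (Ici 0) Q T) {a : ℝ} (ha : 0 < a) :
    N.IsBusyFluid lam mu (Ici 0) (fun t c => a * Q (t / a) c) (fun t c => a * T (t / a) c) := by
  have hdiv : ∀ {t : ℝ}, 0 ≤ t → 0 ≤ t / a := fun ht => div_nonneg ht ha.le
  have hmul : ∀ t : ℝ, a * (t / a) = t := fun t => mul_div_cancel₀ t ha.ne'
  have hle : ∀ {s t : ℝ}, s ≤ t → s / a ≤ t / a := fun hst => by gcongr
  refine of_right_local (fun t ht c => ?_) (fun σ s t hs hst => ?_) (fun t ht c => ?_)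
    (fun c s t hs hst => ?_) (fun c => ?_) (fun σ x hx hpos => ?_)
  · rw [h.balance _ (hdiv ht) c]
    have := upstream_comp (N := N) (fun x => a * x) (fun i => lam i * (t / a))
      (fun c => mu c * T (t / a) c) c
    have h2 : N.upstream (fun i => lam i * t) (fun c => mu c * (a * T (t / a) c)) c
        = a * N.upstream (fun i => lam i * (t / a)) (fun c => mu c * T (t / a) c) c := by
      rw [← this]
      congr 1
      · funext i; rw [mul_left_comm, hmul]
      · funext c; ring
    rw [h2, zero_div]
    ring
  · rw [stationSum_mul, stationSum_mul, ← mul_sub]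
    have := mul_le_mul_of_nonneg_left (h.feasible σ _ (hdiv hs) _ (hdiv (hs.trans hst)) (hle hst))
      ha.le
    rwa [mul_sub a (t / a), hmul, hmul] at this
  · exact mul_nonneg ha.le (h.queue_nonneg _ (hdiv ht) c)
  · exact mul_le_mul_of_nonneg_left
      (h.time_mono c _ (hdiv hs) _ (hdiv (hs.trans hst)) (hle hst)) ha.le
  · rw [zero_div, h.time_zero, mul_zero]
  · rw [stationSum_mul] at hpos
    obtain ⟨δ, hδ, hb⟩ := h.busy_right (hdiv hx) (pos_of_mul_pos_right hpos ha.le)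
    refine ⟨a * δ, mul_pos ha hδ, fun y hy => ?_⟩
    have := hb (y / a) ⟨by gcongr; exact hy.1, by
      rw [div_lt_iff₀ ha, add_mul, div_mul_cancel₀ _ ha.ne', mul_comm δ]; exact hy.2⟩
    have h2 := mul_le_mul_of_nonneg_left this ha.le
    rw [stationSum_mul, stationSum_mul, ← mul_sub]
    rwa [mul_sub a (y / a), hmul, hmul] at h2

theorem shift (h : N.IsBusyFluid lam mu (Ici 0) Q T) {a : ℝ} (ha : 0 ≤ a) :
    N.IsBusyFluid lam mu (Ici 0) (fun t => Q (a + t)) (fun t c => T (a + t) c - T a c) := by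
  refine of_right_local (fun t ht c => ?_) (fun σ s t hs hst => ?_) (fun t ht c => ?_)
    (fun c s t hs hst => ?_) (fun c => ?_) (fun σ x hx hpos => ?_)
  · rw [h.balance (a + t) (add_nonneg ha ht) c, add_zero, h.balance a ha c]
    have := upstream_comp₂ (N := N) (fun x y => x - y) (fun i => lam i * (a + t))
      (fun c => mu c * T (a + t) c) (fun i => lam i * a) (fun c => mu c * T a c) c
    have h2 : N.upstream (fun i => lam i * t) (fun c => mu c * (T (a + t) c - T a c)) c
        = N.upstream (fun i => lam i * (a + t)) (fun c => mu c * T (a + t) c) c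
          - N.upstream (fun i => lam i * a) (fun c => mu c * T a c) c := by
      rw [← this]
      congr 1
      · funext i; ring
      · funext c; ring
    rw [h2]
    ring
  · rw [stationSum_sub, stationSum_sub]
    have := h.feasible σ (a + s) (add_nonneg ha hs) (a + t) (add_nonneg ha (hs.trans hst))
      (by linarith)
    linarith
  · exact h.queue_nonneg _ (add_nonneg ha ht) c
  · have := h.time_mono c (a + s) (add_nonneg ha hs) (a + t) (add_nonneg ha (hs.trans hst))
      (by linarith)
    linarith
  · simp
  · obtain ⟨δ, hδ, hb⟩ := h.busy_right (add_nonneg ha hx) hpos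
    refine ⟨δ, hδ, fun y hy => ?_⟩
    have := hb (a + y) ⟨by linarith [hy.1], by linarith [hy.2]⟩
    rw [stationSum_sub, stationSum_sub]
    linarith

/-- The right-local form of non-idling makes the junction harmless: at time `a` only the second
solution is inspected. -/
theorem concat (h : N.IsBusyFluid lam mu (Ici 0) Q T) {Q' T' : ℝ → N.Class → ℝ}
    (h' : N.IsBusyFluid lam mu (Ici 0) Q' T') {a : ℝ} (ha : 0 ≤ a) (hQ : Q' 0 = Q a) :
    N.IsBusyFluid lam mu (Ici 0) (fun t => if t < a then Q t else Q' (t - a))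
      (fun t c => if t < a then T t c else T a c + T' (t - a) c) := by
  have hsum1 : ∀ σ t, t < a → N.stationSum σ (fun c => if t < a then T t c else
      T a c + T' (t - a) c) = N.stationSum σ (T t) := fun σ t ht => by simp only [if_pos ht]
  have hsum2 : ∀ σ t, a ≤ t → N.stationSum σ (fun c => if t < a then T t c else
      T a c + T' (t - a) c) = N.stationSum σ (T a) + N.stationSum σ (T' (t - a)) :=
    fun σ t ht => by simp only [if_neg ht.not_gt, stationSum_add]
  have hz : ∀ σ, N.stationSum σ (T' 0) = 0 := fun σ =>
    Finset.sum_eq_zero fun c _ => h'.time_zero c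
  refine of_right_local (fun t ht c => ?_) (fun σ s t hs hst => ?_) (fun t ht c => ?_)
    (fun c s t hs hst => ?_) (fun c => ?_) (fun σ x hx hpos => ?_)
  · have h0 : (if (0 : ℝ) < a then Q 0 else Q' (0 - a)) = Q 0 := by
      rcases ha.eq_or_lt with rfl | ha'
      · simp [hQ]
      · simp [ha']
    rw [h0]
    rcases lt_or_ge t a with hta | hta
    · simp only [if_pos hta]
      exact h.balance t ht c
    · simp only [if_neg hta.not_gt]
      rw [h'.balance _ (sub_nonneg.2 hta) c, hQ, h.balance a ha c]
      have := upstream_comp₂ (N := N) (fun x y => x + y) (fun i => lam i * a)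
        (fun c => mu c * T a c) (fun i => lam i * (t - a)) (fun c => mu c * T' (t - a) c) c
      have h2 : N.upstream (fun i => lam i * t) (fun c => mu c * (T a c + T' (t - a) c)) c
          = N.upstream (fun i => lam i * a) (fun c => mu c * T a c) c
            + N.upstream (fun i => lam i * (t - a)) (fun c => mu c * T' (t - a) c) c := by
        rw [← this]
        congr 1
        · funext i; ring
        · funext c; ring
      rw [h2]
      ring
  · rcases lt_or_ge t a with hta | hta
    · rw [hsum1 σ t hta, hsum1 σ s (hst.trans_lt hta)]
      exact h.feasible σ s hs t (hs.trans hst) hst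
    · rcases lt_or_ge s a with hsa | hsa
      · rw [hsum1 σ s hsa, hsum2 σ t hta]
        have h1 := h.feasible σ s hs a ha hsa.le
        have h2 := h'.feasible σ 0 (le_refl (0 : ℝ)) (t - a) (sub_nonneg.2 hta) (sub_nonneg.2 hta)
        rw [hz] at h2
        linarith
      · rw [hsum2 σ s hsa, hsum2 σ t hta]
        have h2 := h'.feasible σ (s - a) (sub_nonneg.2 hsa) (t - a) (sub_nonneg.2 hta)
          (by linarith)
        linarith
  · rcases lt_or_ge t a with hta | hta
    · simp only [if_pos hta]
      exact h.queue_nonneg t ht c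
    · simp only [if_neg hta.not_gt]
      exact h'.queue_nonneg _ (sub_nonneg.2 hta) c
  · rcases lt_or_ge t a with hta | hta
    · simp only [if_pos hta, if_pos (hst.trans_lt hta)]
      exact h.time_mono c s hs t (hs.trans hst) hst
    · simp only [if_neg hta.not_gt]
      rcases lt_or_ge s a with hsa | hsa
      · simp only [if_pos hsa]
        have h1 := h.time_mono c s hs a ha hsa.le
        have h2 := h'.time_mono c 0 (le_refl (0 : ℝ)) (t - a) (sub_nonneg.2 hta)
          (sub_nonneg.2 hta)
        rw [h'.time_zero] at h2
        linarith
      · simp only [if_neg hsa.not_gt]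
        have h2 := h'.time_mono c (s - a) (sub_nonneg.2 hsa) (t - a) (sub_nonneg.2 hta)
          (by linarith)
        linarith
  · rcases ha.eq_or_lt with rfl | ha'
    · simp [h.time_zero, h'.time_zero]
    · simp [ha', h.time_zero]
  · rcases lt_or_ge x a with hxa | hxa
    · simp only [if_pos hxa] at hpos
      obtain ⟨δ, hδ, hb⟩ := h.busy_right hx hpos
      refine ⟨min δ (a - x), lt_min hδ (sub_pos.2 hxa), fun y hy => ?_⟩
      have hya : y < a := by linarith [hy.2, min_le_right δ (a - x)]
      rw [hsum1 σ x hxa, hsum1 σ y hya]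
      exact hb y ⟨hy.1, by linarith [hy.2, min_le_left δ (a - x)]⟩
    · simp only [if_neg hxa.not_gt] at hpos
      obtain ⟨δ, hδ, hb⟩ := h'.busy_right (sub_nonneg.2 hxa) hpos
      refine ⟨δ, hδ, fun y hy => ?_⟩
      rw [hsum2 σ x hxa, hsum2 σ y (hxa.trans hy.1.le)]
      have := hb (y - a) ⟨by linarith [hy.1], by linarith [hy.2]⟩
      linarith

/-- Fluid solutions from a common initial level converge pointwise along an ultrafilter, and
the limit is a fluid solution. -/
theorem exists_limit {ι : Type*} (𝓤 : Ultrafilter ι) {q : N.Class → ℝ}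
    {Q T : ι → ℝ → N.Class → ℝ} (h : ∀ k, N.IsBusyFluid lam mu (Ici 0) (Q k) (T k))
    (hq : ∀ k, Q k 0 = q) :
    ∃ Q' T' : ℝ → N.Class → ℝ, N.IsBusyFluid lam mu (Ici 0) Q' T' ∧ Q' 0 = q ∧
      ∀ t, 0 ≤ t → ∀ c, Tendsto (fun k => Q k t c) 𝓤 (𝓝 (Q' t c)) := by
  -- All values lie in the compact interval `[0, t]`, so limits along the ultrafilter exist at every
  -- time at once, without extracting subsequences.
  have hlim : ∀ (t : ℝ) (c : N.Class), ∃ x, 0 ≤ t → Tendsto (fun k => T k t c) 𝓤 (𝓝 x) := by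
    intro t c
    by_cases ht : 0 ≤ t
    · have hmem : ∀ k, T k t c ∈ Icc 0 t := fun k => by
        have h1 := (h k).time_mono c 0 (le_refl (0 : ℝ)) t ht ht
        have h2 := (h k).time_sub_le (le_refl (0 : ℝ)) ht ht c
        rw [(h k).time_zero] at h1 h2
        exact ⟨h1, by linarith⟩
      obtain ⟨x, -, hx⟩ := isCompact_Icc.ultrafilter_le_nhds (𝓤.map fun k => T k t c)
        (by
          rw [le_principal_iff]
          exact Filter.mem_map.2 (Filter.univ_mem' hmem))
      exact ⟨x, fun _ => hx⟩
    · exact ⟨0, fun h => absurd h ht⟩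
  choose T' hT' using hlim
  have hU : ∀ t, 0 ≤ t → ∀ c, Tendsto
      (fun k => N.upstream (fun i => lam i * t) (fun c => mu c * T k t c) c) 𝓤
      (𝓝 (N.upstream (fun i => lam i * t) (fun c => mu c * T' t c) c)) := by
    intro t ht c
    rcases c with ⟨i, ⟨_ | j, hj⟩⟩
    · exact tendsto_const_nhds
    · exact (hT' t _ ht).const_mul _
  have hT0 : ∀ c, T' 0 c = 0 := fun c => by
    refine tendsto_nhds_unique (hT' 0 c le_rfl) ?_
    simp [(h _).time_zero]
  set Q' : ℝ → N.Class → ℝ := fun t c => q c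
    + N.upstream (fun i => lam i * t) (fun c => mu c * T' t c) c - mu c * T' t c with hQ'
  have hQ0 : Q' 0 = q := by
    funext c
    have : N.upstream (fun i => lam i * 0) (fun c => mu c * T' 0 c) c = 0 :=
      upstream_forall (p := fun x => x = 0) (fun i => mul_zero _)
        (fun c => by rw [hT0, mul_zero]) c
    change q c + N.upstream (fun i => lam i * 0) (fun c => mu c * T' 0 c) c - mu c * T' 0 c = q c
    rw [this, hT0]
    ring
  have hQlim : ∀ t, 0 ≤ t → ∀ c, Tendsto (fun k => Q k t c) 𝓤 (𝓝 (Q' t c)) := by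
    intro t ht c
    have : (fun k => Q k t c) = fun k => q c
        + N.upstream (fun i => lam i * t) (fun c => mu c * T k t c) c - mu c * T k t c := by
      funext k
      rw [(h k).balance t ht c, hq k]
    rw [this]
    exact (tendsto_const_nhds.add (hU t ht c)).sub ((hT' t c ht).const_mul _)
  have hTσ : ∀ σ t, 0 ≤ t → Tendsto (fun k => N.stationSum σ (T k t)) 𝓤
      (𝓝 (N.stationSum σ (T' t))) := fun σ t ht => tendsto_finsetSum _ fun c _ => hT' t c ht
  have hQσ : ∀ σ t, 0 ≤ t → Tendsto (fun k => N.stationSum σ (Q k t)) 𝓤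
      (𝓝 (N.stationSum σ (Q' t))) := fun σ t ht => tendsto_finsetSum _ fun c _ => hQlim t ht c
  refine ⟨Q', T', ?_, hQ0, hQlim⟩
  refine of_right_local (fun t ht c => ?_) (fun σ s t hs hst => ?_) (fun t ht c => ?_)
    (fun c s t hs hst => ?_) hT0 (fun σ x hx hpos => ?_)
  · rw [hQ0]
  · exact le_of_tendsto ((hTσ σ t (hs.trans hst)).sub (hTσ σ s hs))
      (Eventually.of_forall fun k => (h k).feasible σ s hs t (hs.trans hst) hst)
  · exact ge_of_tendsto (hQlim t ht c) (Eventually.of_forall fun k => (h k).queue_nonneg t ht c)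
  · exact le_of_tendsto_of_tendsto (hT' s c hs) (hT' t c (hs.trans hst))
      (Eventually.of_forall fun k => (h k).time_mono c s hs t (hs.trans hst) hst)
  · set ε := N.stationSum σ (Q' x) with hε
    set K := Fintype.card N.Class * N.fluidLip lam mu with hK
    have hK0 : 0 ≤ K := mul_nonneg (Nat.cast_nonneg _) fluidLip_nonneg
    -- Station contents are Lipschitz with constant `K` for every index. A content above `ε / 2` at
    -- `x` therefore stays positive for a time that does not depend on the index.
    refine ⟨ε / 2 / (K + 1), by positivity, fun y hy => ?_⟩
    have hy0 : 0 ≤ y := hx.trans hy.1.le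
    refine ge_of_tendsto ((hTσ σ y hy0).sub (hTσ σ x hx)) ?_
    have hev : ∀ᶠ k in 𝓤, ε / 2 < N.stationSum σ (Q k x) :=
      (hQσ σ x hx).eventually (lt_mem_nhds (by linarith))
    filter_upwards [hev] with k hk
    refine (h k).busy σ x hx y hy0 hy.1.le fun z hz => ?_
    have h1 := (h k).abs_stationSum_sub_le (s := x) (t := z) hx (hx.trans hz.1) σ
    rw [abs_of_nonneg (sub_nonneg.2 hz.1)] at h1
    have h2 : (K + 1) * (z - x) < ε / 2 := by
      have : z - x < ε / 2 / (K + 1) := by linarith [hz.2, hy.2]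
      rw [lt_div_iff₀ (by linarith)] at this
      linarith
    have h3 := (abs_le.1 h1).1
    have h4 : K * (z - x) ≤ (K + 1) * (z - x) := by nlinarith [hz.1]
    linarith

end IsBusyFluid

end MultitypeNetwork

namespace MultitypeNetwork

variable {N : MultitypeNetwork}

/-! ### Layering a fluid solution over an initial level -/

/-- One-dimensional reflection: a fluid queue with cumulative input `A` (which includes its initial
content), offered the cumulative service capacity `R`, leaves the capacity `Y` unused. -/
theorem exists_reflection {R A : ℝ → ℝ} {m : ℝ} (hm : 0 < m) (hR0 : R 0 = 0)
    (hR : ∀ s t, 0 ≤ s → s ≤ t → R s ≤ R t) (hRc : ContinuousOn R (Ici 0))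
    (hA : ∀ s t, 0 ≤ s → s ≤ t → A s ≤ A t) (hAc : ContinuousOn A (Ici 0)) (hA0 : 0 ≤ A 0) :
    ∃ Y : ℝ → ℝ, Y 0 = 0 ∧ (∀ s t, 0 ≤ s → s ≤ t → Y s ≤ Y t ∧ Y t - Y s ≤ R t - R s) ∧
      (∀ t, 0 ≤ t → 0 ≤ A t - m * (R t - Y t)) ∧
      ∀ x, 0 ≤ x → 0 < A x - m * (R x - Y x) → ∃ δ > 0, ∀ y ∈ Ioo x (x + δ), Y y ≤ Y x := by
  -- Skorokhod's reflection formula: the unused capacity is the running supremum of the positive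
  -- part of `R - A / m`.
  set g : ℝ → ℝ := fun s => max 0 (R s - A s / m) with hg
  have hbdd : ∀ t, BddAbove (g '' Icc 0 t) := by
    rintro t
    refine ⟨R t, ?_⟩
    rintro _ ⟨s, hs, rfl⟩
    have h1 := hR s t hs.1 hs.2
    have h2 := hR 0 t le_rfl (hs.1.trans hs.2)
    have h3 : 0 ≤ A s / m := div_nonneg (hA0.trans (hA 0 s le_rfl hs.1)) hm.le
    exact max_le (by linarith) (by linarith)
  have hmem : ∀ {s t : ℝ}, 0 ≤ s → s ≤ t → g s ≤ sSup (g '' Icc 0 t) := fun hs hst =>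
    le_csSup (hbdd _) ⟨_, ⟨hs, hst⟩, rfl⟩
  have hne : ∀ {t : ℝ}, 0 ≤ t → (g '' Icc 0 t).Nonempty := fun ht => ⟨_, 0, ⟨le_rfl, ht⟩, rfl⟩
  have hgY : ∀ s, R s - A s / m ≤ g s := fun s => le_max_right _ _
  have hg0 : ∀ s, 0 ≤ g s := fun s => le_max_left _ _
  refine ⟨fun t => sSup (g '' Icc 0 t), ?_, fun s t hs hst => ⟨?_, ?_⟩, fun t ht => ?_,
    fun x hx hpos => ?_⟩
  · simp only [Icc_self, image_singleton, csSup_singleton, hg, hR0]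
    exact max_eq_left (by have := div_nonneg hA0 hm.le; linarith)
  · exact csSup_le_csSup (hbdd t) (hne hs) (image_mono (Icc_subset_Icc_right hst))
  · rw [sub_le_iff_le_add]
    refine csSup_le (hne (hs.trans hst)) ?_
    rintro _ ⟨x, hx, rfl⟩
    have hRst := hR s t hs hst
    rcases le_total x s with hxs | hxs
    · linarith [hmem hx.1 hxs]
    · refine max_le ?_ ?_
      · linarith [hg0 s, hmem hs le_rfl]
      · have h1 := hR x t hx.1 hx.2
        have h2 : A s / m ≤ A x / m := by gcongr; exact hA s x hs hxs
        linarith [hgY s, hmem hs le_rfl]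
  · have h1 := (hgY t).trans (hmem ht le_rfl)
    have h2 : m * (R t - A t / m) ≤ m * sSup (g '' Icc 0 t) :=
      mul_le_mul_of_nonneg_left h1 hm.le
    rw [mul_sub, mul_div_cancel₀ _ hm.ne'] at h2
    rw [mul_sub]
    linarith
  · set Yx := sSup (g '' Icc 0 x) with hYx
    -- Positive content means that `R - A / m` lies strictly below the running supremum. By
    -- continuity the supremum does not increase just after `x`.
    have hlt : R x - A x / m < Yx := by
      have : m * (R x - A x / m) < m * Yx := by
        rw [mul_sub, mul_div_cancel₀ _ hm.ne']
        rw [mul_sub] at hpos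
        linarith
      exact lt_of_mul_lt_mul_left this hm.le
    have hc : ContinuousWithinAt (fun s => R s - A s / m) (Ici 0) x :=
      (hRc x hx).sub ((hAc x hx).div_const m)
    obtain ⟨δ, hδ, hb⟩ := Metric.mem_nhdsWithin_iff.1 (hc.eventually (gt_mem_nhds hlt))
    refine ⟨δ, hδ, fun y hy => csSup_le (hne (hx.trans hy.1.le)) ?_⟩
    rintro _ ⟨z, hz, rfl⟩
    rcases le_total z x with hzx | hzx
    · exact hmem hz.1 hzx
    · refine max_le ((hg0 x).trans (hmem hx le_rfl)) ?_
      refine (hb ⟨?_, hz.1⟩ : R z - A z / m < Yx).le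
      rw [Real.ball_eq_Ioo]
      exact ⟨by linarith, by linarith [hz.2, hy.2]⟩

/-- An enumeration of the classes in which upstream classes come first. -/
def rank (c : N.Class) : ℕ := c.2.val * N.numTypes + c.1.val

theorem rank_injective : Function.Injective (rank (N := N)) := by
  rintro ⟨i, j⟩ ⟨i', j'⟩ h
  simp only [rank] at h
  have hi := i.2
  have hi' := i'.2
  have hij : i.val = i'.val := by
    have := congrArg (· % N.numTypes) h
    simpa [Nat.mul_add_mod', Nat.mod_eq_of_lt hi, Nat.mod_eq_of_lt hi'] using this
  obtain rfl : i = i' := Fin.ext hij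
  have hpos : 0 < N.numTypes := by omega
  have hj : j.val = j'.val := by
    have : j.val * N.numTypes = j'.val * N.numTypes := by omega
    exact Nat.eq_of_mul_eq_mul_right hpos this
  obtain rfl : j = j' := Fin.ext hj
  rfl

theorem rank_lt_succ {i : Fin N.numTypes} {j : ℕ} (h : j + 1 < N.stages i) :
    rank (N := N) ⟨i, ⟨j, Nat.lt_of_succ_lt h⟩⟩ < rank (N := N) ⟨i, ⟨j + 1, h⟩⟩ := by
  have := i.2
  simp only [rank, add_mul, one_mul]
  omega

variable {lam : Fin N.numTypes → ℝ} {mu : N.Class → ℝ}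

/-- The content of an autonomous layer of fluid: initial content `q`, no external arrivals. -/
def layerQueue (mu : N.Class → ℝ) (q : N.Class → ℝ) (T : N.Class → ℝ) (c : N.Class) : ℝ :=
  q c + N.upstream (fun _ => 0) (fun c => mu c * T c) c - mu c * T c

theorem stationSum_update (σ : Fin N.numStations) (T : N.Class → ℝ) (c : N.Class) (x : ℝ)
    (hx : T c = 0) : N.stationSum σ (Function.update T c x)
      = N.stationSum σ T + if N.station c = σ then x else 0 := by
  classical
  have : ∀ b, Function.update T c x b = T b + if b = c then x else 0 := fun b => by
    by_cases hb : b = c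
    · subst hb; simp [hx]
    · simp [hb]
  simp only [stationSum, this, Finset.sum_add_distrib]
  congr 1
  simp [Finset.sum_ite_eq', Finset.mem_filter]

/-- Serving `c` affects only the inflow of the next class on its route, and that class has larger
rank. -/
theorem upstream_update_of_rank_le (T : N.Class → ℝ) {c b : N.Class} (x : ℝ)
    (hb : rank b ≤ rank c) : N.upstream (fun _ => 0) (fun a => mu a * Function.update T c x a) b
      = N.upstream (fun _ => 0) (fun a => mu a * T a) b := by
  rcases b with ⟨i, ⟨_ | j, h⟩⟩
  · rfl
  · have hne : (⟨i, ⟨j, Nat.lt_of_succ_lt h⟩⟩ : N.Class) ≠ c := by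
      rintro rfl
      exact absurd (rank_lt_succ h) hb.not_gt
    simp [upstream, Function.update_of_ne hne]

/-- A layer of fluid without arrivals can be served, without idling, by any given
capacities `R σ`. -/
theorem exists_layer (hmu : ∀ c, 0 < mu c) {q : N.Class → ℝ} (hq : ∀ c, 0 ≤ q c)
    {R : Fin N.numStations → ℝ → ℝ} (hR0 : ∀ σ, R σ 0 = 0)
    (hR : ∀ σ s t, 0 ≤ s → s ≤ t → R σ s ≤ R σ t ∧ R σ t - R σ s ≤ t - s) :
    ∃ T : ℝ → N.Class → ℝ, (∀ c, T 0 c = 0) ∧ (∀ c s t, 0 ≤ s → s ≤ t → T s c ≤ T t c) ∧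
      (∀ σ s t, 0 ≤ s → s ≤ t → R σ s - N.stationSum σ (T s) ≤ R σ t - N.stationSum σ (T t)) ∧
      (∀ c t, 0 ≤ t → 0 ≤ layerQueue mu q (T t) c) ∧
      (∀ c x, 0 ≤ x → 0 < layerQueue mu q (T x) c → ∃ δ > 0, ∀ y ∈ Ioo x (x + δ),
        R (N.station c) y - N.stationSum (N.station c) (T y)
          ≤ R (N.station c) x - N.stationSum (N.station c) (T x)) := by
  -- Classes are added by increasing rank, each offered the capacity its station has left, as under
  -- a static priority discipline. The inflow of a new class is already determined, since upstream
  -- classes come first. Later classes only reduce the left-over capacity, so the busy property of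
  -- the earlier ones persists.
  have key : ∀ k : ℕ, ∃ T : ℝ → N.Class → ℝ, (∀ c, k ≤ rank c → ∀ t, T t c = 0) ∧
      (∀ c, T 0 c = 0) ∧ (∀ c s t, 0 ≤ s → s ≤ t → T s c ≤ T t c) ∧
      (∀ σ s t, 0 ≤ s → s ≤ t → R σ s - N.stationSum σ (T s) ≤ R σ t - N.stationSum σ (T t)) ∧
      (∀ c, rank c < k → ∀ t, 0 ≤ t → 0 ≤ layerQueue mu q (T t) c) ∧
      (∀ c, rank c < k → ∀ x, 0 ≤ x → 0 < layerQueue mu q (T x) c → ∃ δ > 0,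
        ∀ y ∈ Ioo x (x + δ), R (N.station c) y - N.stationSum (N.station c) (T y)
          ≤ R (N.station c) x - N.stationSum (N.station c) (T x)) := by
    intro k
    induction k with
    | zero =>
      refine ⟨fun _ _ => 0, by simp, by simp, by simp, fun σ s t hs hst => ?_, by simp, by simp⟩
      simpa [stationSum] using (hR σ s t hs hst).1
    | succ k ih =>
      obtain ⟨T, hT, hT0, hTm, hres, hnn, hloc⟩ := ih
      by_cases hk : ∃ c : N.Class, rank c = k
      · obtain ⟨c, rfl⟩ := hk
        set Rc : ℝ → ℝ := fun t => R (N.station c) t - N.stationSum (N.station c) (T t) with hRc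
        set A : ℝ → ℝ := fun t => q c + N.upstream (fun _ => 0) (fun c => mu c * T t c) c with hA
        have hTle : ∀ a s t, 0 ≤ s → s ≤ t → T t a - T s a ≤ t - s := fun a s t hs hst =>
          sub_le_of_mono_of_feasible (fun c => hTm c s t hs hst)
            (fun σ => by linarith [hres σ s t hs hst, (hR σ s t hs hst).2]) a
        have hTc : ∀ a, ContinuousOn (fun t => T t a) (Ici 0) := fun a =>
          continuousOn_of_abs_sub_le (K := 1) fun _ hx _ hy => abs_sub_le_of_mono 1
            (fun s hs t _ hst => ⟨hTm a s t hs hst, by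
              rw [one_mul]; exact hTle a s t hs hst⟩) hx hy
        have hRσc : ContinuousOn (R (N.station c)) (Ici 0) :=
          continuousOn_of_abs_sub_le (K := 1) fun _ hx _ hy => abs_sub_le_of_mono 1
            (fun s hs t _ hst => by rw [one_mul]; exact hR _ s t hs hst) hx hy
        obtain ⟨Y, hY0, hYm, hYnn, hYloc⟩ := exists_reflection (R := Rc) (A := A) (hmu c)
          (by simp [hRc, hR0, stationSum, hT0]) (fun s t hs hst => hres _ s t hs hst)
          (hRσc.sub (continuousOn_finsetSum _ fun a _ => hTc a))
          (fun s t hs hst => by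
            refine add_le_add_right (upstream_forall₂ (p := fun x y => x ≤ y) (fun _ => le_rfl)
              (fun a => ?_) c) _
            exact mul_le_mul_of_nonneg_left (hTm a s t hs hst) (hmu a).le)
          (by
            refine continuousOn_const.add ?_
            rcases c with ⟨i, ⟨_ | j, hj⟩⟩
            · exact continuousOn_const
            · exact continuousOn_const.mul (hTc _))
          (add_nonneg (hq c) (upstream_forall (p := fun x => 0 ≤ x) (fun _ => le_rfl)
            (fun a => by rw [hT0, mul_zero]) c))
        have hTc0 : ∀ t, T t c = 0 := hT c le_rfl
        set T' : ℝ → N.Class → ℝ := fun t => Function.update (T t) c (Rc t - Y t) with hT'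
        have hsum : ∀ σ t, R σ t - N.stationSum σ (T' t)
            = if N.station c = σ then Y t else R σ t - N.stationSum σ (T t) := by
          intro σ t
          rw [hT', stationSum_update σ (T t) c _ (hTc0 t)]
          split_ifs with h
          · subst h; simp only [hRc]; ring
          · ring
        have hne : ∀ b : N.Class, b ≠ c → ∀ t, T' t b = T t b := fun b hb t =>
          Function.update_of_ne hb _ _
        have hself : ∀ t, T' t c = Rc t - Y t := fun t => Function.update_self _ _ _
        have hres' : ∀ σ s t, 0 ≤ s → s ≤ t →
            (R σ t - N.stationSum σ (T' t)) - (R σ s - N.stationSum σ (T' s))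
              ≤ (R σ t - N.stationSum σ (T t)) - (R σ s - N.stationSum σ (T s)) := by
          intro σ s t hs hst
          rw [hsum, hsum]
          split_ifs with h
          · subst h; exact (hYm s t hs hst).2
          · exact le_rfl
        have hlq : ∀ b : N.Class, b ≠ c → rank b ≤ rank c → ∀ t,
            layerQueue mu q (T' t) b = layerQueue mu q (T t) b := by
          intro b hb hbc t
          rw [layerQueue, layerQueue, upstream_update_of_rank_le _ _ hbc, hne b hb]
        have hlqc : ∀ t, layerQueue mu q (T' t) c = A t - mu c * (Rc t - Y t) := by
          intro t
          rw [layerQueue, upstream_update_of_rank_le _ _ le_rfl, hself]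
        refine ⟨T', fun b hb t => ?_, fun b => ?_, fun b s t hs hst => ?_,
          fun σ s t hs hst => ?_, fun b hb t ht => ?_, fun b hb x hx hpos => ?_⟩
        · rw [hne b (by rintro rfl; omega), hT b (by omega)]
        · by_cases hb : b = c
          · subst hb; rw [hself, hY0]; simp [hRc, hR0, stationSum, hT0]
          · rw [hne b hb, hT0]
        · by_cases hb : b = c
          · subst hb; rw [hself, hself]; linarith [(hYm s t hs hst).2]
          · rw [hne b hb, hne b hb]; exact hTm b s t hs hst
        · rw [hsum, hsum]
          split_ifs with h
          · exact (hYm s t hs hst).1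
          · exact hres σ s t hs hst
        · by_cases hbc : b = c
          · subst hbc; rw [hlqc]; exact hYnn t ht
          · rw [hlq b hbc (by omega)]
            exact hnn b (lt_of_le_of_ne (by omega) fun h => hbc (rank_injective h)) t ht
        · by_cases hbc : b = c
          · subst hbc
            rw [hlqc] at hpos
            obtain ⟨δ, hδ, h⟩ := hYloc x hx hpos
            refine ⟨δ, hδ, fun y hy => ?_⟩
            rw [hsum, hsum, if_pos rfl, if_pos rfl]
            exact h y hy
          · rw [hlq b hbc (by omega)] at hpos
            obtain ⟨δ, hδ, h⟩ :=
              hloc b (lt_of_le_of_ne (by omega) fun h => hbc (rank_injective h)) x hx hpos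
            refine ⟨δ, hδ, fun y hy => ?_⟩
            linarith [h y hy, hres' (N.station b) x y hx hy.1.le]
      · have hk' : ∀ c : N.Class, rank c ≠ k := fun c hc => hk ⟨c, hc⟩
        refine ⟨T, fun c hc => hT c (by omega), hT0, hTm, hres, fun c hc => ?_, fun c hc => ?_⟩
        · exact hnn c (lt_of_le_of_ne (by omega) (hk' c))
        · exact hloc c (lt_of_le_of_ne (by omega) (hk' c))
  obtain ⟨T, -, h0, hm, hres, hnn, hloc⟩ := key (∑ c : N.Class, (rank c + 1))
  have hlt : ∀ c : N.Class, rank c < ∑ c : N.Class, (rank c + 1) := fun c => by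
    have := Finset.single_le_sum (f := fun c : N.Class => rank c + 1) (fun _ _ => Nat.zero_le _)
      (Finset.mem_univ c)
    omega
  exact ⟨T, h0, hm, hres, fun c => hnn c (hlt c), fun c => hloc c (hlt c)⟩

/-- From every initial level there is a non-idling fluid solution that dominates a given one that
starts empty. -/
theorem IsBusyFluid.exists_dominating (hmu : ∀ c, 0 < mu c) {Q T : ℝ → N.Class → ℝ}
    (h : N.IsBusyFluid lam mu (Ici 0) Q T) (h0 : Q 0 = 0) {q : N.Class → ℝ}
    (hq : ∀ c, 0 ≤ q c) : ∃ Q' T' : ℝ → N.Class → ℝ, N.IsBusyFluid lam mu (Ici 0) Q' T' ∧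
      Q' 0 = q ∧ ∀ t, 0 ≤ t → ∀ c, Q t c ≤ Q' t c := by
  -- The extra layer is offered only the idle time of `(Q, T)`, so the given solution keeps absolute
  -- priority and the two layers add up.
  obtain ⟨S, hS0, hSm, hres, hnn, hloc⟩ := exists_layer hmu hq
    (R := fun σ t => t - N.stationSum σ (T t))
    (fun σ => by simp [stationSum, h.time_zero])
    (fun σ s t hs hst => by
      have h1 := h.feasible σ s hs t (hs.trans hst) hst
      have h2 : N.stationSum σ (T s) ≤ N.stationSum σ (T t) :=
        stationSum_mono σ fun c => h.time_mono c s hs t (hs.trans hst) hst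
      constructor <;> linarith)
  have hl0 : ∀ c, layerQueue mu q (S 0) c = q c := fun c => by
    have : N.upstream (fun _ => (0 : ℝ)) (fun c => mu c * S 0 c) c = 0 :=
      upstream_forall (p := fun x => x = 0) (fun i => rfl) (fun c => by rw [hS0, mul_zero]) c
    rw [layerQueue, this, hS0]; ring
  refine ⟨fun t c => Q t c + layerQueue mu q (S t) c, fun t c => T t c + S t c, ?_, ?_, ?_⟩
  · refine IsBusyFluid.of_right_local (fun t ht c => ?_) (fun σ s t hs hst => ?_)
      (fun t ht c => ?_) (fun c s t hs hst => ?_) (fun c => ?_) (fun σ x hx hpos => ?_)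
    · rw [h.balance t ht c, hl0, layerQueue]
      have := upstream_comp₂ (N := N) (fun x y => x + y) (fun i => lam i * t)
        (fun c => mu c * T t c) (fun i => 0) (fun c => mu c * S t c) c
      have h2 : N.upstream (fun i => lam i * t) (fun c => mu c * (T t c + S t c)) c
          = N.upstream (fun i => lam i * t) (fun c => mu c * T t c) c
            + N.upstream (fun i => 0) (fun c => mu c * S t c) c := by
        rw [← this]
        congr 1
        · funext i; ring
        · funext c; ring
      rw [h2]
      ring
    · rw [stationSum_add, stationSum_add]
      linarith [hres σ s t hs hst]
    · exact add_nonneg (h.queue_nonneg t ht c) (hnn c t ht)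
    · exact add_le_add (h.time_mono c s hs t (hs.trans hst) hst) (hSm c s t hs hst)
    · rw [h.time_zero, hS0, add_zero]
    · simp only [stationSum_add] at hpos ⊢
      -- If the given solution has fluid at the station, it keeps the station busy by itself.
      -- Otherwise the extra layer is present there and uses up all the idle capacity.
      by_cases hQ : 0 < N.stationSum σ (Q x)
      · obtain ⟨δ, hδ, hb⟩ := h.busy_right hx hQ
        refine ⟨δ, hδ, fun y hy => ?_⟩
        have : N.stationSum σ (S x) ≤ N.stationSum σ (S y) :=
          stationSum_mono σ fun c => hSm c x y hx hy.1.le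
        linarith [hb y hy]
      · obtain ⟨c, rfl, hc⟩ := exists_pos_of_stationSum_pos
          (σ := σ) (q := layerQueue mu q (S x)) (by linarith)
        obtain ⟨δ, hδ, hb⟩ := hloc c x hx hc
        exact ⟨δ, hδ, fun y hy => by linarith [hb y hy]⟩
  · funext c
    simp only [h0, hl0, Pi.zero_apply, zero_add]
  · intro t ht c
    linarith [hnn c t ht]

/-! ### From an excursion to linear divergence -/

theorem l1_mono {q r : N.Class → ℝ} (hq : ∀ c, 0 ≤ q c) (hqr : ∀ c, q c ≤ r c) :
    N.l1 q ≤ N.l1 r :=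
  Finset.sum_le_sum fun c _ => abs_le_abs_of_nonneg (hq c) (hqr c)

theorem l1_mul (a : ℝ) (ha : 0 ≤ a) (q : N.Class → ℝ) :
    N.l1 (fun c => a * q c) = a * N.l1 q := by
  simp only [l1, abs_mul, abs_of_nonneg ha, Finset.mul_sum]

theorem l1_eq_zero {q : N.Class → ℝ} : N.l1 q = 0 ↔ q = 0 := by
  rw [l1, Finset.sum_eq_zero_iff_of_nonneg (fun _ _ => abs_nonneg _)]
  simp [funext_iff]

theorem l1_pos {q : N.Class → ℝ} (hq : q ≠ 0) : 0 < N.l1 q :=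
  (l1_nonneg q).lt_of_ne' (mt l1_eq_zero.1 hq)

/-- If the fluid model is not globally weakly stable, some fluid solution leaves zero at time `0`
and stays away from it until time `1`. -/
theorem exists_excursion (h : ¬ N.GloballyWeaklyStable lam mu) :
    ∃ Q T : ℝ → N.Class → ℝ, N.IsBusyFluid lam mu (Ici 0) Q T ∧ Q 0 = 0 ∧
      ∀ t ∈ Ioc 0 1, Q t ≠ 0 := by
  simp only [GloballyWeaklyStable, not_forall] at h
  obtain ⟨Q, T, hsol, hni, h0, t, ht, hQt⟩ := h
  have hB := hsol.isBusyFluid hni ordConnected_Ici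
  -- The last zero before `t` is moved to the origin, and the interval from there to `t` is rescaled
  -- to `[0, 1]`.
  set S := {x | x ∈ Icc 0 t ∧ N.l1 (Q x) = 0} with hS
  have hSc : IsClosed S := by
    have : ContinuousOn (fun t => N.l1 (Q t)) (Icc 0 t) :=
      hB.continuousOn_l1.mono Icc_subset_Ici_self
    exact this.preimage_isClosed_of_isClosed isClosed_Icc (isClosed_singleton (x := (0 : ℝ)))
  have hSne : S.Nonempty := ⟨0, ⟨le_rfl, ht⟩, l1_eq_zero.2 h0⟩
  have hSb : BddAbove S := ⟨t, fun x hx => hx.1.2⟩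
  set a := sSup S with ha
  have haS : a ∈ S := hSc.csSup_mem hSne hSb
  have hat : a < t := lt_of_le_of_ne haS.1.2 fun h => hQt (by
    rw [← h]; exact l1_eq_zero.1 haS.2)
  have hpos : 0 < (t - a)⁻¹ := inv_pos.2 (sub_pos.2 hat)
  refine ⟨_, _, (hB.shift haS.1.1).scale hpos, ?_, fun x hx hx0 => ?_⟩
  · funext c
    have := l1_eq_zero.1 haS.2
    simp [this]
  · have hQ0 : Q (a + x / (t - a)⁻¹) = 0 := by
      funext c
      have := congrFun hx0 c
      simp only [Pi.zero_apply, mul_eq_zero] at this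
      exact this.resolve_left hpos.ne'
    rw [div_inv_eq_mul] at hQ0
    have h1 : 0 < x * (t - a) := mul_pos hx.1 (sub_pos.2 hat)
    have h2 : x * (t - a) ≤ 1 * (t - a) := by
      gcongr
      exact hx.2
    have : a + x * (t - a) ∈ S := ⟨⟨by linarith [haS.1.1], by linarith⟩, l1_eq_zero.2 hQ0⟩
    linarith [le_csSup hSb this]

/-- If the fluid model is not globally weakly stable, then fluid solutions that diverge linearly
start from every level. -/
theorem exists_fluidDivergesAtRate (hmu : ∀ c, 0 < mu c) (h : ¬ N.GloballyWeaklyStable lam mu) :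
    ∃ γ : ℝ, 0 < γ ∧ N.FluidDivergesAtRate lam mu γ := by
  obtain ⟨E, TE, hE, hE0, hEpos⟩ := exists_excursion h
  set L := Fintype.card N.Class * N.fluidLip lam mu + 1 with hL
  have hL0 : 0 < L := by
    have : 0 ≤ Fintype.card N.Class * N.fluidLip lam mu :=
      mul_nonneg (Nat.cast_nonneg _) fluidLip_nonneg
    linarith
  set b := N.l1 (E 1) with hb
  have hb0 : 0 < b := l1_pos (hEpos 1 ⟨one_pos, le_rfl⟩)
  -- The excursion has a positive minimum once a neighbourhood of its starting time, where it
  -- vanishes, is removed. During that neighbourhood the old level, which decreases at rate at most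
  -- `L`, still suffices.
  obtain ⟨m, hm0, hm⟩ : ∃ m > 0, ∀ x ∈ Icc (min 1 (b / (4 * L))) 1, m ≤ N.l1 (E x) := by
    have hsub : Icc (min 1 (b / (4 * L))) 1 ⊆ Ioc 0 1 := fun x hx =>
      ⟨lt_of_lt_of_le (lt_min one_pos (by positivity)) hx.1, hx.2⟩
    obtain ⟨x, hx, hmin⟩ := isCompact_Icc.exists_isMinOn
      (nonempty_Icc.2 (min_le_left 1 (b / (4 * L))))
      (hE.continuousOn_l1.mono fun x hx => (hsub hx).1.le)
    exact ⟨N.l1 (E x), l1_pos (hEpos x (hsub hx)), fun y hy => hmin hy⟩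
  -- After a restart at time `s` from a level at least `b s / 2`, the level is at least `b s / 4`
  -- for a time `b s / (4 L)`, and at least `m s` afterwards. Times up to `2 s` are considered,
  -- which accounts for the halves.
  set γ := min (b / 8) (m / 2) with hγ
  have hγ0 : 0 < γ := lt_min (by positivity) (by positivity)
  have hdom : ∀ a : ℝ, 0 < a → ∀ q : N.Class → ℝ, (∀ c, 0 ≤ q c) →
      ∃ Q' T' : ℝ → N.Class → ℝ, N.IsBusyFluid lam mu (Ici 0) Q' T' ∧ Q' 0 = q ∧
        ∀ t, 0 ≤ t → a * N.l1 (E (t / a)) ≤ N.l1 (Q' t) := by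
    intro a ha q hq
    obtain ⟨Q', T', h', h0', hle⟩ := (hE.scale ha).exists_dominating hmu
      (by funext c; simp [hE0]) hq
    refine ⟨Q', T', h', h0', fun t ht => ?_⟩
    rw [← l1_mul a ha.le]
    exact l1_mono (fun c => mul_nonneg ha.le (hE.queue_nonneg _ (div_nonneg ht ha.le) c))
      (fun c => hle t ht c)
  -- Induction on the number of doublings: at time `s = a 2 ^ k` an excursion magnified by `s` is
  -- layered over the current level. At time `2 s` it has norm `b s`, which is again `b / 2` times
  -- the elapsed time.
  have key : ∀ (q : N.Class → ℝ), (∀ c, 0 ≤ q c) → ∀ a : ℝ, 0 < a → ∀ k : ℕ,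
      ∃ Q' T' : ℝ → N.Class → ℝ, N.IsBusyFluid lam mu (Ici 0) Q' T' ∧ Q' 0 = q ∧
        (∀ t ∈ Icc a (a * 2 ^ k), γ * t ≤ N.l1 (Q' t)) ∧
        b / 2 * (a * 2 ^ k) ≤ N.l1 (Q' (a * 2 ^ k)) := by
    intro q hq a ha k
    induction k with
    | zero =>
      obtain ⟨Q', T', h', h0', hle⟩ := hdom a ha q hq
      have h1 := hle a ha.le
      rw [div_self ha.ne'] at h1
      refine ⟨Q', T', h', h0', fun t ht => ?_, ?_⟩
      · have : t = a := le_antisymm (by simpa using ht.2) ht.1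
        subst this
        have : γ * t ≤ b / 8 * t := by gcongr; exact min_le_left _ _
        nlinarith
      · simp only [pow_zero, mul_one]
        nlinarith
    | succ k ih =>
      obtain ⟨Q', T', h', h0', hγt, hend⟩ := ih
      set s := a * 2 ^ k with hs
      have hs0 : 0 < s := by positivity
      have has : a ≤ s := le_mul_of_one_le_right ha.le (one_le_pow₀ (by norm_num))
      obtain ⟨Q₂, T₂, h₂, h0₂, hle⟩ := hdom s hs0 (Q' s) (h'.queue_nonneg s hs0.le)
      have h2s : a * 2 ^ (k + 1) = 2 * s := by rw [hs]; ring
      refine ⟨_, _, h'.concat h₂ hs0.le h0₂, ?_, fun t ht => ?_, ?_⟩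
      · simp [hs0, h0']
      · rw [h2s] at ht
        rcases lt_or_ge t s with hts | hts
        · simp only [if_pos hts]
          exact hγt t ⟨ht.1, hts.le⟩
        · simp only [if_neg hts.not_gt]
          set x := t - s with hx
          have hx0 : 0 ≤ x := sub_nonneg.2 hts
          have htx : t = s + x := by rw [hx]; ring
          have hxs : x ≤ s := by linarith [ht.2]
          by_cases hxb : x ≤ b * s / (4 * L)
          · have h1 := h₂.l1_sub_le (s := 0) (t := x) (le_refl (0 : ℝ)) hx0
            rw [h0₂, sub_zero, abs_of_nonneg hx0] at h1
            have h2 : L * x ≤ b * s / 4 := by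
              rw [le_div_iff₀ (by positivity)] at hxb
              linarith
            have h3 : γ * t ≤ b / 8 * (2 * s) :=
              mul_le_mul (min_le_left _ _) ht.2 (ha.le.trans ht.1) (by positivity)
            have h4 : (L - 1) * x ≤ L * x := by nlinarith
            have h5 : L - 1 = Fintype.card N.Class * N.fluidLip lam mu := by rw [hL]; ring
            rw [h5] at h4
            linarith
          · have h1 := hle x hx0
            have h2 : m ≤ N.l1 (E (x / s)) := by
              refine hm _ ⟨(min_le_right _ _).trans ?_, (div_le_one hs0).2 hxs⟩
              rw [le_div_iff₀ hs0]
              have : b / (4 * L) * s = b * s / (4 * L) := by ring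
              linarith
            have h3 : γ * t ≤ m / 2 * (2 * s) :=
              mul_le_mul (min_le_right _ _) ht.2 (ha.le.trans ht.1) (by positivity)
            nlinarith
      · rw [h2s]
        have : ¬ (2 * s < s) := by linarith
        simp only [if_neg this]
        have h1 := hle s hs0.le
        rw [div_self hs0.ne'] at h1
        have h2 : 2 * s - s = s := by ring
        rw [h2]
        linarith
  refine ⟨γ, hγ0, fun q hq => ?_⟩
  -- The bound of the `k`-th solution holds on `[2⁻ᵏ, 2ᵏ]`; these intervals exhaust the positive
  -- times.
  choose Q' T' h' h0' hγt _ using fun k : ℕ => key q hq ((2 : ℝ) ^ k)⁻¹ (by positivity) (2 * k)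
  obtain ⟨Q₁, T₁, h₁, h0₁, hlim⟩ := IsBusyFluid.exists_limit (hyperfilter ℕ) h' h0'
  refine ⟨Q₁, T₁, h₁.isFluidSolution (le_refl (0 : ℝ)) (fun t ht => ht),
    h₁.fluidNonIdling ordConnected_Ici, h0₁, fun t ht => ?_⟩
  rcases ht.eq_or_lt with rfl | ht
  · simp [l1_nonneg]
  have hl : Tendsto (fun k => N.l1 (Q' k t)) (hyperfilter ℕ) (𝓝 (N.l1 (Q₁ t))) :=
    tendsto_finsetSum _ fun c _ => (hlim t ht.le c).abs
  refine ge_of_tendsto hl ?_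
  have hev : ∀ᶠ k : ℕ in atTop, t ≤ (2 : ℝ) ^ k ∧ t⁻¹ ≤ (2 : ℝ) ^ k := by
    have := tendsto_pow_atTop_atTop_of_one_lt (r := (2 : ℝ)) (by norm_num)
    exact (this.eventually_ge_atTop t).and (this.eventually_ge_atTop t⁻¹)
  have hev' := (Nat.cofinite_eq_atTop ▸ hyperfilter_le_cofinite :
    (hyperfilter ℕ : Filter ℕ) ≤ atTop) hev
  filter_upwards [hev'] with k hk
  have hp : (0 : ℝ) < 2 ^ k := by positivity
  refine hγt k t ⟨inv_le_of_inv_le₀ ht hk.2, ?_⟩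
  rw [mul_comm 2 k, pow_mul, sq, ← mul_assoc, inv_mul_cancel₀ hp.ne', one_mul]
  exact hk.1

end MultitypeNetwork

namespace MultitypeNetwork

variable {N : MultitypeNetwork}

/-! ### Piecewise linear plans -/

/-- A piecewise linear fluid trajectory: `len` pieces, with breakpoints `time r`, levels `level r`
at the breakpoints, and constant service rates `rate r` in between. -/
structure Plan (N : MultitypeNetwork) where
  len : ℕ
  time : ℕ → ℝ
  level : ℕ → N.Class → ℝ
  rate : ℕ → N.Class → ℝ

/-- The plan is a non-idling fluid solution: on each piece every station is either working at full
rate or empty. -/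
structure Plan.IsFluid (lam : Fin N.numTypes → ℝ) (mu : N.Class → ℝ) (π : N.Plan) : Prop where
  time_zero : π.time 0 = 0
  time_le : ∀ r < π.len, π.time r ≤ π.time (r + 1)
  rate_nonneg : ∀ r < π.len, ∀ c, 0 ≤ π.rate r c
  rate_le : ∀ r < π.len, ∀ σ, N.stationSum σ (π.rate r) ≤ 1
  level_nonneg : ∀ r ≤ π.len, ∀ c, 0 ≤ π.level r c
  level_succ : ∀ r < π.len, ∀ c, π.level (r + 1) c = π.level r c
    + (π.time (r + 1) - π.time r)
      * (N.upstream lam (fun c => mu c * π.rate r c) c - mu c * π.rate r c)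
  full_or_empty : ∀ r < π.len, ∀ σ, N.stationSum σ (π.rate r) = 1 ∨
    ∀ c, N.station c = σ → π.level r c = 0 ∧ π.level (r + 1) c = 0

variable {lam : Fin N.numTypes → ℝ} {mu : N.Class → ℝ} {I : Set ℝ} {Q T : ℝ → N.Class → ℝ}

/-- The decomposition property speaks about open intervals only. Cutting off `δ` at both ends loses
`2 δ`, which is less than the supposed deficit `g`. -/
theorem IsBusyFluid.busy_Ioo (h : N.IsBusyFluid lam mu I Q T) {a b : ℝ} (hab : a < b)
    (hI : Icc a b ⊆ I) {σ : Fin N.numStations}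
    (hpos : ∀ x ∈ Ioo a b, 0 < N.stationSum σ (Q x)) :
    b - a ≤ N.stationSum σ (T b) - N.stationSum σ (T a) := by
  by_contra! hlt
  set g := (b - a) - (N.stationSum σ (T b) - N.stationSum σ (T a)) with hg
  have hg0 : 0 < g := by linarith
  set δ := min (g / 4) ((b - a) / 4) with hδ
  have hδ0 : 0 < δ := lt_min (by linarith) (by linarith)
  have h1 : δ ≤ g / 4 := min_le_left _ _
  have h2 : δ ≤ (b - a) / 4 := min_le_right _ _
  have ha : a ∈ I := hI ⟨le_rfl, hab.le⟩
  have hb : b ∈ I := hI ⟨hab.le, le_rfl⟩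
  have ha' : a + δ ∈ I := hI ⟨by linarith, by linarith⟩
  have hb' : b - δ ∈ I := hI ⟨by linarith, by linarith⟩
  have h3 := h.busy σ _ ha' _ hb' (by linarith)
    (fun x hx => hpos x ⟨by linarith [hx.1], by linarith [hx.2]⟩)
  have h4 : N.stationSum σ (T a) ≤ N.stationSum σ (T (a + δ)) :=
    stationSum_mono σ fun c => h.time_mono c _ ha _ ha' (by linarith)
  have h5 : N.stationSum σ (T (b - δ)) ≤ N.stationSum σ (T b) :=
    stationSum_mono σ fun c => h.time_mono c _ hb' _ hb (by linarith)
  linarith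

theorem IsBusyFluid.queue_eq_zero_of_Ioo (h : N.IsBusyFluid lam mu I Q T) {a b : ℝ} (hab : a < b)
    (hI : Icc a b ⊆ I) {σ : Fin N.numStations}
    (hz : ∀ x ∈ Ioo a b, N.stationSum σ (Q x) = 0) {c : N.Class} (hc : N.station c = σ) :
    ∀ x ∈ Icc a b, Q x c = 0 := by
  subst hc
  have heq : EqOn (fun x => Q x c) (fun _ => 0) (Ioo a b) := fun x hx => by
    have hnn := h.queue_nonneg x (hI ⟨hx.1.le, hx.2.le⟩)
    exact le_antisymm ((le_stationSum hnn c).trans (hz x hx).le) (hnn c)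
  exact heq.of_subset_closure ((h.continuousOn_queue c).mono hI) continuousOn_const
    Ioo_subset_Icc_self (by rw [closure_Ioo hab.ne])

/-- No class loses fluid faster than its service rate. This controls the early times, at which
divergence at rate `γ` says little. -/
theorem IsBusyFluid.le_l1 (h : N.IsBusyFluid lam mu (Ici 0) Q T) (hlam : ∀ i, 0 ≤ lam i)
    (hmu : ∀ c, 0 ≤ mu c) {t : ℝ} (ht : 0 ≤ t) : N.l1 (Q 0) - (∑ c, mu c) * t ≤ N.l1 (Q t) := by
  rw [l1_of_nonneg (h.queue_nonneg 0 (le_refl (0 : ℝ))), l1_of_nonneg (h.queue_nonneg t ht),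
    Finset.sum_mul, ← Finset.sum_sub_distrib]
  refine Finset.sum_le_sum fun c _ => ?_
  have hT : ∀ c, 0 ≤ T t c ∧ T t c ≤ t := fun c => by
    have h1 := h.time_mono c 0 (le_refl (0 : ℝ)) t ht ht
    have h2 := h.time_sub_le (le_refl (0 : ℝ)) ht ht c
    rw [h.time_zero] at h1 h2
    exact ⟨h1, by linarith⟩
  rw [h.balance t ht c]
  have h1 : 0 ≤ N.upstream (fun i => lam i * t) (fun c => mu c * T t c) c :=
    upstream_forall (p := fun x => 0 ≤ x) (fun i => mul_nonneg (hlam i) ht)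
      (fun c => mul_nonneg (hmu c) (hT c).1) c
  have h2 := mul_le_mul_of_nonneg_left (hT c).2 (hmu c)
  linarith

/-- By the finite decomposition property, from every level of norm one there is a plan
for the time interval `[0, θ]`, with a bounded number of pieces, that stays away from zero
and ends at a level of norm at least `γ θ`. -/
theorem exists_plan (hFDP : N.FiniteDecomposition lam mu) (hlam : ∀ i, 0 ≤ lam i)
    (hmu : ∀ c, 0 ≤ mu c) {γ : ℝ} (hγ : 0 < γ) (hdiv : N.FluidDivergesAtRate lam mu γ) {θ : ℝ}
    (hθ : 0 < θ) : ∃ K : ℕ, ∀ q : N.Class → ℝ, (∀ c, 0 ≤ q c) → N.l1 q = 1 →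
      ∃ π : N.Plan, π.IsFluid lam mu ∧ π.len ≤ K ∧ π.level 0 = q ∧ π.time π.len = θ ∧
        (∀ r ≤ π.len, γ / (γ + ∑ c, mu c) ≤ N.l1 (π.level r)) ∧
        γ * θ ≤ N.l1 (π.level π.len) := by
  obtain ⟨ν, B, hν, hB, hF⟩ := hFDP
  set L := ∑ c, mu c with hL
  have hL0 : 0 ≤ L := Finset.sum_nonneg fun c _ => hmu c
  -- The height at which the lower bounds `1 - L t` and `γ t` cross.
  set m₀ := γ / (γ + L) with hm₀
  have hm₀0 : 0 < m₀ := by positivity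
  refine ⟨⌈ν * θ * (1 / m₀) + B⌉₊, fun q hq hq1 => ?_⟩
  obtain ⟨Q, T, hsol, hni, hQ0, hQγ⟩ := hdiv q hq
  have hB0 := hsol.isBusyFluid hni ordConnected_Ici
  have hlow : ∀ t, 0 ≤ t → m₀ ≤ N.l1 (Q t) := by
    intro t ht
    have h1 := hB0.le_l1 hlam hmu ht
    rw [hQ0, hq1] at h1
    have h2 := hQγ t ht
    rcases le_total t (1 / (γ + L)) with hle | hle
    · have : (γ + L) * t ≤ 1 := by
        rw [le_div_iff₀ (by positivity)] at hle; linarith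
      have h3 : m₀ = 1 - L * (1 / (γ + L)) := by rw [hm₀]; field_simp; ring
      have h4 : L * t ≤ L * (1 / (γ + L)) := by gcongr
      linarith
    · have h3 : m₀ = γ * (1 / (γ + L)) := by rw [hm₀]; ring
      have h4 : γ * (1 / (γ + L)) ≤ γ * t := by gcongr
      linarith
  have hB1 := hB0.mono (J := Icc 0 θ) Icc_subset_Ici_self
  have h0mem : (0 : ℝ) ∈ Icc 0 θ := ⟨le_rfl, hθ.le⟩
  obtain ⟨Q', T', hsol', hni', M, τ, hτ, hτ0, hτM, hM, -, hQeq, hdich⟩ := hF θ hθ Q T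
    (hB1.isFluidSolution h0mem fun t ht => ht.1) (hB1.fluidNonIdling ordConnected_Icc)
    (fun t ht h => by
      have := hlow t ht.1
      rw [l1_eq_zero.2 h] at this
      linarith)
  have hB' := hsol'.isBusyFluid hni' ordConnected_Icc
  have hτmem : ∀ m, τ m ∈ Icc 0 θ := fun m =>
    ⟨hτ0 ▸ hτ.monotone (Fin.zero_le m), hτM ▸ hτ.monotone (Fin.le_last m)⟩
  set tm : ℕ → ℝ := fun r => if h : r < M + 1 then τ ⟨r, h⟩ else θ with htm
  have htm1 : ∀ r (h : r < M + 1), tm r = τ ⟨r, h⟩ := fun r h => dif_pos h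
  have htmem : ∀ r ≤ M, tm r ∈ Icc 0 θ := fun r hr => by
    rw [htm1 r (by omega)]; exact hτmem _
  have htQ : ∀ r ≤ M, Q' (tm r) = Q (tm r) := fun r hr => by
    rw [htm1 r (by omega)]; exact hQeq _
  have htlt : ∀ r < M, tm r < tm (r + 1) := fun r hr => by
    rw [htm1 r (by omega), htm1 (r + 1) (by omega)]
    exact hτ (Fin.mk_lt_mk.2 (Nat.lt_succ_self r))
  have ht0 : tm 0 = 0 := by rw [htm1 0 (by omega)]; exact hτ0
  have htM : tm M = θ := by rw [htm1 M (by omega)]; exact hτM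
  -- Only the values at the breakpoints are kept, and the rates are the average efforts between
  -- them. The norms of the levels can then be read off from `Q`, which agrees with `Q'` there.
  set rt : ℕ → N.Class → ℝ := fun r c => (tm (r + 1) - tm r)⁻¹ * (T' (tm (r + 1)) c - T' (tm r) c)
    with hrt
  have hpos : ∀ r < M, 0 < tm (r + 1) - tm r := fun r hr => sub_pos.2 (htlt r hr)
  have hsum : ∀ r < M, ∀ σ, N.stationSum σ (rt r) = (tm (r + 1) - tm r)⁻¹
      * (N.stationSum σ (T' (tm (r + 1))) - N.stationSum σ (T' (tm r))) := fun r hr σ => by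
    rw [hrt, stationSum_mul, stationSum_sub]
  have hle1 : ∀ r < M, ∀ σ, N.stationSum σ (rt r) ≤ 1 := fun r hr σ => by
    rw [hsum r hr, inv_mul_le_iff₀ (hpos r hr), mul_one]
    exact hB'.feasible σ _ (htmem r hr.le) _ (htmem _ hr) (htlt r hr).le
  have hsubI : ∀ r < M, Icc (tm r) (tm (r + 1)) ⊆ Icc 0 θ := fun r hr =>
    Icc_subset_Icc (htmem r hr.le).1 (htmem _ hr).2
  refine ⟨⟨M, tm, fun r => Q' (tm r), rt⟩, ⟨ht0, fun r hr => (htlt r hr).le, fun r hr c => ?_,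
    hle1, fun r hr c => hB'.queue_nonneg _ (htmem r hr) c, fun r hr c => ?_, fun r hr σ => ?_⟩,
    ?_, ?_, htM, fun r hr => ?_, ?_⟩
  · exact mul_nonneg (inv_pos.2 (hpos r hr)).le (sub_nonneg.2
      (hB'.time_mono c _ (htmem r hr.le) _ (htmem _ hr) (htlt r hr).le))
  · change Q' (tm (r + 1)) c = Q' (tm r) c + (tm (r + 1) - tm r)
      * (N.upstream lam (fun c => mu c * rt r c) c - mu c * rt r c)
    have hd : ∀ c, (tm (r + 1) - tm r) * (mu c * rt r c)
        = mu c * T' (tm (r + 1)) c - mu c * T' (tm r) c := fun c => by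
      rw [hrt, mul_left_comm, mul_inv_cancel_left₀ (hpos r hr).ne', mul_sub]
    have hu : (tm (r + 1) - tm r) * N.upstream lam (fun c => mu c * rt r c) c
        = N.upstream (fun i => lam i * tm (r + 1)) (fun c => mu c * T' (tm (r + 1)) c) c
          - N.upstream (fun i => lam i * tm r) (fun c => mu c * T' (tm r) c) c := by
      rw [← upstream_comp (fun x => (tm (r + 1) - tm r) * x),
        ← upstream_comp₂ (fun x y => x - y)]
      congr 1
      · funext i; ring
      · funext c; exact hd c
    rw [mul_sub, hd, hu, hB'.balance _ (htmem _ hr) c, hB'.balance _ (htmem r hr.le) c]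
    ring
  · have hr : r < M := hr
    have hcast : τ (Fin.castSucc ⟨r, hr⟩) = tm r := (htm1 r (by omega)).symm
    have hsucc : τ (Fin.succ ⟨r, hr⟩) = tm (r + 1) := (htm1 (r + 1) (by omega)).symm
    rcases hdich ⟨r, hr⟩ σ with h | h <;> rw [hcast, hsucc] at h
    · left
      refine le_antisymm (hle1 r hr σ) ?_
      change 1 ≤ N.stationSum σ (rt r)
      rw [hsum r hr, le_inv_mul_iff₀ (hpos r hr), mul_one]
      exact hB'.busy_Ioo (htlt r hr) (hsubI r hr) h
    · right
      intro c hc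
      have := hB'.queue_eq_zero_of_Ioo (htlt r hr) (hsubI r hr) h hc
      exact ⟨this _ ⟨le_rfl, (htlt r hr).le⟩, this _ ⟨(htlt r hr).le, le_rfl⟩⟩
  · have hsup : sSup ((fun t => 1 / N.l1 (Q t)) '' Icc 0 θ) ≤ 1 / m₀ := by
      refine csSup_le ⟨_, 0, h0mem, rfl⟩ ?_
      rintro _ ⟨t, ht, rfl⟩
      exact one_div_le_one_div_of_le hm₀0 (hlow t ht.1)
    have : (M : ℝ) ≤ ν * θ * (1 / m₀) + B := hM.trans (by gcongr)
    exact_mod_cast this.trans (Nat.le_ceil _)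
  · change Q' (tm 0) = q
    rw [htQ 0 (Nat.zero_le _), ht0, hQ0]
  · change m₀ ≤ N.l1 (Q' (tm r))
    rw [htQ r hr]
    exact hlow _ (htmem r hr).1
  · change γ * θ ≤ N.l1 (Q' (tm M))
    rw [htQ M le_rfl, htM]
    exact hQγ θ hθ.le

end MultitypeNetwork

namespace MultitypeNetwork

namespace Primitives

variable {N : MultitypeNetwork} {Ω Ω' : Type*}

/-! ### The queueing process under a given control -/

/-- The sum of the first `k` interarrival times. -/
def arrivalSum (p : N.Primitives Ω) (x : N.State) (i : Fin N.numTypes) (k : ℕ) (ω : Ω) : ℝ :=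
  ∑ r ∈ Finset.range k, p.interarrival x i r ω

/-- The sum of the first `k` service times. -/
def serviceSum (p : N.Primitives Ω) (x : N.State) (c : N.Class) (k : ℕ) (ω : Ω) : ℝ :=
  ∑ r ∈ Finset.range k, p.service x c r ω

/-- All interarrival and service times are non-negative. -/
structure Nonneg (p : N.Primitives Ω) : Prop where
  X : ∀ i k ω, 0 ≤ p.X i k ω
  S : ∀ c k ω, 0 ≤ p.S c k ω

variable {p : N.Primitives Ω} {x : N.State} {u u' : N.Control Ω} {ω : Ω}

theorem Nonneg.interarrival (hp : p.Nonneg) (i k ω) : 0 ≤ p.interarrival x i k ω := by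
  unfold Primitives.interarrival
  split_ifs
  · exact NNReal.coe_nonneg _
  · exact hp.X i k ω

theorem Nonneg.service (hp : p.Nonneg) (c k ω) : 0 ≤ p.service x c k ω := by
  unfold Primitives.service
  split_ifs
  · exact NNReal.coe_nonneg _
  · exact hp.S c k ω

theorem Nonneg.monotone_arrivalSum (hp : p.Nonneg) (i : Fin N.numTypes) (ω : Ω) :
    Monotone fun k => p.arrivalSum x i k ω :=
  monotone_nat_of_le_succ fun k => by
    simp only [arrivalSum, Finset.sum_range_succ]
    linarith [hp.interarrival (x := x) i k ω]

theorem Nonneg.monotone_serviceSum (hp : p.Nonneg) (c : N.Class) (ω : Ω) :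
    Monotone fun k => p.serviceSum x c k ω :=
  monotone_nat_of_le_succ fun k => by
    simp only [serviceSum, Finset.sum_range_succ]
    linarith [hp.service (x := x) c k ω]

/-- The supremum in `arrivals` takes the default value `0` on an unbounded set; `hb` excludes this.
-/
theorem arrivals_eq_iff (hp : p.Nonneg) {i : Fin N.numTypes} {t : ℝ} (ht : 0 ≤ t)
    (hb : ∃ k, t < p.arrivalSum x i k ω) {m : ℕ} : p.arrivals x i t ω = m ↔
      p.arrivalSum x i m ω ≤ t ∧ t < p.arrivalSum x i (m + 1) ω := by
  have hmono := hp.monotone_arrivalSum (x := x) i ω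
  obtain ⟨K, hK⟩ := hb
  set s := {k : ℕ | p.arrivalSum x i k ω ≤ t} with hs
  have hbdd : BddAbove s := ⟨K, fun k hk => by
    by_contra! h
    exact absurd (hmono h.le) (by simpa using lt_of_le_of_lt hk hK)⟩
  have hne : s.Nonempty := ⟨0, by simpa [hs, arrivalSum] using ht⟩
  have hmem : sSup s ∈ s := Nat.sSup_mem hne hbdd
  constructor
  · rintro rfl
    refine ⟨hmem, ?_⟩
    by_contra! h
    have : sSup s + 1 ≤ sSup s := le_csSup hbdd h
    omega
  · rintro ⟨h1, h2⟩
    refine le_antisymm (csSup_le hne fun k hk => ?_) (le_csSup hbdd h1)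
    by_contra! h
    have h3 := hmono (show m + 1 ≤ k from h)
    exact absurd (lt_of_lt_of_le h2 h3) (not_lt.2 hk)

theorem arrivals_eq_zero {i : Fin N.numTypes} {t : ℝ}
    (hb : ∀ k, p.arrivalSum x i k ω ≤ t) : p.arrivals x i t ω = 0 := by
  refine Nat.sSup_of_not_bddAbove ?_
  rintro ⟨K, hK⟩
  have : K + 1 ≤ K := hK (hb (K + 1))
  omega

/-- This holds even after infinitely many arrivals, when the count stays at its default value. -/
theorem eventually_arrivals_eq (hp : p.Nonneg) (i : Fin N.numTypes) {t : ℝ} (ht : 0 ≤ t) :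
    ∀ᶠ s in 𝓝[≥] t, p.arrivals x i s ω = p.arrivals x i t ω := by
  by_cases hb : ∃ k, t < p.arrivalSum x i k ω
  · obtain ⟨h1, h2⟩ := (arrivals_eq_iff hp ht hb).1 rfl
    filter_upwards [Ico_mem_nhdsGE h2] with s hs
    exact (arrivals_eq_iff hp (ht.trans hs.1) ⟨_, hs.2⟩).2 ⟨h1.trans hs.1, hs.2⟩
  · push Not at hb
    filter_upwards [self_mem_nhdsWithin] with s hs
    rw [arrivals_eq_zero hb, arrivals_eq_zero fun k => (hb k).trans hs]

/-- At time `t` the observed arrivals show that the arrival times of some type accumulate. -/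
def Accumulates (p : N.Primitives Ω) (x : N.State) (t : ℝ) (ω : Ω) : Prop :=
  ∃ i, ∃ r : ℚ, 0 ≤ (r : ℝ) ∧ (r : ℝ) ≤ t ∧ p.arrivals x i t ω < p.arrivals x i r ω

theorem arrivals_le_of_bounded (hp : p.Nonneg) {i : Fin N.numTypes} {s t : ℝ} (hs : 0 ≤ s)
    (hst : s ≤ t) (hb : ∃ k, t < p.arrivalSum x i k ω) :
    p.arrivals x i s ω ≤ p.arrivals x i t ω := by
  have hb' : ∃ k, s < p.arrivalSum x i k ω := hb.imp fun k hk => hst.trans_lt hk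
  obtain ⟨h1, -⟩ := (arrivals_eq_iff hp hs hb').1 rfl
  obtain ⟨-, h2⟩ := (arrivals_eq_iff hp (hs.trans hst) hb).1 rfl
  by_contra! h
  exact absurd (hp.monotone_arrivalSum (x := x) i ω h) (by simpa using by linarith)

theorem not_accumulates (hp : p.Nonneg) {t : ℝ}
    (hb : ∀ i, ∃ k, t < p.arrivalSum x i k ω) : ¬ p.Accumulates x t ω := by
  rintro ⟨i, r, hr0, hrt, hlt⟩
  exact absurd (arrivals_le_of_bounded hp hr0 hrt (hb i)) (by simpa using hlt)

/-- Once infinitely many arrivals have occurred the count remains `0`, so a drop that has been seen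
remains visible. -/
theorem Accumulates.mono (hp : p.Nonneg) {s t : ℝ} (hst : s ≤ t) (h : p.Accumulates x s ω) :
    p.Accumulates x t ω := by
  obtain ⟨i, r, hr0, hrs, hlt⟩ := h
  refine ⟨i, r, hr0, hrs.trans hst, ?_⟩
  by_cases hb : ∃ k, s < p.arrivalSum x i k ω
  · exact absurd (arrivals_le_of_bounded hp hr0 hrs hb) (by simpa using hlt)
  · push Not at hb
    rw [arrivals_eq_zero fun k => (hb k).trans hst]
    omega

/-- A drop of the count after time `s` would, by right-continuity, also be a drop from its value at
a rational time, and so it would be detected. -/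
theorem arrivals_le (hp : p.Nonneg) {s t : ℝ} (hs : 0 ≤ s) (hst : s ≤ t)
    (ht : ¬ p.Accumulates x t ω) (i : Fin N.numTypes) :
    p.arrivals x i s ω ≤ p.arrivals x i t ω := by
  by_cases hb : ∃ k, t < p.arrivalSum x i k ω
  · exact arrivals_le_of_bounded hp hs hst hb
  · push Not at hb
    by_cases hb' : ∃ k, s < p.arrivalSum x i k ω
    · obtain ⟨k, hk⟩ := hb'
      have hlt : s < t := hk.trans_le (hb k)
      obtain ⟨z, hz, hsub⟩ := (mem_nhdsGE_iff_exists_Ico_subset' hlt).1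
        (eventually_arrivals_eq (x := x) (ω := ω) hp i hs)
      obtain ⟨r, hr1, hr2⟩ := exists_rat_btwn (lt_min hz hlt : s < min z t)
      have h1 : p.arrivals x i r ω = p.arrivals x i s ω :=
        hsub ⟨hr1.le, hr2.trans_le (min_le_left _ _)⟩
      by_contra! h
      exact ht ⟨i, r, hs.trans hr1.le, (hr2.trans_le (min_le_right _ _)).le, by omega⟩
    · push Not at hb'
      rw [arrivals_eq_zero hb']
      omega

theorem inflow_eq_upstream (u : N.Control Ω) (c : N.Class) (t : ℝ) (ω : Ω) :
    p.inflow x u c t ω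
      = N.upstream (fun i => p.arrivals x i t ω) (fun c => p.departures x u c t ω) c := by
  rcases c with ⟨i, ⟨_ | j, h⟩⟩ <;> rfl

open Classical in
theorem departures_eq_findGreatest (u : N.Control Ω) (c : N.Class) (t : ℝ) (ω : Ω) :
    p.departures x u c t ω = Nat.findGreatest
      (fun k => p.serviceSum x c k ω ≤ busyTime u c t ω) (x.q c + p.inflow x u c t ω) := by
  rcases c with ⟨i, ⟨_ | j, h⟩⟩ <;> rfl

theorem busyTime_nonneg (u : N.Control Ω) (c : N.Class) (t : ℝ) (ω : Ω) :
    0 ≤ busyTime u c t ω := measureReal_nonneg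

theorem departures_eq_iff (hp : p.Nonneg) {c : N.Class} {t : ℝ} {m : ℕ} :
    p.departures x u c t ω = m ↔ m ≤ x.q c + p.inflow x u c t ω ∧
      p.serviceSum x c m ω ≤ busyTime u c t ω ∧
      (m < x.q c + p.inflow x u c t ω → busyTime u c t ω < p.serviceSum x c (m + 1) ω) := by
  classical
  have hmono := hp.monotone_serviceSum (x := x) c ω
  rw [departures_eq_findGreatest, Nat.findGreatest_eq_iff]
  refine and_congr_right fun hm => and_congr ?_ ?_
  · refine ⟨fun h => ?_, fun h _ => h⟩
    by_cases h0 : m = 0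
    · subst h0; simpa [serviceSum] using busyTime_nonneg u c t ω
    · exact h h0
  · refine ⟨fun h hlt => not_le.1 (h (Nat.lt_succ_self m) hlt), fun h n hmn hn hle => ?_⟩
    exact absurd ((hmono hmn).trans hle) (not_le.2 (h (by omega)))

theorem le_departures {c : N.Class} {t : ℝ} {m : ℕ}
    (h1 : m ≤ x.q c + p.inflow x u c t ω) (h2 : p.serviceSum x c m ω ≤ busyTime u c t ω) :
    m ≤ p.departures x u c t ω := by
  classical
  rw [departures_eq_findGreatest]
  exact Nat.le_findGreatest h1 h2

theorem serviceSum_departures_le (hp : p.Nonneg) (u : N.Control Ω) (c : N.Class) (t : ℝ) (ω : Ω) :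
    p.serviceSum x c (p.departures x u c t ω) ω ≤ busyTime u c t ω :=
  ((departures_eq_iff hp).1 rfl).2.1

theorem queue_pos_iff {c : N.Class} {t : ℝ} : 0 < p.queue x u c t ω ↔
    p.departures x u c t ω < x.q c + p.inflow x u c t ω := by
  unfold queue; omega

theorem busyTime_lt_of_queue_pos (hp : p.Nonneg) {c : N.Class} {t : ℝ}
    (h : 0 < p.queue x u c t ω) :
    busyTime u c t ω < p.serviceSum x c (p.departures x u c t ω + 1) ω :=
  ((departures_eq_iff hp).1 rfl).2.2 (queue_pos_iff.1 h)

/-! ### Busy times -/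

theorem busySet_finite (u : N.Control Ω) (c : N.Class) (t : ℝ) (ω : Ω) :
    volume {s : ℝ | s ∈ Icc 0 t ∧ u s ω (N.station c) = some c} ≠ ∞ :=
  measure_ne_top_of_subset (fun _ h => h.1) (by simp)

theorem busyTime_mono (u : N.Control Ω) (c : N.Class) (ω : Ω) {s t : ℝ} (hst : s ≤ t) :
    busyTime u c s ω ≤ busyTime u c t ω :=
  measureReal_mono (fun _ h => ⟨⟨h.1.1, h.1.2.trans hst⟩, h.2⟩) (busySet_finite u c t ω)

theorem busyTime_zero (u : N.Control Ω) (c : N.Class) (ω : Ω) : busyTime u c 0 ω = 0 := by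
  have : {s : ℝ | s ∈ Icc (0 : ℝ) 0 ∧ u s ω (N.station c) = some c} ⊆ {0} := fun s hs => by
    simpa using hs.1
  have h0 : volume {s : ℝ | s ∈ Icc (0 : ℝ) 0 ∧ u s ω (N.station c) = some c} = 0 :=
    measure_mono_null this (by simp)
  simp only [busyTime, Measure.real, h0, ENNReal.toReal_zero]

theorem busyTime_le_add (u : N.Control Ω) (c : N.Class) (ω : Ω) {s t : ℝ} (hst : s ≤ t) :
    busyTime u c t ω ≤ busyTime u c s ω + (t - s) := by
  have hsub : {y : ℝ | y ∈ Icc 0 t ∧ u y ω (N.station c) = some c}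
      ⊆ {y : ℝ | y ∈ Icc 0 s ∧ u y ω (N.station c) = some c} ∪ Ioc s t := by
    rintro y ⟨⟨h0, ht⟩, hu⟩
    rcases le_or_gt y s with h | h
    · exact Or.inl ⟨⟨h0, h⟩, hu⟩
    · exact Or.inr ⟨h, ht⟩
  refine (measureReal_mono hsub (measure_union_lt_top (busySet_finite u c s ω).lt_top
    (by simp)).ne).trans ((measureReal_union_le _ _).trans ?_)
  rw [Real.volume_real_Ioc_of_le hst]
  rfl

theorem busyTime_le (u : N.Control Ω) (c : N.Class) (ω : Ω) {t : ℝ} (ht : 0 ≤ t) :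
    busyTime u c t ω ≤ t := by
  have := busyTime_le_add u c ω ht
  rw [busyTime_zero] at this
  linarith

/-- A single instant has measure zero, so the queues at time `t` do not depend on the control at
`t`. This allows the control at `t` to depend on the queues at `t` without circularity. -/
theorem busyTime_congr {u : N.Control Ω} {u' : N.Control Ω'} {ω : Ω} {ω' : Ω'} {t : ℝ}
    (h : ∀ s ∈ Ico 0 t, u s ω = u' s ω') (c : N.Class) :
    busyTime u c t ω = busyTime u' c t ω' := by
  refine congrArg ENNReal.toReal (measure_congr ?_)
  have hne : ∀ᵐ y : ℝ, y ≠ t := by simp [ae_iff]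
  filter_upwards [hne] with y hy
  refine propext (and_congr_right fun hyt => ?_)
  rw [h y ⟨hyt.1, lt_of_le_of_ne hyt.2 hy⟩]

/-- The busy set of an arbitrary control need not be measurable; additivity over the disjoint union
only needs `A` to be. -/
theorem busyTime_ge_of_measurable {c : N.Class} {s t : ℝ} (hs : 0 ≤ s) (hst : s ≤ t) {A : Set ℝ}
    (hA : MeasurableSet A) (hAst : A ⊆ Ioc s t) (hu : ∀ y ∈ A, u y ω (N.station c) = some c) :
    busyTime u c s ω + volume.real A ≤ busyTime u c t ω := by
  have hd : Disjoint {y : ℝ | y ∈ Icc 0 s ∧ u y ω (N.station c) = some c} A :=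
    disjoint_left.2 fun y hy hyA => absurd hy.1.2 (not_le.2 (hAst hyA).1)
  have hfin : volume A ≠ ∞ := measure_ne_top_of_subset hAst (by simp)
  unfold busyTime
  rw [← measureReal_union hd hA (busySet_finite u c s ω) hfin]
  refine measureReal_mono ?_ (busySet_finite u c t ω)
  rintro y (hy | hy)
  · exact ⟨⟨hy.1.1, hy.1.2.trans hst⟩, hy.2⟩
  · exact ⟨⟨hs.trans (hAst hy).1.le, (hAst hy).2⟩, hu y hy⟩

theorem busyTime_le_of_not_served {c : N.Class} {s t : ℝ}
    (hu : ∀ y ∈ Ioc s t, u y ω (N.station c) ≠ some c) :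
    busyTime u c t ω ≤ busyTime u c s ω := by
  refine measureReal_mono ?_ (busySet_finite u c s ω)
  rintro y ⟨⟨h0, ht⟩, hy⟩
  refine ⟨⟨h0, ?_⟩, hy⟩
  by_contra! h
  exact hu y ⟨h, ht⟩ hy

/-! ### Dependence of the queues on the control -/

theorem departures_congr (t : ℝ) (h : ∀ c, busyTime u c t ω = busyTime u' c t ω) (c : N.Class) :
    p.departures x u c t ω = p.departures x u' c t ω := by
  classical
  refine upstream_induction (p := fun c => p.departures x u c t ω = p.departures x u' c t ω)
    (fun i => ?_) (fun i j hj ih => ?_) c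
  · rw [departures_eq_findGreatest, departures_eq_findGreatest, h]; rfl
  · have : p.inflow x u ⟨i, ⟨j + 1, hj⟩⟩ t ω = p.inflow x u' ⟨i, ⟨j + 1, hj⟩⟩ t ω := ih
    rw [departures_eq_findGreatest, departures_eq_findGreatest, h, this]

theorem queue_congr_departures {s t : ℝ} {p : N.Primitives Ω} {p' : N.Primitives Ω'}
    {u : N.Control Ω} {u' : N.Control Ω'} {ω : Ω} {ω' : Ω'}
    (hA : ∀ i, p.arrivals x i s ω = p'.arrivals x i t ω')
    (hD : ∀ c, p.departures x u c s ω = p'.departures x u' c t ω') (c : N.Class) :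
    p.queue x u c s ω = p'.queue x u' c t ω' := by
  unfold queue
  rw [inflow_eq_upstream, inflow_eq_upstream, hD c]
  simp only [hA, hD]

theorem queue_congr {t : ℝ} (h : ∀ s ∈ Ico 0 t, u s ω = u' s ω) (c : N.Class) :
    p.queue x u c t ω = p.queue x u' c t ω :=
  queue_congr_departures (fun _ => rfl) (departures_congr t fun c => busyTime_congr h c) c

theorem departures_mono (hp : p.Nonneg) (u : N.Control Ω) {s t : ℝ} (hs : 0 ≤ s) (hst : s ≤ t)
    (ht : ¬ p.Accumulates x t ω) (c : N.Class) :
    p.departures x u c s ω ≤ p.departures x u c t ω := by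
  refine upstream_induction
    (p := fun c => p.departures x u c s ω ≤ p.departures x u c t ω)
    (fun i => ?_) (fun i j hj ih => ?_) c
  · refine le_departures ((p.departures_le x u _ s ω).trans ?_)
      ((serviceSum_departures_le hp u _ s ω).trans (busyTime_mono u _ ω hst))
    exact Nat.add_le_add_left (arrivals_le hp hs hst ht i) _
  · refine le_departures ((p.departures_le x u _ s ω).trans ?_)
      ((serviceSum_departures_le hp u _ s ω).trans (busyTime_mono u _ ω hst))
    exact Nat.add_le_add_left ih _

/-- If the arrivals have not changed since time `s`, and no service can have been completed, then
no departures have occurred. -/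
theorem departures_eq_of_lt (hp : p.Nonneg) {s t : ℝ}
    (hA : ∀ i, p.arrivals x i t ω = p.arrivals x i s ω)
    (hT : ∀ c, busyTime u c s ω ≤ busyTime u' c t ω)
    (hlt : ∀ c, 0 < p.queue x u c s ω →
      busyTime u' c t ω < p.serviceSum x c (p.departures x u c s ω + 1) ω) (c : N.Class) :
    p.departures x u' c t ω = p.departures x u c s ω := by
  have key : ∀ c, p.inflow x u' c t ω = p.inflow x u c s ω →
      p.departures x u' c t ω = p.departures x u c s ω := fun c hc => by
    rw [departures_eq_iff hp, hc]
    exact ⟨p.departures_le x u c s ω, (serviceSum_departures_le hp u c s ω).trans (hT c),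
      fun h => hlt c (queue_pos_iff.2 h)⟩
  refine upstream_induction
    (p := fun c => p.departures x u' c t ω = p.departures x u c s ω)
    (fun i => key _ (hA i)) (fun i j hj ih => key _ ih) c

/-- The queues are right-continuous, uniformly over all controls that agree until
time `e`. -/
theorem exists_queue_eq_right (hp : p.Nonneg) (u : N.Control Ω) (ω : Ω) {e : ℝ} (he : 0 ≤ e) :
    ∃ δ > 0, ∀ u' : N.Control Ω, (∀ s ∈ Ico 0 e, u' s ω = u s ω) → ∀ s ∈ Ico e (e + δ),
      (∀ i, p.arrivals x i s ω = p.arrivals x i e ω) ∧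
      ∀ c, p.departures x u' c s ω = p.departures x u c e ω := by
  have hA : ∀ᶠ s in 𝓝[≥] e, ∀ i, p.arrivals x i s ω = p.arrivals x i e ω :=
    eventually_all.2 fun i => eventually_arrivals_eq hp i he
  -- Work progresses at rate at most one, so the work left at time `e` bounds the time until the
  -- next departure, whatever the control does afterwards.
  have hD : ∀ᶠ s in 𝓝[≥] e, ∀ c, 0 < p.queue x u c e ω →
      busyTime u c e ω + (s - e) < p.serviceSum x c (p.departures x u c e ω + 1) ω := by
    refine eventually_all.2 fun c => ?_
    by_cases hc : 0 < p.queue x u c e ω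
    · have h1 := busyTime_lt_of_queue_pos hp hc
      have : Tendsto (fun s => busyTime u c e ω + (s - e)) (𝓝[≥] e)
          (𝓝 (busyTime u c e ω + (e - e))) :=
        (Continuous.tendsto (by fun_prop) e).mono_left nhdsWithin_le_nhds
      rw [sub_self, add_zero] at this
      filter_upwards [this.eventually (gt_mem_nhds h1)] with s hs _ using hs
    · exact Eventually.of_forall fun s h => absurd h hc
  obtain ⟨z, hz, hsub⟩ := mem_nhdsGE_iff_exists_Ico_subset.1 (hA.and hD)
  refine ⟨z - e, sub_pos.2 hz, fun u' hu' s hs => ?_⟩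
  have hsz : s ∈ Ico e z := ⟨hs.1, by linarith [hs.2]⟩
  obtain ⟨h1, h2⟩ := hsub hsz
  refine ⟨h1, departures_eq_of_lt hp h1 (fun c => ?_) (fun c hc => ?_)⟩
  · rw [← busyTime_congr hu' c]
    exact busyTime_mono u' c ω hs.1
  · have := busyTime_le_add u' c ω hs.1
    rw [busyTime_congr hu' c] at this
    exact this.trans_lt (h2 c hc)

end Primitives

/-! ### Scheduling rules -/

/-- A scheduling rule organised in phases. A phase starts at an integer time; a phase that starts
when the queue lengths are `q₀` lasts `dur q₀` time units. At time `t`, in a phase that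
started at time `s` with queue lengths `q₀`, and when the current queue lengths are `q`, the station
`σ` serves the class `serve s q₀ q t σ`. -/
structure Rule (N : MultitypeNetwork) where
  dur : (N.Class → ℕ) → ℕ
  serve : ℕ → (N.Class → ℕ) → (N.Class → ℕ) → ℝ → Fin N.numStations → Option N.Class
  serve_spec : ∀ s q₀ q t σ c, serve s q₀ q t σ = some c → N.station c = σ ∧ 0 < q c
  serve_ne_none : ∀ s q₀ q t σ, (∃ c, N.station c = σ ∧ 0 < q c) → serve s q₀ q t σ ≠ none
  measurable_serve : ∀ s q₀ q σ c, MeasurableSet {t | serve s q₀ q t σ = some c}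
  left_const : ∀ s q₀ q t, ∃ v, ∀ᶠ y in 𝓝[<] t, serve s q₀ q y = v

namespace Rule

variable {N : MultitypeNetwork} {Ω Ω' : Type*}

/-- The phase (starting time and initial queue lengths) at the integer time `k`, if `h l` are the
queue lengths at the times `l ≤ k`. -/
def phase (ρ : N.Rule) (h : ℕ → N.Class → ℕ) : ℕ → ℕ × (N.Class → ℕ)
  | 0 => (0, h 0)
  | k + 1 => if (phase ρ h k).1 + ρ.dur (phase ρ h k).2 ≤ k + 1 then (k + 1, h (k + 1))
      else phase ρ h k

theorem phase_congr (ρ : N.Rule) {h h' : ℕ → N.Class → ℕ} {k : ℕ} (hh : ∀ l ≤ k, h l = h' l) :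
    ρ.phase h k = ρ.phase h' k := by
  induction k with
  | zero => simp [phase, hh 0 le_rfl]
  | succ k ih => rw [phase, phase, ih fun l hl => hh l (by omega), hh (k + 1) le_rfl]

open Classical in
/-- The control prescribed by the rule, given the queues that result from the control `u`. The
stations stop when the arrivals are seen to accumulate. -/
def next (ρ : N.Rule) (p : N.Primitives Ω) (x : N.State) (u : N.Control Ω) : N.Control Ω :=
  fun t ω => if t < 0 ∨ p.Accumulates x t ω then fun _ => none else
    ρ.serve (ρ.phase (fun k c => p.queue x u c k ω) ⌊t⌋₊).1
      (ρ.phase (fun k c => p.queue x u c k ω) ⌊t⌋₊).2 (fun c => p.queue x u c t ω) t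

/-- The two sample spaces may differ, so this serves both for comparing paths and for passing to the
path space. -/
theorem next_congr (ρ : N.Rule) {p : N.Primitives Ω} {p' : N.Primitives Ω'} {x : N.State}
    {u : N.Control Ω} {u' : N.Control Ω'} {ω : Ω} {ω' : Ω'} {t : ℝ}
    (hacc : p.Accumulates x t ω ↔ p'.Accumulates x t ω')
    (h : ∀ s ∈ Icc 0 t, ∀ c, p.queue x u c s ω = p'.queue x u' c s ω') :
    ρ.next p x u t ω = ρ.next p' x u' t ω' := by
  unfold next
  by_cases hb : t < 0 ∨ p.Accumulates x t ω
  · rw [if_pos hb, if_pos (by rwa [hacc] at hb)]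
  · rw [if_neg hb, if_neg (by rwa [hacc] at hb)]
    have ht : 0 ≤ t := not_lt.1 fun h => hb (Or.inl h)
    have h1 : ρ.phase (fun k c => p.queue x u c k ω) ⌊t⌋₊
        = ρ.phase (fun k c => p'.queue x u' c k ω') ⌊t⌋₊ :=
      ρ.phase_congr fun l hl => by
        funext c
        exact h l ⟨Nat.cast_nonneg l, (Nat.le_floor_iff ht).1 hl⟩ c
    have h2 : (fun c => p.queue x u c t ω) = fun c => p'.queue x u' c t ω' := by
      funext c
      exact h t ⟨ht, le_rfl⟩ c
    rw [h1, h2]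

/-! ### Existence and uniqueness of the control prescribed by a rule -/

/-- Successive approximations of the control prescribed by a rule. -/
def approx (ρ : N.Rule) (p : N.Primitives Ω) (x : N.State) (k : ℕ) : N.Control Ω :=
  (ρ.next p x)^[k] fun _ _ _ => none

theorem approx_succ (ρ : N.Rule) (p : N.Primitives Ω) (x : N.State) (k : ℕ) :
    ρ.approx p x (k + 1) = ρ.next p x (ρ.approx p x k) :=
  Function.iterate_succ_apply' _ _ _

/-- A bounded integer-valued monotone function is constant just before `e`. -/
theorem exists_eventually_eq_left {f : ℝ → ℕ} {e : ℝ} (he : 0 < e) {K : ℕ}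
    (hf : ∀ s t, 0 ≤ s → s ≤ t → t < e → f s ≤ f t) (hK : ∀ s, 0 ≤ s → s < e → f s ≤ K) :
    ∃ v, ∀ᶠ s in 𝓝[<] e, f s = v := by
  set A := f '' Ico 0 e with hA
  have hbdd : BddAbove A := ⟨K, by rintro _ ⟨s, hs, rfl⟩; exact hK s hs.1 hs.2⟩
  have hne : A.Nonempty := ⟨_, 0, ⟨le_rfl, he⟩, rfl⟩
  obtain ⟨s₀, hs₀, hmax⟩ := Nat.sSup_mem hne hbdd
  refine ⟨sSup A, ?_⟩
  filter_upwards [Ico_mem_nhdsLT hs₀.2] with s hs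
  refine le_antisymm (le_csSup hbdd ⟨s, ⟨hs₀.1.trans hs.1, hs.2⟩, rfl⟩) ?_
  rw [← hmax]
  exact hf s₀ s hs₀.1 hs.1 hs.2

variable {p : N.Primitives Ω} {x : N.State} {ω : Ω} {ρ : N.Rule}

/-- The approximations agree from some index on, before time `e`. -/
def Settled (ρ : N.Rule) (p : N.Primitives Ω) (x : N.State) (ω : Ω) (e : ℝ) : Prop :=
  ∃ K, ∀ k ≥ K, ∀ s ∈ Ico 0 e, ρ.approx p x k s ω = ρ.approx p x K s ω

/-- One application of `next` turns agreement of the queues into agreement of the controls, at the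
price of one index. -/
theorem settled_of_queue {e : ℝ} {K : ℕ} (h : ∀ k ≥ K, ∀ s ∈ Ico 0 e, ∀ c,
    p.queue x (ρ.approx p x k) c s ω = p.queue x (ρ.approx p x K) c s ω) :
    ρ.Settled p x ω e := by
  refine ⟨K + 1, fun k hk s hs => ?_⟩
  obtain ⟨l, rfl⟩ : ∃ l, k = l + 1 := ⟨k - 1, by omega⟩
  rw [approx_succ, approx_succ]
  exact ρ.next_congr Iff.rfl fun y hy => h l (by omega) y ⟨hy.1, hy.2.trans_lt hs.2⟩

theorem Settled.mono {e e' : ℝ} (h : ρ.Settled p x ω e) (hle : e' ≤ e) : ρ.Settled p x ω e' := by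
  obtain ⟨K, hK⟩ := h
  exact ⟨K, fun k hk s hs => hK k hk s ⟨hs.1, hs.2.trans_le hle⟩⟩

/-- Approximations that agree before `e` have the same queues at `e`, and these stay frozen for a
time `δ` common to all such controls. -/
theorem Settled.extend (hp : p.Nonneg) {e : ℝ} (he : 0 ≤ e) (h : ρ.Settled p x ω e) :
    ∃ δ > 0, ρ.Settled p x ω (e + δ) := by
  obtain ⟨K, hK⟩ := h
  obtain ⟨δ, hδ, hr⟩ := Primitives.exists_queue_eq_right (x := x) hp (ρ.approx p x K) ω he
  refine ⟨δ, hδ, settled_of_queue (K := K) fun k hk s hs c => ?_⟩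
  rcases lt_or_ge s e with hse | hse
  · exact Primitives.queue_congr
      (fun y hy => hK k hk y ⟨hy.1, hy.2.trans hse⟩) c
  · obtain ⟨-, h2⟩ := hr (ρ.approx p x k) (hK k hk) s ⟨hse, hs.2⟩
    obtain ⟨-, h4⟩ := hr (ρ.approx p x K) (fun _ _ => rfl) s ⟨hse, hs.2⟩
    exact Primitives.queue_congr_departures (fun _ => rfl) (fun c => by rw [h2, h4]) c

/-- The danger is that the index of stabilisation tends to infinity as `e` is approached. It does
not, because bounded monotone counts are constant just before `e`: on a last interval the limit
control is constant and nothing happens, and any approximation that agrees with it up to some time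
in this interval sees the same frozen queues until `e`. -/
theorem settled_of_forall_lt (hp : p.Nonneg) {e : ℝ} (he : 0 < e) (hacc : ¬ p.Accumulates x e ω)
    (h : ∀ e' < e, ρ.Settled p x ω e') : ρ.Settled p x ω e := by
  choose! K hK using h
  -- the limit of the approximations before time `e`
  set v : N.Control Ω := fun s => ρ.approx p x (K ((s + e) / 2)) s with hv
  have hvK : ∀ e' < e, ∀ k ≥ K e', ∀ s ∈ Ico 0 e', ρ.approx p x k s ω = v s ω := by
    intro e' he' k hk s hs
    have hse : s < e := hs.2.trans he'
    rw [hK e' he' k hk s hs, ← hK e' he' (max (K e') (K ((s + e) / 2))) (le_max_left _ _) s hs]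
    exact hK ((s + e) / 2) (by linarith) _ (le_max_right _ _) s ⟨hs.1, by linarith⟩
  have hq : ∀ e' < e, ∀ k ≥ K e', ∀ s ∈ Ico 0 e', ∀ c,
      p.queue x (ρ.approx p x k) c s ω = p.queue x v c s ω := fun e' he' k hk s hs c =>
    Primitives.queue_congr (fun y hy => hvK e' he' k hk y ⟨hy.1, hy.2.trans hs.2⟩) c
  have hfix : ∀ s, 0 ≤ s → s < e → v s ω = ρ.next p x v s ω := by
    intro s hs hse
    have he' : (s + e) / 2 < e := by linarith
    have hse' : s < (s + e) / 2 := by linarith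
    rw [← hvK _ he' (K ((s + e) / 2) + 1) (by omega) s ⟨hs, hse'⟩, approx_succ]
    exact ρ.next_congr Iff.rfl fun y hy => hq _ he' _ le_rfl y ⟨hy.1, hy.2.trans_lt hse'⟩
  have hacc' : ∀ s, s ≤ e → ¬ p.Accumulates x s ω := fun s hs h => hacc (h.mono hp hs)
  -- everything is constant just before time `e`
  have hA : ∀ i, ∃ a, ∀ᶠ s in 𝓝[<] e, p.arrivals x i s ω = a := fun i =>
    exists_eventually_eq_left he (K := p.arrivals x i e ω)
      (fun s t hs hst hte => Primitives.arrivals_le hp hs hst (hacc' t hte.le) i)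
      (fun s hs hse => Primitives.arrivals_le hp hs hse.le hacc i)
  have hD : ∀ c, ∃ d, ∀ᶠ s in 𝓝[<] e, p.departures x v c s ω = d := fun c =>
    exists_eventually_eq_left he (K := p.departures x v c e ω)
      (fun s t hs hst hte => Primitives.departures_mono hp v hs hst (hacc' t hte.le) c)
      (fun s hs hse => Primitives.departures_mono hp v hs hse.le hacc c)
  have hfl : ∃ k, ∀ᶠ s : ℝ in 𝓝[<] e, ⌊s⌋₊ = k :=
    exists_eventually_eq_left he (K := ⌊e⌋₊) (fun s t _ hst _ => Nat.floor_mono hst)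
      (fun s _ hse => Nat.floor_mono hse.le)
  choose a ha using hA
  choose d hd using hD
  obtain ⟨k₀, hk₀⟩ := hfl
  set m := ρ.phase (fun k c => p.queue x v c k ω) k₀ with hm
  set qv : N.Class → ℕ := fun c => x.q c + N.upstream a d c - d c with hqv
  obtain ⟨w, hw⟩ := ρ.left_const m.1 m.2 qv e
  have hall : ∀ᶠ s in 𝓝[<] e, (∀ i, p.arrivals x i s ω = a i) ∧
      (∀ c, p.departures x v c s ω = d c) ∧ ⌊s⌋₊ = k₀ ∧ ρ.serve m.1 m.2 qv s = w ∧ 0 ≤ s := by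
    filter_upwards [eventually_all.2 ha, eventually_all.2 hd, hk₀, hw, Ico_mem_nhdsLT he]
      with s h1 h2 h3 h4 h5
    exact ⟨h1, h2, h3, h4, h5.1⟩
  obtain ⟨s₁, hs₁, hsub⟩ := (mem_nhdsLT_iff_exists_Ico_subset (a := e)).1 hall
  have hs₁e : s₁ < e := hs₁
  have hs₁0 : 0 ≤ s₁ := (hsub ⟨le_rfl, hs₁e⟩).2.2.2.2
  have hvw : ∀ s ∈ Ico s₁ e, v s ω = w := by
    intro s hs
    obtain ⟨h1, h2, h3, h4, h5⟩ := hsub hs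
    rw [hfix s h5 hs.2, next, if_neg (by
      rintro (h | h)
      · exact absurd h (not_lt.2 h5)
      · exact hacc' s hs.2.le h)]
    have hqs : (fun c => p.queue x v c s ω) = qv := by
      funext c
      simp only [Primitives.queue, Primitives.inflow_eq_upstream, h1, h2, hqv]
    rw [hqs, h3, ← hm, h4]
  -- a time after which no class that is not being served can complete a service
  have hqeq : ∀ s ∈ Ico s₁ e, ∀ c, p.queue x v c s ω = p.queue x v c s₁ ω := fun s hs c =>
    Primitives.queue_congr_departures
      (fun i => by rw [(hsub hs).1, (hsub ⟨le_rfl, hs₁e⟩).1])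
      (fun c => by rw [(hsub hs).2.1, (hsub ⟨le_rfl, hs₁e⟩).2.1]) c
  have hex : ∀ᶠ s in 𝓝[<] e, ∀ c, 0 < p.queue x v c s₁ ω →
      Primitives.busyTime v c s₁ ω + (e - s) < p.serviceSum x c (d c + 1) ω := by
    refine eventually_all.2 fun c => ?_
    by_cases hc : 0 < p.queue x v c s₁ ω
    · have h1 := Primitives.busyTime_lt_of_queue_pos hp hc
      rw [(hsub ⟨le_rfl, hs₁e⟩).2.1] at h1
      have : Tendsto (fun s => Primitives.busyTime v c s₁ ω + (e - s)) (𝓝[<] e)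
          (𝓝 (Primitives.busyTime v c s₁ ω + (e - e))) :=
        (Continuous.tendsto (by fun_prop) e).mono_left nhdsWithin_le_nhds
      rw [sub_self, add_zero] at this
      filter_upwards [this.eventually (gt_mem_nhds h1)] with s hs _ using hs
    · exact Eventually.of_forall fun s h => absurd h hc
  obtain ⟨s₂, hs₂, hs₂I⟩ := (hex.and (Ico_mem_nhdsLT hs₁e)).exists
  have hs₂0 : 0 ≤ s₂ := hs₁0.trans hs₂I.1
  have main : ∀ k ≥ K s₂, ∀ s ∈ Ico 0 e, ∀ c,
      p.queue x (ρ.approx p x k) c s ω = p.queue x v c s ω := by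
    intro k hk s hs c
    rcases lt_or_ge s s₂ with hss | hss
    · exact hq s₂ hs₂I.2 k hk s ⟨hs.1, hss⟩ c
    have hsI : s ∈ Ico s₁ e := ⟨hs₂I.1.trans hss, hs.2⟩
    have hT₂ : ∀ c, Primitives.busyTime (ρ.approx p x k) c s₂ ω = Primitives.busyTime v c s₂ ω :=
      fun c => Primitives.busyTime_congr (hvK s₂ hs₂I.2 k hk) c
    refine Primitives.queue_congr_departures (fun _ => rfl) (fun c => ?_) c
    rw [(hsub hsI).2.1 c, ← (hsub hs₂I).2.1 c]
    refine Primitives.departures_eq_of_lt hp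
      (fun i => by rw [(hsub hsI).1, (hsub hs₂I).1]) (fun c => ?_) (fun c hc => ?_) c
    · rw [← hT₂]
      exact Primitives.busyTime_mono _ c ω hss
    · have h1 := Primitives.busyTime_le_add (ρ.approx p x k) c ω hss
      rw [hT₂] at h1
      rw [(hsub hs₂I).2.1 c]
      rw [hqeq s₂ hs₂I] at hc
      -- A class served by the limit control does not complete a job before `e` even under permanent
      -- service, so no approximation can do better. A class that is not served still needs more
      -- work than the time left until `e`.
      by_cases hserved : w (N.station c) = some c
      · have h2 := Primitives.busyTime_ge_of_measurable (u := v) (ω := ω) (c := c) hs₂0 hss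
          measurableSet_Ioc (subset_refl _) (fun y hy => by
            rw [hvw y ⟨hs₂I.1.trans hy.1.le, hy.2.trans_lt hs.2⟩, hserved])
        rw [Real.volume_real_Ioc_of_le hss] at h2
        have h3 := Primitives.busyTime_lt_of_queue_pos (u := v) (t := s) hp
          (by rw [hqeq s hsI]; exact hc)
        rw [(hsub hsI).2.1 c] at h3
        linarith
      · have h2 := Primitives.busyTime_le_of_not_served (u := v) (ω := ω) (c := c)
          (s := s₁) (t := s₂) (fun y hy => by
            rw [hvw y ⟨hy.1.le, hy.2.trans_lt hs₂I.2⟩]; exact hserved)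
        linarith [hs₂ c hc, hs.2]
  exact settled_of_queue (K := K s₂) fun k hk s hs c => by
    rw [main k hk s hs, main _ le_rfl s hs]

/-- Continuous induction: `settled_of_forall_lt` reaches the supremum of the settled times and
`Settled.extend` goes beyond it. -/
theorem settled (hp : p.Nonneg) {t : ℝ} (hacc : ¬ p.Accumulates x t ω) : ρ.Settled p x ω t := by
  rcases le_or_gt t 0 with ht | ht
  · exact ⟨0, fun k _ s hs => absurd (hs.1.trans_lt hs.2) (not_lt.2 ht)⟩
  set A := {e | e ∈ Icc 0 t ∧ ρ.Settled p x ω e} with hA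
  have hbdd : BddAbove A := ⟨t, fun e he => he.1.2⟩
  have h0 : (0 : ℝ) ∈ A := ⟨⟨le_rfl, ht.le⟩, 0, fun k _ s hs => absurd hs.2 (not_lt.2 hs.1)⟩
  set E := sSup A with hE
  have hE0 : 0 ≤ E := le_csSup hbdd h0
  have hEt : E ≤ t := csSup_le ⟨0, h0⟩ fun e he => he.1.2
  have hES : ρ.Settled p x ω E := by
    rcases hE0.eq_or_lt with h | h
    · rw [← h]; exact h0.2
    · refine settled_of_forall_lt hp h (fun hc => hacc (hc.mono hp hEt)) fun e' he' => ?_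
      obtain ⟨e'', he'', hlt⟩ := exists_lt_of_lt_csSup ⟨0, h0⟩ he'
      exact he''.2.mono hlt.le
  rcases hEt.eq_or_lt with h | h
  · rw [← h]; exact hES
  · obtain ⟨δ, hδ, hs⟩ := hES.extend hp hE0
    have : min (E + δ) t ∈ A :=
      ⟨⟨le_min (by linarith) ht.le, min_le_right _ _⟩, hs.mono (min_le_left _ _)⟩
    have h1 := le_csSup hbdd this
    have h2 : E < min (E + δ) t := lt_min (by linarith) h
    exact absurd h1 (not_le.2 h2)

open Classical in
/-- The control prescribed by a rule. -/
def control (ρ : N.Rule) (p : N.Primitives Ω) (x : N.State) : N.Control Ω := fun t ω σ =>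
  if h : ∃ c, ∀ᶠ k in atTop, ρ.approx p x k t ω σ = some c then some h.choose else none

theorem control_eq_some {t : ℝ} {σ : Fin N.numStations} {c : N.Class} :
    ρ.control p x t ω σ = some c ↔ ∀ᶠ k in atTop, ρ.approx p x k t ω σ = some c := by
  unfold control
  constructor
  · intro h
    split_ifs at h with hc
    rw [← h]
    exact hc.choose_spec
  · intro h
    have hc : ∃ c, ∀ᶠ k in atTop, ρ.approx p x k t ω σ = some c := ⟨c, h⟩
    rw [dif_pos hc]
    obtain ⟨k, h1, h2⟩ := (h.and hc.choose_spec).exists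
    rw [← h2, h1]

theorem control_eq_of_eventually {t : ℝ} {v : Fin N.numStations → Option N.Class}
    (h : ∀ᶠ k in atTop, ρ.approx p x k t ω = v) : ρ.control p x t ω = v := by
  funext σ
  refine Option.ext fun c => ?_
  rw [control_eq_some]
  constructor
  · intro hc
    obtain ⟨k, h1, h2⟩ := (h.and hc).exists
    rw [← h1, h2]
  · intro hc
    filter_upwards [h] with k hk
    rw [hk, hc]

/-- The control prescribed by a rule satisfies the rule, on every path. -/
theorem control_eq_next (hp : p.Nonneg) (t : ℝ) (ω : Ω) :
    ρ.control p x t ω = ρ.next p x (ρ.control p x) t ω := by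
  by_cases hb : t < 0 ∨ p.Accumulates x t ω
  · rw [next, if_pos hb]
    refine control_eq_of_eventually ?_
    filter_upwards [eventually_ge_atTop 1] with k hk
    obtain ⟨l, rfl⟩ : ∃ l, k = l + 1 := ⟨k - 1, by omega⟩
    rw [approx_succ, next, if_pos hb]
  · push Not at hb
    obtain ⟨K, hK⟩ := settled (ρ := ρ) hp hb.2
    have hlim : ∀ s ∈ Ico 0 t, ρ.control p x s ω = ρ.approx p x K s ω := fun s hs =>
      control_eq_of_eventually ((eventually_ge_atTop K).mono fun k hk => hK k hk s hs)
    have hq : ∀ k ≥ K, ∀ s ∈ Icc 0 t, ∀ c,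
        p.queue x (ρ.approx p x k) c s ω = p.queue x (ρ.control p x) c s ω := by
      intro k hk s hs c
      refine Primitives.queue_congr (fun y hy => ?_) c
      have hyt : y ∈ Ico 0 t := ⟨hy.1, hy.2.trans_le hs.2⟩
      rw [hlim y hyt, hK k hk y hyt]
    refine control_eq_of_eventually ?_
    filter_upwards [eventually_ge_atTop (K + 1)] with k hk
    obtain ⟨l, rfl⟩ : ∃ l, k = l + 1 := ⟨k - 1, by omega⟩
    rw [approx_succ]
    exact ρ.next_congr Iff.rfl (hq l (by omega))

/-- Two paths along which the rule sees the same queues as long as the controls agree have the same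
control. -/
theorem control_congr (hp : p.Nonneg) {ω' : Ω} {t : ℝ} (hω : ¬ p.Accumulates x t ω)
    (hω' : ¬ p.Accumulates x t ω')
    (h : ∀ e ∈ Icc 0 t, (∀ s ∈ Ico 0 e, ρ.control p x s ω = ρ.control p x s ω') →
      ∀ c, p.queue x (ρ.control p x) c e ω = p.queue x (ρ.control p x) c e ω') :
    ∀ s ∈ Ico 0 t, ρ.control p x s ω = ρ.control p x s ω' := by
  rcases le_or_gt t 0 with ht | ht
  · exact fun s hs => absurd (hs.1.trans_lt hs.2) (not_lt.2 ht)
  set u := ρ.control p x with hu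
  -- Continuous induction on the time of agreement; right-continuity of both queue processes carries
  -- it past the supremum.
  set A := {e | e ∈ Icc 0 t ∧ ∀ s ∈ Ico 0 e, u s ω = u s ω'} with hA
  have hbdd : BddAbove A := ⟨t, fun e he => he.1.2⟩
  have h0 : (0 : ℝ) ∈ A := ⟨⟨le_rfl, ht.le⟩, fun s hs => absurd hs.2 (not_lt.2 hs.1)⟩
  set E := sSup A with hE
  have hE0 : 0 ≤ E := le_csSup hbdd h0
  have hEt : E ≤ t := csSup_le ⟨0, h0⟩ fun e he => he.1.2
  have hES : ∀ s ∈ Ico 0 E, u s ω = u s ω' := by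
    intro s hs
    obtain ⟨e, he, hlt⟩ := exists_lt_of_lt_csSup ⟨0, h0⟩ hs.2
    exact he.2 s ⟨hs.1, hlt⟩
  rcases hEt.eq_or_lt with hEt' | hEt'
  · rw [← hEt']; exact hES
  · obtain ⟨δ, hδ, hr⟩ := Primitives.exists_queue_eq_right (x := x) hp u ω hE0
    obtain ⟨δ', hδ', hr'⟩ := Primitives.exists_queue_eq_right (x := x) hp u ω' hE0
    set z := min (min (E + δ) (E + δ')) t with hz
    have hzδ : z ≤ E + δ := (min_le_left _ _).trans (min_le_left _ _)
    have hzδ' : z ≤ E + δ' := (min_le_left _ _).trans (min_le_right _ _)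
    have hEz : E < z := lt_min (lt_min (by linarith) (by linarith)) hEt'
    have hqE : ∀ y ∈ Ico 0 z, ∀ c, p.queue x u c y ω = p.queue x u c y ω' := by
      intro y hy c
      rcases lt_or_ge y E with hyE | hyE
      · exact h y ⟨hy.1, hyE.le.trans hEt⟩ (fun s hs => hES s ⟨hs.1, hs.2.trans hyE⟩) c
      · have h1 := hr u (fun _ _ => rfl) y ⟨hyE, hy.2.trans_le hzδ⟩
        have h2 := hr' u (fun _ _ => rfl) y ⟨hyE, hy.2.trans_le hzδ'⟩
        rw [Primitives.queue_congr_departures (p := p) (p' := p) (u := u) (u' := u) h1.1 h1.2 c,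
          Primitives.queue_congr_departures (p := p) (p' := p) (u := u) (u' := u) h2.1 h2.2 c]
        exact h E ⟨hE0, hEt⟩ hES c
    have hzA : z ∈ A := by
      refine ⟨⟨hE0.trans hEz.le, min_le_right _ _⟩, fun s hs => ?_⟩
      have hst : s ≤ t := hs.2.le.trans (min_le_right _ _)
      rw [hu, control_eq_next hp s ω, control_eq_next hp s ω']
      refine ρ.next_congr ?_ fun y hy => hqE y ⟨hy.1, hy.2.trans_lt hs.2⟩
      exact ⟨fun hc => absurd (hc.mono hp hst) hω, fun hc => absurd (hc.mono hp hst) hω'⟩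
    exact absurd (le_csSup hbdd hzA) (not_le.2 hEz)

end Rule

end MultitypeNetwork

namespace MultitypeNetwork

variable {N : MultitypeNetwork} {Ω Ω' : Type*}

/-! ### Measurability -/

theorem Rule.measurable_phase [MeasurableSpace Ω] (ρ : N.Rule) {h : Ω → ℕ → N.Class → ℕ} {k : ℕ}
    (hh : ∀ l ≤ k, ∀ c, Measurable fun ω => h ω l c) :
    Measurable fun ω => ρ.phase (h ω) k := by
  induction k with
  | zero => exact measurable_const.prodMk (measurable_pi_lambda _ fun c => hh 0 le_rfl c)
  | succ k ih =>
    have ih' := ih fun l hl => hh l (by omega)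
    refine Measurable.ite (ih' (MeasurableSet.of_discrete
      (s := {m : ℕ × (N.Class → ℕ) | m.1 + ρ.dur m.2 ≤ k + 1}))) ?_ ih'
    exact measurable_const.prodMk (measurable_pi_lambda _ fun c => hh (k + 1) le_rfl c)

namespace Primitives

section

variable {p : N.Primitives Ω} {x : N.State}

theorem arrivals_of_neg (hp : p.Nonneg) {i : Fin N.numTypes} {t : ℝ} (ht : t < 0) (ω : Ω) :
    p.arrivals x i t ω = 0 := by
  have : {k : ℕ | ∑ r ∈ Finset.range k, p.interarrival x i r ω ≤ t} = ∅ := by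
    ext k
    have := Finset.sum_nonneg fun r (_ : r ∈ Finset.range k) => hp.interarrival (x := x) i r ω
    simp only [mem_ofPred_eq, mem_empty_iff_false, iff_false, not_le]
    linarith
  rw [arrivals, this]
  simp

theorem measurable_queue_of {u : N.Control Ω} {α : Type*} [MeasurableSpace α] {t : α → ℝ} {f : α → Ω}
    (hA : ∀ i, Measurable fun y => p.arrivals x i (t y) (f y))
    (hD : ∀ c, Measurable fun y => p.departures x u c (t y) (f y)) (c : N.Class) :
    Measurable fun y => p.queue x u c (t y) (f y) := by
  unfold queue
  refine (measurable_const.add ?_).sub (hD c)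
  rcases c with ⟨i, ⟨_ | j, h⟩⟩
  · exact hA i
  · exact hD _

end

variable [MeasurableSpace Ω] {p : N.Primitives Ω} {x : N.State} {u : N.Control Ω}

/-- All interarrival and service times are measurable. -/
structure IsMeasurable (p : N.Primitives Ω) : Prop where
  X : ∀ i k, Measurable (p.X i k)
  S : ∀ c k, Measurable (p.S c k)

theorem IsMeasurable.arrivalSum (hm : p.IsMeasurable) (i : Fin N.numTypes) (k : ℕ) :
    Measurable (p.arrivalSum x i k) := by
  unfold Primitives.arrivalSum
  refine Finset.measurable_sum _ fun r _ => ?_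
  unfold Primitives.interarrival
  split_ifs
  · exact measurable_const
  · exact hm.X i r

theorem IsMeasurable.serviceSum (hm : p.IsMeasurable) (c : N.Class) (k : ℕ) :
    Measurable (p.serviceSum x c k) := by
  unfold Primitives.serviceSum
  refine Finset.measurable_sum _ fun r _ => ?_
  unfold Primitives.service
  split_ifs
  · exact measurable_const
  · exact hm.S c r

theorem measurable_arrivals (hp : p.Nonneg) (hm : p.IsMeasurable) (i : Fin N.numTypes) :
    Measurable fun y : ℝ × Ω => p.arrivals x i y.1 y.2 := by
  refine measurable_to_countable' fun m => ?_
  -- The second set accounts for the default value `0`, at negative times and after infinitely many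
  -- arrivals.
  have hset : (fun y : ℝ × Ω => p.arrivals x i y.1 y.2) ⁻¹' {m}
      = {y | 0 ≤ y.1 ∧ p.arrivalSum x i m y.2 ≤ y.1 ∧ y.1 < p.arrivalSum x i (m + 1) y.2}
        ∪ {y | m = 0 ∧ (y.1 < 0 ∨ ∀ k, p.arrivalSum x i k y.2 ≤ y.1)} := by
    ext ⟨t, ω⟩
    simp only [mem_preimage, mem_singleton_iff, mem_union, mem_ofPred_eq]
    rcases lt_or_ge t 0 with ht | ht
    · rw [arrivals_of_neg hp ht]
      simp [ht, not_le.2 ht, eq_comm]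
    · by_cases hb : ∃ k, t < p.arrivalSum x i k ω
      · rw [arrivals_eq_iff hp ht hb]
        have : ¬ ∀ k, p.arrivalSum x i k ω ≤ t := by push Not; exact hb
        simp [ht, this, not_lt.2 ht]
      · push Not at hb
        rw [arrivals_eq_zero hb]
        simp [ht, hb, not_lt.2 ht, not_lt.2 (hb _), eq_comm]
  rw [hset]
  have hV : ∀ k, Measurable fun y : ℝ × Ω => p.arrivalSum x i k y.2 := fun k =>
    (hm.arrivalSum i k).comp measurable_snd
  refine MeasurableSet.union ?_ ?_
  · exact (measurableSet_le measurable_const measurable_fst).inter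
      ((measurableSet_le (hV m) measurable_fst).inter
        (measurableSet_lt measurable_fst (hV (m + 1))))
  · refine (MeasurableSet.const _).inter ?_
    have hall : MeasurableSet {y : ℝ × Ω | ∀ k, p.arrivalSum x i k y.2 ≤ y.1} := by
      rw [show {y : ℝ × Ω | ∀ k, p.arrivalSum x i k y.2 ≤ y.1}
        = ⋂ k, {y | p.arrivalSum x i k y.2 ≤ y.1} from by ext; simp]
      exact MeasurableSet.iInter fun k => measurableSet_le (hV k) measurable_fst
    exact (measurableSet_lt measurable_fst measurable_const).union hall

theorem measurableSet_accumulates (hp : p.Nonneg) (hm : p.IsMeasurable) :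
    MeasurableSet {y : ℝ × Ω | p.Accumulates x y.1 y.2} := by
  have : {y : ℝ × Ω | p.Accumulates x y.1 y.2} = ⋃ i, ⋃ r : ℚ, {y | 0 ≤ (r : ℝ) ∧
      (r : ℝ) ≤ y.1 ∧ p.arrivals x i y.1 y.2 < p.arrivals x i r y.2} := by
    ext; simp [Accumulates]
  rw [this]
  refine MeasurableSet.iUnion fun i => MeasurableSet.iUnion fun r => ?_
  refine (MeasurableSet.const _).inter ((measurableSet_le measurable_const measurable_fst).inter ?_)
  exact measurableSet_lt (measurable_arrivals hp hm i)
    ((measurable_arrivals hp hm i).comp (measurable_const.prodMk measurable_snd))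

/-- The control is jointly measurable in time and the sample point. -/
def IsMeasurableControl (u : N.Control Ω) : Prop :=
  ∀ σ c, MeasurableSet {y : ℝ × Ω | u y.1 y.2 σ = some c}

theorem IsMeasurableControl.busyTime (hu : IsMeasurableControl u) (c : N.Class) :
    Measurable fun y : ℝ × Ω => busyTime u c y.1 y.2 := by
  have hS : MeasurableSet {z : (ℝ × Ω) × ℝ |
      z.2 ∈ Icc 0 z.1.1 ∧ u z.2 z.1.2 (N.station c) = some c} := by
    refine MeasurableSet.inter ?_ ?_
    · exact (measurableSet_le measurable_const measurable_snd).inter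
        (measurableSet_le measurable_snd measurable_fst.fst)
    · exact (measurable_snd.prodMk measurable_fst.snd) (hu (N.station c) c)
  exact (measurable_measure_prodMk_left hS).ennreal_toReal

theorem IsMeasurableControl.departures (hp : p.Nonneg) (hm : p.IsMeasurable)
    (hu : IsMeasurableControl u) (c : N.Class) :
    Measurable fun y : ℝ × Ω => p.departures x u c y.1 y.2 := by
  have key : ∀ c, (Measurable fun y : ℝ × Ω => p.inflow x u c y.1 y.2) →
      Measurable fun y : ℝ × Ω => p.departures x u c y.1 y.2 := by
    intro c hc
    refine measurable_to_countable' fun m => ?_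
    have hset : (fun y : ℝ × Ω => p.departures x u c y.1 y.2) ⁻¹' {m}
        = {y | m ≤ x.q c + p.inflow x u c y.1 y.2} ∩
          ({y | p.serviceSum x c m y.2 ≤ Primitives.busyTime u c y.1 y.2} ∩
          ({y | m < x.q c + p.inflow x u c y.1 y.2}ᶜ ∪
            {y | Primitives.busyTime u c y.1 y.2 < p.serviceSum x c (m + 1) y.2})) := by
      ext ⟨t, ω⟩
      simp only [mem_preimage, mem_singleton_iff, departures_eq_iff hp, mem_inter_iff,
        mem_union, mem_ofPred_eq, mem_compl_iff]
      tauto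
    rw [hset]
    have hV : ∀ k, Measurable fun y : ℝ × Ω => p.serviceSum x c k y.2 := fun k =>
      (hm.serviceSum c k).comp measurable_snd
    refine (measurableSet_le measurable_const (measurable_const.add hc)).inter
      ((measurableSet_le (hV m) (hu.busyTime c)).inter ?_)
    exact (measurableSet_lt measurable_const (measurable_const.add hc)).compl.union
      (measurableSet_lt (hu.busyTime c) (hV (m + 1)))
  exact upstream_induction
    (p := fun c => Measurable fun y : ℝ × Ω => p.departures x u c y.1 y.2)
    (fun i => key _ (measurable_arrivals hp hm i)) (fun i j hj ih => key _ ih) c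

theorem IsMeasurableControl.queue (hp : p.Nonneg) (hm : p.IsMeasurable)
    (hu : IsMeasurableControl u) (c : N.Class) :
    Measurable fun y : ℝ × Ω => p.queue x u c y.1 y.2 :=
  measurable_queue_of (measurable_arrivals hp hm) (hu.departures hp hm) c

end Primitives

namespace Rule

open Primitives

variable [MeasurableSpace Ω] {p : N.Primitives Ω} {x : N.State} {u : N.Control Ω} {ρ : N.Rule}

theorem isMeasurableControl_next (hp : p.Nonneg) (hm : p.IsMeasurable)
    (hu : IsMeasurableControl u) : IsMeasurableControl (ρ.next p x u) := by
  intro σ c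
  set ph : ℝ × Ω → ℕ × (N.Class → ℕ) := fun y =>
    ρ.phase (fun k c => p.queue x u c k y.2) ⌊y.1⌋₊ with hph
  set qu : ℝ × Ω → N.Class → ℕ := fun y c => p.queue x u c y.1 y.2 with hqu
  have hphm : Measurable ph := by
    have h1 : Measurable fun z : ℕ × Ω => ρ.phase (fun k c => p.queue x u c k z.2) z.1 :=
      measurable_from_prod_countable_right fun k => ρ.measurable_phase fun l _ c =>
        (hu.queue hp hm c).comp (measurable_const.prodMk measurable_id)
    exact h1.comp ((Nat.measurable_floor.comp measurable_fst).prodMk measurable_snd)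
  have hqum : Measurable qu := measurable_pi_lambda _ fun c => hu.queue hp hm c
  -- Phases and queue vectors take countably many values, and for each of them `measurable_serve`
  -- applies.
  have hset : {y : ℝ × Ω | ρ.next p x u y.1 y.2 σ = some c}
      = ({y | y.1 < 0} ∪ {y | p.Accumulates x y.1 y.2})ᶜ ∩
        ⋃ m : ℕ × (N.Class → ℕ), ⋃ q : N.Class → ℕ, ph ⁻¹' {m} ∩ (qu ⁻¹' {q} ∩
          Prod.fst ⁻¹' {t | ρ.serve m.1 m.2 q t σ = some c}) := by
    ext y
    simp only [next, mem_ofPred_eq, mem_inter_iff, mem_compl_iff, mem_union, mem_iUnion,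
      mem_preimage, mem_singleton_iff]
    split_ifs with h
    · simp [h]
    · simp only [h, not_false_eq_true, true_and]
      constructor
      · intro hs
        exact ⟨ph y, qu y, rfl, rfl, hs⟩
      · rintro ⟨m, q, rfl, rfl, hs⟩
        exact hs
  rw [hset]
  refine ((measurableSet_lt measurable_fst measurable_const).union
    (measurableSet_accumulates hp hm)).compl.inter ?_
  refine MeasurableSet.iUnion fun m => MeasurableSet.iUnion fun q => ?_
  exact (hphm (measurableSet_singleton m)).inter ((hqum (measurableSet_singleton q)).inter
    (measurable_fst (ρ.measurable_serve m.1 m.2 q σ c)))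

theorem isMeasurableControl_approx (hp : p.Nonneg) (hm : p.IsMeasurable) (k : ℕ) :
    IsMeasurableControl (ρ.approx p x k) := by
  induction k with
  | zero => intro σ c; simp [approx]
  | succ k ih => rw [approx_succ]; exact isMeasurableControl_next hp hm ih

theorem isMeasurableControl_control (hp : p.Nonneg) (hm : p.IsMeasurable) :
    IsMeasurableControl (ρ.control p x) := by
  intro σ c
  have : {y : ℝ × Ω | ρ.control p x y.1 y.2 σ = some c}
      = ⋃ K : ℕ, ⋂ k : ℕ, ⋂ _ : K ≤ k, {y | ρ.approx p x k y.1 y.2 σ = some c} := by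
    ext y
    simp [control_eq_some, eventually_atTop]
  rw [this]
  exact MeasurableSet.iUnion fun K => MeasurableSet.iInter fun k => MeasurableSet.iInter fun _ =>
    isMeasurableControl_approx hp hm k σ c

/-- A control that satisfies a rule is a non-idling policy. -/
theorem isNonIdlingPolicy {P : Measure Ω} (hu : IsMeasurableControl u)
    (hfix : ∀ t ω, u t ω = ρ.next p x u t ω)
    (hacc : ∀ᵐ ω ∂P, ∀ t, ¬ p.Accumulates x t ω) : p.IsNonIdlingPolicy P x u := by
  have hserve : ∀ t, 0 ≤ t → ∀ ω, ¬ p.Accumulates x t ω → ∃ m : ℕ × (N.Class → ℕ),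
      u t ω = ρ.serve m.1 m.2 (fun c => p.queue x u c t ω) t := by
    intro t ht ω hω
    refine ⟨ρ.phase (fun k c => p.queue x u c k ω) ⌊t⌋₊, ?_⟩
    rw [hfix t ω, next, if_neg (by rintro (h | h); exacts [absurd h (not_lt.2 ht), hω h])]
  refine ⟨hu, ?_, ?_, ?_⟩
  · intro t ht σ c
    have hA : ∀ i, ∀ s ∈ Icc 0 t, Measurable[p.history x u t] (p.arrivals x i s) := by
      intro i s hs
      refine Measurable.mono (comap_measurable _) ?_ le_rfl
      exact (le_iSup (fun i => MeasurableSpace.comap (p.arrivals x i s) ⊤) i).trans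
        (le_sup_left.trans (le_iSup₂ (f := fun s (_ : s ∈ Icc (0 : ℝ) t) =>
          (⨆ i, MeasurableSpace.comap (p.arrivals x i s) ⊤) ⊔
          ⨆ c, MeasurableSpace.comap (p.departures x u c s) ⊤) s hs))
    have hD : ∀ c, ∀ s ∈ Icc 0 t, Measurable[p.history x u t] (p.departures x u c s) := by
      intro c s hs
      refine Measurable.mono (comap_measurable _) ?_ le_rfl
      exact (le_iSup (fun c => MeasurableSpace.comap (p.departures x u c s) ⊤) c).trans
        (le_sup_right.trans (le_iSup₂ (f := fun s (_ : s ∈ Icc (0 : ℝ) t) =>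
          (⨆ i, MeasurableSpace.comap (p.arrivals x i s) ⊤) ⊔
          ⨆ c, MeasurableSpace.comap (p.departures x u c s) ⊤) s hs))
    have hQ : ∀ s ∈ Icc 0 t, ∀ c, Measurable[p.history x u t] (p.queue x u c s) := by
      intro s hs c
      let _ := p.history x u t
      exact measurable_queue_of (t := fun _ => s) (f := fun ω => ω) (fun i => hA i s hs)
        (fun c => hD c s hs) c
    let _ := p.history x u t
    set ph : Ω → ℕ × (N.Class → ℕ) := fun ω =>
      ρ.phase (fun k c => p.queue x u c k ω) ⌊t⌋₊ with hph
    set qu : Ω → N.Class → ℕ := fun ω c => p.queue x u c t ω with hqu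
    have hphm : Measurable ph := ρ.measurable_phase fun l hl c =>
      hQ l ⟨Nat.cast_nonneg l, (Nat.le_floor_iff ht).1 hl⟩ c
    have hqum : Measurable qu := measurable_pi_lambda _ fun c => hQ t ⟨ht, le_rfl⟩ c
    -- Accumulation is witnessed by counts at rational times up to `t`, so stopping because of it is
    -- non-anticipating.
    have haccm : MeasurableSet {ω | p.Accumulates x t ω} := by
      have : {ω | p.Accumulates x t ω} = ⋃ i, ⋃ r : ℚ, ⋃ _ : 0 ≤ (r : ℝ) ∧ (r : ℝ) ≤ t,
          {ω | p.arrivals x i t ω < p.arrivals x i r ω} := by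
        ext
        simp only [Accumulates, mem_iUnion, mem_ofPred_eq, exists_prop, and_assoc]
      rw [this]
      exact MeasurableSet.iUnion fun i => MeasurableSet.iUnion fun r => MeasurableSet.iUnion
        fun hr => measurableSet_lt (hA i t ⟨ht, le_rfl⟩) (hA i r hr)
    have hset : {ω | u t ω σ = some c} = {ω | p.Accumulates x t ω}ᶜ ∩
        ⋃ m : ℕ × (N.Class → ℕ), ⋃ q : N.Class → ℕ, ⋃ _ : ρ.serve m.1 m.2 q t σ = some c,
          ph ⁻¹' {m} ∩ qu ⁻¹' {q} := by
      ext ω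
      simp only [mem_ofPred_eq, hfix t ω, next, mem_inter_iff, mem_compl_iff,
        mem_iUnion, mem_preimage, mem_singleton_iff]
      by_cases h : p.Accumulates x t ω
      · simp [h]
      · rw [if_neg (by rintro (h' | h'); exacts [absurd h' (not_lt.2 ht), h h'])]
        simp only [h, not_false_eq_true, true_and, exists_prop]
        constructor
        · intro hs
          exact ⟨ph ω, qu ω, hs, rfl, rfl⟩
        · rintro ⟨m, q, hs, rfl, rfl⟩
          exact hs
    rw [hset]
    refine haccm.compl.inter ?_
    refine MeasurableSet.iUnion fun m => MeasurableSet.iUnion fun q => MeasurableSet.iUnion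
      fun _ => ?_
    exact (hphm (measurableSet_singleton m)).inter (hqum (measurableSet_singleton q))
  · filter_upwards [hacc] with ω hω t ht σ c hc
    obtain ⟨m, hm⟩ := hserve t ht ω (hω t)
    rw [hm] at hc
    exact ρ.serve_spec _ _ _ _ _ _ hc
  · filter_upwards [hacc] with ω hω t ht σ hc
    obtain ⟨m, hm⟩ := hserve t ht ω (hω t)
    rw [hm]
    exact ρ.serve_ne_none _ _ _ _ _ hc

end Rule

/-! ### The path space -/

/-- The space of all sequences of interarrival and service times. -/
abbrev Path (N : MultitypeNetwork) : Type := (Fin N.numTypes ⊕ N.Class) × ℕ → ℝ≥0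

/-- The coordinates of the path space, as stochastic primitives. -/
def pathPrimitives (N : MultitypeNetwork) : N.Primitives N.Path where
  X i k ζ := ζ (Sum.inl i, k)
  S c k ζ := ζ (Sum.inr c, k)

theorem pathPrimitives_nonneg : N.pathPrimitives.Nonneg :=
  ⟨fun _ _ _ => NNReal.coe_nonneg _, fun _ _ _ => NNReal.coe_nonneg _⟩

theorem pathPrimitives_isMeasurable : N.pathPrimitives.IsMeasurable :=
  ⟨fun i k => (measurable_pi_apply (Sum.inl i, k)).coe_nnreal_real,
    fun c k => (measurable_pi_apply (Sum.inr c, k)).coe_nnreal_real⟩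

namespace Primitives

/-- The path of a sample point. -/
def path (p : N.Primitives Ω) (ω : Ω) : N.Path := fun a =>
  (Sum.elim p.X p.S a.1 a.2 ω).toNNReal

variable {p : N.Primitives Ω} {x : N.State}

theorem measurable_path [MeasurableSpace Ω] (hm : p.IsMeasurable) : Measurable p.path := by
  refine measurable_pi_lambda _ fun a => ?_
  rcases a with ⟨i | c, k⟩
  · exact (hm.X i k).real_toNNReal
  · exact (hm.S c k).real_toNNReal

theorem interarrival_path (hp : p.Nonneg) (i : Fin N.numTypes) (k : ℕ) (ω : Ω) :
    N.pathPrimitives.interarrival x i k (p.path ω) = p.interarrival x i k ω := by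
  unfold interarrival
  split_ifs
  · rfl
  · exact Real.coe_toNNReal _ (hp.X i k ω)

theorem service_path (hp : p.Nonneg) (c : N.Class) (k : ℕ) (ω : Ω) :
    N.pathPrimitives.service x c k (p.path ω) = p.service x c k ω := by
  unfold service
  split_ifs
  · rfl
  · exact Real.coe_toNNReal _ (hp.S c k ω)

theorem arrivals_path (hp : p.Nonneg) (i : Fin N.numTypes) (t : ℝ) (ω : Ω) :
    N.pathPrimitives.arrivals x i t (p.path ω) = p.arrivals x i t ω := by
  unfold arrivals
  simp only [interarrival_path hp]

theorem departures_path (hp : p.Nonneg) (U : N.Control N.Path) (c : N.Class) (t : ℝ) (ω : Ω) :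
    N.pathPrimitives.departures x U c t (p.path ω)
      = p.departures x (fun t ω => U t (p.path ω)) c t ω := by
  classical
  have key : ∀ c, N.pathPrimitives.inflow x U c t (p.path ω)
      = p.inflow x (fun t ω => U t (p.path ω)) c t ω →
      N.pathPrimitives.departures x U c t (p.path ω)
        = p.departures x (fun t ω => U t (p.path ω)) c t ω := by
    intro c hc
    rw [departures_eq_findGreatest, departures_eq_findGreatest, hc]
    simp only [serviceSum, service_path hp]
    rfl
  exact upstream_induction (p := fun c => N.pathPrimitives.departures x U c t (p.path ω)
    = p.departures x (fun t ω => U t (p.path ω)) c t ω)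
    (fun i => key _ (arrivals_path hp i t ω)) (fun i j hj ih => key _ ih) c

theorem queue_path (hp : p.Nonneg) (U : N.Control N.Path) (c : N.Class) (t : ℝ) (ω : Ω) :
    N.pathPrimitives.queue x U c t (p.path ω)
      = p.queue x (fun t ω => U t (p.path ω)) c t ω :=
  queue_congr_departures (fun i => arrivals_path hp i t ω)
    (fun c => departures_path hp U c t ω) c

theorem totalQueue_path (hp : p.Nonneg) (U : N.Control N.Path) (t : ℝ) (ω : Ω) :
    N.pathPrimitives.totalQueue x U t (p.path ω)
      = p.totalQueue x (fun t ω => U t (p.path ω)) t ω :=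
  Finset.sum_congr rfl fun c _ => queue_path hp U c t ω

theorem accumulates_path (hp : p.Nonneg) (t : ℝ) (ω : Ω) :
    N.pathPrimitives.Accumulates x t (p.path ω) ↔ p.Accumulates x t ω := by
  unfold Accumulates
  simp only [arrivals_path hp]

end Primitives

/-- The control on the path space prescribed by a rule. -/
def Rule.pathControl (ρ : N.Rule) (x : N.State) : N.Control N.Path := ρ.control N.pathPrimitives x

/-- The control prescribed by a rule is a non-idling policy. -/
theorem Rule.isNonIdlingPolicy_pathControl [MeasurableSpace Ω] {P : Measure Ω}
    {p : N.Primitives Ω} {x : N.State} {ρ : N.Rule} (hp : p.Nonneg) (hm : p.IsMeasurable)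
    (hacc : ∀ᵐ ω ∂P, ∀ t, ¬ p.Accumulates x t ω) :
    p.IsNonIdlingPolicy P x fun t ω => ρ.pathControl x t (p.path ω) := by
  refine isNonIdlingPolicy (ρ := ρ) (fun σ c => ?_) (fun t ω => ?_) hacc
  · exact (measurable_fst.prodMk ((Primitives.measurable_path hm).comp measurable_snd))
      (isMeasurableControl_control (ρ := ρ) (x := x) pathPrimitives_nonneg
        pathPrimitives_isMeasurable σ c)
  · change ρ.control N.pathPrimitives x t (p.path ω) = _
    rw [control_eq_next pathPrimitives_nonneg]
    exact ρ.next_congr (Primitives.accumulates_path hp t ω)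
      fun s _ c => Primitives.queue_path hp (ρ.pathControl x) c s ω

end MultitypeNetwork

namespace MultitypeNetwork

variable {N : MultitypeNetwork}

/-! ### Tracking a linear piece of a plan -/

/-- A process with arrivals `A`, departures `D`, busy times `T` and queues `Q` which, on the time
interval `[a, b]`, obeys the law of large numbers up to the error `ε` and reserves a fraction
`rate c` of the time for the class `c`. -/
structure TracksRates (lam : Fin N.numTypes → ℝ) (mu : N.Class → ℝ) (rate : N.Class → ℝ)
    (a b ε : ℝ) (A : ℝ → Fin N.numTypes → ℝ) (D T Q : ℝ → N.Class → ℝ) : Prop where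
  balance : ∀ t ∈ Icc a b, ∀ c, Q t c = Q a c
    + N.upstream (fun i => A t i - A a i) (fun c => D t c - D a c) c - (D t c - D a c)
  queue_nonneg : ∀ t ∈ Icc a b, ∀ c, 0 ≤ Q t c
  arrivals : ∀ t ∈ Icc a b, ∀ i, |A t i - A a i - lam i * (t - a)| ≤ ε
  departures : ∀ t ∈ Icc a b, ∀ c, |D t c - D a c - mu c * (T t c - T a c)| ≤ ε
  feasible : ∀ t ∈ Icc a b, ∀ σ, N.stationSum σ (T t) - N.stationSum σ (T a) ≤ t - a
  time_mono : ∀ c, ∀ s ∈ Icc a b, ∀ t ∈ Icc a b, s ≤ t → T s c ≤ T t c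
  reserved : ∀ c, ∀ s ∈ Icc a b, ∀ t ∈ Icc a b, s ≤ t → (∀ y ∈ Ioc s t, 0 < Q y c) →
    rate c * (t - s) - 2 ≤ T t c - T s c

namespace TracksRates

variable {lam : Fin N.numTypes → ℝ} {mu : N.Class → ℝ} {rate : N.Class → ℝ} {a b ε : ℝ}
  {A : ℝ → Fin N.numTypes → ℝ} {D T Q : ℝ → N.Class → ℝ}

/-- Stages count from `0`, so at the first stage the inherited error disappears and only the error
`ε` of the arrivals remains. This lets both kinds of class share one induction along the route. -/
theorem le_upstream (h : TracksRates lam mu rate a b ε A D T Q) (hε : 0 ≤ ε) {t E : ℝ}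
    (ht : t ∈ Icc a b) (c : N.Class)
    (hD : ∀ c' : N.Class, c'.2.val + 1 = c.2.val →
      mu c' * rate c' * (t - a) - c.2.val * E ≤ D t c' - D a c') :
    (t - a) * N.upstream lam (fun c => mu c * rate c) c - (c.2.val * E + ε)
      ≤ N.upstream (fun i => A t i - A a i) (fun c => D t c - D a c) c := by
  rcases c with ⟨i, ⟨_ | l, hl⟩⟩
  · have := (abs_le.1 (h.arrivals t ht i)).1
    simp only [upstream, Nat.cast_zero, zero_mul]
    linarith
  · have h1 := hD ⟨i, ⟨l, Nat.lt_of_succ_lt hl⟩⟩ rfl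
    simp only [upstream] at h1 ⊢
    linarith

theorem upstream_le (h : TracksRates lam mu rate a b ε A D T Q) (hε : 0 ≤ ε) {t E : ℝ}
    (ht : t ∈ Icc a b) (c : N.Class)
    (hD : ∀ c' : N.Class, c'.2.val + 1 = c.2.val →
      D t c' - D a c' ≤ mu c' * rate c' * (t - a) + c.2.val * E) :
    N.upstream (fun i => A t i - A a i) (fun c => D t c - D a c) c
      ≤ (t - a) * N.upstream lam (fun c => mu c * rate c) c + (c.2.val * E + ε) := by
  rcases c with ⟨i, ⟨_ | l, hl⟩⟩
  · have := (abs_le.1 (h.arrivals t ht i)).2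
    simp only [upstream, Nat.cast_zero, zero_mul]
    linarith
  · have h1 := hD ⟨i, ⟨l, Nat.lt_of_succ_lt hl⟩⟩ rfl
    simp only [upstream] at h1 ⊢
    linarith

/-- Departures from a class do not fall behind the plan if the inflow does not. -/
theorem le_departures_of_le_upstream (h : TracksRates lam mu rate a b ε A D T Q) {e m E : ℝ}
    (he : 0 ≤ e) (hε : 0 ≤ ε) (hE : 0 ≤ E) {c : N.Class} (hmuc : 0 < mu c) (hmc : mu c ≤ m)
    (hrate1 : rate c ≤ 1) {q : ℝ} (hq : |Q a c - q| ≤ e)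
    (htgt : ∀ t ∈ Icc a b, 0 ≤ q + (t - a)
      * (N.upstream lam (fun c => mu c * rate c) c - mu c * rate c))
    (hup : ∀ s ∈ Icc a b, (s - a) * N.upstream lam (fun c => mu c * rate c) c - (E + ε)
        ≤ N.upstream (fun i => A s i - A a i) (fun c => D s c - D a c) c)
    {t : ℝ} (ht : t ∈ Icc a b) :
    mu c * rate c * (t - a) - (E + (e + 3 * ε + 3 * m)) ≤ D t c - D a c := by
  have hab : a ≤ b := ht.1.trans ht.2
  have haI : a ∈ Icc a b := ⟨le_rfl, hab⟩
  have hDt := (abs_le.1 (h.departures t ht c)).1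
  set S := {s | s ∈ Icc a t ∧ Q s c = 0} with hS
  rcases S.eq_empty_or_nonempty with hSe | hSne
  · have hpos : ∀ y ∈ Ioc a t, 0 < Q y c := fun y hy => by
      refine (h.queue_nonneg y ⟨hy.1.le, hy.2.trans ht.2⟩ c).lt_of_ne' fun h0 => ?_
      have : y ∈ S := ⟨⟨hy.1.le, hy.2⟩, h0⟩
      rw [hSe] at this
      exact this
    have h2 := mul_le_mul_of_nonneg_left (h.reserved c a haI t ht ht.1 hpos) hmuc.le
    rw [mul_sub, ← mul_assoc] at h2
    linarith
  · have hSb : BddAbove S := ⟨t, fun s hs => hs.1.2⟩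
    set z := sSup S with hz
    -- After the last empty time `z` the reserved share is available. The supremum need not be
    -- attained, so an empty time `s` within distance one of `z` is used, which raises the loss from
    -- `2` to `3`.
    obtain ⟨s, hsS, hsz⟩ := exists_lt_of_lt_csSup hSne (show z - 1 < sSup S by linarith)
    have hsz' : s ≤ z := le_csSup hSb hsS
    have hzt : z ≤ t := csSup_le hSne fun s hs => hs.1.2
    have hsI : s ∈ Icc a b := ⟨hsS.1.1, hsS.1.2.trans ht.2⟩
    have hzI : z ∈ Icc a b := ⟨hsS.1.1.trans hsz', hzt.trans ht.2⟩
    have hpos : ∀ y ∈ Ioc z t, 0 < Q y c := fun y hy => by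
      refine (h.queue_nonneg y ⟨hzI.1.trans hy.1.le, hy.2.trans ht.2⟩ c).lt_of_ne' fun h0 => ?_
      exact absurd (le_csSup hSb ⟨⟨hzI.1.trans hy.1.le, hy.2⟩, h0⟩) (not_le.2 hy.1)
    have h1 := h.reserved c z hzI t ht hzt hpos
    have h2 := h.time_mono c s hsI z hzI hsz'
    have h3 := h.balance s hsI c
    rw [hsS.2] at h3
    have h4 := hup s hsI
    have h5 := htgt s hsI
    have h6 := (abs_le.1 hq).1
    have h7 := (abs_le.1 (h.departures s hsI c)).2
    -- At `s` the queue is empty while the planned level is non-negative, so the departures until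
    -- then are not behind the plan by more than the other errors.
    have h8 : mu c * rate c * (s - a) - (e + E + 2 * ε) ≤ mu c * (T s c - T a c) := by
      linarith
    have h9 : rate c * (t - s) - 3 ≤ T t c - T s c := by
      have : rate c * (z - s) ≤ 1 * 1 :=
        mul_le_mul hrate1 (by linarith) (by linarith) zero_le_one
      linarith
    have h10 := mul_le_mul_of_nonneg_left h9 hmuc.le
    linarith

/-- Departures do not fall behind the plan. -/
theorem le_departures (h : TracksRates lam mu rate a b ε A D T Q) {e m : ℝ} (he : 0 ≤ e)
    (hε : 0 ≤ ε) (hm0 : 0 ≤ m) (hmu : ∀ c, 0 < mu c) (hm : ∀ c, mu c ≤ m)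
    (hrate1 : ∀ c, rate c ≤ 1) {q : N.Class → ℝ} (hq : ∀ c, |Q a c - q c| ≤ e)
    (htgt : ∀ t ∈ Icc a b, ∀ c, 0 ≤ q c + (t - a)
      * (N.upstream lam (fun c => mu c * rate c) c - mu c * rate c)) :
    ∀ j : ℕ, ∀ c : N.Class, c.2.val + 1 = j → ∀ t ∈ Icc a b,
      mu c * rate c * (t - a) - (j : ℝ) * (e + 3 * ε + 3 * m) ≤ D t c - D a c := by
  intro j
  induction j with
  | zero => intro c hc; omega
  | succ j ih =>
    intro c hc t ht
    have hw0 : 0 ≤ e + 3 * ε + 3 * m := by positivity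
    obtain rfl : c.2.val = j := by omega
    have := h.le_departures_of_le_upstream he hε (mul_nonneg (Nat.cast_nonneg c.2.val) hw0)
      (hmu c) (hm c) (hrate1 c) (hq c) (fun t ht => htgt t ht c)
      (fun s hs => h.le_upstream hε hs c fun c' hc' => ih c' hc' s hs) ht
    push_cast
    linarith

/-- Departures do not run ahead of the plan. -/
theorem departures_le (h : TracksRates lam mu rate a b ε A D T Q) {e E m m' : ℝ} (he : 0 ≤ e)
    (hε : 0 ≤ ε) (hE : 0 ≤ E) (hm0 : 0 ≤ m) (hm0' : 0 ≤ m') (hmu : ∀ c, 0 < mu c)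
    (hm : ∀ c, mu c ≤ m) (hm' : ∀ c, (mu c)⁻¹ ≤ m') {q : N.Class → ℝ}
    (hq : ∀ c, |Q a c - q c| ≤ e)
    (hlow : ∀ c, ∀ t ∈ Icc a b, mu c * rate c * (t - a) - E ≤ D t c - D a c)
    (hfull : ∀ σ, N.stationSum σ rate = 1 ∨ ∀ c, N.station c = σ → q c = 0 ∧
      q c + (b - a) * (N.upstream lam (fun c => mu c * rate c) c - mu c * rate c) = 0) :
    ∀ j : ℕ, ∀ c : N.Class, c.2.val + 1 = j → ∀ t ∈ Icc a b,
      D t c - D a c ≤ mu c * rate c * (t - a)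
        + j * (m * (Fintype.card N.Class * (m' * (E + ε))) + ε + (e + ε)) := by
  set F := m * (Fintype.card N.Class * (m' * (E + ε))) + ε with hF
  have hF0 : 0 ≤ F := by positivity
  intro j
  induction j with
  | zero => intro c hc; omega
  | succ j ih =>
    intro c hc t ht
    obtain rfl : c.2.val = j := by omega
    have hjG : 0 ≤ (c.2.val : ℝ) * (F + (e + ε)) := by positivity
    have haI : a ∈ Icc a b := ⟨le_rfl, ht.1.trans ht.2⟩
    push_cast
    rw [add_mul, one_mul]
    rcases hfull (N.station c) with hsum | hzero
    · -- the station works at full rate, and no class falls behind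
      have hT : ∀ c', rate c' * (t - a) - m' * (E + ε) ≤ T t c' - T a c' := by
        intro c'
        have h1 := hlow c' t ht
        have h2 := (abs_le.1 (h.departures t ht c')).2
        have h3 : mu c' * (rate c' * (t - a)) - (E + ε) ≤ mu c' * (T t c' - T a c') := by linarith
        have h4 := mul_le_mul_of_nonneg_left h3 (inv_pos.2 (hmu c')).le
        rw [mul_sub, inv_mul_cancel_left₀ (hmu c').ne', inv_mul_cancel_left₀ (hmu c').ne'] at h4
        have h5 : (mu c')⁻¹ * (E + ε) ≤ m' * (E + ε) := by gcongr; exact hm' c'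
        linarith
      have hsumT : T t c - T a c ≤ rate c * (t - a) + Fintype.card N.Class * (m' * (E + ε)) := by
        have h1 := le_stationSum (q := fun c' => T t c' - T a c' - rate c' * (t - a)
          + m' * (E + ε)) (fun c' => by linarith [hT c']) c
        have h2 : N.stationSum (N.station c) (fun c' => T t c' - T a c' - rate c' * (t - a)
            + m' * (E + ε)) = (N.stationSum (N.station c) (T t) - N.stationSum (N.station c) (T a))
            - (t - a) + N.stationSum (N.station c) (fun _ => m' * (E + ε)) := by
          rw [stationSum_add, stationSum_sub, stationSum_sub]
          have : N.stationSum (N.station c) (fun c' => rate c' * (t - a)) = t - a := by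
            simp only [mul_comm _ (t - a)]
            rw [stationSum_mul, hsum, mul_one]
          rw [this]
        have h3 : N.stationSum (N.station c) (fun _ => m' * (E + ε))
            ≤ Fintype.card N.Class * (m' * (E + ε)) := by
          rw [stationSum, Finset.sum_const, nsmul_eq_mul]
          gcongr
          exact Finset.card_le_univ _
        have h4 := h.feasible t ht (N.station c)
        have h5 : 0 ≤ m' * (E + ε) := by positivity
        linarith
      have h1 := mul_le_mul_of_nonneg_left hsumT (hmu c).le
      have h2 := (abs_le.1 (h.departures t ht c)).2
      have h3 : mu c * (Fintype.card N.Class * (m' * (E + ε)))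
          ≤ m * (Fintype.card N.Class * (m' * (E + ε))) := by
        gcongr
        exact hm c
      linarith
    · -- the station is empty in the plan
      obtain ⟨hq0, hqb⟩ := hzero c rfl
      have hflat : (t - a) * N.upstream lam (fun c => mu c * rate c) c
          = mu c * rate c * (t - a) := by
        rw [hq0, zero_add, mul_eq_zero] at hqb
        rcases hqb with h0 | h0
        · have : t = a := le_antisymm (by linarith [ht.2]) ht.1
          subst this
          ring
        · rw [sub_eq_zero.1 h0]; ring
      have h1 := h.upstream_le hε ht c
        fun c' hc' => ih c' hc' t ht
      have h2 := h.balance t ht c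
      have h3 := h.queue_nonneg t ht c
      have h4 := (abs_le.1 (hq c)).2
      rw [hq0] at h4
      linarith

/-- The constant by which the tracking error grows on one piece of a plan. -/
def errorConst (N : MultitypeNetwork) (m m' : ℝ) : ℝ :=
  let d := (Fintype.card N.Class : ℝ)
  1 + 2 * (d * (3 + 3 * m) + d * (m * (d * (m' * (d * (3 + 3 * m) + 1))) + 2))

theorem errorConst_nonneg {m m' : ℝ} (hm : 0 ≤ m) (hm' : 0 ≤ m') : 0 ≤ errorConst N m m' := by
  unfold errorConst
  positivity

theorem stage_lt_card (c : N.Class) : c.2.val + 1 ≤ Fintype.card N.Class := by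
  have : Fintype.card (Fin (N.stages c.1)) ≤ Fintype.card N.Class :=
    Fintype.card_le_of_injective (fun j => (⟨c.1, j⟩ : N.Class))
      fun j j' h => by simpa using h
  rw [Fintype.card_fin] at this
  exact (Nat.succ_le_of_lt c.2.2).trans this

/-- On one piece of a plan, the tracking error grows by at most a constant factor. -/
theorem abs_queue_sub_le (h : TracksRates lam mu rate a b ε A D T Q) {e m m' : ℝ} (he : 0 ≤ e)
    (hε : 0 ≤ ε) (hm0 : 0 ≤ m) (hm0' : 0 ≤ m') (hmu : ∀ c, 0 < mu c)
    (hm : ∀ c, mu c ≤ m) (hm' : ∀ c, (mu c)⁻¹ ≤ m') (hrate1 : ∀ c, rate c ≤ 1)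
    {q : N.Class → ℝ} (hq : ∀ c, |Q a c - q c| ≤ e)
    (htgt : ∀ t ∈ Icc a b, ∀ c, 0 ≤ q c + (t - a)
      * (N.upstream lam (fun c => mu c * rate c) c - mu c * rate c))
    (hfull : ∀ σ, N.stationSum σ rate = 1 ∨ ∀ c, N.station c = σ → q c = 0 ∧
      q c + (b - a) * (N.upstream lam (fun c => mu c * rate c) c - mu c * rate c) = 0)
    {t : ℝ} (ht : t ∈ Icc a b) (c : N.Class) :
    |Q t c - (q c + (t - a) * (N.upstream lam (fun c => mu c * rate c) c - mu c * rate c))|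
      ≤ errorConst N m m' * (e + ε + 1) := by
  set d := (Fintype.card N.Class : ℝ) with hd
  set v := e + ε + 1 with hv
  have hv0 : 0 ≤ v := by positivity
  set w := e + 3 * ε + 3 * m with hw
  have hw0 : 0 ≤ w := by positivity
  have hwv : w ≤ (3 + 3 * m) * v := by
    have : 0 ≤ m * (e + ε) := by positivity
    rw [hw, hv]
    linarith
  have hstage : ∀ c : N.Class, ((c.2.val + 1 : ℕ) : ℝ) ≤ d := fun c => by
    rw [hd]; exact Nat.cast_le.2 (stage_lt_card c)
  have hstage' : ∀ c : N.Class, (c.2.val : ℝ) ≤ d := fun c => by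
    have := hstage c
    push_cast at this
    linarith
  have hd0 : 0 ≤ d := Nat.cast_nonneg _
  have hlow : ∀ c, ∀ t ∈ Icc a b, mu c * rate c * (t - a) - d * w ≤ D t c - D a c := by
    intro c t ht
    have h1 := h.le_departures he hε hm0 hmu hm hrate1 hq htgt _ c rfl t ht
    have h2 := mul_le_mul_of_nonneg_right (hstage c) hw0
    linarith
  set G := m * (d * (m' * (d * w + ε))) + ε + (e + ε) with hG
  have hG0 : 0 ≤ G := by positivity
  have hupp : ∀ c, ∀ t ∈ Icc a b, D t c - D a c ≤ mu c * rate c * (t - a) + d * G := by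
    intro c t ht
    have h1 := h.departures_le he hε (by positivity) hm0 hm0' hmu hm hm' hq hlow hfull _ c rfl t ht
    have h2 := mul_le_mul_of_nonneg_right (hstage c) hG0
    linarith
  have hGv : G ≤ (m * (d * (m' * (d * (3 + 3 * m) + 1))) + 2) * v := by
    have h1 : d * w + ε ≤ (d * (3 + 3 * m) + 1) * v := by
      have := mul_le_mul_of_nonneg_left hwv hd0
      rw [hv] at this ⊢
      linarith
    have h2 : m * (d * (m' * (d * w + ε))) ≤ m * (d * (m' * ((d * (3 + 3 * m) + 1) * v))) := by
      gcongr
    rw [hG]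
    linarith
  have h1 := h.balance t ht c
  have hlow' : (t - a) * N.upstream lam (fun c => mu c * rate c) c - (d * w + ε)
      ≤ N.upstream (fun i => A t i - A a i) (fun c => D t c - D a c) c := by
    have h2 := h.le_upstream hε ht c fun c' hc' => by
      have := h.le_departures he hε hm0 hmu hm hrate1 hq htgt _ c' rfl t ht
      rwa [hc'] at this
    have h3 := mul_le_mul_of_nonneg_right (hstage' c) hw0
    linarith
  have hupp' : N.upstream (fun i => A t i - A a i) (fun c => D t c - D a c) c
      ≤ (t - a) * N.upstream lam (fun c => mu c * rate c) c + (d * G + ε) := by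
    have h2 := h.upstream_le hε ht c fun c' hc' => by
      have := h.departures_le he hε (by positivity) hm0 hm0' hmu hm hm' hq hlow hfull _ c' rfl t ht
      rwa [hc'] at this
    have h3 := mul_le_mul_of_nonneg_right (hstage' c) hG0
    linarith
  have h4 := hlow c t ht
  have h5 := hupp c t ht
  have h6 := abs_le.1 (hq c)
  have hbound : e + ε + (d * w + d * G) ≤ errorConst N m m' * v := by
    have h7 := mul_le_mul_of_nonneg_left hwv hd0
    have h8 := mul_le_mul_of_nonneg_left hGv hd0
    have h9 : e + ε ≤ v := by rw [hv]; linarith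
    have h10 : 0 ≤ d * w + d * G := by positivity
    simp only [errorConst, ← hd]
    linarith
  have hdw : 0 ≤ d * w := by positivity
  have hdG : 0 ≤ d * G := by positivity
  refine (abs_le.2 ⟨?_, ?_⟩ : _ ≤ e + ε + (d * w + d * G)).trans hbound <;> linarith

end TracksRates

end MultitypeNetwork

namespace MultitypeNetwork

variable {N : MultitypeNetwork}

/-! ### The tracking rule -/

/-- The left end of the part of the unit interval that is allotted to the class `c`. -/
def slotStart (rate : N.Class → ℝ) (c : N.Class) : ℝ :=
  ∑ c' with N.station c' = N.station c ∧ rank c' < rank c, rate c'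

theorem slotStart_nonneg {rate : N.Class → ℝ} (h : ∀ c, 0 ≤ rate c) (c : N.Class) :
    0 ≤ slotStart rate c :=
  Finset.sum_nonneg fun c _ => h c

theorem slotStart_add (rate : N.Class → ℝ) (c : N.Class) : slotStart rate c + rate c
    = ∑ c' with N.station c' = N.station c ∧ rank c' ≤ rank c, rate c' := by
  classical
  have : (Finset.univ.filter fun c' : N.Class => N.station c' = N.station c ∧ rank c' ≤ rank c)
      = insert c (Finset.univ.filter fun c' : N.Class =>
        N.station c' = N.station c ∧ rank c' < rank c) := by
    ext c'
    simp only [Finset.mem_filter, Finset.mem_univ, true_and, Finset.mem_insert]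
    constructor
    · rintro ⟨h1, h2⟩
      rcases h2.eq_or_lt with h | h
      · exact Or.inl (rank_injective h)
      · exact Or.inr ⟨h1, h⟩
    · rintro (rfl | ⟨h1, h2⟩)
      · exact ⟨rfl, le_rfl⟩
      · exact ⟨h1, h2.le⟩
  rw [this, Finset.sum_insert (by simp), add_comm]
  rfl

theorem slotStart_add_le_one {rate : N.Class → ℝ} (h : ∀ c, 0 ≤ rate c) {c : N.Class}
    (h1 : N.stationSum (N.station c) rate ≤ 1) : slotStart rate c + rate c ≤ 1 := by
  rw [slotStart_add]
  refine le_trans (Finset.sum_le_sum_of_subset_of_nonneg ?_ fun c _ _ => h c) h1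
  intro c'
  simp only [Finset.mem_filter, Finset.mem_univ, true_and]
  exact And.left

theorem slotStart_add_le {rate : N.Class → ℝ} (h : ∀ c, 0 ≤ rate c) {c c' : N.Class}
    (hσ : N.station c = N.station c') (hlt : rank c < rank c') :
    slotStart rate c + rate c ≤ slotStart rate c' := by
  rw [slotStart_add]
  refine Finset.sum_le_sum_of_subset_of_nonneg ?_ fun c _ _ => h c
  intro a
  simp only [Finset.mem_filter, Finset.mem_univ, true_and]
  rintro ⟨h1, h2⟩
  exact ⟨h1.trans hσ, h2.trans_lt hlt⟩

/-- At time `t`, the plan `π`, started at time `s` and enlarged by the factor `n`, reserves the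
station of the class `c` for this class. -/
def Plan.Reserved (π : N.Plan) (s n t : ℝ) (c : N.Class) : Prop :=
  ∃ r < π.len, (s + n * π.time r ≤ t ∧ t < s + n * π.time (r + 1)) ∧
    slotStart (π.rate r) c ≤ Int.fract t ∧ Int.fract t < slotStart (π.rate r) c + π.rate r c

theorem Plan.IsFluid.time_mono {lam : Fin N.numTypes → ℝ} {mu : N.Class → ℝ} {π : N.Plan}
    (hπ : π.IsFluid lam mu) {r r' : ℕ} (h : r ≤ r') (h' : r' ≤ π.len) : π.time r ≤ π.time r' := by
  induction r', h using Nat.le_induction with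
  | base => exact le_rfl
  | succ k hk ih => exact (ih (by omega)).trans (hπ.time_le k (by omega))

/-- The pieces are consecutive in time and, within a piece, the slots of the classes of one station
are disjoint. -/
theorem Plan.IsFluid.reserved_unique {lam : Fin N.numTypes → ℝ} {mu : N.Class → ℝ} {π : N.Plan}
    (hπ : π.IsFluid lam mu) {s n t : ℝ} (hn : 0 ≤ n) {c c' : N.Class}
    (hσ : N.station c = N.station c') (h : π.Reserved s n t c) (h' : π.Reserved s n t c') :
    c = c' := by
  obtain ⟨r, hr, ⟨h1, h2⟩, h3, h4⟩ := h
  obtain ⟨r', hr', ⟨h1', h2'⟩, h3', h4'⟩ := h'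
  have hrr : r = r' := by
    by_contra hne
    rcases Nat.lt_or_gt_of_ne hne with hlt | hlt
    · have := mul_le_mul_of_nonneg_left (hπ.time_mono (show r + 1 ≤ r' from hlt) hr'.le) hn
      linarith
    · have := mul_le_mul_of_nonneg_left (hπ.time_mono (show r' + 1 ≤ r from hlt) hr.le) hn
      linarith
  subst hrr
  by_contra hne
  rcases Nat.lt_or_gt_of_ne (fun h => hne (rank_injective h)) with hlt | hlt
  · have := slotStart_add_le (hπ.rate_nonneg r hr) hσ hlt
    linarith
  · have := slotStart_add_le (hπ.rate_nonneg r hr) hσ.symm hlt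
    linarith

theorem measurableSet_reserved (π : N.Plan) (s n : ℝ) (c : N.Class) :
    MeasurableSet {t | π.Reserved s n t c} := by
  have : {t | π.Reserved s n t c} = ⋃ r ∈ Finset.range π.len,
      Ico (s + n * π.time r) (s + n * π.time (r + 1)) ∩
        Int.fract ⁻¹' Ico (slotStart (π.rate r) c) (slotStart (π.rate r) c + π.rate r c) := by
    ext t
    simp only [Plan.Reserved, mem_ofPred_eq, mem_iUnion, Finset.mem_range, mem_inter_iff, mem_Ico,
      mem_preimage, exists_prop]
  rw [this]
  exact Finset.measurableSet_biUnion _ fun r _ =>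
    measurableSet_Ico.inter (measurable_fract measurableSet_Ico)

/-- The predicate is constant just before `t`. -/
def LeftConst (p : ℝ → Prop) (t : ℝ) : Prop := ∃ v : Prop, ∀ᶠ y in 𝓝[<] t, p y ↔ v

theorem LeftConst.and {p p' : ℝ → Prop} {t : ℝ} (h : LeftConst p t) (h' : LeftConst p' t) :
    LeftConst (fun y => p y ∧ p' y) t := by
  obtain ⟨v, hv⟩ := h
  obtain ⟨v', hv'⟩ := h'
  exact ⟨v ∧ v', by filter_upwards [hv, hv'] with y h1 h2; rw [h1, h2]⟩

theorem leftConst_le (α t : ℝ) : LeftConst (fun y => α ≤ y) t := by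
  refine ⟨α < t, ?_⟩
  rcases lt_or_ge α t with h | h
  · filter_upwards [Ioo_mem_nhdsLT h] with y hy
    simp [h, hy.1.le]
  · filter_upwards [self_mem_nhdsWithin] with y hy
    simp [not_lt.2 h, lt_of_lt_of_le hy h]

theorem leftConst_lt (α t : ℝ) : LeftConst (fun y => y < α) t := by
  obtain ⟨v, hv⟩ := leftConst_le α t
  exact ⟨¬ v, by filter_upwards [hv] with y hy; rw [← hy, not_le]⟩

/-- To the left of `t` the floor is `⌈t⌉ - 1`, also when `t` is an integer. -/
theorem eventually_fract_eq (t : ℝ) : ∀ᶠ y in 𝓝[<] t, Int.fract y = y - ((⌈t⌉ : ℝ) - 1) := by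
  filter_upwards [Ioo_mem_nhdsLT (show (⌈t⌉ : ℝ) - 1 < t by linarith [Int.ceil_lt_add_one t])]
    with y hy
  have : ⌊y⌋ = ⌈t⌉ - 1 := by
    rw [Int.floor_eq_iff]
    push_cast
    exact ⟨hy.1.le, by linarith [hy.2, Int.le_ceil t]⟩
  rw [Int.fract, this]
  push_cast
  ring

theorem leftConst_reserved (π : N.Plan) (s n t : ℝ) (c : N.Class) :
    LeftConst (fun y => π.Reserved s n y c) t := by
  have key : ∀ r, LeftConst (fun y => (s + n * π.time r ≤ y ∧ y < s + n * π.time (r + 1)) ∧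
      slotStart (π.rate r) c ≤ Int.fract y ∧
      Int.fract y < slotStart (π.rate r) c + π.rate r c) t := by
    intro r
    refine ((leftConst_le _ t).and (leftConst_lt _ t)).and (LeftConst.and ?_ ?_)
    · obtain ⟨v, hv⟩ := leftConst_le (slotStart (π.rate r) c + ((⌈t⌉ : ℝ) - 1)) t
      refine ⟨v, ?_⟩
      filter_upwards [hv, eventually_fract_eq t] with y h1 h2
      rw [h2, ← h1, le_sub_iff_add_le]
    · obtain ⟨v, hv⟩ := leftConst_lt (slotStart (π.rate r) c + π.rate r c + ((⌈t⌉ : ℝ) - 1)) t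
      refine ⟨v, ?_⟩
      filter_upwards [hv, eventually_fract_eq t] with y h1 h2
      rw [h2, ← h1, sub_lt_iff_lt_add]
  choose v hv using key
  refine ⟨∃ r < π.len, v r, ?_⟩
  filter_upwards [(eventually_all_finset (Finset.range π.len)).2 fun r _ => hv r] with y hy
  refine exists_congr fun r => and_congr_right fun hr => hy r (Finset.mem_range.2 hr)

open Classical in
/-- A nonempty class of the station `σ`, in the set `R` if possible. -/
def pick (q : N.Class → ℕ) (R : N.Class → Prop) (σ : Fin N.numStations) : Option N.Class :=
  if h : ∃ c, N.station c = σ ∧ 0 < q c ∧ R c then some h.choose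
  else if h' : ∃ c, N.station c = σ ∧ 0 < q c then some h'.choose else none

theorem pick_spec {q : N.Class → ℕ} {R : N.Class → Prop} {σ : Fin N.numStations} {c : N.Class}
    (h : pick q R σ = some c) : N.station c = σ ∧ 0 < q c := by
  unfold pick at h
  split_ifs at h with h1 h2
  · rw [← Option.some.inj h]
    exact ⟨h1.choose_spec.1, h1.choose_spec.2.1⟩
  · rw [← Option.some.inj h]
    exact h2.choose_spec

theorem pick_ne_none {q : N.Class → ℕ} {R : N.Class → Prop} {σ : Fin N.numStations}
    (h : ∃ c, N.station c = σ ∧ 0 < q c) : pick q R σ ≠ none := by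
  unfold pick
  split_ifs <;> simp

theorem pick_eq {q : N.Class → ℕ} {R : N.Class → Prop} {c : N.Class}
    (hc : 0 < q c) (hR : R c)
    (huniq : ∀ c', N.station c' = N.station c → R c' → c' = c) :
    pick q R (N.station c) = some c := by
  have h : ∃ c', N.station c' = N.station c ∧ 0 < q c' ∧ R c' := ⟨c, rfl, hc, hR⟩
  unfold pick
  rw [dif_pos h]
  exact congrArg some (huniq _ h.choose_spec.1 h.choose_spec.2.2)

/-- The total number of jobs. -/
def size (q : N.Class → ℕ) : ℕ := ∑ c, q c

/-- A phase that starts with the queue lengths `q₀` follows the plan `plan q₀`, enlarged by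
the number of jobs, during its life time `θ`. -/
def trackingRule (plan : (N.Class → ℕ) → N.Plan) (θ : ℝ) : N.Rule where
  -- The additional unit keeps the end of the plan strictly inside the phase, and gives every phase
  -- positive length even when the network is empty.
  dur q₀ := ⌈θ * size q₀⌉₊ + 1
  serve s q₀ q t := pick q ((plan q₀).Reserved s (size q₀) t)
  serve_spec _ _ _ _ _ _ h := pick_spec h
  serve_ne_none _ _ _ _ _ h := pick_ne_none h
  measurable_serve s q₀ q σ c := by
    -- For fixed queues the choice depends on time only through the set of reserved classes, one of
    -- finitely many.
    have : {t : ℝ | pick q ((plan q₀).Reserved s (size q₀) t) σ = some c}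
        = ⋃ R : N.Class → Prop, ⋃ _ : pick q R σ = some c, ⋂ c',
          {t : ℝ | (plan q₀).Reserved s (size q₀) t c' ↔ R c'} := by
      ext t
      simp only [mem_ofPred_eq, mem_iUnion, mem_iInter, exists_prop]
      constructor
      · exact fun h => ⟨_, h, fun _ => Iff.rfl⟩
      · rintro ⟨R, h, hR⟩
        rw [show (plan q₀).Reserved s (size q₀) t = R from funext fun c' => propext (hR c')]
        exact h
    rw [this]
    refine MeasurableSet.iUnion fun R => MeasurableSet.iUnion fun _ => MeasurableSet.iInter
      fun c' => ?_
    have h1 := measurableSet_reserved (plan q₀) s (size q₀) c'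
    by_cases hR : R c'
    · exact (congrArg MeasurableSet (by ext; simp [hR])).mp h1
    · exact (congrArg MeasurableSet (by ext; simp [hR])).mp h1.compl
  left_const s q₀ q t := by
    have h := fun c => leftConst_reserved (plan q₀) s (size q₀) t c
    choose v hv using h
    refine ⟨pick q v, ?_⟩
    filter_upwards [eventually_all.2 hv] with y hy
    rw [show (plan q₀).Reserved s (size q₀) y = v from funext fun c' => propext (hy c')]

/-! ### Time shares -/

/-- The times whose fractional part lies in a given interval have the right density. -/
theorem exists_slots {lo hi s t : ℝ} (h0 : 0 ≤ lo) (h : lo ≤ hi) (h1 : hi ≤ 1) :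
    ∃ A : Set ℝ, MeasurableSet A ∧ A ⊆ Ioo s t ∧
      (∀ y ∈ A, lo ≤ Int.fract y ∧ Int.fract y < hi) ∧
      (hi - lo) * (t - s) - 2 ≤ volume.real A := by
  refine ⟨⋃ k ∈ Finset.Ico ⌈s⌉ ⌊t⌋, Ioo ((k : ℝ) + lo) (k + hi), ?_, ?_, ?_, ?_⟩
  · exact Finset.measurableSet_biUnion _ fun k _ => measurableSet_Ioo
  · intro y hy
    simp only [mem_iUnion, Finset.mem_Ico, exists_prop] at hy
    obtain ⟨k, ⟨hk1, hk2⟩, hy1, hy2⟩ := hy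
    have h3 : s ≤ k := Int.ceil_le.1 hk1
    have h4 : ((k + 1 : ℤ) : ℝ) ≤ t := Int.le_floor.1 (by omega)
    push_cast at h4
    exact ⟨by linarith, by linarith⟩
  · intro y hy
    simp only [mem_iUnion, Finset.mem_Ico, exists_prop] at hy
    obtain ⟨k, -, hy1, hy2⟩ := hy
    have hfl : ⌊y⌋ = k := Int.floor_eq_iff.2 ⟨by linarith, by linarith⟩
    rw [Int.fract, hfl]
    exact ⟨by linarith, by linarith⟩
  · rw [measureReal_biUnion_finset ?_ ?_ fun k _ => by simp]
    · have : ∀ k ∈ Finset.Ico ⌈s⌉ ⌊t⌋, volume.real (Ioo ((k : ℝ) + lo) (k + hi)) = hi - lo := by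
        intro k _
        rw [Real.volume_real_Ioo_of_le (by linarith)]
        ring
      rw [Finset.sum_congr rfl this, Finset.sum_const, nsmul_eq_mul, Int.card_Ico]
      -- Only complete unit intervals are used; the incomplete ones at the two ends cost at most
      -- `2`.
      have h2 : t - s - 2 ≤ ((⌊t⌋ - ⌈s⌉).toNat : ℝ) := by
        have h3 : ((⌊t⌋ - ⌈s⌉ : ℤ) : ℝ) ≤ ((⌊t⌋ - ⌈s⌉).toNat : ℝ) := by
          exact_mod_cast Int.self_le_toNat _
        push_cast at h3
        linarith [Int.ceil_lt_add_one s, Int.lt_floor_add_one t]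
      have h4 := mul_le_mul_of_nonneg_right h2 (sub_nonneg.2 h)
      linarith
    · intro k hk l hl hkl
      rw [Function.onFun, disjoint_left]
      rintro y ⟨h2, h3⟩ ⟨h4, h5⟩
      apply hkl
      have e1 : ⌊y⌋ = k := Int.floor_eq_iff.2 ⟨by linarith, by linarith⟩
      have e2 : ⌊y⌋ = l := Int.floor_eq_iff.2 ⟨by linarith, by linarith⟩
      rw [← e1, e2]
    · exact fun k _ => measurableSet_Ioo

namespace Primitives

variable {Ω : Type*} [MeasurableSpace Ω] {u : N.Control Ω}

/-- A station works on its classes one at a time. -/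
theorem stationSum_busyTime_le (hu : IsMeasurableControl u) (ω : Ω) {s t : ℝ} (hst : s ≤ t)
    (σ : Fin N.numStations) :
    N.stationSum σ (fun c => busyTime u c t ω) - N.stationSum σ (fun c => busyTime u c s ω)
      ≤ t - s := by
  set A : N.Class → Set ℝ := fun c => {y | u y ω (N.station c) = some c} ∩ Ioc s t with hA
  have hAm : ∀ c, MeasurableSet (A c) := fun c => by
    have : MeasurableSet {y | u y ω (N.station c) = some c} :=
      (measurable_id.prodMk measurable_const) (hu (N.station c) c)
    exact this.inter measurableSet_Ioc
  have hAfin : ∀ c, volume (A c) ≠ ∞ := fun c =>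
    measure_ne_top_of_subset inter_subset_right (by simp)
  have h1 : ∀ c, busyTime u c t ω - busyTime u c s ω ≤ volume.real (A c) := by
    intro c
    have hsub : {y : ℝ | y ∈ Icc 0 t ∧ u y ω (N.station c) = some c}
        ⊆ {y : ℝ | y ∈ Icc 0 s ∧ u y ω (N.station c) = some c} ∪ A c := by
      rintro y ⟨⟨h0, ht⟩, hy⟩
      rcases le_or_gt y s with h | h
      · exact Or.inl ⟨⟨h0, h⟩, hy⟩
      · exact Or.inr ⟨hy, h, ht⟩
    have := (measureReal_mono hsub (measure_union_lt_top (busySet_finite u c s ω).lt_top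
      (hAfin c).lt_top).ne).trans (measureReal_union_le _ _)
    unfold busyTime
    linarith
  rw [← stationSum_sub]
  calc N.stationSum σ (fun c => busyTime u c t ω - busyTime u c s ω)
      ≤ ∑ c with N.station c = σ, volume.real (A c) := Finset.sum_le_sum fun c _ => h1 c
    _ = volume.real (⋃ c ∈ Finset.univ.filter fun c => N.station c = σ, A c) := by
      rw [measureReal_biUnion_finset _ (fun c _ => hAm c) fun c _ => hAfin c]
      intro c hc c' hc' hcc
      simp only [Finset.coe_filter, Finset.mem_univ, true_and, mem_ofPred_eq] at hc hc'
      rw [Function.onFun, disjoint_left]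
      rintro y ⟨h2, -⟩ ⟨h3, -⟩
      simp only [mem_ofPred_eq] at h2 h3
      rw [hc] at h2
      rw [hc', h2] at h3
      exact hcc (Option.some.inj h3)
    _ ≤ volume.real (Ioc s t) :=
      measureReal_mono (iUnion₂_subset fun c _ => inter_subset_right) (by simp)
    _ = t - s := Real.volume_real_Ioc_of_le hst

end Primitives

end MultitypeNetwork

namespace MultitypeNetwork

variable {N : MultitypeNetwork}

/-! ### Tracking a plan -/

/-- An affine function attains its minimum at an end. On each piece it thus suffices to know the
plan at the breakpoints. -/
theorem add_mul_nonneg_of_endpoints {u g y z : ℝ} (hu : 0 ≤ u) (hz : 0 ≤ u + z * g) (hy : 0 ≤ y)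
    (hyz : y ≤ z) : 0 ≤ u + y * g := by
  rcases le_total 0 g with hg | hg
  · have := mul_nonneg hy hg
    linarith
  · have := mul_le_mul_of_nonpos_right hyz hg
    linarith

namespace Plan.IsFluid

variable {lam : Fin N.numTypes → ℝ} {mu : N.Class → ℝ} {π : N.Plan} {s n ε m m' : ℝ}
  {A : ℝ → Fin N.numTypes → ℝ} {D T Q : ℝ → N.Class → ℝ}

theorem rate_le_one (hπ : π.IsFluid lam mu) {r : ℕ} (hr : r < π.len) (c : N.Class) :
    π.rate r c ≤ 1 :=
  (le_stationSum (hπ.rate_nonneg r hr) c).trans (hπ.rate_le r hr _)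

theorem scaled_level_succ (hπ : π.IsFluid lam mu) {r : ℕ} (hr : r < π.len) (c : N.Class) :
    n * π.level (r + 1) c = n * π.level r c
      + ((s + n * π.time (r + 1)) - (s + n * π.time r))
        * (N.upstream lam (fun c => mu c * π.rate r c) c - mu c * π.rate r c) := by
  rw [hπ.level_succ r hr c]
  ring

/-- The tracking error on one piece of the plan. -/
theorem abs_sub_le_of_piece (hπ : π.IsFluid lam mu) (hn : 0 ≤ n) (hε : 0 ≤ ε) (hm0 : 0 ≤ m)
    (hm0' : 0 ≤ m') (hmu : ∀ c, 0 < mu c) (hm : ∀ c, mu c ≤ m) (hm' : ∀ c, (mu c)⁻¹ ≤ m') {r : ℕ}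
    (hr : r < π.len)
    (htr : TracksRates lam mu (π.rate r) (s + n * π.time r) (s + n * π.time (r + 1)) ε A D T Q)
    {e : ℝ} (he : 0 ≤ e) (hq : ∀ c, |Q (s + n * π.time r) c - n * π.level r c| ≤ e)
    {t : ℝ} (ht : t ∈ Icc (s + n * π.time r) (s + n * π.time (r + 1))) (c : N.Class) :
    |Q t c - (n * π.level r c + (t - (s + n * π.time r))
      * (N.upstream lam (fun c => mu c * π.rate r c) c - mu c * π.rate r c))|
      ≤ TracksRates.errorConst N m m' * (e + ε + 1) := by
  refine htr.abs_queue_sub_le (q := fun c => n * π.level r c) he hε hm0 hm0' hmu hm hm'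
    (hπ.rate_le_one hr) hq (fun y hy c => ?_) (fun σ => ?_) ht c
  · refine add_mul_nonneg_of_endpoints (mul_nonneg hn (hπ.level_nonneg r hr.le c)) ?_
      (sub_nonneg.2 hy.1) (sub_le_sub_right hy.2 _)
    rw [← hπ.scaled_level_succ hr]
    exact mul_nonneg hn (hπ.level_nonneg (r + 1) hr c)
  · refine (hπ.full_or_empty r hr σ).imp_right fun h c hc => ?_
    obtain ⟨h1, h2⟩ := h c hc
    exact ⟨by simp [h1], by rw [← hπ.scaled_level_succ hr, h2, mul_zero]⟩

/-- The one-piece estimate gives the recursion `e ↦ K (e + ε + 1)` for the error at the breakpoints,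
starting from `0`; the stated expression dominates it. -/
theorem abs_sub_le
    (hπ : π.IsFluid lam mu) (hn : 0 ≤ n) (hε : 0 ≤ ε) (hm0 : 0 ≤ m)
    (hm0' : 0 ≤ m') (hmu : ∀ c, 0 < mu c) (hm : ∀ c, mu c ≤ m) (hm' : ∀ c, (mu c)⁻¹ ≤ m')
    (htr : ∀ r < π.len,
      TracksRates lam mu (π.rate r) (s + n * π.time r) (s + n * π.time (r + 1)) ε A D T Q)
    (hq : ∀ c, Q s c = n * π.level 0 c)
    {r : ℕ} (hr : r ≤ π.len) (c : N.Class) :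
    |Q (s + n * π.time r) c - n * π.level r c|
      ≤ (TracksRates.errorConst N m m' + 1) ^ r * (ε + 1) - (ε + 1) := by
  have hK := TracksRates.errorConst_nonneg (N := N) hm0 hm0'
  set K := TracksRates.errorConst N m m'
  have hpow : ∀ r : ℕ, 0 ≤ (K + 1) ^ r * (ε + 1) - (ε + 1) := fun r => by
    have := mul_le_mul_of_nonneg_right (one_le_pow₀ (n := r) (show 1 ≤ K + 1 by linarith))
      (show 0 ≤ ε + 1 by linarith)
    linarith
  induction r generalizing c with
  | zero => simp [hπ.time_zero, hq]
  | succ r ih =>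
    have hr' : r < π.len := hr
    have hle : s + n * π.time r ≤ s + n * π.time (r + 1) := by
      have := mul_le_mul_of_nonneg_left (hπ.time_le r hr') hn
      linarith
    have h1 := hπ.abs_sub_le_of_piece hn hε hm0 hm0' hmu hm hm' hr' (htr r hr') (hpow r)
      (fun c => ih hr'.le c) ⟨hle, le_rfl⟩ c
    rw [← hπ.scaled_level_succ hr'] at h1
    refine h1.trans ?_
    have h2 := mul_nonneg (pow_nonneg (show 0 ≤ K + 1 by linarith) r) (show 0 ≤ ε + 1 by linarith)
    have h3 := hpow r
    rw [pow_succ]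
    have : K * ((K + 1) ^ r * (ε + 1) - (ε + 1) + ε + 1) = K * ((K + 1) ^ r * (ε + 1)) := by ring
    rw [this]
    linarith

theorem sum_sub_le {f g : N.Class → ℝ} {E : ℝ} (h : ∀ c, |f c - g c| ≤ E) :
    ∑ c, g c - Fintype.card N.Class * E ≤ ∑ c, f c := by
  have : ∑ c, (g c - E) ≤ ∑ c, f c :=
    Finset.sum_le_sum fun c _ => by linarith [(abs_le.1 (h c)).1]
  rwa [Finset.sum_sub_distrib, Finset.sum_const, nsmul_eq_mul, Finset.card_univ] at this

/-- The total queue length at the end of the plan. -/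
theorem le_sum_queue_end
    (hπ : π.IsFluid lam mu) (hn : 0 ≤ n) (hε : 0 ≤ ε) (hm0 : 0 ≤ m)
    (hm0' : 0 ≤ m') (hmu : ∀ c, 0 < mu c) (hm : ∀ c, mu c ≤ m) (hm' : ∀ c, (mu c)⁻¹ ≤ m')
    (htr : ∀ r < π.len,
      TracksRates lam mu (π.rate r) (s + n * π.time r) (s + n * π.time (r + 1)) ε A D T Q)
    (hq : ∀ c, Q s c = n * π.level 0 c) :
    n * N.l1 (π.level π.len)
      - Fintype.card N.Class * ((TracksRates.errorConst N m m' + 1) ^ π.len * (ε + 1))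
      ≤ ∑ c, Q (s + n * π.time π.len) c := by
  have h1 := sum_sub_le fun c => hπ.abs_sub_le hn hε hm0 hm0' hmu hm hm' htr hq le_rfl c
  rw [← Finset.mul_sum, ← l1_of_nonneg (hπ.level_nonneg _ le_rfl)] at h1
  have : 0 ≤ (Fintype.card N.Class : ℝ) * (ε + 1) := by positivity
  rw [mul_sub] at h1
  linarith

/-- The total queue length during the plan. -/
theorem le_sum_queue
    (hπ : π.IsFluid lam mu) (hn : 0 ≤ n) (hε : 0 ≤ ε) (hm0 : 0 ≤ m)
    (hm0' : 0 ≤ m') (hmu : ∀ c, 0 < mu c) (hm : ∀ c, mu c ≤ m) (hm' : ∀ c, (mu c)⁻¹ ≤ m')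
    (htr : ∀ r < π.len,
      TracksRates lam mu (π.rate r) (s + n * π.time r) (s + n * π.time (r + 1)) ε A D T Q)
    (hq : ∀ c, Q s c = n * π.level 0 c)
    {m₁ : ℝ} (hm₁ : ∀ r ≤ π.len, m₁ ≤ N.l1 (π.level r)) {t : ℝ}
    (ht : t ∈ Icc s (s + n * π.time π.len)) :
    n * m₁ - Fintype.card N.Class * ((TracksRates.errorConst N m m' + 1) ^ π.len * (ε + 1))
      ≤ ∑ c, Q t c := by
  have hK := TracksRates.errorConst_nonneg (N := N) hm0 hm0'
  set K := TracksRates.errorConst N m m' with hKdef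
  have hε1 : 0 ≤ ε + 1 := by linarith
  have hmono : ∀ r ≤ π.len, (K + 1) ^ r * (ε + 1) ≤ (K + 1) ^ π.len * (ε + 1) := fun r hr =>
    mul_le_mul_of_nonneg_right (pow_le_pow_right₀ (by linarith) hr) hε1
  have hpow : ∀ r : ℕ, 0 ≤ (K + 1) ^ r * (ε + 1) - (ε + 1) := fun r => by
    have := mul_le_mul_of_nonneg_right (one_le_pow₀ (n := r) (show 1 ≤ K + 1 by linarith)) hε1
    linarith
  have hlev : ∀ r ≤ π.len, 0 ≤ ∑ c, (n * π.level r c) - n * m₁ := fun r hr => by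
    rw [← Finset.mul_sum, ← l1_of_nonneg (hπ.level_nonneg r hr), ← mul_sub]
    exact mul_nonneg hn (sub_nonneg.2 (hm₁ r hr))
  have key : ∀ r ≤ π.len, ∀ t ∈ Icc s (s + n * π.time r),
      n * m₁ - Fintype.card N.Class * ((K + 1) ^ π.len * (ε + 1)) ≤ ∑ c, Q t c := by
    intro r
    induction r with
    | zero =>
      intro _ t ht
      rw [hπ.time_zero, mul_zero, add_zero] at ht
      obtain rfl : t = s := le_antisymm ht.2 ht.1
      have h1 := hlev 0 (by omega)
      simp only [← hq] at h1
      have : 0 ≤ (Fintype.card N.Class : ℝ) * ((K + 1) ^ π.len * (ε + 1)) := by positivity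
      linarith
    | succ r ih =>
      intro hr t ht
      have hr' : r < π.len := hr
      rcases le_total t (s + n * π.time r) with hle | hle
      · exact ih hr'.le t ⟨ht.1, hle⟩
      have h1 := sum_sub_le fun c => hπ.abs_sub_le_of_piece hn hε hm0 hm0' hmu hm hm' hr'
        (htr r hr') (hpow r) (fun c => hπ.abs_sub_le hn hε hm0 hm0' hmu hm hm' htr hq hr'.le c)
        ⟨hle, ht.2⟩ c
      rw [← hKdef] at h1
      have h2 : K * ((K + 1) ^ r * (ε + 1) - (ε + 1) + ε + 1) ≤ (K + 1) ^ π.len * (ε + 1) := by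
        have h3 := hmono (r + 1) hr
        have h4 : 0 ≤ (K + 1) ^ r * (ε + 1) := by positivity
        rw [pow_succ] at h3
        linarith
      have h5 := mul_le_mul_of_nonneg_left h2 (Nat.cast_nonneg (α := ℝ) (Fintype.card N.Class))
      -- The planned total is affine on the piece and lies above `n m₁` at both ends.
      have h6 : 0 ≤ (∑ c, n * π.level r c - n * m₁) + (t - (s + n * π.time r))
          * ∑ c, (N.upstream lam (fun c => mu c * π.rate r c) c - mu c * π.rate r c) := by
        refine add_mul_nonneg_of_endpoints (z := (s + n * π.time (r + 1)) - (s + n * π.time r))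
          (hlev r hr'.le) ?_ (sub_nonneg.2 hle) (sub_le_sub_right ht.2 _)
        have h7 := hlev (r + 1) hr
        simp only [hπ.scaled_level_succ (s := s) hr', Finset.sum_add_distrib,
          ← Finset.mul_sum] at h7 ⊢
        linarith
      rw [Finset.sum_add_distrib, ← Finset.mul_sum _ _ (t - (s + n * π.time r))] at h1
      linarith
  exact key π.len le_rfl t ht

end Plan.IsFluid

/-! ### Phases -/

namespace Rule

variable {ρ : N.Rule} {h : ℕ → N.Class → ℕ} {k : ℕ}

theorem phase_fst_le (k : ℕ) : (ρ.phase h k).1 ≤ k := by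
  induction k with
  | zero => simp [phase]
  | succ k ih =>
    rw [phase]
    split_ifs
    · exact le_rfl
    · omega

theorem phase_snd (k : ℕ) : (ρ.phase h k).2 = h (ρ.phase h k).1 := by
  induction k with
  | zero => simp [phase]
  | succ k ih =>
    rw [phase]
    split_ifs
    · rfl
    · exact ih

theorem phase_fst (k : ℕ) : ρ.phase h (ρ.phase h k).1 = ρ.phase h k := by
  induction k with
  | zero => simp [phase]
  | succ k ih =>
    by_cases hc : (ρ.phase h k).1 + ρ.dur (ρ.phase h k).2 ≤ k + 1
    · have : ρ.phase h (k + 1) = (k + 1, h (k + 1)) := by rw [phase, if_pos hc]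
      rw [this]
      exact this
    · have : ρ.phase h (k + 1) = ρ.phase h k := by rw [phase, if_neg hc]
      rw [this]
      exact ih

theorem lt_phase_end (hdur : ∀ q, 0 < ρ.dur q) (k : ℕ) :
    k < (ρ.phase h k).1 + ρ.dur (ρ.phase h k).2 := by
  cases k with
  | zero => exact Nat.add_pos_right _ (hdur _)
  | succ k =>
    rw [phase]
    split_ifs with hc
    · simpa using hdur _
    · omega

theorem phase_eq_of_lt {s : ℕ} (hs : (ρ.phase h s).1 = s) (hk : s ≤ k)
    (hlt : k < s + ρ.dur (h s)) : ρ.phase h k = (s, h s) := by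
  induction k, hk using Nat.le_induction with
  | base =>
    have := phase_snd (ρ := ρ) (h := h) s
    rw [hs] at this
    exact Prod.ext hs this
  | succ k hk ih =>
    rw [phase, ih (by omega), if_neg (by simpa using by omega)]

theorem phase_end (hdur : ∀ q, 0 < ρ.dur q) {s : ℕ} (hs : (ρ.phase h s).1 = s) :
    (ρ.phase h (s + ρ.dur (h s))).1 = s + ρ.dur (h s) := by
  have hd := hdur (h s)
  obtain ⟨k, hk⟩ : ∃ k, s + ρ.dur (h s) = k + 1 := ⟨s + ρ.dur (h s) - 1, by omega⟩
  have h1 := phase_eq_of_lt (k := k) hs (by omega) (by omega)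
  rw [hk, phase, h1, if_pos (by simpa using by omega)]

end Rule

end MultitypeNetwork

namespace MultitypeNetwork

variable {N : MultitypeNetwork}

/-! ### Growth along the phases -/

/-- Every plan starts at the given (normalised) queue lengths, stays away from zero, and triples the
total queue length by its end. -/
structure IsGrowthPlan (lam : Fin N.numTypes → ℝ) (mu : N.Class → ℝ) (θ m₁ : ℝ) (L : ℕ)
    (plan : (N.Class → ℕ) → N.Plan) : Prop where
  isFluid : ∀ q, 0 < size q → (plan q).IsFluid lam mu
  len_le : ∀ q, 0 < size q → (plan q).len ≤ L
  level_zero : ∀ q, 0 < size q → ∀ c, (size q : ℝ) * (plan q).level 0 c = q c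
  time_len : ∀ q, 0 < size q → (plan q).time (plan q).len = θ
  le_level : ∀ q, 0 < size q → ∀ r ≤ (plan q).len, m₁ ≤ N.l1 ((plan q).level r)
  le_level_len : ∀ q, 0 < size q → 3 ≤ N.l1 ((plan q).level (plan q).len)

namespace Primitives

variable {Ω : Type*} {p : N.Primitives Ω} {x : N.State} {u : N.Control Ω} {ω : Ω}

theorem queue_cast (c : N.Class) (t : ℝ) : (p.queue x u c t ω : ℝ) = x.q c
    + N.upstream (fun i => (p.arrivals x i t ω : ℝ)) (fun c => (p.departures x u c t ω : ℝ)) c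
    - p.departures x u c t ω := by
  rw [queue, Nat.cast_sub (p.departures_le x u c t ω), inflow_eq_upstream, Nat.cast_add,
    upstream_comp (fun n : ℕ => (n : ℝ))]

theorem queue_balance (c : N.Class) (a t : ℝ) : (p.queue x u c t ω : ℝ) = p.queue x u c a ω
    + N.upstream (fun i => (p.arrivals x i t ω : ℝ) - p.arrivals x i a ω)
      (fun c => (p.departures x u c t ω : ℝ) - p.departures x u c a ω) c
    - ((p.departures x u c t ω : ℝ) - p.departures x u c a ω) := by
  rw [queue_cast, queue_cast, upstream_comp₂ (fun a b : ℝ => a - b)]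
  ring

/-- The queue lengths seen by the scheduling rule. -/
def queueAt (p : N.Primitives Ω) (x : N.State) (u : N.Control Ω) (ω : Ω) (k : ℕ) : N.Class → ℕ :=
  fun c => p.queue x u c k ω

theorem size_queueAt (k : ℕ) : size (p.queueAt x u ω k) = p.totalQueue x u k ω := rfl

/-- Along the path `ω`, the control follows the rule, and arrivals do not accumulate. -/
structure Follows (p : N.Primitives Ω) (x : N.State) (u : N.Control Ω) (ρ : N.Rule) (ω : Ω) :
    Prop where
  unbounded : ∀ i (t : ℝ), ∃ k, t < p.arrivalSum x i k ω
  serve : ∀ t : ℝ, 0 ≤ t → u t ω = ρ.serve (ρ.phase (p.queueAt x u ω) ⌊t⌋₊).1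
    (ρ.phase (p.queueAt x u ω) ⌊t⌋₊).2 (fun c => p.queue x u c t ω) t

theorem Follows.arrivals_mono {ρ : N.Rule} (hf : p.Follows x u ρ ω) (hp : p.Nonneg) {s t : ℝ}
    (hs : 0 ≤ s) (hst : s ≤ t) (i : Fin N.numTypes) :
    p.arrivals x i s ω ≤ p.arrivals x i t ω :=
  arrivals_le_of_bounded hp hs hst (hf.unbounded i t)

theorem Follows.departures_mono {ρ : N.Rule} (hf : p.Follows x u ρ ω) (hp : p.Nonneg) {s t : ℝ}
    (hs : 0 ≤ s) (hst : s ≤ t) (c : N.Class) :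
    p.departures x u c s ω ≤ p.departures x u c t ω :=
  Primitives.departures_mono hp u hs hst (not_accumulates hp fun i => hf.unbounded i t) c

/-- The total queue length decreases by at most the number of departures. -/
theorem Follows.le_totalQueue {ρ : N.Rule} (hf : p.Follows x u ρ ω) (hp : p.Nonneg) {s t : ℝ}
    (hs : 0 ≤ s) (hst : s ≤ t) : (p.totalQueue x u s ω : ℝ)
      - ∑ c, ((p.departures x u c t ω : ℝ) - p.departures x u c s ω) ≤ p.totalQueue x u t ω := by
  unfold totalQueue
  push_cast
  rw [← Finset.sum_sub_distrib]
  refine Finset.sum_le_sum fun c _ => ?_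
  rw [queue_balance c s t]
  have : 0 ≤ N.upstream (fun i => (p.arrivals x i t ω : ℝ) - p.arrivals x i s ω)
      (fun c => (p.departures x u c t ω : ℝ) - p.departures x u c s ω) c :=
    upstream_forall (p := fun y : ℝ => 0 ≤ y)
      (fun i => sub_nonneg.2 (Nat.cast_le.2 (hf.arrivals_mono hp hs hst i)))
      (fun c => sub_nonneg.2 (Nat.cast_le.2 (hf.departures_mono hp hs hst c))) c
  linarith

theorem Follows.serve_of_phase {ρ : N.Rule} (hf : p.Follows x u ρ ω) {s : ℕ}
    (hs : (ρ.phase (p.queueAt x u ω) s).1 = s) {t : ℝ}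
    (ht : t ∈ Ico (s : ℝ) (s + ρ.dur (p.queueAt x u ω s))) :
    u t ω = ρ.serve s (p.queueAt x u ω s) (fun c => p.queue x u c t ω) t := by
  have ht0 : 0 ≤ t := (Nat.cast_nonneg s).trans ht.1
  have h1 : s ≤ ⌊t⌋₊ := Nat.le_floor ht.1
  have h2 : ⌊t⌋₊ < s + ρ.dur (p.queueAt x u ω s) := by
    rw [Nat.floor_lt ht0]
    push_cast
    exact ht.2
  rw [hf.serve t ht0, Rule.phase_eq_of_lt hs h1 h2]

variable [MeasurableSpace Ω] {lam : Fin N.numTypes → ℝ} {mu : N.Class → ℝ} {θ m₁ : ℝ} {L : ℕ}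
  {plan : (N.Class → ℕ) → N.Plan}

/-- The scheduling rule reserves the planned fractions of time. -/
theorem Follows.tracksRates (hu : IsMeasurableControl u)
    (hplan : IsGrowthPlan lam mu θ m₁ L plan) (hf : p.Follows x u (trackingRule plan θ) ω) {s : ℕ}
    (hs : ((trackingRule plan θ).phase (p.queueAt x u ω) s).1 = s)
    (hpos : 0 < size (p.queueAt x u ω s)) {ε : ℝ}
    (hA : ∀ t ∈ Icc (s : ℝ) (s + (trackingRule plan θ).dur (p.queueAt x u ω s)), ∀ i,
      |(p.arrivals x i t ω : ℝ) - p.arrivals x i s ω - lam i * (t - s)| ≤ ε)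
    (hD : ∀ t ∈ Icc (s : ℝ) (s + (trackingRule plan θ).dur (p.queueAt x u ω s)), ∀ c,
      |(p.departures x u c t ω : ℝ) - p.departures x u c s ω
        - mu c * (busyTime u c t ω - busyTime u c s ω)| ≤ ε)
    {r : ℕ} (hr : r < (plan (p.queueAt x u ω s)).len) :
    TracksRates lam mu ((plan (p.queueAt x u ω s)).rate r)
      (s + size (p.queueAt x u ω s) * (plan (p.queueAt x u ω s)).time r)
      (s + size (p.queueAt x u ω s) * (plan (p.queueAt x u ω s)).time (r + 1)) (2 * ε)
      (fun t i => (p.arrivals x i t ω : ℝ)) (fun t c => (p.departures x u c t ω : ℝ))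
      (fun t c => busyTime u c t ω) (fun t c => (p.queue x u c t ω : ℝ)) := by
  set q₀ := p.queueAt x u ω s with hq₀
  set π := plan q₀ with hπdef
  have hπ := hplan.isFluid q₀ hpos
  rw [← hπdef] at hπ
  set n : ℝ := (size q₀ : ℝ) with hn
  have hn0 : 0 ≤ n := Nat.cast_nonneg _
  set a := (s : ℝ) + n * π.time r with ha
  set b := (s : ℝ) + n * π.time (r + 1) with hb
  have hsa : (s : ℝ) ≤ a := by
    have := mul_nonneg hn0 (hπ.time_zero ▸ hπ.time_mono (Nat.zero_le r) hr.le)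
    linarith
  have hab : a ≤ b := by
    have := mul_le_mul_of_nonneg_left (hπ.time_le r hr) hn0
    linarith
  have hend : b < s + (trackingRule plan θ).dur q₀ := by
    have h1 := mul_le_mul_of_nonneg_left (hπ.time_mono (show r + 1 ≤ π.len from hr) le_rfl) hn0
    rw [hplan.time_len q₀ hpos] at h1
    have h2 : (((trackingRule plan θ).dur q₀ : ℕ) : ℝ) = (⌈θ * size q₀⌉₊ : ℝ) + 1 := by
      simp [trackingRule]
    have h3 := Nat.le_ceil (θ * (size q₀ : ℝ))
    rw [h2, hb]
    linarith
  have hsub : ∀ t ∈ Icc a b, t ∈ Icc (s : ℝ) (s + (trackingRule plan θ).dur q₀) := fun t ht =>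
    ⟨hsa.trans ht.1, ht.2.trans hend.le⟩
  have haI : a ∈ Icc a b := ⟨le_rfl, hab⟩
  refine ⟨fun t _ c => queue_balance c a t, fun t _ c => Nat.cast_nonneg _, fun t ht i => ?_,
    fun t ht c => ?_, fun t ht σ => stationSum_busyTime_le hu ω ht.1 σ,
    fun c y _ t _ hyt => busyTime_mono u c ω hyt, fun c y hy t ht hyt hQ => ?_⟩
  -- The errors are measured from the start `s` of the phase; moving the reference time to the start
  -- of the piece doubles them.
  · have h1 := abs_le.1 (hA t (hsub t ht) i)
    have h2 := abs_le.1 (hA a (hsub a haI) i)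
    exact abs_le.2 ⟨by linarith, by linarith⟩
  · have h1 := abs_le.1 (hD t (hsub t ht) c)
    have h2 := abs_le.1 (hD a (hsub a haI) c)
    exact abs_le.2 ⟨by linarith, by linarith⟩
  · have hr0 := hπ.rate_nonneg r hr
    obtain ⟨S, hSm, hSsub, hSfr, hSvol⟩ := exists_slots (s := y) (t := t)
      (slotStart_nonneg hr0 c) (le_add_of_nonneg_right (hr0 c))
      (slotStart_add_le_one hr0 (hπ.rate_le r hr _))
    have h1 := busyTime_ge_of_measurable (u := u) (ω := ω) (c := c)
      ((Nat.cast_nonneg s).trans (hsub y hy).1) hyt hSm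
      (hSsub.trans Ioo_subset_Ioc_self) (fun z hz => by
        have hzI := hSsub hz
        have hza : a ≤ z := hy.1.trans hzI.1.le
        have hzb : z < b := hzI.2.trans_le ht.2
        rw [hf.serve_of_phase hs (t := z) ⟨hsa.trans hza, hzb.trans hend⟩]
        have hres : π.Reserved s n z c := ⟨r, hr, ⟨hza, hzb⟩, hSfr z hz⟩
        refine pick_eq ?_ hres fun c' hc' hR => hπ.reserved_unique hn0 hc' hR hres
        exact Nat.cast_pos.1 (hQ z ⟨hzI.1, hzI.2.le⟩))
    rw [add_sub_cancel_left] at hSvol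
    change π.rate r c * (t - y) - 2 ≤ busyTime u c t ω - busyTime u c y ω
    linarith

/-- If the law of large numbers holds during a phase, then the total queue length doubles. -/
theorem exists_phase_growth (hp : p.Nonneg) (hu : IsMeasurableControl u) (hmu : ∀ c, 0 < mu c)
    (hplan : IsGrowthPlan lam mu θ m₁ L plan) (hθ : 0 ≤ θ) {κ : ℝ} (hκ : κ < m₁) (hκ1 : κ ≤ 1) :
    ∃ ε > 0, ∃ n₁ : ℕ, ∀ ω, p.Follows x u (trackingRule plan θ) ω → ∀ s : ℕ,
      ((trackingRule plan θ).phase (p.queueAt x u ω) s).1 = s →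
      n₁ ≤ size (p.queueAt x u ω s) →
      (∀ t ∈ Icc (s : ℝ) (s + (trackingRule plan θ).dur (p.queueAt x u ω s)),
        (∀ i, |(p.arrivals x i t ω : ℝ) - p.arrivals x i s ω - lam i * (t - s)|
          ≤ ε * size (p.queueAt x u ω s)) ∧
        ∀ c, |(p.departures x u c t ω : ℝ) - p.departures x u c s ω
          - mu c * (busyTime u c t ω - busyTime u c s ω)| ≤ ε * size (p.queueAt x u ω s)) →
      (∀ t ∈ Icc (s : ℝ) (s + (trackingRule plan θ).dur (p.queueAt x u ω s)),
        κ * size (p.queueAt x u ω s) ≤ p.totalQueue x u t ω) ∧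
      2 * size (p.queueAt x u ω s)
        ≤ size (p.queueAt x u ω (s + (trackingRule plan θ).dur (p.queueAt x u ω s))) := by
  set d := (Fintype.card N.Class : ℝ) with hd
  have hd0 : 0 ≤ d := Nat.cast_nonneg _
  set m := ∑ c, mu c with hm
  set m' := ∑ c, (mu c)⁻¹ with hm'
  have hm0 : 0 ≤ m := Finset.sum_nonneg fun c _ => (hmu c).le
  have hm0' : 0 ≤ m' := Finset.sum_nonneg fun c _ => (inv_pos.2 (hmu c)).le
  have hmc : ∀ c, mu c ≤ m := fun c =>
    Finset.single_le_sum (fun c _ => (hmu c).le) (Finset.mem_univ c)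
  have hmc' : ∀ c, (mu c)⁻¹ ≤ m' := fun c =>
    Finset.single_le_sum (f := fun c => (mu c)⁻¹) (fun c _ => (inv_pos.2 (hmu c)).le)
      (Finset.mem_univ c)
  have hK := TracksRates.errorConst_nonneg (N := N) hm0 hm0'
  set B := (TracksRates.errorConst N m m' + 1) ^ L with hB
  have hB1 : 1 ≤ B := one_le_pow₀ (by linarith)
  -- The admissible loss is `δ n`: the gap `m₁ - κ` is available during the plan, and a full `n`
  -- lies between the planned `3 n` and the claimed `2 n`.
  set δ := min (m₁ - κ) 1 with hδ
  have hδ0 : 0 < δ := lt_min (by linarith) one_pos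
  set ε := δ / (4 * (d * B + d + 1)) with hε
  have hden : 0 < 4 * (d * B + d + 1) := by positivity
  have hε0 : 0 < ε := div_pos hδ0 hden
  have hεδ : 2 * ε * (d * B + d) ≤ δ / 2 := by
    have h1 : ε * (4 * (d * B + d + 1)) = δ := div_mul_cancel₀ _ hden.ne'
    linarith
  -- Half of the admissible loss absorbs the errors proportional to `n`, by the choice of `ε`; the
  -- other half absorbs the constant errors, for large `n`.
  obtain ⟨n₁, hn₁⟩ := exists_nat_ge ((d * B + 2 * m) / (δ / 2))
  refine ⟨ε, hε0, n₁ + 1, fun ω hf s hs hn herr => ?_⟩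
  set q₀ := p.queueAt x u ω s with hq₀
  have hpos : 0 < size q₀ := by omega
  set n : ℝ := (size q₀ : ℝ) with hndef
  have hn0 : 0 ≤ n := Nat.cast_nonneg _
  have hn1 : d * B + 2 * m ≤ δ / 2 * n := by
    have h1 : (n₁ : ℝ) ≤ n := Nat.cast_le.2 (by omega)
    rw [div_le_iff₀ (by positivity)] at hn₁
    have := mul_le_mul_of_nonneg_right h1 (show 0 ≤ δ / 2 by positivity)
    linarith
  have hπ := hplan.isFluid q₀ hpos
  set π := plan q₀ with hπdef
  have htr : ∀ r < π.len, _ := fun r hr => hf.tracksRates hu hplan hs hpos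
    (fun t ht => (herr t ht).1) (fun t ht => (herr t ht).2) hr
  have hlevel : ∀ c, (p.queue x u c s ω : ℝ) = n * π.level 0 c := fun c =>
    (hplan.level_zero q₀ hpos c).symm
  have hε' : 0 ≤ 2 * (ε * n) := by positivity
  have hBlen : (TracksRates.errorConst N m m' + 1) ^ π.len ≤ B :=
    pow_le_pow_right₀ (by linarith) (hplan.len_le q₀ hpos)
  have hE : d * ((TracksRates.errorConst N m m' + 1) ^ π.len * (2 * (ε * n) + 1))
      ≤ d * (B * (2 * (ε * n) + 1)) := by gcongr
  have hEδ : d * (B * (2 * (ε * n) + 1)) + 2 * m + d * (2 * (ε * n)) ≤ δ * n := by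
    have h1 := mul_le_mul_of_nonneg_right hεδ hn0
    linarith
  have hm2 : 0 ≤ 2 * m + d * (2 * (ε * n)) := by positivity
  have hδn1 : δ * n ≤ (m₁ - κ) * n := mul_le_mul_of_nonneg_right (min_le_left _ _) hn0
  have hδn2 : δ * n ≤ 1 * n := mul_le_mul_of_nonneg_right (min_le_right _ _) hn0
  have hcast : ∀ t : ℝ, ∑ c, (p.queue x u c t ω : ℝ) = p.totalQueue x u t ω := fun t => by
    simp [totalQueue]
  have hdur : (((trackingRule plan θ).dur q₀ : ℕ) : ℝ) = (⌈θ * size q₀⌉₊ : ℝ) + 1 := by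
    simp [trackingRule]
  have hmid : ∀ t ∈ Icc (s : ℝ) (s + n * θ), κ * n ≤ p.totalQueue x u t ω := by
    intro t ht
    rw [← hplan.time_len q₀ hpos] at ht
    have h1 := hπ.le_sum_queue hn0 hε' hm0 hm0' hmu hmc hmc' htr hlevel
      (hplan.le_level q₀ hpos) ht
    rw [hcast] at h1
    linarith
  have hEnd : 3 * n - d * (B * (2 * (ε * n) + 1)) ≤ p.totalQueue x u (s + n * θ) ω := by
    have h1 := hπ.le_sum_queue_end hn0 hε' hm0 hm0' hmu hmc hmc' htr hlevel
    rw [hcast, hplan.time_len q₀ hpos] at h1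
    have h2 := mul_le_mul_of_nonneg_left (hplan.le_level_len q₀ hpos) hn0
    linarith
  have hθn : 0 ≤ n * θ := by positivity
  -- After the plan has ended at most two time units remain, by rounding and the additional unit in
  -- `dur`. Departures then remove at most `2 m` jobs, up to the error of the law of large numbers.
  have hlate : ∀ t ∈ Icc ((s : ℝ) + n * θ) (s + (trackingRule plan θ).dur q₀),
      2 * n ≤ p.totalQueue x u t ω := by
    intro t ht
    have hs0 : (0 : ℝ) ≤ s := Nat.cast_nonneg s
    have h1 := hf.le_totalQueue hp (show 0 ≤ (s : ℝ) + n * θ by linarith) ht.1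
    have hlen : t - (s + n * θ) ≤ 2 := by
      have := Nat.ceil_lt_add_one (show 0 ≤ θ * (size q₀ : ℝ) by rw [mul_comm]; exact hθn)
      have h3 := ht.2
      rw [hdur] at h3
      linarith
    have h2 : ∑ c, ((p.departures x u c t ω : ℝ) - p.departures x u c (s + n * θ) ω)
        ≤ ∑ c, (2 * mu c + 2 * (ε * n)) := by
      refine Finset.sum_le_sum fun c _ => ?_
      have h3 := abs_le.1 ((herr t ⟨by linarith [ht.1], ht.2⟩).2 c)
      have h4 := abs_le.1 ((herr (s + n * θ) ⟨by linarith, ht.1.trans ht.2⟩).2 c)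
      have h5 := busyTime_le_add u c ω ht.1
      have h6 := mul_le_mul_of_nonneg_left (show busyTime u c t ω
        - busyTime u c (s + n * θ) ω ≤ 2 by linarith) (hmu c).le
      linarith
    rw [Finset.sum_add_distrib, ← Finset.mul_sum, Finset.sum_const, nsmul_eq_mul,
      Finset.card_univ] at h2
    linarith
  refine ⟨fun t ht => ?_, ?_⟩
  · rcases le_total t (s + n * θ) with h | h
    · exact hmid t ⟨ht.1, h⟩
    · have h1 := hlate t ⟨h, ht.2⟩
      have h2 := mul_le_mul_of_nonneg_right hκ1 hn0
      linarith
  · have hmem : ((s : ℝ) + n * θ) ≤ s + (trackingRule plan θ).dur q₀ := by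
      rw [hdur]
      have := Nat.le_ceil (θ * (size q₀ : ℝ))
      linarith
    have h1 := hlate _ ⟨hmem, le_rfl⟩
    rw [size_queueAt (s + (trackingRule plan θ).dur q₀)]
    have h2 : ((s + (trackingRule plan θ).dur q₀ : ℕ) : ℝ) = s + (trackingRule plan θ).dur q₀ := by
      push_cast; rfl
    rw [h2]
    rw [hndef] at h1
    exact_mod_cast h1

end Primitives

end MultitypeNetwork

/-! ### Linear growth over infinitely many phases -/

namespace MultitypeNetwork

variable {N : MultitypeNetwork}

namespace Primitives

variable {Ω : Type*} {p : N.Primitives Ω} {x : N.State} {u : N.Control Ω} {ω : Ω}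
  {lam : Fin N.numTypes → ℝ} {mu : N.Class → ℝ}

/-- From time `τ` on, arrivals and departures obey the law of large numbers up to an error
`ε (t - τ + M)`. -/
structure RegularAfter (p : N.Primitives Ω) (x : N.State) (u : N.Control Ω)
    (lam : Fin N.numTypes → ℝ) (mu : N.Class → ℝ) (τ M ε : ℝ) (ω : Ω) : Prop where
  arrivals : ∀ t, τ ≤ t → ∀ i,
    |(p.arrivals x i t ω : ℝ) - p.arrivals x i τ ω - lam i * (t - τ)| ≤ ε * (t - τ + M)
  departures : ∀ t, τ ≤ t → ∀ c, |(p.departures x u c t ω : ℝ) - p.departures x u c τ ω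
    - mu c * (busyTime u c t ω - busyTime u c τ ω)| ≤ ε * (t - τ + M)

/-- If every phase from the time `s 0` on is at least twice as large as the preceding one, the
total queue length grows linearly. -/
theorem le_growthRate_of_phases {s n : ℕ → ℕ} {θ κ : ℝ} (hθ : 1 ≤ θ) (hκ : 0 ≤ κ)
    (hn : ∀ j, 2 ≤ n j) (hs : ∀ j, s j < s (j + 1)) (hdur : ∀ j, (s (j + 1) : ℝ) ≤ s j + (θ * n j + 2))
    (hdouble : ∀ j, 2 * n j ≤ n (j + 1))
    (hQ : ∀ j, ∀ t ∈ Icc (s j : ℝ) (s (j + 1)), κ * n j ≤ p.totalQueue x u t ω) :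
    ((κ / (8 * θ) : ℝ) : EReal) ≤ p.growthRate x u ω := by
  have hn' : ∀ j, (2 : ℝ) ≤ n j := fun j => by exact_mod_cast hn j
  have hd' : ∀ j, (2 : ℝ) * n j ≤ n (j + 1) := fun j => by exact_mod_cast hdouble j
  have hθn : ∀ j, 2 ≤ θ * n j := fun j => by
    have := mul_le_mul hθ (hn' j) zero_le_two (by linarith)
    linarith
  -- The sizes double, so the past phases sum like a geometric series and are comparable with the
  -- current one.
  have hbound : ∀ j, (s j : ℝ) ≤ s 0 + 2 * (θ * n j) := by
    intro j
    induction j with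
    | zero => linarith [hθn 0]
    | succ j ih =>
      have h1 := mul_le_mul_of_nonneg_left (hd' j) (show 0 ≤ θ by linarith)
      linarith [hdur j, hθn j]
  have hmono : StrictMono s := strictMono_nat_of_lt_succ hs
  refine le_liminf_of_le (by isBoundedDefault) ?_
  filter_upwards [eventually_ge_atTop (2 * (s 0 : ℝ)), eventually_ge_atTop (1 : ℝ)] with t ht ht1
  have hex : ∃ j, t < s j := by
    obtain ⟨k, hk⟩ := exists_nat_gt t
    exact ⟨k, hk.trans_le (Nat.cast_le.2 (hmono.le_apply))⟩
  classical
  have hfind := Nat.find_spec hex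
  have h0 : Nat.find hex ≠ 0 := fun h0 => by
    rw [h0] at hfind
    have : (0 : ℝ) ≤ s 0 := Nat.cast_nonneg _
    linarith
  obtain ⟨j, hj⟩ := Nat.exists_eq_succ_of_ne_zero h0
  have hj1 : (s j : ℝ) ≤ t := not_lt.1 (Nat.find_min hex (by omega))
  rw [hj] at hfind
  have h1 := hQ j t ⟨hj1, hfind.le⟩
  have h2 := hbound j
  have h3 := hdur j
  -- Here `t ≤ s 0 + 3 θ n + 2` and `s 0 ≤ t / 2`, so `t ≤ 6 θ n + 4`, and `2 ≤ θ n`. This is the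
  -- source of the factor `8`.
  have h4 : t ≤ 8 * (θ * n j) := by linarith [hθn j]
  rw [EReal.coe_le_coe_iff, div_le_div_iff₀ (by positivity) (by linarith)]
  have h5 := mul_le_mul_of_nonneg_left h4 hκ
  have h6 := mul_le_mul_of_nonneg_right h1 (show 0 ≤ 8 * θ by linarith)
  linarith

theorem RegularAfter.sub {τ M ε : ℝ} (h : p.RegularAfter x u lam mu τ M ε ω) {s t : ℝ} (hε : 0 ≤ ε)
    (hs : τ ≤ s) (hst : s ≤ t) :
    (∀ i, |(p.arrivals x i t ω : ℝ) - p.arrivals x i s ω - lam i * (t - s)|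
      ≤ 2 * (ε * (t - τ + M))) ∧
    ∀ c, |(p.departures x u c t ω : ℝ) - p.departures x u c s ω
      - mu c * (busyTime u c t ω - busyTime u c s ω)| ≤ 2 * (ε * (t - τ + M)) := by
  have h0 : ε * (s - τ + M) ≤ ε * (t - τ + M) := by gcongr
  constructor
  · intro i
    have h1 := abs_le.1 (h.arrivals t (hs.trans hst) i)
    have h2 := abs_le.1 (h.arrivals s hs i)
    exact abs_le.2 ⟨by linarith, by linarith⟩
  · intro c
    have h1 := abs_le.1 (h.departures t (hs.trans hst) c)
    have h2 := abs_le.1 (h.departures s hs c)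
    exact abs_le.2 ⟨by linarith, by linarith⟩

variable [MeasurableSpace Ω] {θ m₁ : ℝ} {L : ℕ} {plan : (N.Class → ℕ) → N.Plan}

/-- Linear growth of the total queue length follows from the law of large numbers after a time at
which the total queue length is large. -/
theorem exists_growth (hp : p.Nonneg) (hu : IsMeasurableControl u) (hmu : ∀ c, 0 < mu c)
    (hplan : IsGrowthPlan lam mu θ m₁ L plan) (hθ : 1 ≤ θ) {κ : ℝ} (hκ0 : 0 ≤ κ) (hκ : κ < m₁)
    (hκ1 : κ ≤ 1) :
    ∃ ε > 0, ∃ K M₀ : ℕ, ∀ M ≥ M₀, ∀ ω, p.Follows x u (trackingRule plan θ) ω → ∀ τ : ℝ, 0 ≤ τ →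
      ((((trackingRule plan θ).phase (p.queueAt x u ω) ⌊τ⌋₊).1 = τ ∧
        M ≤ size ((trackingRule plan θ).phase (p.queueAt x u ω) ⌊τ⌋₊).2) ∨
      (size ((trackingRule plan θ).phase (p.queueAt x u ω) ⌊τ⌋₊).2 < M ∧
        K * M ≤ p.totalQueue x u τ ω)) →
      p.RegularAfter x u lam mu τ M ε ω →
      ((κ / (8 * θ) : ℝ) : EReal) ≤ p.growthRate x u ω := by
  obtain ⟨ε₀, hε₀, n₁, hgrow⟩ := exists_phase_growth (x := x) hp hu hmu hplan (by linarith) hκ hκ1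
  set ρ := trackingRule plan θ with hρ
  set d := (Fintype.card N.Class : ℝ) with hd
  have hd0 : 0 ≤ d := Nat.cast_nonneg _
  set m := ∑ c, mu c with hm
  have hm0 : 0 ≤ m := Finset.sum_nonneg fun c _ => (hmu c).le
  -- If the queue becomes large inside a phase that began small, the phase still has to finish. At
  -- most `(θ + 2) M` time units remain, in which at most `(m + d) (θ + 3) M` jobs depart; starting
  -- from `K M` jobs, at least `M` are left.
  obtain ⟨K, hK⟩ := exists_nat_ge (1 + (m + d) * (θ + 3))
  have hρdur : ∀ q, 0 < ρ.dur q := fun q => Nat.succ_pos _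
  have hdurle : ∀ q, (ρ.dur q : ℝ) ≤ θ * size q + 2 := fun q => by
    have h1 : (ρ.dur q : ℝ) = (⌈θ * size q⌉₊ : ℝ) + 1 := by simp [hρ, trackingRule]
    have h2 := Nat.ceil_lt_add_one (show 0 ≤ θ * (size q : ℝ) by positivity)
    linarith
  -- In a phase of size `n ≥ M` the quantity `t - τ + M` is at most `(2 θ + 5) n`; the other factor
  -- `2` comes from comparing two times after `τ`.
  refine ⟨min 1 (ε₀ / (2 * (2 * θ + 5))), by positivity, K, max n₁ 2,
    fun M hM ω hf τ hτ hstart hreg => ?_⟩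
  set ε := min 1 (ε₀ / (2 * (2 * θ + 5))) with hε
  have hε0 : 0 ≤ ε := by positivity
  have hε1 : ε ≤ 1 := min_le_left _ _
  have hεε : ε * (2 * (2 * θ + 5)) ≤ ε₀ := by
    rw [← le_div_iff₀ (by positivity)]
    exact min_le_right _ _
  have hM2 : 2 ≤ M := (le_max_right _ _).trans hM
  have hM2' : (2 : ℝ) ≤ M := by exact_mod_cast hM2
  set h := p.queueAt x u ω with hh
  -- the first complete phase
  obtain ⟨s₀, hs₀, hτs₀, hs₀τ, hMs₀⟩ : ∃ s₀ : ℕ, (ρ.phase h s₀).1 = s₀ ∧ τ ≤ s₀ ∧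
      (s₀ : ℝ) - τ ≤ (θ + 2) * M ∧ M ≤ size (h s₀) := by
    rcases hstart with ⟨h1, h2⟩ | ⟨h1, h2⟩
    · refine ⟨(ρ.phase h ⌊τ⌋₊).1, by rw [Rule.phase_fst], h1.ge, ?_, ?_⟩
      · rw [h1, sub_self]; positivity
      · rwa [Rule.phase_snd ⌊τ⌋₊] at h2
    · set s := (ρ.phase h ⌊τ⌋₊).1 with hs
      have hq : (ρ.phase h ⌊τ⌋₊).2 = h s := Rule.phase_snd _
      rw [hq] at h1
      have hss : (ρ.phase h s).1 = s := by rw [hs, Rule.phase_fst]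
      have hlt : ⌊τ⌋₊ < s + ρ.dur (h s) := by
        have := Rule.lt_phase_end (h := h) hρdur ⌊τ⌋₊
        rwa [hq] at this
      have hsτ : (s : ℝ) ≤ τ := (Nat.cast_le.2 (Rule.phase_fst_le _)).trans (Nat.floor_le hτ)
      have hτe : τ ≤ ((s + ρ.dur (h s) : ℕ) : ℝ) :=
        (Nat.lt_floor_add_one τ).le.trans (by exact_mod_cast hlt)
      have hlen : ((s + ρ.dur (h s) : ℕ) : ℝ) - τ ≤ (θ + 2) * M := by
        have h3 := hdurle (h s)
        have h4 : θ * (size (h s) : ℝ) ≤ θ * M := by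
          gcongr
        push_cast
        linarith
      refine ⟨s + ρ.dur (h s), Rule.phase_end hρdur hss, hτe, hlen, ?_⟩
      have h5 := hf.le_totalQueue hp hτ hτe
      set e : ℝ := ((s + ρ.dur (h s) : ℕ) : ℝ) with he
      have h6 : ∑ c, ((p.departures x u c e ω : ℝ) - p.departures x u c τ ω)
          ≤ ∑ c, (mu c * ((θ + 2) * M) + (θ + 3) * M) := by
        refine Finset.sum_le_sum fun c _ => ?_
        have h7 := (abs_le.1 (hreg.departures e hτe c)).2
        have h8 := busyTime_le_add u c ω hτe
        have h9 : mu c * (busyTime u c e ω - busyTime u c τ ω) ≤ mu c * ((θ + 2) * M) :=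
          mul_le_mul_of_nonneg_left (by linarith) (hmu c).le
        have h10 : ε * (e - τ + M) ≤ 1 * (e - τ + M) :=
          mul_le_mul_of_nonneg_right hε1 (by linarith)
        linarith
      rw [Finset.sum_add_distrib, ← Finset.sum_mul, Finset.sum_const, nsmul_eq_mul,
        Finset.card_univ, ← hm, ← hd] at h6
      have h11 : (K : ℝ) * M ≤ p.totalQueue x u τ ω := by exact_mod_cast h2
      have h12 := mul_le_mul_of_nonneg_right hK (show (0 : ℝ) ≤ M by positivity)
      have h13 : m * ((θ + 2) * M) ≤ m * ((θ + 3) * M) := by gcongr; linarith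
      have h14 : (M : ℝ) ≤ p.totalQueue x u e ω := by linarith
      rw [hh, size_queueAt]
      exact_mod_cast h14
  -- one phase after the other
  have hstep : ∀ s : ℕ, (ρ.phase h s).1 = s → τ ≤ s → (s : ℝ) - τ ≤ (θ + 2) * size (h s) →
      M ≤ size (h s) →
      (∀ t ∈ Icc (s : ℝ) (s + ρ.dur (h s)), κ * size (h s) ≤ p.totalQueue x u t ω) ∧
      2 * size (h s) ≤ size (h (s + ρ.dur (h s))) := by
    intro s hs hτs hsn hMn
    refine hgrow ω hf s hs ((le_max_left _ _).trans (hM.trans hMn)) fun t ht => ?_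
    have hMn' : (M : ℝ) ≤ size (h s) := Nat.cast_le.2 hMn
    have h1 : 2 * (ε * (t - τ + M)) ≤ ε₀ * size (h s) := by
      have h2 : t - τ + M ≤ (2 * θ + 5) * size (h s) := by
        linarith [ht.2, hdurle (h s)]
      have h3 := mul_le_mul_of_nonneg_left h2 hε0
      have h4 := mul_le_mul_of_nonneg_right hεε (show (0 : ℝ) ≤ size (h s) by positivity)
      linarith
    obtain ⟨h2, h3⟩ := hreg.sub hε0 hτs ht.1
    exact ⟨fun i => (h2 i).trans h1, fun c => (h3 c).trans h1⟩
  set S : ℕ → ℕ := fun j => (fun s => s + ρ.dur (h s))^[j] s₀ with hS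
  have hSsucc : ∀ j, S (j + 1) = S j + ρ.dur (h (S j)) := fun j =>
    Function.iterate_succ_apply' _ _ _
  -- The bound `(θ + 2) n` for the time elapsed since `τ` reproduces itself: a phase adds at most `θ
  -- n + 2 ≤ (θ + 2) n` while `n` doubles.
  have hinv : ∀ j, (ρ.phase h (S j)).1 = S j ∧ τ ≤ S j ∧
      (S j : ℝ) - τ ≤ (θ + 2) * size (h (S j)) ∧ M ≤ size (h (S j)) := by
    intro j
    induction j with
    | zero =>
      have : (M : ℝ) ≤ size (h s₀) := Nat.cast_le.2 hMs₀
      exact ⟨hs₀, hτs₀, hs₀τ.trans (mul_le_mul_of_nonneg_left this (by linarith)), hMs₀⟩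
    | succ j ih =>
      obtain ⟨h1, h2, h3, h4⟩ := ih
      obtain ⟨-, h5⟩ := hstep (S j) h1 h2 h3 h4
      rw [← hSsucc] at h5
      have h5' : (2 : ℝ) * size (h (S j)) ≤ size (h (S (j + 1))) := by exact_mod_cast h5
      have h4' : (M : ℝ) ≤ size (h (S j)) := Nat.cast_le.2 h4
      refine ⟨by rw [hSsucc]; exact Rule.phase_end hρdur h1, ?_, ?_, by omega⟩
      · rw [hSsucc]
        push_cast
        have : (0 : ℝ) ≤ ρ.dur (h (S j)) := Nat.cast_nonneg _
        linarith
      · have h6 := mul_le_mul_of_nonneg_left h5' (show 0 ≤ θ + 2 by linarith)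
        have h7 := hdurle (h (S j))
        have h8 : (S (j + 1) : ℝ) = S j + ρ.dur (h (S j)) := by rw [hSsucc]; push_cast; rfl
        linarith
  refine le_growthRate_of_phases (s := S) (n := fun j => size (h (S j))) hθ hκ0
    (fun j => hM2.trans (hinv j).2.2.2) (fun j => ?_) (fun j => ?_) (fun j => ?_)
    (fun j t ht => ?_)
  · rw [hSsucc]
    exact Nat.lt_add_of_pos_right (hρdur _)
  · rw [hSsucc]
    push_cast
    linarith [hdurle (h (S j))]
  · obtain ⟨h1, h2, h3, h4⟩ := hinv j
    have := (hstep (S j) h1 h2 h3 h4).2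
    rwa [← hSsucc] at this
  · obtain ⟨h1, h2, h3, h4⟩ := hinv j
    refine (hstep (S j) h1 h2 h3 h4).1 t ?_
    rw [hSsucc] at ht
    push_cast at ht
    exact ht

end Primitives

end MultitypeNetwork

namespace MultitypeNetwork

variable {N : MultitypeNetwork}

/-! ### Counting processes -/

namespace Primitives

variable {Ω : Type*} {p : N.Primitives Ω} {x : N.State} {u : N.Control Ω} {ω : Ω}

/-- No more time is spent on a class than the completed jobs and the next one require. -/
theorem Follows.busyTime_le_serviceSum {ρ : N.Rule} (hf : p.Follows x u ρ ω) (hp : p.Nonneg)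
    (t : ℝ) (c : N.Class) :
    busyTime u c t ω ≤ p.serviceSum x c (p.departures x u c t ω + 1) ω := by
  have hserve : ∀ y, 0 ≤ y → u y ω (N.station c) = some c → 0 < p.queue x u c y ω := by
    intro y hy h
    rw [hf.serve y hy] at h
    exact (ρ.serve_spec _ _ _ _ _ _ h).2
  set A := {y | y ∈ Icc 0 t ∧ 0 < p.queue x u c y ω} with hA
  rcases A.eq_empty_or_nonempty with hAe | hAne
  · have h1 := busyTime_le_of_not_served (u := u) (ω := ω) (c := c) (s := 0) (t := t)
      fun y hy h => by
        have : y ∈ A := ⟨⟨hy.1.le, hy.2⟩, hserve y hy.1.le h⟩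
        rw [hAe] at this
        exact this
    rw [busyTime_zero] at h1
    exact h1.trans (Finset.sum_nonneg fun r _ => hp.service c r ω)
  · have hbdd : BddAbove A := ⟨t, fun y hy => hy.1.2⟩
    -- After the last time `z` with jobs present the class is not served. The supremum need not be
    -- attained, hence the argument with `ε` below.
    set z := sSup A with hz
    have hz0 : 0 ≤ z := by
      obtain ⟨y, hy⟩ := hAne
      exact hy.1.1.trans (le_csSup hbdd hy)
    have h1 := busyTime_le_of_not_served (u := u) (ω := ω) (c := c) (s := z) (t := t)
      fun y hy h => absurd (le_csSup hbdd ⟨⟨hz0.trans hy.1.le, hy.2⟩,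
        hserve y (hz0.trans hy.1.le) h⟩) (not_le.2 hy.1)
    refine h1.trans (le_of_forall_pos_le_add fun ε hε => ?_)
    obtain ⟨y, hyA, hy⟩ := exists_lt_of_lt_csSup hAne (show z - ε < sSup A by linarith)
    have h2 := busyTime_le_add u c ω (le_csSup hbdd hyA)
    have h3 := busyTime_lt_of_queue_pos hp hyA.2
    have h4 := hp.monotone_serviceSum (x := x) c ω
      (Nat.add_le_add_right (hf.departures_mono hp hyA.1.1 hyA.1.2 c) 1)
    simp only at h4
    linarith

end Primitives

/-- If the partial sums of the times between events are close to their means, then so is the number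
of events. -/
theorem exists_count_regular {α ε : ℝ} (hα : 0 < α) (hε : 0 < ε) : ∃ η > 0, ∃ M₀ : ℕ, ∀ M ≥ M₀,
    ∀ S : ℕ → ℝ, (∀ m : ℕ, |S m - α * m| ≤ η * (m + M)) → ∀ R, 0 ≤ R → R ≤ η * M →
    ∀ (m : ℕ) (y : ℝ), 0 ≤ y → (∀ m', m = m' + 1 → R + S m' ≤ y) → y ≤ R + S m →
    |(m : ℝ) - α⁻¹ * y| ≤ ε * (y + M) := by
  obtain ⟨M₀, hM₀⟩ := exists_nat_ge (4 / ε)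
  -- The first bound allows solving for `m`; the second absorbs the terms with `M`, and the third
  -- those with `y`. The remaining constant `2 α` is absorbed by `M ≥ 4 / ε`.
  refine ⟨min (α / 2) (min (ε * α / 6) (ε * α ^ 2 / 2)), by positivity, M₀,
    fun M hM S hS R hR0 hR m y hy hlow hupp => ?_⟩
  set η := min (α / 2) (min (ε * α / 6) (ε * α ^ 2 / 2)) with hη
  have hη0 : 0 < η := by positivity
  have hη1 : η ≤ α / 2 := min_le_left _ _
  have hη2 : η ≤ ε * α / 6 := (min_le_right _ _).trans (min_le_left _ _)
  have hη3 : η ≤ ε * α ^ 2 / 2 := (min_le_right _ _).trans (min_le_right _ _)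
  have hMr : (M₀ : ℝ) ≤ M := Nat.cast_le.2 hM
  have hM0 : (0 : ℝ) ≤ M := Nat.cast_nonneg M
  have hm0 : (0 : ℝ) ≤ m := Nat.cast_nonneg m
  have hM4 : 4 ≤ ε * M := by
    rw [div_le_iff₀ hε] at hM₀
    have := mul_le_mul_of_nonneg_right hMr hε.le
    linarith
  have h1 : y - α * m ≤ 2 * (η * M) + η * m := by linarith [(abs_le.1 (hS m)).2]
  have h2 : α * m - y ≤ α + η * M + η * m := by
    cases m with
    | zero =>
      have : 0 ≤ η * M := by positivity
      simp only [Nat.cast_zero, mul_zero]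
      linarith
    | succ m' =>
      have h3 := hlow m' rfl
      have h4 := (abs_le.1 (hS m')).1
      push_cast
      linarith
  have hm : α / 2 * m ≤ y + α + η * M := by
    have := mul_le_mul_of_nonneg_right hη1 hm0
    linarith
  have hηm : η * m ≤ α + η * M + 2 * η / α * y := by
    have h3 := mul_le_mul_of_nonneg_left hm (show 0 ≤ 2 * η / α by positivity)
    have h4 : 2 * η / α * (α / 2 * m) = η * m := by field_simp
    have h5 : 2 * η / α ≤ 1 := by
      rw [div_le_one hα]
      linarith
    have h6 := mul_le_mul_of_nonneg_right h5 (show 0 ≤ α + η * M by positivity)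
    linarith
  have h7 : |α * m - y| ≤ 2 * α + 3 * (η * M) + 2 * η / α * y := by
    have h8 : 0 ≤ η * M := by positivity
    exact abs_le.2 ⟨by linarith, by linarith⟩
  have h8 : |(m : ℝ) - α⁻¹ * y| = α⁻¹ * |α * m - y| := by
    rw [← abs_of_pos (inv_pos.2 hα), ← abs_mul, abs_of_pos (inv_pos.2 hα), mul_sub,
      inv_mul_cancel_left₀ hα.ne']
  have h9 : 3 * (η * M) ≤ α * (ε / 2 * M) := by
    have := mul_le_mul_of_nonneg_right hη2 hM0
    linarith
  have h10 : 2 * η / α * y ≤ α * (ε * y) := by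
    have h11 : 2 * η / α ≤ α * ε := by
      rw [div_le_iff₀ hα]
      linarith
    have := mul_le_mul_of_nonneg_right h11 hy
    linarith
  have h12 : 2 * α ≤ α * (ε / 2 * M) := by
    have := mul_le_mul_of_nonneg_left hM4 hα.le
    linarith
  rw [h8, inv_mul_le_iff₀ hα]
  linarith

/-! ### Renewal sequences on the path space -/

/-- The renewal sequences that drive the network: arrivals of the types and services of the
classes. -/
abbrev Source (N : MultitypeNetwork) : Type := Fin N.numTypes ⊕ N.Class

namespace Path

variable {x : N.State} {ρ : N.Rule} {ζ ζ' : N.Path}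

/-- The `k`-th interarrival or service time. -/
def item (x : N.State) : N.Source → ℕ → N.Path → ℝ
  | Sum.inl i, k, ζ => N.pathPrimitives.interarrival x i k ζ
  | Sum.inr c, k, ζ => N.pathPrimitives.service x c k ζ

/-- The sum of the first `k` interarrival or service times. -/
def itemSum (x : N.State) (a : N.Source) (k : ℕ) (ζ : N.Path) : ℝ :=
  ∑ r ∈ Finset.range k, item x a r ζ

/-- The number of arrivals or of departures until time `t`. -/
def count (ρ : N.Rule) (x : N.State) : N.Source → ℝ → N.Path → ℕ
  | Sum.inl i, t, ζ => N.pathPrimitives.arrivals x i t ζ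
  | Sum.inr c, t, ζ => N.pathPrimitives.departures x (ρ.pathControl x) c t ζ

/-- The time that has been available for arrivals or services until time `t`. -/
def clock (ρ : N.Rule) (x : N.State) : N.Source → ℝ → N.Path → ℝ
  | Sum.inl _, t, _ => t
  | Sum.inr c, t, ζ => Primitives.busyTime (ρ.pathControl x) c t ζ

/-- The arrival times do not accumulate. -/
def Good (x : N.State) (ζ : N.Path) : Prop :=
  ∀ i (t : ℝ), ∃ k, t < N.pathPrimitives.arrivalSum x i k ζ

/-- The first interarrival time, and the first service time of a class that is initially nonempty,
are given by the initial state. -/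
def IsInitial (x : N.State) : N.Source → ℕ → Prop
  | Sum.inl _, k => k = 0
  | Sum.inr c, k => k = 0 ∧ 0 < x.q c

theorem item_of_not_isInitial {a : N.Source} {k : ℕ} (h : ¬ IsInitial x a k) (ζ : N.Path) :
    item x a k ζ = ζ (a, k) := by
  rcases a with i | c
  · exact if_neg h
  · exact if_neg h

/-- An upper bound of the times given by the initial state. -/
def initialBound (x : N.State) : N.Source → ℝ
  | Sum.inl i => x.z₁ i
  | Sum.inr c => x.z₂ c

theorem item_of_isInitial {a : N.Source} {k : ℕ} (h : IsInitial x a k) (ζ : N.Path) :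
    item x a k ζ = initialBound x a := by
  rcases a with i | c
  · exact if_pos h
  · exact if_pos h

theorem isInitial_zero {a : N.Source} {k : ℕ} (h : IsInitial x a k) : k = 0 := by
  rcases a with i | c
  · exact h
  · exact h.1

theorem item_nonneg (a : N.Source) (k : ℕ) (ζ : N.Path) : 0 ≤ item x a k ζ := by
  rcases a with i | c
  · exact pathPrimitives_nonneg.interarrival i k ζ
  · exact pathPrimitives_nonneg.service c k ζ

theorem itemSum_succ (a : N.Source) (k : ℕ) (ζ : N.Path) :
    itemSum x a (k + 1) ζ = itemSum x a k ζ + item x a k ζ := Finset.sum_range_succ _ _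

theorem Good.not_accumulates (h : Good x ζ) (t : ℝ) : ¬ N.pathPrimitives.Accumulates x t ζ :=
  Primitives.not_accumulates pathPrimitives_nonneg fun i => h i t

theorem Good.follows (h : Good x ζ) :
    N.pathPrimitives.Follows x (ρ.pathControl x) ρ ζ := by
  refine ⟨h, fun t ht => ?_⟩
  rw [Rule.pathControl, Rule.control_eq_next pathPrimitives_nonneg, Rule.next, if_neg]
  · rfl
  · rintro (h' | h')
    · exact absurd h' (not_lt.2 ht)
    · exact h.not_accumulates t h'

theorem Good.count_mono (h : Good x ζ) {s t : ℝ} (hs : 0 ≤ s) (hst : s ≤ t) (a : N.Source) :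
    count ρ x a s ζ ≤ count ρ x a t ζ := by
  rcases a with i | c
  · exact (h.follows (ρ := ρ)).arrivals_mono pathPrimitives_nonneg hs hst i
  · exact h.follows.departures_mono pathPrimitives_nonneg hs hst c

theorem Good.itemSum_count_le (h : Good x ζ) {t : ℝ} (ht : 0 ≤ t) (a : N.Source) :
    itemSum x a (count ρ x a t ζ) ζ ≤ clock ρ x a t ζ := by
  rcases a with i | c
  · exact ((Primitives.arrivals_eq_iff pathPrimitives_nonneg ht (h i t)).1 rfl).1
  · exact Primitives.serviceSum_departures_le pathPrimitives_nonneg _ c t ζ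

theorem Good.clock_le (h : Good x ζ) {t : ℝ} (ht : 0 ≤ t) (a : N.Source) :
    clock ρ x a t ζ ≤ itemSum x a (count ρ x a t ζ + 1) ζ := by
  rcases a with i | c
  · exact ((Primitives.arrivals_eq_iff pathPrimitives_nonneg ht (h i t)).1 rfl).2.le
  · exact h.follows.busyTime_le_serviceSum pathPrimitives_nonneg t c

theorem clock_mono (a : N.Source) {s t : ℝ} (hst : s ≤ t) :
    clock ρ x a s ζ ≤ clock ρ x a t ζ := by
  rcases a with i | c
  · exact hst
  · exact Primitives.busyTime_mono _ c ζ hst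

theorem clock_sub_le (a : N.Source) {s t : ℝ} (hst : s ≤ t) :
    clock ρ x a t ζ - clock ρ x a s ζ ≤ t - s := by
  rcases a with i | c
  · exact le_rfl
  · have := Primitives.busyTime_le_add (ρ.pathControl x) c ζ hst
    simp only [clock]
    linarith

/-- The items after the `κ`-th one obey the law of large numbers. -/
def Fresh (a : N.Source) (κ : ℕ) (α η M : ℝ) (ζ : N.Path) : Prop :=
  ∀ m : ℕ, |∑ r ∈ Finset.range m, (ζ (a, κ + 1 + r) : ℝ) - α * m| ≤ η * (m + M)

/-- The initial state can only prescribe item `0`, so the items after the `κ`-th one are coordinates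
of the path. -/
theorem itemSum_add (a : N.Source) (κ m : ℕ) (ζ : N.Path) : itemSum x a (κ + 1 + m) ζ
    = itemSum x a (κ + 1) ζ + ∑ r ∈ Finset.range m, (ζ (a, κ + 1 + r) : ℝ) := by
  rw [itemSum, Finset.sum_range_add]
  refine congrArg _ (Finset.sum_congr rfl fun r _ => item_of_not_isInitial (fun h => ?_) ζ)
  have := isInitial_zero h
  omega

/-- The law of large numbers for the items that are not yet in use at time `τ`, and a bound for the
remaining times of those in use, imply the law of large numbers for the
process after time `τ`. -/
theorem exists_regularAfter {α : N.Source → ℝ} (hα : ∀ a, 0 < α a) {ε : ℝ} (hε : 0 < ε) :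
    ∃ η : N.Source → ℝ, (∀ a, 0 < η a) ∧ ∃ M₀ : ℕ, ∀ M ≥ M₀, ∀ ζ : N.Path, Good x ζ →
      ∀ τ, 0 ≤ τ → (∀ a, Fresh a (count ρ x a τ ζ) (α a) (η a) M ζ) →
      (∀ a, itemSum x a (count ρ x a τ ζ + 1) ζ - clock ρ x a τ ζ ≤ η a * M) →
      N.pathPrimitives.RegularAfter x (ρ.pathControl x) (fun i => (α (Sum.inl i))⁻¹)
        (fun c => (α (Sum.inr c))⁻¹) τ M ε ζ := by
  have h := fun a => exists_count_regular (hα a) hε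
  choose η hη M₀ hM₀ using h
  refine ⟨η, hη, Finset.univ.sup M₀, fun M hM ζ hζ τ hτ hfresh hres => ?_⟩
  have key : ∀ a t, τ ≤ t → |(count ρ x a t ζ : ℝ) - count ρ x a τ ζ
      - (α a)⁻¹ * (clock ρ x a t ζ - clock ρ x a τ ζ)| ≤ ε * (t - τ + M) := by
    intro a t ht
    obtain ⟨m, hm⟩ := Nat.exists_eq_add_of_le (hζ.count_mono (ρ := ρ) hτ ht a)
    have hΔ := sub_nonneg.2 (clock_mono (x := x) (ρ := ρ) (ζ := ζ) a ht)
    have h1 := hM₀ a M ((Finset.le_sup (Finset.mem_univ a)).trans hM) _ (hfresh a)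
      (itemSum x a (count ρ x a τ ζ + 1) ζ - clock ρ x a τ ζ) (sub_nonneg.2 (hζ.clock_le hτ a))
      (hres a) m _ hΔ (fun m' hm' => ?_) ?_
    · rw [hm]
      push_cast
      rw [add_sub_cancel_left]
      refine h1.trans (mul_le_mul_of_nonneg_left ?_ hε.le)
      linarith [clock_sub_le (x := x) (ρ := ρ) (ζ := ζ) a ht]
    · have h2 := hζ.itemSum_count_le (ρ := ρ) (hτ.trans ht) a
      rw [hm, hm', show count ρ x a τ ζ + (m' + 1) = count ρ x a τ ζ + 1 + m' by ring,
        itemSum_add] at h2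
      linarith
    · have h2 := hζ.clock_le (ρ := ρ) (hτ.trans ht) a
      rw [hm, show count ρ x a τ ζ + m + 1 = count ρ x a τ ζ + 1 + m by ring, itemSum_add] at h2
      linarith
  exact ⟨fun t ht i => key (Sum.inl i) t ht, fun t ht c => key (Sum.inr c) t ht⟩

/-! ### Causality -/

/-- The process until time `t` only depends on the items completed by time `t`, and on the fact that
the next ones are not yet completed. -/
theorem Good.agree (hζ : Good x ζ) (hζ' : Good x ζ') {t : ℝ}
    (hpast : ∀ a, ∀ k < count ρ x a t ζ, item x a k ζ' = item x a k ζ)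
    (hcur : ∀ a, item x a (count ρ x a t ζ) ζ' = item x a (count ρ x a t ζ) ζ ∨
      clock ρ x a t ζ < itemSum x a (count ρ x a t ζ + 1) ζ') :
    ∀ y ∈ Icc 0 t, ∀ a, count ρ x a y ζ' = count ρ x a y ζ ∧
      clock ρ x a y ζ' = clock ρ x a y ζ := by
  have hsum : ∀ a, ∀ k ≤ count ρ x a t ζ, itemSum x a k ζ' = itemSum x a k ζ := fun a k hk =>
    Finset.sum_congr rfl fun r hr => hpast a r ((Finset.mem_range.1 hr).trans_le hk)
  have hnext : ∀ a (y : ℝ), ∀ k ≤ count ρ x a t ζ, y ≤ clock ρ x a t ζ →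
      y < itemSum x a (k + 1) ζ → y < itemSum x a (k + 1) ζ' := by
    intro a y k hk hy hlt
    rcases hk.eq_or_lt with rfl | hk'
    · rcases hcur a with h | h
      · rw [itemSum_succ, h, hsum a _ le_rfl, ← itemSum_succ]
        exact hlt
      · exact hy.trans_lt h
    · rw [hsum a _ hk']
      exact hlt
  have hcount : ∀ y ∈ Icc 0 t,
      (∀ s ∈ Ico 0 y, ρ.pathControl x s ζ = ρ.pathControl x s ζ') →
      ∀ a, count ρ x a y ζ' = count ρ x a y ζ := by
    intro y hy hu
    have hA : ∀ i, N.pathPrimitives.arrivals x i y ζ' = N.pathPrimitives.arrivals x i y ζ := by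
      intro i
      have hle := hζ.count_mono (ρ := ρ) hy.1 hy.2 (Sum.inl i)
      obtain ⟨h1, h2⟩ := (Primitives.arrivals_eq_iff pathPrimitives_nonneg hy.1 (hζ i y)).1 rfl
      rw [Primitives.arrivals_eq_iff pathPrimitives_nonneg hy.1 (hζ' i y)]
      exact ⟨(hsum (Sum.inl i) _ hle).trans_le h1, hnext (Sum.inl i) y _ hle hy.2 h2⟩
    have hD : ∀ c, N.pathPrimitives.departures x (ρ.pathControl x) c y ζ'
        = N.pathPrimitives.departures x (ρ.pathControl x) c y ζ := by
      have hstep : ∀ c, N.pathPrimitives.inflow x (ρ.pathControl x) c y ζ'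
          = N.pathPrimitives.inflow x (ρ.pathControl x) c y ζ →
          N.pathPrimitives.departures x (ρ.pathControl x) c y ζ'
            = N.pathPrimitives.departures x (ρ.pathControl x) c y ζ := by
        intro c hc
        have hle := hζ.count_mono (ρ := ρ) hy.1 hy.2 (Sum.inr c)
        have hT := Primitives.busyTime_congr hu c
        obtain ⟨h1, h2, h3⟩ := (Primitives.departures_eq_iff (x := x) (ω := ζ) (c := c) (t := y)
          (u := ρ.pathControl x) pathPrimitives_nonneg).1 rfl
        rw [Primitives.departures_eq_iff pathPrimitives_nonneg, hc, ← hT]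
        refine ⟨h1, (hsum (Sum.inr c) _ hle).trans_le h2, fun h => ?_⟩
        exact hnext (Sum.inr c) _ _ hle (clock_mono (Sum.inr c) hy.2) (h3 h)
      exact fun c => upstream_induction
        (p := fun c => N.pathPrimitives.departures x (ρ.pathControl x) c y ζ'
          = N.pathPrimitives.departures x (ρ.pathControl x) c y ζ)
        (fun i => hstep _ (hA i)) (fun i j hj ih => hstep _ ih) c
    rintro (i | c)
    · exact hA i
    · exact hD c
  -- Equal controls before a time give equal counts at it, by `hcount`, and equal queues give equal
  -- controls; `Rule.control_congr` closes this loop.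
  have hu := Rule.control_congr (ρ := ρ) (x := x) pathPrimitives_nonneg (hζ.not_accumulates t)
    (hζ'.not_accumulates t) (fun e he hu c => Primitives.queue_congr_departures
      (fun i => (hcount e he hu (Sum.inl i)).symm) (fun c => (hcount e he hu (Sum.inr c)).symm) c)
  intro y hy a
  have huy : ∀ s ∈ Ico 0 y, ρ.pathControl x s ζ = ρ.pathControl x s ζ' := fun s hs =>
    hu s ⟨hs.1, hs.2.trans_le hy.2⟩
  refine ⟨hcount y hy huy a, ?_⟩
  rcases a with i | c
  · rfl
  · exact (Primitives.busyTime_congr huy c).symm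

end Path

end MultitypeNetwork

/-! ### Sequences of independent identically distributed non-negative random variables -/

section Sequences

variable (m : Measure ℝ≥0) [IsProbabilityMeasure m]

/-- The strong law of large numbers on the sequence space. -/
theorem ae_tendsto_average (hint : Integrable (fun z : ℝ≥0 => (z : ℝ)) m) :
    ∀ᵐ s ∂(Measure.infinitePi fun _ : ℕ => m),
      Tendsto (fun n : ℕ => (∑ r ∈ Finset.range n, (s r : ℝ)) / n) atTop
        (𝓝 (∫ z : ℝ≥0, (z : ℝ) ∂m)) := by
  set ν := Measure.infinitePi fun _ : ℕ => m
  have hev : ∀ r : ℕ, MeasurePreserving (fun s : ℕ → ℝ≥0 => s r) ν m := fun r =>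
    measurePreserving_eval_infinitePi (fun _ : ℕ => m) r
  have hint0 : Integrable (fun s : ℕ → ℝ≥0 => (s 0 : ℝ)) ν :=
    ((hev 0).integrable_comp hint.aestronglyMeasurable).2 hint
  have hind : iIndepFun (fun (r : ℕ) (s : ℕ → ℝ≥0) => (s r : ℝ)) ν :=
    iIndepFun_infinitePi (X := fun _ (z : ℝ≥0) => (z : ℝ)) fun _ => measurable_coe_nnreal_real
  have hid : ∀ r : ℕ, IdentDistrib (fun s : ℕ → ℝ≥0 => (s r : ℝ)) (fun s => (s 0 : ℝ)) ν ν := by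
    intro r
    have : IdentDistrib (fun s : ℕ → ℝ≥0 => s r) (fun s => s 0) ν ν :=
      ⟨(hev r).measurable.aemeasurable, (hev 0).measurable.aemeasurable,
        by rw [(hev r).map_eq, (hev 0).map_eq]⟩
    exact this.comp measurable_coe_nnreal_real
  have h := strong_law_ae_real (fun (r : ℕ) (s : ℕ → ℝ≥0) => (s r : ℝ)) hint0
    (fun i j hij => hind.indepFun hij) hid
  have hmean : ∫ s, ((s 0 : ℝ≥0) : ℝ) ∂ν = ∫ z : ℝ≥0, (z : ℝ) ∂m := by
    rw [← (hev 0).map_eq,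
      integral_map (hev 0).measurable.aemeasurable (by rw [(hev 0).map_eq]; exact hint.1)]
  rw [hmean] at h
  exact h

/-- The partial sums are close to their means. -/
def NearMean (α η M : ℝ) (s : ℕ → ℝ≥0) : Prop :=
  ∀ k : ℕ, |∑ r ∈ Finset.range k, (s r : ℝ) - α * k| ≤ η * (k + M)

theorem measurableSet_nearMean (α η M : ℝ) : MeasurableSet {s | NearMean α η M s} := by
  have : {s | NearMean α η M s}
      = ⋂ k : ℕ, {s | |∑ r ∈ Finset.range k, (s r : ℝ) - α * k| ≤ η * (k + M)} := by
    ext; simp [NearMean]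
  rw [this]
  refine MeasurableSet.iInter fun k => measurableSet_le ?_ measurable_const
  have h1 : Measurable fun s : ℕ → ℝ≥0 => ∑ r ∈ Finset.range k, (s r : ℝ) :=
    Finset.measurable_sum _ fun r _ => (measurable_pi_apply r).coe_nnreal_real
  exact (h1.sub_const _).abs

/-- Finitely many initial averages can be far from `α`; the additive constant `M` absorbs them. -/
theorem exists_nearMean_of_tendsto {α η : ℝ} (hη : 0 < η) {s : ℕ → ℝ≥0}
    (h : Tendsto (fun n : ℕ => (∑ r ∈ Finset.range n, (s r : ℝ)) / n) atTop (𝓝 α)) :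
    ∃ M : ℕ, NearMean α η M s := by
  set S : ℕ → ℝ := fun k => ∑ r ∈ Finset.range k, (s r : ℝ)
  obtain ⟨k₀, hk₀⟩ := Metric.tendsto_atTop.1 h η hη
  obtain ⟨M, hM⟩ := exists_nat_ge ((∑ k ∈ Finset.range (k₀ + 1), |S k - α * k|) / η)
  rw [div_le_iff₀ hη] at hM
  refine ⟨M, fun k => ?_⟩
  rcases le_or_gt k k₀ with hk | hk
  · have h1 : |S k - α * k| ≤ ∑ k ∈ Finset.range (k₀ + 1), |S k - α * k| :=
      Finset.single_le_sum (f := fun k : ℕ => |S k - α * k|) (fun _ _ => abs_nonneg _)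
        (Finset.mem_range.2 (by omega))
    have h2 : 0 ≤ η * k := by positivity
    change |S k - α * k| ≤ _
    linarith
  · have hk0 : (0 : ℝ) < k := by exact_mod_cast (by omega : 0 < k)
    have h1 := (hk₀ k hk.le).le
    rw [Real.dist_eq] at h1
    have h2 : |S k - α * k| = |S k / k - α| * k := by
      rw [← abs_of_pos hk0, ← abs_mul, abs_of_pos hk0, sub_mul, div_mul_cancel₀ _ hk0.ne']
    change |S k - α * k| ≤ _
    rw [h2]
    have h3 := mul_le_mul_of_nonneg_right h1 hk0.le
    have h4 : 0 ≤ η * M := by positivity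
    linarith

/-- The exceptional sets decrease in `M`, to a null set by the strong law, so continuity from above
suffices. -/
theorem exists_measure_not_nearMean_le (hint : Integrable (fun z : ℝ≥0 => (z : ℝ)) m) {η : ℝ}
    (hη : 0 < η) {δ : ℝ≥0∞} (hδ : 0 < δ) : ∃ M₀ : ℕ, ∀ M ≥ M₀,
    Measure.infinitePi (fun _ : ℕ => m) {s | ¬ NearMean (∫ z : ℝ≥0, (z : ℝ) ∂m) η M s} ≤ δ := by
  set ν := Measure.infinitePi fun _ : ℕ => m
  set α := ∫ z : ℝ≥0, (z : ℝ) ∂m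
  set B : ℕ → Set (ℕ → ℝ≥0) := fun M => {s | ¬ NearMean α η M s} with hB
  have hBm : ∀ M, MeasurableSet (B M) := fun M => (measurableSet_nearMean α η M).compl
  have hanti : Antitone B := by
    intro M M' hM s hs hs'
    refine hs fun k => (hs' k).trans ?_
    have : (M : ℝ) ≤ M' := Nat.cast_le.2 hM
    gcongr
  have hnull : ν (⋂ M, B M) = 0 := by
    refine measure_mono_null (fun s hs => ?_) (ae_tendsto_average m hint)
    intro h
    obtain ⟨M, hM⟩ := exists_nearMean_of_tendsto hη h
    exact mem_iInter.1 hs M hM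
  have hlim := tendsto_measure_iInter_atTop (μ := ν) (fun M => (hBm M).nullMeasurableSet) hanti
    ⟨0, measure_ne_top _ _⟩
  rw [hnull] at hlim
  obtain ⟨M₀, hM₀⟩ := eventually_atTop.1 (hlim.eventually (gt_mem_nhds hδ))
  exact ⟨M₀, fun M hM => (hM₀ M hM).le⟩

end Sequences

namespace MultitypeNetwork

variable {N : MultitypeNetwork}

/-! ### The law of the path -/

/-- The path measure: all items are independent, and the items of the source `a` have
law `law a`. -/
def pathMeasure (law : N.Source → Measure ℝ≥0) [∀ a, IsProbabilityMeasure (law a)] :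
    Measure N.Path :=
  Measure.infinitePi fun b : N.Source × ℕ => law b.1

variable {law : N.Source → Measure ℝ≥0} [∀ a, IsProbabilityMeasure (law a)]

instance : IsProbabilityMeasure (pathMeasure law) := by
  unfold pathMeasure
  infer_instance

theorem pathMeasure_map_shift (a : N.Source) (κ : ℕ) :
    (pathMeasure law).map (fun ζ r => ζ (a, κ + r)) = Measure.infinitePi fun _ : ℕ => law a :=
  Measure.map_infinitePi_infinitePi_of_inj (f := fun r : ℕ => (a, κ + r))
    (fun r r' h => by simpa using h)

theorem measurable_shift (a : N.Source) (κ : ℕ) :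
    Measurable fun (ζ : N.Path) (r : ℕ) => ζ (a, κ + r) :=
  measurable_pi_lambda _ fun _ => measurable_pi_apply _

theorem iIndepFun_path : iIndepFun (fun (b : N.Source × ℕ) (ζ : N.Path) => ζ b)
    (pathMeasure law) :=
  iIndepFun_infinitePi (X := fun _ (z : ℝ≥0) => z) fun _ => measurable_id

theorem pathMeasure_map_eval (b : N.Source × ℕ) : (pathMeasure law).map (fun ζ => ζ b) = law b.1 :=
  Measure.infinitePi_map_eval (fun b : N.Source × ℕ => law b.1) b

/-- The σ-algebra generated by a set of items. -/
abbrev itemAlgebra (N : MultitypeNetwork) (S : Set (N.Source × ℕ)) : MeasurableSpace N.Path :=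
  ⨆ b ∈ S, MeasurableSpace.comap (fun ζ : N.Path => ζ b) inferInstance

theorem measurable_itemAlgebra {S : Set (N.Source × ℕ)} {b : N.Source × ℕ} (hb : b ∈ S) :
    Measurable[itemAlgebra N S] (fun ζ : N.Path => ζ b) :=
  Measurable.mono (comap_measurable _) (le_iSup₂ (f := fun b (_ : b ∈ S) =>
    MeasurableSpace.comap (fun ζ : N.Path => ζ b) inferInstance) b hb) le_rfl

theorem indep_itemAlgebra {S T : Set (N.Source × ℕ)} (h : Disjoint S T) :
    Indep (itemAlgebra N S) (itemAlgebra N T) (pathMeasure law) :=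
  indep_iSup_of_disjoint (fun b => (measurable_pi_apply b).comap_le) iIndepFun_path.iIndep h

namespace Path

variable {x : N.State} {ρ : N.Rule}

theorem ae_good (hint : ∀ a, Integrable (fun z : ℝ≥0 => (z : ℝ)) (law a))
    (hpos : ∀ a, 0 < ∫ z : ℝ≥0, (z : ℝ) ∂(law a)) (x : N.State) :
    ∀ᵐ ζ ∂(pathMeasure law), Good x ζ := by
  refine ae_all_iff.2 fun i => ?_
  have h := ae_tendsto_average (law (Sum.inl i)) (hint _)
  rw [← pathMeasure_map_shift (Sum.inl i) 0] at h
  filter_upwards [ae_of_ae_map (measurable_shift _ _).aemeasurable h] with ζ hζ t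
  simp only [zero_add] at hζ
  have htop : Tendsto (fun n : ℕ => ∑ r ∈ Finset.range n, (ζ (Sum.inl i, r) : ℝ)) atTop atTop := by
    have h1 := hζ.pos_mul_atTop (hpos _) (tendsto_natCast_atTop_atTop (R := ℝ))
    refine h1.congr' ?_
    filter_upwards [eventually_gt_atTop 0] with n hn
    exact div_mul_cancel₀ _ (Nat.cast_ne_zero.2 hn.ne')
  obtain ⟨k, hk⟩ := (htop.eventually (eventually_gt_atTop (t + ζ (Sum.inl i, 0)))).exists
  refine ⟨k, ?_⟩
  -- Passing to the residual first interarrival time lowers a partial sum by at most the first item.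
  have h1 : ∑ r ∈ Finset.range k, (ζ (Sum.inl i, r) : ℝ)
      ≤ N.pathPrimitives.arrivalSum x i k ζ + ζ (Sum.inl i, 0) := by
    cases k with
    | zero => simp [Primitives.arrivalSum]
    | succ k =>
      rw [Primitives.arrivalSum, Finset.sum_range_succ', Finset.sum_range_succ']
      have h2 : ∀ r ∈ Finset.range k, N.pathPrimitives.interarrival x i (r + 1) ζ
          = ζ (Sum.inl i, r + 1) := fun r _ => rfl
      rw [Finset.sum_congr rfl h2]
      have := pathPrimitives_nonneg.interarrival (x := x) i 0 ζ
      linarith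
  linarith

/-- The set `E` describes events up to time `t`, at which the counts are `κ`. -/
structure IsPast (ρ : N.Rule) (x : N.State) (t : ℝ) (κ : N.Source → ℕ) (E : Set N.Path) : Prop where
  measurableSet : MeasurableSet E
  count_eq : ∀ ζ ∈ E, ∀ a, count ρ x a t ζ = κ a
  agree : ∀ ζ ∈ E, ∀ ζ', (∀ y ∈ Icc 0 t, ∀ a, count ρ x a y ζ' = count ρ x a y ζ) → ζ' ∈ E

/-- The path with all items after the `κ`-th ones replaced by `1`. -/
def trunc (κ : N.Source → ℕ) (ζ : N.Path) : N.Path := fun b => if b.2 ≤ κ b.1 then ζ b else 1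

theorem item_congr {ζ ζ' : N.Path} {a : N.Source} {k : ℕ} (h : ζ' (a, k) = ζ (a, k)) :
    item x a k ζ' = item x a k ζ := by
  by_cases hI : IsInitial x a k
  · rw [item_of_isInitial hI, item_of_isInitial hI]
  · rw [item_of_not_isInitial hI, item_of_not_isInitial hI, h]

theorem item_trunc {κ : N.Source → ℕ} {ζ : N.Path} {a : N.Source} {k : ℕ} (hk : k ≤ κ a) :
    item x a k (trunc κ ζ) = item x a k ζ :=
  item_congr (if_pos hk)

theorem itemSum_nonneg (a : N.Source) (k : ℕ) (ζ : N.Path) : 0 ≤ itemSum x a k ζ :=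
  Finset.sum_nonneg fun r _ => item_nonneg a r ζ

/-- The replacement value `1` is positive, so the partial sums diverge. -/
theorem good_trunc (κ : N.Source → ℕ) (ζ : N.Path) : Good x (trunc κ ζ) := by
  intro i t
  obtain ⟨m, hm⟩ := exists_nat_gt t
  refine ⟨κ (Sum.inl i) + 1 + m, hm.trans_le ?_⟩
  change _ ≤ itemSum x (Sum.inl i) (κ (Sum.inl i) + 1 + m) (trunc κ ζ)
  rw [itemSum_add]
  have h1 : ∀ r ∈ Finset.range m,
      ((trunc κ ζ (Sum.inl i, κ (Sum.inl i) + 1 + r) : ℝ≥0) : ℝ) = 1 := by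
    intro r _
    rw [trunc, if_neg (by simpa using by omega)]
    rfl
  rw [Finset.sum_congr rfl h1]
  simp only [Finset.sum_const, Finset.card_range, nsmul_eq_mul, mul_one]
  linarith [itemSum_nonneg (x := x) (Sum.inl i) (κ (Sum.inl i) + 1) (trunc κ ζ)]

/-- By causality, items after those in use at time `t` do not influence an event of the past. Up to
a null set this makes `E` measurable with respect to the items up to `κ`. -/
theorem IsPast.trunc_mem_iff {t : ℝ} {κ : N.Source → ℕ} {E : Set N.Path}
    (hE : IsPast ρ x t κ E) {ζ : N.Path} (hζ : Good x ζ) : trunc κ ζ ∈ E ↔ ζ ∈ E := by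
  constructor
  · intro h
    have hc := hE.count_eq _ h
    refine hE.agree _ h ζ fun y hy a => ((good_trunc κ ζ).agree hζ (fun a k hk => ?_)
      (fun a => Or.inl ?_) y hy a).1
    · rw [hc] at hk
      exact (item_trunc hk.le).symm
    · rw [hc]
      exact (item_trunc le_rfl).symm
  · intro h
    have hc := hE.count_eq _ h
    refine hE.agree _ h _ fun y hy a => (hζ.agree (good_trunc κ ζ) (fun a k hk => ?_)
      (fun a => Or.inl ?_) y hy a).1
    · rw [hc] at hk
      exact item_trunc hk.le
    · rw [hc]
      exact item_trunc le_rfl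

/-- The items not yet in use are independent of the past. -/
theorem IsPast.measure_not_fresh_le {t : ℝ} {κ : N.Source → ℕ} {E : Set N.Path}
    (hE : IsPast ρ x t κ E) (hgood : ∀ᵐ ζ ∂(pathMeasure law), Good x ζ) {a : N.Source}
    {α η M : ℝ} {δ : ℝ≥0∞}
    (hδ : Measure.infinitePi (fun _ : ℕ => law a) {s | ¬ NearMean α η M s} ≤ δ) :
    pathMeasure law (E ∩ {ζ | ¬ Fresh a (κ a) α η M ζ}) ≤ δ * pathMeasure law E := by
  set S : Set (N.Source × ℕ) := {b | b.2 ≤ κ b.1} with hS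
  have hindep := indep_itemAlgebra (law := law) (disjoint_compl_right (a := S))
  have hpast : MeasurableSet[itemAlgebra N S] (trunc κ ⁻¹' E) := by
    have : Measurable[itemAlgebra N S] (trunc (N := N) κ) := by
      let _ := itemAlgebra N S
      refine measurable_pi_lambda _ fun b => ?_
      by_cases hb : b.2 ≤ κ b.1
      · simp only [trunc, if_pos hb]
        exact measurable_itemAlgebra hb
      · simp only [trunc, if_neg hb]
        exact measurable_const
    exact this hE.measurableSet
  set F : Set N.Path := {ζ | ¬ Fresh a (κ a) α η M ζ} with hF
  have hFeq : F = (fun (ζ : N.Path) (r : ℕ) => ζ (a, κ a + 1 + r)) ⁻¹' {s | ¬ NearMean α η M s} :=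
    rfl
  have hfut : MeasurableSet[itemAlgebra N Sᶜ] F := by
    have : Measurable[itemAlgebra N Sᶜ] (fun (ζ : N.Path) (r : ℕ) => ζ (a, κ a + 1 + r)) := by
      let _ := itemAlgebra N Sᶜ
      refine measurable_pi_lambda _ fun r => measurable_itemAlgebra ?_
      simp only [hS, mem_compl_iff, mem_ofPred_eq]
      omega
    rw [hFeq]
    exact this (measurableSet_nearMean α η M).compl
  have hFδ : pathMeasure law F ≤ δ := by
    have hB : MeasurableSet {s | ¬ NearMean α η M s} := (measurableSet_nearMean α η M).compl
    rw [hFeq, ← Measure.map_apply (measurable_shift a (κ a + 1)) hB, pathMeasure_map_shift]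
    exact hδ
  -- Now `E` may be replaced by an event that depends on the items in `S` only, whereas `F` depends
  -- on the others.
  have haeE : (trunc κ ⁻¹' E : Set N.Path) =ᵐ[pathMeasure law] E := by
    filter_upwards [hgood] with ζ hζ
    exact propext (hE.trunc_mem_iff hζ)
  calc pathMeasure law (E ∩ F) = pathMeasure law (trunc κ ⁻¹' E ∩ F) :=
        measure_congr (haeE.symm.inter (ae_eq_refl F))
    _ = pathMeasure law (trunc κ ⁻¹' E) * pathMeasure law F :=
        (Indep_iff _ _ _).1 hindep _ _ hpast hfut
    _ ≤ pathMeasure law E * δ := by rw [measure_congr haeE]; gcongr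
    _ = δ * pathMeasure law E := mul_comm _ _

end Path

end MultitypeNetwork

/-! ### Residual times of the items in use -/

/-- The residual life times have uniformly small tails. -/
def HasResidualTails (m : Measure ℝ≥0) : Prop :=
  ∀ δ : ℝ≥0∞, 0 < δ → ∃ y₀ : ℝ, ∀ y ≥ y₀, ∀ e : ℝ, 0 ≤ e →
    m {z : ℝ≥0 | e + y < z} ≤ δ * m {z : ℝ≥0 | e < z}

namespace MultitypeNetwork

variable {N : MultitypeNetwork} {law : N.Source → Measure ℝ≥0} [∀ a, IsProbabilityMeasure (law a)]

namespace Path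

variable {x : N.State} {ρ : N.Rule}

theorem measurable_item (a : N.Source) (k : ℕ) : Measurable (item (N := N) x a k) := by
  by_cases h : IsInitial x a k
  · rw [show item x a k = fun _ => initialBound x a from funext fun ζ => item_of_isInitial h ζ]
    exact measurable_const
  · rw [show item x a k = fun ζ => ((ζ (a, k) : ℝ≥0) : ℝ)
      from funext fun ζ => item_of_not_isInitial h ζ]
    exact Measurable.coe_nnreal_real (measurable_pi_apply (a, k))

theorem measurable_itemSum (a : N.Source) (k : ℕ) : Measurable (itemSum (N := N) x a k) :=
  Finset.measurable_sum _ fun r _ => measurable_item a r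

theorem measurable_clock (a : N.Source) (t : ℝ) : Measurable (clock (N := N) ρ x a t) := by
  rcases a with i | c
  · exact measurable_const
  · exact (Primitives.IsMeasurableControl.busyTime (Rule.isMeasurableControl_control (ρ := ρ)
      (x := x) pathPrimitives_nonneg pathPrimitives_isMeasurable) c).comp
      (measurable_const.prodMk measurable_id)

theorem measurable_count (a : N.Source) (t : ℝ) : Measurable (count (N := N) ρ x a t) := by
  rcases a with i | c
  · exact (Primitives.measurable_arrivals pathPrimitives_nonneg pathPrimitives_isMeasurable i).comp
      (measurable_const.prodMk measurable_id)
  · exact (Primitives.IsMeasurableControl.departures pathPrimitives_nonneg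
      pathPrimitives_isMeasurable (Rule.isMeasurableControl_control (ρ := ρ)
      (x := x) pathPrimitives_nonneg pathPrimitives_isMeasurable) c).comp
      (measurable_const.prodMk measurable_id)

theorem clock_le_self {t : ℝ} (ht : 0 ≤ t) (a : N.Source) (ζ : N.Path) : clock ρ x a t ζ ≤ t := by
  rcases a with i | c
  · exact le_rfl
  · exact Primitives.busyTime_le _ c ζ ht

open Classical in
/-- The path with one item replaced. -/
def replace (b : N.Source × ℕ) (z : ℝ≥0) (ζ : N.Path) : N.Path := Function.update ζ b z

theorem replace_self (b : N.Source × ℕ) (z : ℝ≥0) (ζ : N.Path) : replace b z ζ b = z := by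
  simp [replace]

theorem replace_of_ne {b b' : N.Source × ℕ} (h : b' ≠ b) (z : ℝ≥0) (ζ : N.Path) :
    replace b z ζ b' = ζ b' := by
  simp [replace, h]

/-- Replacing one item lowers the partial sums by at most that item, so they remain unbounded. -/
theorem Good.replace {ζ : N.Path} (hζ : Good x ζ) (b : N.Source × ℕ) (z : ℝ≥0) :
    Good x (replace b z ζ) := by
  classical
  intro i t
  obtain ⟨k, hk⟩ := hζ i (t + ζ b)
  refine ⟨k, ?_⟩
  have h1 : ∀ r ∈ Finset.range k, N.pathPrimitives.interarrival x i r ζ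
      ≤ N.pathPrimitives.interarrival x i r (Path.replace b z ζ)
        + if r = b.2 then (ζ b : ℝ) else 0 := by
    intro r _
    by_cases hr : (Sum.inl i, r) = b
    · subst hr
      by_cases hI : r = 0
      · simp [Primitives.interarrival, hI]
      · have := pathPrimitives_nonneg.interarrival (x := x) i r
          (Path.replace (Sum.inl i, r) z ζ)
        have h2 : N.pathPrimitives.interarrival x i r ζ = ζ (Sum.inl i, r) := if_neg hI
        rw [if_pos rfl, h2]
        linarith
    · have h2 : item x (Sum.inl i) r (Path.replace b z ζ) = item x (Sum.inl i) r ζ :=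
        item_congr (replace_of_ne hr z ζ)
      have h3 : (0 : ℝ) ≤ if r = b.2 then (ζ b : ℝ) else 0 := by
        split_ifs
        · exact NNReal.coe_nonneg _
        · exact le_rfl
      change item x (Sum.inl i) r ζ ≤ item x (Sum.inl i) r (Path.replace b z ζ) + _
      rw [h2]
      linarith
  have h2 := Finset.sum_le_sum h1
  rw [Finset.sum_add_distrib, Finset.sum_ite_eq'] at h2
  have h3 : (if b.2 ∈ Finset.range k then (ζ b : ℝ) else 0) ≤ ζ b := by
    split_ifs
    · exact le_rfl
    · exact NNReal.coe_nonneg _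
  change _ < ∑ r ∈ Finset.range k, N.pathPrimitives.interarrival x i r ζ at hk
  change _ < ∑ r ∈ Finset.range k, N.pathPrimitives.interarrival x i r (Path.replace b z ζ)
  linarith

theorem measurable_replace (b : N.Source × ℕ) (z : ℝ≥0) :
    Measurable[itemAlgebra N {b}ᶜ] (replace (N := N) b z) := by
  let _ := itemAlgebra N {b}ᶜ
  refine measurable_pi_lambda _ fun b' => ?_
  by_cases h : b' = b
  · subst h
    simp only [replace_self]
    exact measurable_const
  · simp only [replace_of_ne h]
    exact measurable_itemAlgebra h

/-- The elapsed part of the current item. -/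
def elapsed (ρ : N.Rule) (x : N.State) (a : N.Source) (k : ℕ) (t : ℝ) (ζ : N.Path) : ℝ :=
  max (clock ρ x a t ζ - itemSum x a k ζ) 0

/-- The residual times of the items in use have uniformly small tails, given the past. -/
theorem IsPast.measure_residual_le {t : ℝ} (ht : 0 ≤ t) {κ : N.Source → ℕ} {E : Set N.Path}
    (hE : IsPast ρ x t κ E) (hgood : ∀ᵐ ζ ∂(pathMeasure law), Good x ζ) {a : N.Source}
    (ha : ¬ IsInitial x a (κ a)) {y : ℝ} {δ : ℝ≥0∞}
    (hδ : ∀ e : ℝ, 0 ≤ e → law a {z : ℝ≥0 | e + y < z} ≤ δ * law a {z : ℝ≥0 | e < z}) :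
    pathMeasure law (E ∩ {ζ | y < itemSum x a (κ a + 1) ζ - clock ρ x a t ζ})
      ≤ δ * pathMeasure law E := by
  set b : N.Source × ℕ := (a, κ a) with hb
  -- An item of length `t + 1` cannot be completed by time `t`, so the replacement does not disturb
  -- the past as long as the original item was still in use.
  set z₁ : ℝ≥0 := ⟨t + 1, by linarith⟩ with hz₁
  set ν := pathMeasure law with hν
  set R : N.Path → N.Path := replace b z₁ with hR
  have hRm : Measurable R := by
    refine (measurable_replace b z₁).mono ?_ le_rfl
    exact iSup₂_le fun b _ => (measurable_pi_apply b).comap_le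
  -- the replaced path and the replaced item are independent
  have hindep : IndepFun R (fun ζ : N.Path => ζ b) ν := by
    have h1 := indep_itemAlgebra (law := law) (disjoint_compl_left (a := ({b} : Set _)))
    refine indep_of_indep_of_le_left (indep_of_indep_of_le_right h1 ?_) ?_
    · exact (measurable_itemAlgebra (mem_singleton b)).comap_le
    · exact (measurable_replace b z₁).comap_le
  have hmap : ν.map (fun ζ => (R ζ, ζ b)) = (ν.map R).prod (law a) := by
    rw [(indepFun_iff_map_prod_eq_prod_map_map hRm.aemeasurable
      (measurable_pi_apply b).aemeasurable).1 hindep, hν, pathMeasure_map_eval]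
  have hitem : ∀ ζ : N.Path, ∀ a' k, (a', k) ≠ b → item x a' k (R ζ) = item x a' k ζ :=
    fun ζ a' k h => item_congr (replace_of_ne h z₁ ζ)
  have hsum : ∀ ζ, itemSum x a (κ a) (R ζ) = itemSum x a (κ a) ζ := fun ζ =>
    Finset.sum_congr rfl fun r hr => hitem ζ a r fun h => by
      have := (Prod.mk.inj h).2
      have := Finset.mem_range.1 hr
      omega
  have hfst : ∀ ζ, Good x ζ → ζ ∈ E → R ζ ∈ E ∧ clock ρ x a t (R ζ) = clock ρ x a t ζ := by
    intro ζ hζ hζE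
    have hc := hE.count_eq ζ hζE
    have hag := hζ.agree (ρ := ρ) (t := t) (hζ.replace b z₁) (fun a' k hk => ?_) (fun a' => ?_)
    · exact ⟨hE.agree ζ hζE _ fun y hy a' => (hag y hy a').1, (hag t ⟨ht, le_rfl⟩ a).2⟩
    · rw [hc] at hk
      exact hitem ζ a' k fun h => by
        obtain ⟨rfl, rfl⟩ := Prod.mk.inj h
        exact lt_irrefl _ hk
    · rw [hc]
      by_cases haa : a' = a
      · subst haa
        right
        rw [itemSum_succ, item_of_not_isInitial ha, replace_self]
        have h1 := itemSum_nonneg (x := x) a' (κ a') (Path.replace b z₁ ζ)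
        have h2 := clock_le_self (ρ := ρ) (x := x) ht a' ζ
        have h3 : (z₁ : ℝ) = t + 1 := rfl
        linarith
      · exact Or.inl (hitem ζ a' _ fun h => haa (Prod.mk.inj h).1)
  -- Conversely, any item longer than its elapsed part can be put back without changing the past.
  have hsnd : ∀ ζ, Good x ζ → R ζ ∈ E → elapsed ρ x a (κ a) t (R ζ) < ζ b → ζ ∈ E := by
    intro ζ hζ hζE hlt
    have hc := hE.count_eq _ hζE
    refine hE.agree _ hζE ζ fun y hy a' => ((hζ.replace b z₁).agree (ρ := ρ) (t := t) hζ
      (fun a' k hk => ?_) (fun a' => ?_) y hy a').1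
    · change k < count ρ x a' t (R ζ) at hk
      rw [hc] at hk
      exact (hitem ζ a' k fun h => by
        obtain ⟨rfl, rfl⟩ := Prod.mk.inj h
        exact lt_irrefl _ hk).symm
    · change item x a' (count ρ x a' t (R ζ)) ζ = item x a' (count ρ x a' t (R ζ)) (R ζ) ∨
        clock ρ x a' t (R ζ) < itemSum x a' (count ρ x a' t (R ζ) + 1) ζ
      rw [hc]
      by_cases haa : a' = a
      · subst haa
        right
        rw [itemSum_succ, item_of_not_isInitial ha, ← hsum ζ]
        have := (le_max_left _ _).trans_lt hlt
        linarith
      · exact Or.inl (hitem ζ a' _ fun h => haa (Prod.mk.inj h).1).symm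
  have hem : Measurable (elapsed (N := N) ρ x a (κ a) t) :=
    ((measurable_clock a t).sub (measurable_itemSum a (κ a))).max measurable_const
  set B : ℝ → Set (N.Path × ℝ≥0) := fun y =>
    {w | w.1 ∈ E ∧ elapsed ρ x a (κ a) t w.1 + y < w.2} with hB
  have hBm : ∀ y, MeasurableSet (B y) := fun y =>
    (measurable_fst hE.measurableSet).inter (measurableSet_lt
      ((hem.comp measurable_fst).add_const y) measurable_snd.coe_nnreal_real)
  have hRb : Measurable fun ζ : N.Path => (R ζ, ζ b) := hRm.prodMk (measurable_pi_apply b)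
  have hBν : ∀ y, ν ((fun ζ => (R ζ, ζ b)) ⁻¹' B y) = ∫⁻ ξ, law a (Prod.mk ξ ⁻¹' B y) ∂(ν.map R) :=
    fun y => by rw [← Measure.map_apply hRb (hBm y), hmap, Measure.prod_apply (hBm y)]
  -- Given the replaced path, `E` with a residual above `y` forces the independent item to exceed
  -- its elapsed part by more than `y`, while exceeding it at all already implies `E`. The tail
  -- bound is applied for each replaced path and integrated.
  calc ν (E ∩ {ζ | y < itemSum x a (κ a + 1) ζ - clock ρ x a t ζ})
      ≤ ν ((fun ζ => (R ζ, ζ b)) ⁻¹' B y) := by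
        refine measure_mono_ae ?_
        filter_upwards [hgood] with ζ hζ ⟨hζE, hlt⟩
        obtain ⟨h1, h2⟩ := hfst ζ hζ hζE
        refine ⟨h1, ?_⟩
        have h3 := hζ.itemSum_count_le (ρ := ρ) ht a
        rw [hE.count_eq ζ hζE] at h3
        simp only [mem_ofPred_eq] at hlt
        rw [itemSum_succ, item_of_not_isInitial ha] at hlt
        change max (clock ρ x a t (R ζ) - itemSum x a (κ a) (R ζ)) 0 + y < ζ b
        rw [h2, hsum, max_eq_left (by linarith)]
        linarith
    _ = ∫⁻ ξ, law a (Prod.mk ξ ⁻¹' B y) ∂(ν.map R) := hBν y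
    _ ≤ ∫⁻ ξ, δ * law a (Prod.mk ξ ⁻¹' B 0) ∂(ν.map R) := by
        refine lintegral_mono fun ξ => ?_
        by_cases hξ : ξ ∈ E
        · have h1 : ∀ y, Prod.mk ξ ⁻¹' B y = {z : ℝ≥0 | elapsed ρ x a (κ a) t ξ + y < z} := by
            intro y
            ext z
            simp [hB, hξ]
          rw [h1, h1, add_zero]
          exact hδ _ (le_max_right _ _)
        · have h1 : Prod.mk ξ ⁻¹' B y = ∅ := by
            ext z
            simp [hB, hξ]
          rw [h1]
          simp
    _ = δ * ∫⁻ ξ, law a (Prod.mk ξ ⁻¹' B 0) ∂(ν.map R) :=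
        lintegral_const_mul _ (measurable_measure_prodMk_left (hBm 0))
    _ = δ * ν ((fun ζ => (R ζ, ζ b)) ⁻¹' B 0) := by rw [hBν]
    _ ≤ δ * ν E := by
        refine mul_le_mul_right (measure_mono_ae ?_) δ
        filter_upwards [hgood] with ζ hζ ⟨h1, h2⟩
        refine hsnd ζ hζ h1 ?_
        simpa using h2

/-- The regularity conditions after time `t` have high probability, given the past. -/
theorem exists_measure_irregular_le (hint : ∀ a, Integrable (fun z : ℝ≥0 => (z : ℝ)) (law a))
    (htail : ∀ a, HasResidualTails (law a))
    (hgood : ∀ᵐ ζ ∂(pathMeasure law), Good x ζ) {η : N.Source → ℝ} (hη : ∀ a, 0 < η a)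
    {δ : ℝ≥0∞} (hδ : 0 < δ) : ∃ M₀ : ℕ, ∀ M : ℕ, M₀ ≤ M → ∀ (t : ℝ), 0 ≤ t →
      ∀ (κ : N.Source → ℕ) (E : Set N.Path), IsPast ρ x t κ E →
      pathMeasure law (E ∩ {ζ | ∃ a,
        ¬ Fresh a (κ a) (∫ z : ℝ≥0, (z : ℝ) ∂(law a)) (η a) M ζ ∨
        η a * M < itemSum x a (κ a + 1) ζ - clock ρ x a t ζ})
        ≤ Fintype.card N.Source * (2 * δ) * pathMeasure law E := by
  have h1 := fun a => exists_measure_not_nearMean_le (law a) (hint a) (hη a) hδ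
  have h2 := fun a => htail a δ hδ
  have h3 : ∀ a, ∃ M₀ : ℕ, initialBound x a / η a ≤ M₀ := fun a => exists_nat_ge _
  choose M₁ hM₁ using h1
  choose y₀ hy₀ using h2
  have h4 : ∀ a, ∃ M₀ : ℕ, y₀ a / η a ≤ M₀ := fun a => exists_nat_ge _
  choose M₂ hM₂ using h3
  choose M₃ hM₃ using h4
  refine ⟨Finset.univ.sup fun a => max (M₁ a) (max (M₂ a) (M₃ a)), fun M hM t ht κ E hE => ?_⟩
  have hMa : ∀ a, M₁ a ≤ M ∧ M₂ a ≤ M ∧ M₃ a ≤ M := fun a => by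
    have := (Finset.le_sup (f := fun a => max (M₁ a) (max (M₂ a) (M₃ a)))
      (Finset.mem_univ a)).trans hM
    simpa using this
  have key : ∀ a, pathMeasure law (E ∩ {ζ |
      ¬ Fresh a (κ a) (∫ z : ℝ≥0, (z : ℝ) ∂(law a)) (η a) M ζ ∨
        η a * M < itemSum x a (κ a + 1) ζ - clock ρ x a t ζ}) ≤ 2 * δ * pathMeasure law E := by
    intro a
    obtain ⟨ha1, ha2, ha3⟩ := hMa a
    have hfresh := hE.measure_not_fresh_le hgood (hM₁ a M ha1)
    have hres : pathMeasure law (E ∩ {ζ | η a * M < itemSum x a (κ a + 1) ζ - clock ρ x a t ζ})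
        ≤ δ * pathMeasure law E := by
      -- An item prescribed by the initial state has a fixed length, which the choice of `M₂` keeps
      -- below `η a * M`.
      by_cases hI : IsInitial x a (κ a)
      · refine le_of_eq_of_le (measure_mono_null (t := {ζ | ¬ Good x ζ}) ?_ hgood) bot_le
        rintro ζ ⟨hζE, hlt⟩ hζ
        simp only [mem_ofPred_eq] at hlt
        have h5 := hζ.itemSum_count_le (ρ := ρ) ht a
        rw [hE.count_eq ζ hζE] at h5
        rw [itemSum_succ, item_of_isInitial hI] at hlt
        have h6 := (hM₂ a).trans (Nat.cast_le.2 ha2)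
        rw [div_le_iff₀ (hη a)] at h6
        linarith
      · refine hE.measure_residual_le ht hgood hI fun e he => hy₀ a _ ?_ e he
        have h6 := (hM₃ a).trans (Nat.cast_le.2 ha3)
        rw [div_le_iff₀ (hη a)] at h6
        linarith
    calc _ ≤ pathMeasure law ((E ∩ {ζ | ¬ Fresh a (κ a) (∫ z : ℝ≥0, (z : ℝ) ∂(law a)) (η a) M ζ})
          ∪ (E ∩ {ζ | η a * M < itemSum x a (κ a + 1) ζ - clock ρ x a t ζ})) := by
          refine measure_mono ?_
          rintro ζ ⟨h, h' | h'⟩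
          · exact Or.inl ⟨h, h'⟩
          · exact Or.inr ⟨h, h'⟩
      _ ≤ δ * pathMeasure law E + δ * pathMeasure law E :=
          (measure_union_le _ _).trans (add_le_add hfresh hres)
      _ = 2 * δ * pathMeasure law E := by ring
  calc _ ≤ pathMeasure law (⋃ a, E ∩ {ζ |
          ¬ Fresh a (κ a) (∫ z : ℝ≥0, (z : ℝ) ∂(law a)) (η a) M ζ ∨
          η a * M < itemSum x a (κ a + 1) ζ - clock ρ x a t ζ}) := by
        refine measure_mono ?_
        rintro ζ ⟨h, a, h'⟩
        exact mem_iUnion.2 ⟨a, h, h'⟩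
    _ ≤ ∑ a : N.Source, 2 * δ * pathMeasure law E :=
        (measure_iUnion_fintype_le _ _).trans (Finset.sum_le_sum fun a _ => key a)
    _ = _ := by
        rw [Finset.sum_const, nsmul_eq_mul, Finset.card_univ, ← mul_assoc (Fintype.card N.Source : ℝ≥0∞)]

end Path

end MultitypeNetwork

/-! ### The first hit on dyadic grids, and almost sure growth -/

namespace MultitypeNetwork

variable {N : MultitypeNetwork} {law : N.Source → Measure ℝ≥0} [∀ a, IsProbabilityMeasure (law a)]

namespace Path

variable {x : N.State} {ρ : N.Rule}

/-- The phase at time `t`. -/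
def phaseAt (ρ : N.Rule) (x : N.State) (t : ℝ) (ζ : N.Path) : ℕ × (N.Class → ℕ) :=
  ρ.phase (N.pathPrimitives.queueAt x (ρ.pathControl x) ζ) ⌊t⌋₊

/-- At time `t`, the current phase or the total queue is large. -/
def Hit (ρ : N.Rule) (x : N.State) (M K : ℕ) (t : ℝ) (ζ : N.Path) : Prop :=
  M ≤ size (phaseAt ρ x t ζ).2 ∨ K * M ≤ N.pathPrimitives.totalQueue x (ρ.pathControl x) t ζ

theorem queue_eq_of_count_eq {t : ℝ} {ζ ζ' : N.Path}
    (h : ∀ a, count ρ x a t ζ' = count ρ x a t ζ) (c : N.Class) :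
    N.pathPrimitives.queue x (ρ.pathControl x) c t ζ'
      = N.pathPrimitives.queue x (ρ.pathControl x) c t ζ :=
  Primitives.queue_congr_departures (fun i => h (Sum.inl i)) (fun c => h (Sum.inr c)) c

theorem hit_congr {M K : ℕ} {t : ℝ} (ht : 0 ≤ t) {ζ ζ' : N.Path}
    (h : ∀ y ∈ Icc 0 t, ∀ a, count ρ x a y ζ' = count ρ x a y ζ) :
    Hit ρ x M K t ζ' ↔ Hit ρ x M K t ζ := by
  have h1 : phaseAt ρ x t ζ' = phaseAt ρ x t ζ := ρ.phase_congr fun l hl => funext fun c =>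
    queue_eq_of_count_eq (h l ⟨Nat.cast_nonneg l, (Nat.le_floor_iff ht).1 hl⟩) c
  have h2 : N.pathPrimitives.totalQueue x (ρ.pathControl x) t ζ'
      = N.pathPrimitives.totalQueue x (ρ.pathControl x) t ζ :=
    Finset.sum_congr rfl fun c _ => queue_eq_of_count_eq (h t ⟨ht, le_rfl⟩) c
  rw [Hit, Hit, h1, h2]

theorem measurable_queue (c : N.Class) (t : ℝ) :
    Measurable (N.pathPrimitives.queue x (ρ.pathControl x) c t) :=
  (Primitives.IsMeasurableControl.queue pathPrimitives_nonneg pathPrimitives_isMeasurable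
    (Rule.isMeasurableControl_control (ρ := ρ) (x := x) pathPrimitives_nonneg
    pathPrimitives_isMeasurable) c).comp (measurable_const.prodMk measurable_id)

theorem measurable_totalQueue (t : ℝ) :
    Measurable (N.pathPrimitives.totalQueue x (ρ.pathControl x) t) :=
  Finset.measurable_sum _ fun c _ => measurable_queue c t

theorem measurableSet_hit (M K : ℕ) (t : ℝ) : MeasurableSet {ζ : N.Path | Hit ρ x M K t ζ} := by
  have h1 : Measurable (phaseAt (N := N) ρ x t) :=
    ρ.measurable_phase fun l _ c => measurable_queue c l
  have h2 : MeasurableSet {ζ : N.Path | M ≤ size (phaseAt ρ x t ζ).2} :=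
    h1 (MeasurableSet.of_discrete (s := {m : ℕ × (N.Class → ℕ) | M ≤ size m.2}))
  have h3 : MeasurableSet {ζ : N.Path |
      K * M ≤ N.pathPrimitives.totalQueue x (ρ.pathControl x) t ζ} :=
    measurable_totalQueue t (MeasurableSet.of_discrete (s := {n : ℕ | K * M ≤ n}))
  exact h2.union h3

/-- The dyadic times. -/
def grid (l j : ℕ) : ℝ := (j : ℝ) / 2 ^ l

theorem grid_nonneg (l j : ℕ) : 0 ≤ grid l j := by
  unfold grid
  positivity

theorem grid_lt_iff {l j j' : ℕ} : grid l j < grid l j' ↔ j < j' := by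
  unfold grid
  rw [div_lt_div_iff_of_pos_right (by positivity), Nat.cast_lt]

theorem grid_natCast (l s : ℕ) : grid l (s * 2 ^ l) = s := by
  simp [grid]

theorem grid_succ (l j : ℕ) : grid (l + 1) (2 * j) = grid l j := by
  unfold grid
  rw [pow_succ]
  push_cast
  field_simp

/-- The first hit on the dyadic grid occurs at the `j`-th point, and the counts are `κ`. -/
def firstHit (ρ : N.Rule) (x : N.State) (M K l j : ℕ) (κ : N.Source → ℕ) : Set N.Path :=
  {ζ | Hit ρ x M K (grid l j) ζ ∧ (∀ j' < j, ¬ Hit ρ x M K (grid l j') ζ) ∧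
    ∀ a, count ρ x a (grid l j) ζ = κ a}

theorem isPast_firstHit (M K l j : ℕ) (κ : N.Source → ℕ) :
    IsPast ρ x (grid l j) κ (firstHit ρ x M K l j κ) := by
  refine ⟨?_, fun ζ h => h.2.2, ?_⟩
  · have h1 : MeasurableSet {ζ : N.Path | ∀ j' < j, ¬ Hit ρ x M K (grid l j') ζ} := by
      have : {ζ : N.Path | ∀ j' < j, ¬ Hit ρ x M K (grid l j') ζ}
          = ⋂ j', ⋂ _ : j' < j, {ζ : N.Path | Hit ρ x M K (grid l j') ζ}ᶜ := by
        ext; simp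
      rw [this]
      exact MeasurableSet.iInter fun j' => MeasurableSet.iInter fun _ =>
        (measurableSet_hit M K _).compl
    have h2 : MeasurableSet {ζ : N.Path | ∀ a, count ρ x a (grid l j) ζ = κ a} := by
      have : {ζ : N.Path | ∀ a, count ρ x a (grid l j) ζ = κ a}
          = ⋂ a, count ρ x a (grid l j) ⁻¹' {κ a} := by
        ext; simp
      rw [this]
      exact MeasurableSet.iInter fun a => measurable_count a _ (measurableSet_singleton _)
    exact (measurableSet_hit M K _).inter (h1.inter h2)
  · rintro ζ ⟨h1, h2, h3⟩ ζ' h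
    refine ⟨(hit_congr (grid_nonneg l j) h).2 h1, fun j' hj' hit => h2 j' hj' ?_, fun a => ?_⟩
    · refine (hit_congr (grid_nonneg l j') fun y hy a => h y ⟨hy.1, ?_⟩ a).1 hit
      exact hy.2.trans (grid_lt_iff.2 hj').le
    · rw [h _ ⟨grid_nonneg l j, le_rfl⟩ a, h3]

theorem disjoint_firstHit (M K l : ℕ) : Pairwise (Function.onFun Disjoint
    fun w : ℕ × (N.Source → ℕ) => firstHit ρ x M K l w.1 w.2) := by
  rintro ⟨j, κ⟩ ⟨j', κ'⟩ hne
  rw [Function.onFun, disjoint_left]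
  rintro ζ ⟨h1, h2, h3⟩ ⟨h1', h2', h3'⟩
  have hj : j = j' := by
    rcases lt_trichotomy j j' with h | h | h
    · exact absurd h1 (h2' j h)
    · exact h
    · exact absurd h1' (h2 j' h)
  subst hj
  exact hne (Prod.ext rfl (funext fun a => (h3 a).symm.trans (h3' a)))

/-- There is no hit on the dyadic grid. -/
def noHit (ρ : N.Rule) (x : N.State) (M K l : ℕ) : Set N.Path :=
  {ζ | ∀ j, ¬ Hit ρ x M K (grid l j) ζ}

/-- The grids are nested, so the events `noHit` decrease to a null set. A grid makes the hitting
time take countably many values, which allows conditioning value by value. -/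
theorem tendsto_measure_noHit {M K : ℕ} (hhit : ∀ᵐ ζ ∂(pathMeasure law), ∃ l j,
      K * M ≤ N.pathPrimitives.totalQueue x (ρ.pathControl x) (grid l j) ζ) :
    Tendsto (fun l => pathMeasure law (noHit ρ x M K l)) atTop (𝓝 0) := by
  have hm : ∀ l, MeasurableSet (noHit ρ x M K l) := fun l => by
    have : noHit ρ x M K l = ⋂ j, {ζ : N.Path | Hit ρ x M K (grid l j) ζ}ᶜ := by
      ext; simp [noHit]
    rw [this]
    exact MeasurableSet.iInter fun j => (measurableSet_hit M K _).compl
  have hanti : Antitone (noHit ρ x M K) := antitone_nat_of_succ_le fun l ζ hζ j => by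
    rw [← grid_succ]
    exact hζ (2 * j)
  have h := tendsto_measure_iInter_atTop (μ := pathMeasure law)
    (fun l => (hm l).nullMeasurableSet) hanti ⟨0, measure_ne_top _ _⟩
  have hnull : pathMeasure law (⋂ l, noHit ρ x M K l) = 0 := by
    refine measure_mono_null (fun ζ hζ => ?_) hhit
    rintro ⟨l, j, hlj⟩
    exact mem_iInter.1 hζ l j (Or.inr hlj)
  rwa [hnull] at h

variable {θ m₁ : ℝ} {L : ℕ} {plan : (N.Class → ℕ) → N.Plan}

/-- Linear growth of the total queue under the tracking rule. -/
theorem ae_le_growthRate (hint : ∀ a, Integrable (fun z : ℝ≥0 => (z : ℝ)) (law a))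
    (hpos : ∀ a, 0 < ∫ z : ℝ≥0, (z : ℝ) ∂(law a)) (htail : ∀ a, HasResidualTails (law a))
    (hplan : IsGrowthPlan (fun i => (∫ z : ℝ≥0, (z : ℝ) ∂(law (Sum.inl i)))⁻¹)
      (fun c => (∫ z : ℝ≥0, (z : ℝ) ∂(law (Sum.inr c)))⁻¹) θ m₁ L plan) (hθ : 1 ≤ θ) {κ : ℝ}
    (hκ0 : 0 ≤ κ) (hκ : κ < m₁) (hκ1 : κ ≤ 1)
    (hhit : ∀ n : ℕ, ∀ᵐ ζ ∂(pathMeasure law), ∃ l j, n ≤ N.pathPrimitives.totalQueue x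
      ((trackingRule plan θ).pathControl x) (grid l j) ζ) :
    ∀ᵐ ζ ∂(pathMeasure law), ((κ / (8 * θ) : ℝ) : EReal)
      ≤ N.pathPrimitives.growthRate x ((trackingRule plan θ).pathControl x) ζ := by
  set ρ := trackingRule plan θ with hρ
  set ν := pathMeasure law with hν
  have hgood : ∀ᵐ ζ ∂ν, Good x ζ := ae_good hint hpos x
  obtain ⟨ε, hε, K, M₀, hgrow⟩ := Primitives.exists_growth (p := N.pathPrimitives) (x := x)
    (u := ρ.pathControl x) pathPrimitives_nonneg
    (Rule.isMeasurableControl_control pathPrimitives_nonneg pathPrimitives_isMeasurable)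
    (fun c => inv_pos.2 (hpos (Sum.inr c))) hplan hθ hκ0 hκ hκ1
  obtain ⟨η, hη, M₁, hreg⟩ := exists_regularAfter (ρ := ρ) (x := x) hpos hε
  -- The rule does not involve `δ` or `M`, so an arbitrarily small bound for the probability of
  -- failure means that it is zero.
  have key : ∀ δ : ℝ≥0∞, 0 < δ → ν {ζ | ¬ ((κ / (8 * θ) : ℝ) : EReal)
      ≤ N.pathPrimitives.growthRate x (ρ.pathControl x) ζ}
      ≤ Fintype.card N.Source * (2 * δ) := by
    intro δ hδ
    obtain ⟨M₂, hM₂⟩ := exists_measure_irregular_le (ρ := ρ) (x := x) hint htail hgood hη hδ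
    set M := max M₀ (max M₁ M₂) with hM
    set bad : ℕ → ℕ × (N.Source → ℕ) → Set N.Path := fun l w => firstHit ρ x M K l w.1 w.2 ∩
      {ζ | ∃ a, ¬ Fresh a (w.2 a) (∫ z : ℝ≥0, (z : ℝ) ∂(law a)) (η a) M ζ ∨
        η a * M < itemSum x a (w.2 a + 1) ζ - clock ρ x a (grid l w.1) ζ} with hbad
    -- The conditional bounds are summed over the disjoint events that fix the first hit and the
    -- counts at it.
    have hbadle : ∀ l, ν (⋃ w, bad l w) ≤ Fintype.card N.Source * (2 * δ) := by
      intro l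
      calc ν (⋃ w, bad l w) ≤ ∑' w, ν (bad l w) := measure_iUnion_le _
        _ ≤ ∑' w : ℕ × (N.Source → ℕ), Fintype.card N.Source * (2 * δ)
            * ν (firstHit ρ x M K l w.1 w.2) := by
          refine ENNReal.tsum_le_tsum fun w => ?_
          exact hM₂ M ((le_max_right _ _).trans (le_max_right _ _)) _ (grid_nonneg l w.1) _ _
            (isPast_firstHit M K l w.1 w.2)
        _ = Fintype.card N.Source * (2 * δ)
            * ν (⋃ w : ℕ × (N.Source → ℕ), firstHit ρ x M K l w.1 w.2) := by
          rw [ENNReal.tsum_mul_left, measure_iUnion (disjoint_firstHit M K l)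
            fun w => (isPast_firstHit M K l w.1 w.2).measurableSet]
        _ ≤ Fintype.card N.Source * (2 * δ) * 1 := by gcongr; exact prob_le_one
        _ = _ := mul_one _
    have hcover : ∀ l, ν {ζ | ¬ ((κ / (8 * θ) : ℝ) : EReal)
        ≤ N.pathPrimitives.growthRate x (ρ.pathControl x) ζ}
        ≤ ν (noHit ρ x M K l) + Fintype.card N.Source * (2 * δ) := by
      intro l
      refine le_trans ?_ (add_le_add_right (hbadle l) _)
      refine le_trans ?_ (measure_union_le _ _)
      refine measure_mono_ae ?_
      filter_upwards [hgood] with ζ hζ hng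
      by_contra hcon
      apply hng
      obtain ⟨hnh, hnb⟩ := not_or.1 hcon
      have hex : ∃ j, Hit ρ x M K (grid l j) ζ := by
        by_contra! h
        exact hnh h
      classical
      set j := Nat.find hex with hj
      have hjhit : Hit ρ x M K (grid l j) ζ := Nat.find_spec hex
      have hjmin : ∀ j' < j, ¬ Hit ρ x M K (grid l j') ζ := fun j' h => Nat.find_min hex h
      have hmem : ζ ∈ firstHit ρ x M K l j fun a => count ρ x a (grid l j) ζ :=
        ⟨hjhit, hjmin, fun a => rfl⟩
      have hno : ∀ a, Fresh a (count ρ x a (grid l j) ζ) (∫ z : ℝ≥0, (z : ℝ) ∂(law a)) (η a) M ζ ∧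
          itemSum x a (count ρ x a (grid l j) ζ + 1) ζ - clock ρ x a (grid l j) ζ ≤ η a * M := by
        intro a
        by_contra h
        refine hnb (mem_iUnion.2 ⟨(j, fun a => count ρ x a (grid l j) ζ), hmem, a, ?_⟩)
        rw [not_and_or, not_le] at h
        exact h
      refine hgrow M (le_max_left _ _) ζ hζ.follows (grid l j) (grid_nonneg l j) ?_
        (hreg M ((le_max_left _ _).trans (le_max_right _ _)) ζ hζ (grid l j) (grid_nonneg l j)
          (fun a => (hno a).1) (fun a => (hno a).2))
      change ((phaseAt ρ x (grid l j) ζ).1 = grid l j ∧ M ≤ size (phaseAt ρ x (grid l j) ζ).2) ∨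
        (size (phaseAt ρ x (grid l j) ζ).2 < M ∧ _)
      rcases le_or_gt M (size (phaseAt ρ x (grid l j) ζ).2) with hbig | hsmall
      · refine Or.inl ⟨?_, hbig⟩
        -- The start of a phase is an integer, hence a grid point, and a large phase is a hit from
        -- its start on. So a first hit by a large phase occurs exactly when that phase starts.
        set s := (phaseAt ρ x (grid l j) ζ).1 with hs
        have hsle : (s : ℝ) ≤ grid l j :=
          (Nat.cast_le.2 (Rule.phase_fst_le _)).trans (Nat.floor_le (grid_nonneg l j))
        by_contra hne
        have hlt : grid l (s * 2 ^ l) < grid l j := by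
          rw [grid_natCast]
          exact lt_of_le_of_ne hsle hne
        refine hjmin _ (grid_lt_iff.1 hlt) (Or.inl ?_)
        have : phaseAt ρ x (grid l (s * 2 ^ l)) ζ = phaseAt ρ x (grid l j) ζ := by
          rw [grid_natCast, phaseAt, Nat.floor_natCast, hs]
          exact Rule.phase_fst _
        rwa [this]
      · refine Or.inr ⟨hsmall, ?_⟩
        rcases hjhit with h | h
        · exact absurd h (not_le.2 hsmall)
        · exact h
    have hlim := (tendsto_measure_noHit (ρ := ρ) (x := x) (M := M) (K := K)
      (hhit (K * M))).add_const ((Fintype.card N.Source : ℝ≥0∞) * (2 * δ))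
    rw [zero_add] at hlim
    exact ge_of_tendsto' hlim hcover
  have hzero : Tendsto (fun n : ℕ => (Fintype.card N.Source : ℝ≥0∞) * (2 * (n : ℝ≥0∞)⁻¹)) atTop
      (𝓝 0) := by
    have h1 : Tendsto (fun n : ℕ => (2 : ℝ≥0∞) * (n : ℝ≥0∞)⁻¹) atTop (𝓝 (2 * 0)) :=
      ENNReal.Tendsto.const_mul ENNReal.tendsto_inv_nat_nhds_zero (Or.inr (by simp))
    have h2 := ENNReal.Tendsto.const_mul (a := (Fintype.card N.Source : ℝ≥0∞)) h1
      (Or.inr (ENNReal.natCast_ne_top _))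
    simpa using h2
  exact nonpos_iff_eq_zero.1 (ge_of_tendsto' hzero fun n =>
    key _ (ENNReal.inv_pos.2 (ENNReal.natCast_ne_top n)))

end Path

end MultitypeNetwork

/-! ### From assumption (B) to residual tails -/

/-- Large deviations bounds give uniform bounds for the residual life times. -/
theorem LDBounds.hasResidualTails {Ω : Type*} [MeasurableSpace Ω] {P : Measure Ω}
    [IsProbabilityMeasure P] {Z : ℕ → Ω → ℝ} (h : LDBounds P Z) (hm : ∀ k, Measurable (Z k))
    (hnn : ∀ k ω, 0 ≤ Z k ω) : HasResidualTails (P.map fun ω => (Z 0 ω).toNNReal) := by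
  intro δ hδ
  obtain ⟨L, V, hL, hV, hLV⟩ := h 1 one_pos
  set α := ∫ ω, Z 0 ω ∂P with hα
  have hα0 : 0 ≤ α := integral_nonneg fun ω => hnn 0 ω
  -- the tail at a fixed distance
  have htail : ∀ z, 0 < z → ∀ n : ℕ, 1 ≤ n → P {ω | z + (α + 1) * n ≤ Z 0 ω}
      ≤ ENNReal.ofReal (V * Real.exp (-L * n)) * P {ω | z ≤ Z 0 ω} := by
    intro z hz n hn
    have hS : MeasurableSet {ω | z ≤ Z 0 ω} := measurableSet_le measurable_const (hm 0)
    have h1 := (hLV z hz).1 n hn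
    set B := {ω | 1 * (n : ℝ) ≤ |∑ k ∈ Finset.range n, Z k ω - z - α * n|} with hB
    have h2 : P[|{ω | z ≤ Z 0 ω}] B ≤ ENNReal.ofReal (V * Real.exp (-L * n)) := by
      rw [← ofReal_measureReal]
      exact ENNReal.ofReal_le_ofReal h1
    calc P {ω | z + (α + 1) * n ≤ Z 0 ω} ≤ P ({ω | z ≤ Z 0 ω} ∩ B) := by
          refine measure_mono fun ω hω => ?_
          have hω' : z + (α + 1) * n ≤ Z 0 ω := hω
          have hn0 : 0 ≤ (α + 1) * n := by positivity
          refine ⟨show z ≤ Z 0 ω by linarith, ?_⟩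
          -- If `Z 0` alone exceeds `z` by `(α + 1) n`, the sum of `n` non-negative terms deviates
          -- from `z + α n` by at least `n`. This is the event of (B) with `ε = 1`.
          have h3 : Z 0 ω ≤ ∑ k ∈ Finset.range n, Z k ω :=
            Finset.single_le_sum (f := fun k => Z k ω) (fun k _ => hnn k ω)
              (Finset.mem_range.2 hn)
          change 1 * (n : ℝ) ≤ |∑ k ∈ Finset.range n, Z k ω - z - α * n|
          refine le_trans ?_ (le_abs_self _)
          linarith
      _ = P[|{ω | z ≤ Z 0 ω}] B * P {ω | z ≤ Z 0 ω} := (cond_mul_eq_inter hS _ _).symm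
      _ ≤ _ := by gcongr
  obtain ⟨n, hn1, hn⟩ : ∃ n : ℕ, 1 ≤ n ∧ ENNReal.ofReal (V * Real.exp (-L * n)) ≤ δ := by
    have h1 : Tendsto (fun n : ℕ => V * Real.exp (-L * n)) atTop (𝓝 (V * 0)) := by
      refine (Real.tendsto_exp_atBot.comp ?_).const_mul V
      exact tendsto_natCast_atTop_atTop.const_mul_atTop_of_neg (by linarith)
    rw [mul_zero] at h1
    have h2 := (ENNReal.continuous_ofReal.tendsto 0).comp h1
    rw [ENNReal.ofReal_zero] at h2
    obtain ⟨n, hn1, hn2⟩ := ((eventually_ge_atTop 1).and (h2.eventually (gt_mem_nhds hδ))).exists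
    exact ⟨n, hn1, hn2.le⟩
  refine ⟨(α + 1) * n, fun y hy e he => ?_⟩
  have hmap : ∀ e : ℝ, (P.map fun ω => (Z 0 ω).toNNReal) {z : ℝ≥0 | e < z}
      = P {ω | e < Z 0 ω} := by
    intro e
    rw [Measure.map_apply (hm 0).real_toNNReal
      (measurableSet_lt measurable_const measurable_coe_nnreal_real)]
    congr 1
    ext ω
    simp only [mem_preimage, mem_ofPred_eq, Real.coe_toNNReal _ (hnn 0 ω)]
  rw [hmap, hmap]
  -- Approximation from above reconciles the strict inequalities, and the value `e = 0`, with the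
  -- condition `Z 0 ≥ z`, `z > 0`, of (B).
  have hunion : {ω | e + y < Z 0 ω} = ⋃ k : ℕ, {ω | e + 1 / ((k : ℝ) + 1) + y ≤ Z 0 ω} := by
    ext ω
    simp only [mem_ofPred_eq, mem_iUnion]
    constructor
    · intro h
      obtain ⟨k, hk⟩ := exists_nat_one_div_lt (sub_pos.2 h)
      exact ⟨k, by linarith⟩
    · rintro ⟨k, hk⟩
      have : 0 < 1 / ((k : ℝ) + 1) := by positivity
      linarith
  have hmono : Monotone fun k : ℕ => {ω | e + 1 / ((k : ℝ) + 1) + y ≤ Z 0 ω} := by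
    intro k k' hk ω hω
    have h1 : 1 / ((k' : ℝ) + 1) ≤ 1 / ((k : ℝ) + 1) := Nat.one_div_le_one_div hk
    have h2 : e + 1 / ((k : ℝ) + 1) + y ≤ Z 0 ω := hω
    exact show e + 1 / ((k' : ℝ) + 1) + y ≤ Z 0 ω by linarith
  rw [hunion, hmono.measure_iUnion]
  refine iSup_le fun k => ?_
  have hk : 0 < 1 / ((k : ℝ) + 1) := by positivity
  calc P {ω | e + 1 / ((k : ℝ) + 1) + y ≤ Z 0 ω}
      ≤ P {ω | e + 1 / ((k : ℝ) + 1) + (α + 1) * n ≤ Z 0 ω} := by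
        refine measure_mono fun ω hω => ?_
        have h2 : e + 1 / ((k : ℝ) + 1) + y ≤ Z 0 ω := hω
        exact show e + 1 / ((k : ℝ) + 1) + (α + 1) * n ≤ Z 0 ω by linarith
    _ ≤ ENNReal.ofReal (V * Real.exp (-L * n)) * P {ω | e + 1 / ((k : ℝ) + 1) ≤ Z 0 ω} :=
        htail _ (by linarith) n hn1
    _ ≤ δ * P {ω | e < Z 0 ω} := by
        gcongr
        linarith

/-! ### Transfer from the path space to the given probability space -/

namespace MultitypeNetwork

variable {N : MultitypeNetwork}

namespace Primitives

variable {Ω : Type*} {p : N.Primitives Ω} {x : N.State} {ρ : N.Rule}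

/-- The policy prescribed by a rule. -/
def policy (p : N.Primitives Ω) (ρ : N.Rule) (x : N.State) : N.Control Ω :=
  fun t ω => ρ.pathControl x t (p.path ω)

theorem growthRate_path (hp : p.Nonneg) (ω : Ω) :
    N.pathPrimitives.growthRate x (ρ.pathControl x) (p.path ω)
      = p.growthRate x (p.policy ρ x) ω := by
  unfold growthRate
  simp only [totalQueue_path hp]
  rfl

/-- Queue lengths that occur at some time occur at a dyadic time. -/
theorem exists_grid_queue_eq (U : N.Control N.Path) (ζ : N.Path) {t : ℝ} (ht : 0 ≤ t) :
    ∃ l j, N.pathPrimitives.totalQueue x U (Path.grid l j) ζ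
      = N.pathPrimitives.totalQueue x U t ζ := by
  obtain ⟨δ, hδ, hr⟩ := exists_queue_eq_right (x := x) pathPrimitives_nonneg U ζ ht
  obtain ⟨l, hl⟩ := exists_pow_lt_of_lt_one hδ (show (1 / 2 : ℝ) < 1 by norm_num)
  have h2 : (0 : ℝ) < 2 ^ l := by positivity
  have hl' : 1 / (2 : ℝ) ^ l < δ := by rwa [one_div_pow] at hl
  refine ⟨l, ⌈t * 2 ^ l⌉₊, ?_⟩
  have hmem : Path.grid l ⌈t * 2 ^ l⌉₊ ∈ Ico t (t + δ) := by
    unfold Path.grid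
    constructor
    · rw [le_div_iff₀ h2]
      exact Nat.le_ceil _
    · have h3 := Nat.ceil_lt_add_one (show 0 ≤ t * 2 ^ l by positivity)
      rw [div_lt_iff₀ h2]
      rw [div_lt_iff₀ h2] at hl'
      linarith
  obtain ⟨h3, h4⟩ := hr U (fun _ _ => rfl) _ hmem
  exact Finset.sum_congr rfl fun c _ => queue_congr_departures h3 h4 c

variable [MeasurableSpace Ω] {P : Measure Ω}

theorem AssumptionA.nonneg (hA : p.AssumptionA P) : p.Nonneg := ⟨hA.nonneg_X, hA.nonneg_S⟩

theorem AssumptionA.isMeasurable (hA : p.AssumptionA P) : p.IsMeasurable :=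
  ⟨hA.measurable_X, hA.measurable_S⟩

/-- The laws of the interarrival and service times. -/
def itemLaw (p : N.Primitives Ω) (P : Measure Ω) (a : N.Source) : Measure ℝ≥0 :=
  P.map fun ω => p.path ω (a, 0)

theorem AssumptionA.measurable_item (hA : p.AssumptionA P) (b : N.Source × ℕ) :
    Measurable fun ω => p.path ω b :=
  (measurable_pi_apply b).comp (measurable_path hA.isMeasurable)

theorem AssumptionA.isProbabilityMeasure_itemLaw [IsProbabilityMeasure P] (hA : p.AssumptionA P)
    (a : N.Source) : IsProbabilityMeasure (p.itemLaw P a) :=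
  Measure.isProbabilityMeasure_map (hA.measurable_item (a, 0)).aemeasurable

/-- The law of the path is the product measure. -/
theorem AssumptionA.map_path [IsProbabilityMeasure P] (hA : p.AssumptionA P)
    [∀ a, IsProbabilityMeasure (p.itemLaw P a)] : P.map p.path = pathMeasure (p.itemLaw P) := by
  have hind : iIndepFun (fun (b : N.Source × ℕ) ω => p.path ω b) P :=
    hA.indep.comp (fun _ => Real.toNNReal) fun _ => measurable_real_toNNReal
  rw [pathMeasure]
  have h1 := hind.map_fun_eq_infinitePi_map hA.measurable_item
  have h2 : ∀ b : N.Source × ℕ, P.map (fun ω => p.path ω b) = p.itemLaw P b.1 := by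
    rintro ⟨i | c, k⟩
    · exact ((hA.ident_X i k).comp measurable_real_toNNReal).map_eq
    · exact ((hA.ident_S c k).comp measurable_real_toNNReal).map_eq
  change P.map (fun ω b => p.path ω b) = _
  rw [h1]
  congr 1
  funext b
  exact h2 b

theorem integrable_map_toNNReal {Z : Ω → ℝ} (hm : Measurable Z) (hnn : ∀ ω, 0 ≤ Z ω)
    (hint : Integrable Z P) : Integrable (fun z : ℝ≥0 => (z : ℝ)) (P.map fun ω => (Z ω).toNNReal) ∧
      ∫ z : ℝ≥0, (z : ℝ) ∂(P.map fun ω => (Z ω).toNNReal) = ∫ ω, Z ω ∂P := by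
  have hZ : (fun ω => (((Z ω).toNNReal : ℝ≥0) : ℝ)) = Z := funext fun ω => Real.coe_toNNReal _ (hnn ω)
  have hae : AEStronglyMeasurable (fun z : ℝ≥0 => (z : ℝ)) (P.map fun ω => (Z ω).toNNReal) :=
    measurable_coe_nnreal_real.aestronglyMeasurable
  refine ⟨(integrable_map_measure hae hm.real_toNNReal.aemeasurable).2 ?_, ?_⟩
  · exact hint.congr (Eventually.of_forall fun ω => (Real.coe_toNNReal _ (hnn ω)).symm)
  · rw [integral_map hm.real_toNNReal.aemeasurable hae, hZ]

theorem AssumptionA.integrable_itemLaw (hA : p.AssumptionA P) (a : N.Source) :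
    Integrable (fun z : ℝ≥0 => (z : ℝ)) (p.itemLaw P a) := by
  rcases a with i | c
  · exact (integrable_map_toNNReal (hA.measurable_X i 0) (hA.nonneg_X i 0) (hA.integrable_X i)).1
  · exact (integrable_map_toNNReal (hA.measurable_S c 0) (hA.nonneg_S c 0) (hA.integrable_S c)).1

theorem AssumptionA.mean_inl (hA : p.AssumptionA P) (i : Fin N.numTypes) :
    ∫ z : ℝ≥0, (z : ℝ) ∂(p.itemLaw P (Sum.inl i)) = ∫ ω, p.X i 0 ω ∂P :=
  (integrable_map_toNNReal (hA.measurable_X i 0) (hA.nonneg_X i 0) (hA.integrable_X i)).2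

theorem AssumptionA.mean_inr (hA : p.AssumptionA P) (c : N.Class) :
    ∫ z : ℝ≥0, (z : ℝ) ∂(p.itemLaw P (Sum.inr c)) = ∫ ω, p.S c 0 ω ∂P :=
  (integrable_map_toNNReal (hA.measurable_S c 0) (hA.nonneg_S c 0) (hA.integrable_S c)).2

theorem AssumptionA.mean_pos (hA : p.AssumptionA P) (a : N.Source) :
    0 < ∫ z : ℝ≥0, (z : ℝ) ∂(p.itemLaw P a) := by
  rcases a with i | c
  · rw [hA.mean_inl]; exact hA.mean_pos_X i
  · rw [hA.mean_inr]; exact hA.mean_pos_S c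

theorem AssumptionB.hasResidualTails [IsProbabilityMeasure P] (hB : p.AssumptionB P)
    (hA : p.AssumptionA P) (a : N.Source) : HasResidualTails (p.itemLaw P a) := by
  rcases a with i | c
  · exact (hB.1 i).hasResidualTails (hA.measurable_X i) (hA.nonneg_X i)
  · exact (hB.2 c).hasResidualTails (hA.measurable_S c) (hA.nonneg_S c)

theorem AssumptionA.arrivalRate_pos (hA : p.AssumptionA P) (i : Fin N.numTypes) :
    0 < p.arrivalRate P i := inv_pos.2 (hA.mean_pos_X i)

theorem AssumptionA.serviceRate_pos (hA : p.AssumptionA P) (c : N.Class) :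
    0 < p.serviceRate P c := inv_pos.2 (hA.mean_pos_S c)

variable [IsProbabilityMeasure P]

theorem AssumptionA.ae_good_path (hA : p.AssumptionA P) (x : N.State) :
    ∀ᵐ ω ∂P, Path.Good x (p.path ω) := by
  have := hA.isProbabilityMeasure_itemLaw
  have h := Path.ae_good hA.integrable_itemLaw hA.mean_pos x
  rw [← hA.map_path] at h
  exact ae_of_ae_map (measurable_path hA.isMeasurable).aemeasurable h

theorem AssumptionA.isNonIdlingPolicy (hA : p.AssumptionA P) (ρ : N.Rule) (x : N.State) :
    p.IsNonIdlingPolicy P x (p.policy ρ x) := by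
  refine ρ.isNonIdlingPolicy_pathControl hA.nonneg hA.isMeasurable ?_
  filter_upwards [hA.ae_good_path x] with ω hω t
  rw [← accumulates_path hA.nonneg]
  exact hω.not_accumulates t

/-- Linear growth of the total queue under the tracking rule. -/
theorem ae_le_growthRate (hA : p.AssumptionA P) (hB : p.AssumptionB P) (hC : p.AssumptionC P)
    {θ m₁ : ℝ} {L : ℕ} {plan : (N.Class → ℕ) → N.Plan}
    (hplan : IsGrowthPlan (p.arrivalRate P) (p.serviceRate P) θ m₁ L plan) (hθ : 1 ≤ θ) {κ : ℝ}
    (hκ0 : 0 ≤ κ) (hκ : κ < m₁) (hκ1 : κ ≤ 1) (x : N.State) :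
    ∀ᵐ ω ∂P, ((κ / (8 * θ) : ℝ) : EReal)
      ≤ p.growthRate x (p.policy (trackingRule plan θ) x) ω := by
  have := hA.isProbabilityMeasure_itemLaw
  have hmeas := measurable_path hA.isMeasurable
  have h1 : (fun i => (∫ z : ℝ≥0, (z : ℝ) ∂(p.itemLaw P (Sum.inl i)))⁻¹) = p.arrivalRate P := by
    funext i
    rw [hA.mean_inl]
    rfl
  have h2 : (fun c => (∫ z : ℝ≥0, (z : ℝ) ∂(p.itemLaw P (Sum.inr c)))⁻¹) = p.serviceRate P := by
    funext c
    rw [hA.mean_inr]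
    rfl
  rw [← h1, ← h2] at hplan
  have hgrow := Path.ae_le_growthRate (x := x) hA.integrable_itemLaw hA.mean_pos
    (hB.hasResidualTails hA) hplan hθ hκ0 hκ hκ1 (fun n => ?_)
  · rw [← hA.map_path] at hgrow
    filter_upwards [ae_of_ae_map hmeas.aemeasurable hgrow] with ω hω
    rwa [← growthRate_path hA.nonneg]
  · rw [← hA.map_path, ae_map_iff hmeas.aemeasurable]
    · rcases Nat.eq_zero_or_pos n with rfl | hn
      · exact Eventually.of_forall fun ω => ⟨0, 0, Nat.zero_le _⟩
      filter_upwards [hC x _ (hA.isNonIdlingPolicy (trackingRule plan θ) x) n hn] with ω ⟨t, ht, hq⟩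
      obtain ⟨l, j, hlj⟩ := exists_grid_queue_eq (x := x) ((trackingRule plan θ).pathControl x)
        (p.path ω) ht
      refine ⟨l, j, ?_⟩
      rw [hlj, totalQueue_path hA.nonneg]
      exact hq
    · have : {ζ : N.Path | ∃ l j, n ≤ N.pathPrimitives.totalQueue x
          ((trackingRule plan θ).pathControl x) (Path.grid l j) ζ}
          = ⋃ l, ⋃ j, {ζ | n ≤ N.pathPrimitives.totalQueue x
          ((trackingRule plan θ).pathControl x) (Path.grid l j) ζ} := by
        ext; simp
      rw [this]
      exact MeasurableSet.iUnion fun l => MeasurableSet.iUnion fun j =>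
        Path.measurable_totalQueue _ (MeasurableSet.of_discrete (s := {m : ℕ | n ≤ m}))

end Primitives

end MultitypeNetwork

namespace MultitypeNetwork

variable {N : MultitypeNetwork} {lam : Fin N.numTypes → ℝ} {mu : N.Class → ℝ}

/-! ### Growth plans and constants -/

/-- The horizon `max 1 (3 / γ)` is chosen so that a rate `γ` triples a level of norm one. The plans
are those for the normalised queue vectors; an empty network gets a dummy. -/
theorem exists_isGrowthPlan (hFDP : N.FiniteDecomposition lam mu) (hlam : ∀ i, 0 ≤ lam i)
    (hmu : ∀ c, 0 ≤ mu c) {γ : ℝ} (hγ : 0 < γ) (hdiv : N.FluidDivergesAtRate lam mu γ) :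
    ∃ L plan, IsGrowthPlan lam mu (max 1 (3 / γ)) (γ / (γ + ∑ c, mu c)) L plan := by
  have hθ : (0 : ℝ) < max 1 (3 / γ) := lt_max_of_lt_left one_pos
  have h3 : 3 ≤ γ * max 1 (3 / γ) := by
    calc (3 : ℝ) = γ * (3 / γ) := by field_simp
      _ ≤ _ := by gcongr; exact le_max_right _ _
  obtain ⟨K, hK⟩ := exists_plan hFDP hlam hmu hγ hdiv hθ
  have hex : ∀ q : N.Class → ℕ, ∃ π : N.Plan, 0 < size q → π.IsFluid lam mu ∧ π.len ≤ K ∧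
      (π.level 0 = fun c => (q c : ℝ) / size q) ∧ π.time π.len = max 1 (3 / γ) ∧
        (∀ r ≤ π.len, γ / (γ + ∑ c, mu c) ≤ N.l1 (π.level r)) ∧
        γ * max 1 (3 / γ) ≤ N.l1 (π.level π.len) := by
    intro q
    by_cases hq : 0 < size q
    · have hq' : (0 : ℝ) < size q := by exact_mod_cast hq
      have hnn : ∀ c, 0 ≤ (q c : ℝ) / size q := fun c => by positivity
      obtain ⟨π, hπ⟩ := hK _ hnn (by
        rw [l1_of_nonneg hnn, ← Finset.sum_div, div_eq_one_iff_eq hq'.ne', size]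
        push_cast
        rfl)
      exact ⟨π, fun _ => hπ⟩
    · exact ⟨⟨0, 0, 0, 0⟩, fun h => absurd h hq⟩
  choose plan hplan using hex
  refine ⟨K, plan, fun q hq => (hplan q hq).1, fun q hq => (hplan q hq).2.1, fun q hq c => ?_,
    fun q hq => (hplan q hq).2.2.2.1, fun q hq => (hplan q hq).2.2.2.2.1,
    fun q hq => h3.trans (hplan q hq).2.2.2.2.2⟩
  rw [(hplan q hq).2.2.1]
  have hq' : (size q : ℝ) ≠ 0 := by exact_mod_cast hq.ne'
  field_simp

/-- The rate of divergence is bounded in terms of the parameters of the network. -/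
theorem FluidDivergesAtRate.le_card_mul {γ : ℝ} (hdiv : N.FluidDivergesAtRate lam mu γ)
    (hmu : ∀ c, 0 ≤ mu c) {s : ℝ} (hlams : ∀ i, lam i ≤ s) (hmus : ∀ c, mu c ≤ s) :
    γ ≤ Fintype.card N.Class * s := by
  obtain ⟨Q, T, hsol, hni, hQ0, hQ⟩ := hdiv 0 fun _ => le_rfl
  have hB := hsol.isBusyFluid hni ordConnected_Ici
  have h0 : (0 : ℝ) ∈ Ici (0 : ℝ) := self_mem_Ici
  have h1 : (1 : ℝ) ∈ Ici (0 : ℝ) := mem_Ici.2 zero_le_one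
  have hT0 : ∀ c, 0 ≤ T 1 c := fun c => hsol.time_nonneg 1 h1 c
  have hT1 : ∀ c, T 1 c ≤ 1 := fun c => by
    have h2 := hB.feasible (N.station c) 0 h0 1 h1 zero_le_one
    have h3 : N.stationSum (N.station c) (T 0) = 0 := Finset.sum_eq_zero fun c _ => hB.time_zero c
    linarith [le_stationSum hT0 c]
  have hmuT : ∀ c, mu c * T 1 c ≤ s := fun c =>
    (mul_le_of_le_one_right (hmu c) (hT1 c)).trans (hmus c)
  have hle : ∀ c, Q 1 c ≤ s := fun c => by
    have h2 := hB.balance 1 h1 c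
    have h3 : N.upstream (fun i => lam i * 1) (fun c => mu c * T 1 c) c ≤ s :=
      upstream_forall (p := fun y => y ≤ s) (fun i => by simpa using hlams i) hmuT c
    have h4 : 0 ≤ mu c * T 1 c := mul_nonneg (hmu c) (hT0 c)
    have h5 : Q 0 c = 0 := by rw [hQ0]; rfl
    linarith
  have h2 := hQ 1 zero_le_one
  rw [mul_one, l1_of_nonneg (hsol.queue_nonneg 1 h1)] at h2
  calc γ ≤ ∑ c, Q 1 c := h2
    _ ≤ ∑ _c : N.Class, s := Finset.sum_le_sum fun c _ => hle c
    _ = _ := by simp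

/-- With `s = Λ + Μ ≥ 1`, both terms on the left are at most the number of classes times `s`, and
there are at most `I J` classes. Hence `C` exceeds `γ + ∑ μ`, which puts `γ / C` strictly below the
minimal norm of the plans. -/
theorem FluidDivergesAtRate.add_sum_le_parameterBound {γ : ℝ} (hγ : 0 < γ)
    (hdiv : N.FluidDivergesAtRate lam mu γ) (hlam : ∀ i, 0 < lam i) (hmu : ∀ c, 0 < mu c) :
    γ + ∑ c, mu c ≤ N.parameterBound lam mu := by
  set Λ := ⨆ i, max (lam i) (lam i)⁻¹ with hΛ
  set Μ := ⨆ c, max (mu c) (mu c)⁻¹ with hΜ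
  set J : ℕ := Finset.univ.sup N.stages with hJ
  have hΛ0 : 0 ≤ Λ := Real.iSup_nonneg fun i => (hlam i).le.trans (le_max_left _ _)
  have hΜ0 : 0 ≤ Μ := Real.iSup_nonneg fun c => (hmu c).le.trans (le_max_left _ _)
  have hlamΛ : ∀ i, lam i ≤ Λ := fun i =>
    (le_max_left _ _).trans (le_ciSup (f := fun i => max (lam i) (lam i)⁻¹)
      (Set.finite_range _).bddAbove i)
  have hmaxΜ : ∀ c, max (mu c) (mu c)⁻¹ ≤ Μ := fun c =>
    le_ciSup (f := fun c => max (mu c) (mu c)⁻¹) (Set.finite_range _).bddAbove c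
  have hmuΜ : ∀ c, mu c ≤ Μ := fun c => (le_max_left _ _).trans (hmaxΜ c)
  set s := Λ + Μ with hs
  have hγs : γ ≤ Fintype.card N.Class * s := hdiv.le_card_mul (fun c => (hmu c).le)
    (fun i => by linarith [hlamΛ i]) (fun c => by linarith [hmuΜ c])
  have hne : Nonempty N.Class := by
    by_contra h
    rw [not_nonempty_iff] at h
    simp only [Fintype.card_eq_zero, Nat.cast_zero, zero_mul] at hγs
    linarith
  obtain ⟨c⟩ := hne
  have hs1 : 1 ≤ s := by
    have h1 : 1 ≤ max (mu c) (mu c)⁻¹ := by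
      rcases le_total 1 (mu c) with h | h
      · exact le_max_of_le_left h
      · exact le_max_of_le_right ((one_le_inv₀ (hmu c)).2 h)
    linarith [hmaxΜ c]
  have hJ1 : (1 : ℝ) ≤ J := by
    have h1 : N.stages c.1 ≤ J := Finset.le_sup (f := N.stages) (Finset.mem_univ _)
    exact_mod_cast (N.stages_pos c.1).trans_le h1
  have hcard : (Fintype.card N.Class : ℝ) ≤ N.numTypes * J := by
    have h1 : Fintype.card N.Class ≤ N.numTypes * J := by
      rw [Fintype.card_sigma]
      calc ∑ i, Fintype.card (Fin (N.stages i)) ≤ ∑ _i : Fin N.numTypes, J := by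
            refine Finset.sum_le_sum fun i _ => ?_
            rw [Fintype.card_fin]
            exact Finset.le_sup (f := N.stages) (Finset.mem_univ _)
        _ = _ := by simp
    exact_mod_cast h1
  have hsum : ∑ c, mu c ≤ Fintype.card N.Class * s := by
    calc ∑ c, mu c ≤ ∑ _c : N.Class, s := Finset.sum_le_sum fun c _ => by linarith [hmuΜ c]
      _ = _ := by simp
  have hs2 : s ≤ s ^ 2 := le_self_pow₀ hs1 two_ne_zero
  have hJ3 : (J : ℝ) ≤ J ^ 3 := le_self_pow₀ hJ1 three_ne_zero
  calc γ + ∑ c, mu c ≤ 2 * (Fintype.card N.Class * s) := by linarith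
    _ ≤ 2 * (N.numTypes * J * s) := by gcongr
    _ ≤ 2 * (N.numTypes * J ^ 3 * s ^ 2) := by gcongr
    _ ≤ 13 * (N.numTypes * J ^ 3 * s ^ 2) := by gcongr; norm_num
    _ = 13 * s ^ 2 * N.numTypes * J ^ 3 := by ring

/-! ### Rate stability -/

/-- What has entered and not left the network is what is in it. -/
theorem sum_upstream_sub (a : Fin N.numTypes → ℝ) (d : N.Class → ℝ) :
    ∑ c, (N.upstream a d c - d c) = ∑ i, (a i
      - d ⟨i, ⟨N.stages i - 1, Nat.sub_lt (N.stages_pos i) Nat.one_pos⟩⟩) := by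
  rw [Fintype.sum_sigma]
  refine Finset.sum_congr rfl fun i _ => ?_
  have hpos := N.stages_pos i
  -- The sum along a route telescopes in `h j`, the flow into stage `j`; the value at the length of
  -- the route is the outflow of the last stage.
  let h : ℕ → ℝ := fun
    | 0 => a i
    | j + 1 => if hj : j < N.stages i then d ⟨i, ⟨j, hj⟩⟩ else 0
  have h1 : ∀ j : Fin (N.stages i), N.upstream a d ⟨i, j⟩ - d ⟨i, j⟩ = h j - h (j + 1) := by
    rintro ⟨_ | j, hj⟩
    · simp [h, upstream, hj]
    · simp [h, upstream, hj, Nat.lt_of_succ_lt hj]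
  rw [Finset.sum_congr rfl fun j _ => h1 j,
    Fin.sum_univ_eq_sum_range (fun j => h j - h (j + 1)), Finset.sum_range_sub']
  obtain ⟨n, hn⟩ : ∃ n, N.stages i = n + 1 := ⟨N.stages i - 1, by omega⟩
  have h2 : h (N.stages i)
      = d ⟨i, ⟨N.stages i - 1, Nat.sub_lt (N.stages_pos i) Nat.one_pos⟩⟩ := by
    have h3 : h (N.stages i - 1 + 1)
        = d ⟨i, ⟨N.stages i - 1, Nat.sub_lt (N.stages_pos i) Nat.one_pos⟩⟩ := by
      simp only [h]
      rw [dif_pos (Nat.sub_lt (N.stages_pos i) Nat.one_pos)]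
    rwa [Nat.sub_add_cancel hpos] at h3
  rw [h2]

namespace Path

/-- If the averages of all the tails of the interarrival and service times converge, so do the
arrival rates. -/
theorem tendsto_arrivals_div {x : N.State} {ζ : N.Path} (hζ : Good x ζ) {α : N.Source → ℝ}
    (hα : ∀ a, 0 < α a) (havg : ∀ a κ, Tendsto
      (fun n : ℕ => (∑ r ∈ Finset.range n, (ζ (a, κ + r) : ℝ)) / n) atTop (𝓝 (α a)))
    (ρ : N.Rule) (i : Fin N.numTypes) :
    Tendsto (fun t : ℝ => (N.pathPrimitives.arrivals x i t ζ : ℝ) / t) atTop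
      (𝓝 (α (Sum.inl i))⁻¹) := by
  refine Metric.tendsto_atTop.2 fun ε hε => ?_
  -- On a single path the regularity from time `0` on holds for a sufficiently large constant, which
  -- disappears after division by `t`.
  obtain ⟨η, hη, M₀, hreg⟩ := exists_regularAfter (x := x) (ρ := ρ) hα (half_pos hε)
  have hfresh := fun a => exists_nearMean_of_tendsto (hη a) (havg a (count ρ x a 0 ζ + 1))
  choose M hM using hfresh
  have hres := fun a => exists_nat_ge ((itemSum x a (count ρ x a 0 ζ + 1) ζ
    - clock ρ x a 0 ζ) / η a)
  choose M' hM' using hres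
  set K := M₀ + ∑ a, M a + ∑ a, M' a
  have hMK : ∀ a, M a ≤ K := fun a => by
    have := Finset.single_le_sum (f := M) (fun _ _ => Nat.zero_le _) (Finset.mem_univ a)
    omega
  have hMK' : ∀ a, M' a ≤ K := fun a => by
    have := Finset.single_le_sum (f := M') (fun _ _ => Nat.zero_le _) (Finset.mem_univ a)
    omega
  have h := (hreg K (by omega) ζ hζ 0 le_rfl (fun a m => (hM a m).trans (by
      have := hη a
      have h1 : (M a : ℝ) ≤ K := by exact_mod_cast hMK a
      gcongr)) (fun a => by
      have h1 := (div_le_iff₀' (hη a)).1 (hM' a)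
      have h2 : (M' a : ℝ) ≤ K := by exact_mod_cast hMK' a
      have := hη a
      calc _ ≤ η a * M' a := h1
        _ ≤ η a * K := by gcongr)).arrivals
  set A₀ : ℝ := (N.pathPrimitives.arrivals x i 0 ζ : ℝ)
  have hA₀ : 0 ≤ A₀ := Nat.cast_nonneg _
  refine ⟨(ε / 2 * K + A₀) / (ε / 2) + 1, fun t ht => ?_⟩
  have hK : 0 ≤ (ε / 2 * K + A₀) / (ε / 2) := by positivity
  have ht0 : 0 < t := by linarith
  have h1 := h t ht0.le i
  have h2 : ε / 2 * K + A₀ < ε / 2 * t := by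
    have : (ε / 2 * K + A₀) / (ε / 2) < t := by linarith
    rwa [div_lt_iff₀' (half_pos hε)] at this
  have h3 : (N.pathPrimitives.arrivals x i t ζ : ℝ) / t - (α (Sum.inl i))⁻¹
      = (N.pathPrimitives.arrivals x i t ζ - (α (Sum.inl i))⁻¹ * t) / t := by
    rw [sub_div, mul_div_cancel_right₀ _ ht0.ne']
  rw [Real.dist_eq, h3, abs_div, abs_of_pos ht0, div_lt_iff₀ ht0, abs_lt]
  rw [sub_zero, abs_le] at h1
  constructor <;> linarith

end Path

namespace Primitives

variable {Ω : Type*}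

theorem totalQueue_cast (p : N.Primitives Ω) (x : N.State) (u : N.Control Ω) (t : ℝ) (ω : Ω) :
    (p.totalQueue x u t ω : ℝ) = ∑ c, (x.q c : ℝ) + ∑ i, ((p.arrivals x i t ω : ℝ)
      - p.departures x u ⟨i, ⟨N.stages i - 1, Nat.sub_lt (N.stages_pos i) Nat.one_pos⟩⟩ t ω) := by
  rw [totalQueue, Nat.cast_sum, ← sum_upstream_sub (fun i => (p.arrivals x i t ω : ℝ))
    (fun c => (p.departures x u c t ω : ℝ)), ← Finset.sum_add_distrib]
  exact Finset.sum_congr rfl fun c _ => by rw [queue_cast]; ring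

variable [MeasurableSpace Ω] {P : Measure Ω} [IsProbabilityMeasure P] {p : N.Primitives Ω}

theorem AssumptionA.ae_tendsto_arrivals_div (hA : p.AssumptionA P) (ρ : N.Rule) (x : N.State) :
    ∀ᵐ ω ∂P, ∀ i, Tendsto (fun t : ℝ => (p.arrivals x i t ω : ℝ) / t) atTop
      (𝓝 (p.arrivalRate P i)) := by
  have := hA.isProbabilityMeasure_itemLaw
  have havg : ∀ᵐ ζ ∂(pathMeasure (p.itemLaw P)), ∀ a κ, Tendsto
      (fun n : ℕ => (∑ r ∈ Finset.range n, (ζ (a, κ + r) : ℝ)) / n) atTop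
      (𝓝 (∫ z : ℝ≥0, (z : ℝ) ∂(p.itemLaw P a))) := by
    refine ae_all_iff.2 fun a => ae_all_iff.2 fun κ => ?_
    have h := ae_tendsto_average (p.itemLaw P a) (hA.integrable_itemLaw a)
    rw [← pathMeasure_map_shift a κ] at h
    exact ae_of_ae_map (measurable_shift _ _).aemeasurable h
  rw [← hA.map_path] at havg
  filter_upwards [ae_of_ae_map (measurable_path hA.isMeasurable).aemeasurable havg,
    hA.ae_good_path x] with ω hω hgood i
  have h := Path.tendsto_arrivals_div hgood hA.mean_pos hω ρ i
  rw [hA.mean_inl] at h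
  simp only [arrivals_path hA.nonneg] at h
  exact h

/-- In a rate stable network the total queue does not grow linearly. -/
theorem RateStable.ae_growthRate_eq_zero (hA : p.AssumptionA P) (ρ : N.Rule) {x : N.State}
    {u : N.Control Ω} (h : p.RateStable P x u) : ∀ᵐ ω ∂P, p.growthRate x u ω = 0 := by
  filter_upwards [hA.ae_tendsto_arrivals_div ρ x, ae_all_iff.2 h] with ω hω hd
  have h1 : Tendsto (fun t : ℝ => (p.totalQueue x u t ω : ℝ) / t) atTop (𝓝 0) := by
    have h2 := (tendsto_const_nhds (x := ∑ c, (x.q c : ℝ)).div_atTop tendsto_id).add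
      (tendsto_finsetSum Finset.univ fun i _ => (hω i).sub (hd i))
    simp only [sub_self, Finset.sum_const_zero, add_zero] at h2
    refine h2.congr fun t => ?_
    rw [totalQueue_cast, add_div, Finset.sum_div _ (fun i => (p.arrivals x i t ω : ℝ) - _)]
    simp only [sub_div, id]
  have h2 := ((continuous_coe_real_ereal.tendsto 0).comp h1).liminf_eq
  exact h2

end Primitives

end MultitypeNetwork

end

/-! ### The theorem -/

theorem theorem3p2 {Ω : Type*} [MeasurableSpace Ω] (P : Measure Ω) [IsProbabilityMeasure P]
    (N : MultitypeNetwork) (p : N.Primitives Ω)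
    (hA : p.AssumptionA P) (hB : p.AssumptionB P) (hC : p.AssumptionC P)
    (hunstable : ¬ N.GloballyWeaklyStable (p.arrivalRate P) (p.serviceRate P))
    (hFDP : N.FiniteDecomposition (p.arrivalRate P) (p.serviceRate P)) :
    (∀ x : N.State, ∃ u : N.Control Ω, p.IsNonIdlingPolicy P x u ∧
      (∀ᵐ ω ∂P, 0 < p.growthRate x u ω) ∧ ¬ p.RateStable P x u) ∧
    (∃ γ : ℝ, 0 < γ ∧ N.FluidDivergesAtRate (p.arrivalRate P) (p.serviceRate P) γ) ∧
    (∀ γ : ℝ, 0 < γ → N.FluidDivergesAtRate (p.arrivalRate P) (p.serviceRate P) γ →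
      ∀ C : ℝ, N.parameterBound (p.arrivalRate P) (p.serviceRate P) < C →
      ∀ x : N.State, ∃ u : N.Control Ω, p.IsNonIdlingPolicy P x u ∧
        ∀ᵐ ω ∂P, ((min (γ / C) 1 / (8 * max 1 (3 / γ)) : ℝ) : EReal) ≤ p.growthRate x u ω) := by
  have hlam := hA.arrivalRate_pos
  have hmu := hA.serviceRate_pos
  have hfluid := MultitypeNetwork.exists_fluidDivergesAtRate hmu hunstable
  have key : ∀ γ : ℝ, 0 < γ → N.FluidDivergesAtRate (p.arrivalRate P) (p.serviceRate P) γ →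
      ∀ C : ℝ, N.parameterBound (p.arrivalRate P) (p.serviceRate P) < C → 0 < C ∧
      ∃ ρ : N.Rule, ∀ x : N.State, ∀ᵐ ω ∂P,
        ((min (γ / C) 1 / (8 * max 1 (3 / γ)) : ℝ) : EReal) ≤ p.growthRate x (p.policy ρ x) ω := by
    intro γ hγ hdiv C hbound
    obtain ⟨L, plan, hplan⟩ := MultitypeNetwork.exists_isGrowthPlan hFDP (fun i => (hlam i).le)
      (fun c => (hmu c).le) hγ hdiv
    have hsum : 0 < γ + ∑ c, p.serviceRate P c :=
      add_pos_of_pos_of_nonneg hγ (Finset.sum_nonneg fun c _ => (hmu c).le)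
    have hlt := (hdiv.add_sum_le_parameterBound hγ hlam hmu).trans_lt hbound
    have hC0 : 0 < C := hsum.trans hlt
    refine ⟨hC0, _, MultitypeNetwork.Primitives.ae_le_growthRate hA hB hC hplan (le_max_left _ _)
      (le_min (by positivity) zero_le_one) ((min_le_left _ _).trans_lt ?_) (min_le_right _ _)⟩
    -- The growth argument needs a `κ` strictly below `γ / (γ + ∑ μ)`; the bound for `C` makes `γ /
    -- C` admissible.
    exact div_lt_div_of_pos_left hγ hsum hlt
  refine ⟨fun x => ?_, hfluid, fun γ hγ hdiv C hbound x => ?_⟩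
  · obtain ⟨γ, hγ, hdiv⟩ := hfluid
    -- Any admissible `C` gives a positive rate; one above the parameter bound is taken.
    obtain ⟨hC0, ρ, hρ⟩ := key γ hγ hdiv _ (lt_add_one _)
    have hpos : ∀ᵐ ω ∂P, 0 < p.growthRate x (p.policy ρ x) ω := by
      filter_upwards [hρ x] with ω hω
      refine lt_of_lt_of_le ?_ hω
      have hθ : (0 : ℝ) < max 1 (3 / γ) := lt_max_of_lt_left one_pos
      exact_mod_cast div_pos (lt_min (div_pos hγ hC0) one_pos) (by positivity)
    refine ⟨p.policy ρ x, hA.isNonIdlingPolicy ρ x, hpos, fun hstable => ?_⟩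
    obtain ⟨ω, h1, h2⟩ := (hpos.and (hstable.ae_growthRate_eq_zero hA ρ)).exists
    exact absurd h2 h1.ne'
  · obtain ⟨-, ρ, hρ⟩ := key γ hγ hdiv C hbound
    exact ⟨p.policy ρ x, hA.isNonIdlingPolicy ρ x, hρ x⟩
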